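/- Let $X^{2n}$ be a (Hausdorff, second countable) smooth manifold with a Poisson structure $\pi$ whose divisor $(\wedge^{2n}TX,\wedge^n\pi)$ is elliptic: $\wedge^n\pi$ vanishes precisely on an embedded codimension-two submanifold $\iota_D\colon D\hookrightarrow X$, vanishes to second order there, and has definite normal Hessian. Let $I_{|D|}=\{\langle\wedge^n\pi,\eta\rangle : \eta\in\Omega^{2n}(X)\}\subseteq C^\infty(X)$ be its divisor ideal, and let $\mathcal A_{|D|}$ be the elliptic tangent bundle, i.e. the Lie algebroid with $\Gamma(\mathcal A_{|D|})=\{V\in\Gamma(TX) : V(I_{|D|})\subseteq I_{|D|}\}$; in polar coordinates $(r,\theta)$ normal to $D$ with $I_{|D|}=\langle r^2\rangle$ it is generated by $r\partial_r,\partial_\theta,\partial_{x_i}$. Let $\omega\in\Omega^2(\mathcal A_{|D|})$ be the $\mathcal A_{|D|}$-symplectic form (closed and nondegenerate) dual, i.e. inverse, to $\pi$. Assume that $D$ is cooriented. Define the residues along $D$ of $\mathcal A_{|D|}$-forms by $$\mathrm{Res}_q\colon\ d\log r\wedge d\theta\wedge a+d\log r\wedge b+d\theta\wedge c+e\ \mapsto\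 \iota_D^*a ,$$ and, on the kernel of $\mathrm{Res}_q$, $\mathrm{Res}_r\colon d\log r\wedge b+d\theta\wedge c+e\mapsto\iota_D^*b$ and $\mathrm{Res}_\theta\colon d\log r\wedge b+d\theta\wedge c+e\mapsto\iota_D^*c$, where $d\theta$ is positive for the coorientation. These are well-defined, independently of the coordinates. Assume that the elliptic residue vanishes, $\mathrm{Res}_q(\omega)=0$. Put $\alpha_1=\mathrm{Res}_r(\omega)$, $\alpha_2=\mathrm{Res}_\theta(\omega)\in\Omega^1(D)$ and $\rho=\mathrm{Res}_q(e^\omega)\in\Omega^\bullet(D)$. Then: 1. $\displaystyle \rho=-\alpha_1\wedge\alpha_2+\mathrm{Res}_q\Big(\sum_{k=3}^n\tfrac1{k!}\omega^k\Big)$. 2. $\rho$ is closed, $\alpha_1$ and $\alpha_2$ are closed, and $\rho$ is a global pure spinor on $D$ (nowhere zero, pointwise of the form $e^B\wedge\Omega$ with $\Omega$ decomposable, and locally $d\rho=v\cdot\rho$ for some $v\in\Gamma(TD\oplus T^*D)$) which is $2$-cosymplectic: every point of $D$ has an open neighbourhood $U$ with a closed two-form $\beta$ on $U$ of constant rank $2(n-2)$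 such that $\alpha_1\wedge\alpha_2\wedge\beta^{n-2}$ vanishes nowhere on $U$ and $$\rho|_U=-\alpha_1\wedge\alpha_2\wedge e^\beta .$$ In particular the component $\rho_{2n-2}$ in top degree vanishes nowhere on $D$. 3. Hence $D$ carries a unimodular corank-$2$ symplectic foliation: $T\mathcal F=\ker\alpha_1\cap\ker\alpha_2$ is an involutive distribution of corank two, given by the global closed one-forms $\alpha_1,\alpha_2$, which are linearly independent at each point, and $T\mathcal F$ carries a leafwise closed, leafwise nondegenerate two-form which on each $U$ as in 2 (for a suitable $\beta$) is the restriction of $\beta$. -/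

import Mathlib

open scoped Manifold ContDiff Nat

noncomputable section

namespace EllipticPoisson

/-! ### Exterior calculus over a Lie-Rinehart algebra

`A` plays the role of the algebra of smooth functions and `L` that of the module of sections of a
Lie algebroid (vector fields, sections of the elliptic tangent bundle, vector fields tangent to a
foliation); `⁅V, f⁆` is the derivative of `f` along the anchor of `V`. -/

section Algebra

variable (A N : Type*) [CommRing A] [AddCommGroup N] [Module A N]

/-- Forms of degree `k` on the module `N`. -/
abbrev Form (k : ℕ) := N [⋀^Fin k]→ₗ[A] A

/-- Inhomogeneous forms, given by their components in each degree. -/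
abbrev Forms := ∀ k : ℕ, Form A N k

variable {A N}

/-- The exterior product of homogeneous forms (sum over shuffles, no normalising factor), so that
`(α ∧ β)(V, W) = α(V) β(W) - α(W) β(V)` in degree one. -/
def wedgeHom {j k : ℕ} (a : Form A N j) (b : Form A N k) : Form A N (j + k) :=
  ((LinearMap.mul' A A).compAlternatingMap (a.domCoprod b)).domDomCongr finSumFinEquiv

/-- The exterior product of inhomogeneous forms. -/
def wedge (a b : Forms A N) : Forms A N := fun k =>
  ∑ x : {x : ℕ × ℕ // x ∈ Finset.HasAntidiagonal.antidiagonal k},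
    (wedgeHom (a x.1.1) (b x.1.2)).domDomCongr (finCongr (Finset.HasAntidiagonal.mem_antidiagonal.mp x.2))

infixr:70 " ⋏ " => wedge

/-- A homogeneous form regarded as an inhomogeneous one. -/
def homog {k : ℕ} (a : Form A N k) : Forms A N := Pi.single k a

/-- The constant form `1` of degree zero. -/
def formOne : Forms A N := homog (AlternatingMap.constOfIsEmpty A N (Fin 0) (1 : A))

/-- Exterior powers `a ∧ ... ∧ a`. -/
def formPow (a : Forms A N) : ℕ → Forms A N
  | 0 => formOne
  | j + 1 => a ⋏ formPow a j

/-- The product `α₁ ∧ ... ∧ αₖ` of a tuple of one-forms. -/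
def formProd : {k : ℕ} → (Fin k → Form A N 1) → Forms A N
  | 0, _ => formOne
  | _ + 1, α => homog (α 0) ⋏ formProd (Fin.tail α)

/-- The exponential `e^b = ∑ b^j / j!` of a two-form `b`; in degree `k` only terms with `j ≤ k`
contribute. -/
def formExp [Algebra ℝ A] (b : Form A N 2) : Forms A N := fun k =>
  ∑ j ∈ Finset.range (k + 1), ((j ! : ℝ)⁻¹) • formPow (homog b) j k

end Algebra

section LieRinehart

variable {A L : Type*} [CommRing A] [LieRing L] [Module A L] [LieRingModule L A]

/-- The Lie algebroid differential, by the Koszul formula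
`dη(V₀, …, Vₖ) = ∑ (-1)^j Vⱼ(η(…, V̂ⱼ, …)) + ∑_{i<j} (-1)^j η(…, [Vᵢ, Vⱼ], …, V̂ⱼ, …)`,
where in the second sum the bracket takes the place of `Vᵢ`. -/
def extD {k : ℕ} (η : Form A L k) (V : Fin (k + 1) → L) : A :=
  ∑ j : Fin (k + 1), (-1) ^ (j : ℕ) * ⁅V j, η (V ∘ j.succAbove)⁆ +
    ∑ j : Fin (k + 1), ∑ i : Fin k,
      if i.castSucc < j then
        (-1) ^ (j : ℕ) * η (Function.update (V ∘ j.succAbove) i ⁅V i.castSucc, V j⁆)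
      else 0

/-- `η` is closed. -/
def IsClosedForm {k : ℕ} (η : Form A L k) : Prop := ∀ V, extD η V = 0

/-- A two-form is nondegenerate if `V ↦ ω(V, ·)` is an isomorphism onto the dual module. -/
def IsNondegenerate (ωA : Form A L 2) : Prop :=
  ∀ ξ : L →ₗ[A] A, ∃! V : L, ∀ W : L, ωA ![V, W] = ξ W

end LieRinehart

/-! ### Smooth manifolds -/

section Manifold

variable {E : Type*} [NormedAddCommGroup E] [NormedSpace ℝ E]
  {F : Type*} [NormedAddCommGroup F] [NormedSpace ℝ F]

/-- Smooth real functions on a manifold modelled on `E`. -/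
abbrev Smooth (E : Type*) [NormedAddCommGroup E] [NormedSpace ℝ E]
    (X : Type*) [TopologicalSpace X] [ChartedSpace E X] := C^∞⟮𝓘(ℝ, E), X; ℝ⟯

/-- Smooth vector fields, as derivations of the algebra of smooth functions. -/
abbrev VField (E : Type*) [NormedAddCommGroup E] [NormedSpace ℝ E]
    (X : Type*) [TopologicalSpace X] [ChartedSpace E X] :=
  Derivation ℝ (Smooth E X) (Smooth E X)

/-- Differential forms of degree `k`, as alternating multilinear maps on vector fields. -/
abbrev DForm (E : Type*) [NormedAddCommGroup E] [NormedSpace ℝ E]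
    (X : Type*) [TopologicalSpace X] [ChartedSpace E X] (k : ℕ) :=
  Form (Smooth E X) (VField E X) k

/-- Inhomogeneous differential forms. -/
abbrev DForms (E : Type*) [NormedAddCommGroup E] [NormedSpace ℝ E]
    (X : Type*) [TopologicalSpace X] [ChartedSpace E X] := Forms (Smooth E X) (VField E X)

variable {X : Type*} [TopologicalSpace X] [ChartedSpace E X]
  {D : Type*} [TopologicalSpace D] [ChartedSpace F D]

/-- Sections of the cotangent bundle. -/
abbrev Covector (E : Type*) [NormedAddCommGroup E] [NormedSpace ℝ E]
    (X : Type*) [TopologicalSpace X] [ChartedSpace E X] :=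
  VField E X →ₗ[Smooth E X] Smooth E X

/-- The differential `df`, as a section of the cotangent bundle. -/
def diff (f : Smooth E X) : Covector E X where
  toFun V := V f
  map_add' _ _ := rfl
  map_smul' _ _ := rfl

/-! ### Poisson structures and their divisor ideals -/

/-- Bivector fields, as alternating bilinear maps on covector fields. -/
abbrev Bivector (E : Type*) [NormedAddCommGroup E] [NormedSpace ℝ E]
    (X : Type*) [TopologicalSpace X] [ChartedSpace E X] :=
  Form (Smooth E X) (Covector E X) 2

/-- The bracket `{f, g} = π(df, dg)`. -/
def bracket (π : Bivector E X) (f g : Smooth E X) : Smooth E X := π ![diff f, diff g]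

/-- A bivector is Poisson if its bracket satisfies the Jacobi identity. -/
def IsPoisson (π : Bivector E X) : Prop :=
  ∀ f g h, bracket π f (bracket π g h) + bracket π g (bracket π h f)
    + bracket π h (bracket π f g) = 0

/-- The ideal of the section `πⁿ` of `⋀²ⁿ TX` (with `dim X = 2n`): all functions obtained by
pairing `πⁿ` with `2n`-forms. -/
def divisorIdeal (π : Bivector E X) (n : ℕ) : Ideal (Smooth E X) :=
  Ideal.span (Set.range fun ξ : Fin (2 * n) → Covector E X => formPow (homog π) n (2 * n) ξ)

variable (ι : C^∞⟮𝓘(ℝ, F), D; 𝓘(ℝ, E), X⟯)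

/-- `V` is tangent to the submanifold `D` at the point `p ∈ D`. -/
def IsTangentAt (V : VField E X) (p : D) : Prop :=
  ∀ f : Smooth E X, f.comp ι = 0 → V f (ι p) = 0

/-- `V` is tangent to the submanifold `D` at all points of `D`. -/
def IsTangent (V : VField E X) : Prop := ∀ p, IsTangentAt ι V p

/-- `V` vanishes at all points of `D`. -/
def VanishesAlong (V : VField E X) : Prop := ∀ f : Smooth E X, (V f).comp ι = 0

/-- The vector field `V` on `X` restricts to the vector field `W` on `D`. -/
def IsRelated (V : VField E X) (W : VField F D) : Prop :=
  ∀ f : Smooth E X, (V f).comp ι = W (f.comp ι)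

/-- `𝓘` is an elliptic divisor ideal with support `D`: it consists of the global sections of an
ideal sheaf, has zero set `D`, and near each point of `D` it is generated by a function for which
`D` is critical with definite normal Hessian (after a change of sign, positive definite). -/
structure IsEllipticIdeal (𝓘 : Ideal (Smooth E X)) : Prop where
  local_mem : ∀ f : Smooth E X,
    (∀ x, ∃ f' ∈ 𝓘, ∀ᶠ y in nhds x, f y = f' y) → f ∈ 𝓘
  zeroLocus : {x : X | ∀ f ∈ 𝓘, f x = 0} = Set.range ι
  generator : ∀ p : D, ∃ U : Set X, IsOpen U ∧ ι p ∈ U ∧ ∃ g ∈ 𝓘,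
    (∀ f ∈ 𝓘, ∃ h : Smooth E X, ∀ x ∈ U, f x = h x * g x) ∧
    ∀ q : D, ι q ∈ U → ∀ V : VField E X,
      V g (ι q) = 0 ∧ (IsTangentAt ι V q ∨ 0 < V (V g) (ι q))

/-- The module of vector fields preserving the ideal `𝓘`. For an elliptic divisor ideal this is
the module of sections of the elliptic tangent bundle, with its Lie algebroid structure. -/
def preserving (𝓘 : Ideal (Smooth E X)) : LieRinehartSubalgebra (Smooth E X) (VField E X) where
  carrier := {V | ∀ f ∈ 𝓘, V f ∈ 𝓘}
  add_mem' hV hW f hf := 𝓘.add_mem (hV f hf) (hW f hf)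
  zero_mem' _ _ := 𝓘.zero_mem
  smul_mem' c _ hV f hf := 𝓘.mul_mem_left c (hV f hf)
  lie_mem' hV hW f hf := by
    rw [Derivation.commutator_apply]
    exact 𝓘.sub_mem (hV _ (hW f hf)) (hW _ (hV f hf))

/-- Sections of the Lie algebroid of vector fields preserving `𝓘`. -/
abbrev ASec (𝓘 : Ideal (Smooth E X)) := ↥(preserving 𝓘)

/-- Lie algebroid forms on the Lie algebroid of vector fields preserving `𝓘`. -/
abbrev AForm (𝓘 : Ideal (Smooth E X)) (k : ℕ) := Form (Smooth E X) (ASec 𝓘) k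

/-- `ω` is inverse to (a lift to the Lie algebroid of) the bivector `π`: if `ω(V, ·)` is the
restriction of the covector field `ξ`, then `V = π(ξ, ·)`. -/
def IsDual {𝓘 : Ideal (Smooth E X)} (π : Bivector E X) (ωA : AForm 𝓘 2) : Prop :=
  ∀ (ξ η : Covector E X) (V : ASec 𝓘),
    (∀ W : ASec 𝓘, ωA ![V, W] = ξ W.1) → π ![ξ, η] = η V.1

/-! ### Residues along the degeneracy locus -/

/-- A coorientation of the codimension-two submanifold `D`, given by a representing nowhere
vanishing section of `⋀² (ND)*`, extended to a two-form on `X`. -/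
structure Coorientation where
  form : DForm E X 2
  conormal : ∀ V W : VField E X, ∀ p : D, IsTangentAt ι V p → form ![V, W] (ι p) = 0
  nonvanishing : ∀ p : D, ∃ V W : VField E X, form ![V, W] (ι p) ≠ 0

/-- `V` represents `r ∂_r` along `D`: it vanishes along `D` and its linearisation
`v ↦ [v, V]` on the normal bundle is the identity. -/
structure IsRadial (V : VField E X) : Prop where
  vanishes : VanishesAlong ι V
  linearization : ∀ W : VField E X, IsTangent ι (⁅W, V⁆ - W)

variable {ι} in
/-- `V` represents `∂_θ` along the cooriented submanifold `D`: it vanishes along `D` and its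
linearisation `v ↦ Jv = [v, V]` on the normal bundle is a positively oriented complex structure. -/
structure IsAngular (ν : Coorientation ι) (V : VField E X) : Prop where
  vanishes : VanishesAlong ι V
  linearization : ∀ W : VField E X, IsTangent ι (⁅⁅W, V⁆, V⁆ + W)
  positive : ∀ (W : VField E X) (p : D), 0 ≤ ν.form ![W, ⁅W, V⁆] (ι p)

variable {ι} {𝓘 : Ideal (Smooth E X)}

/-- `ξ` is the elliptic residue of `η`: the coefficient of `d log r ∧ dθ`, restricted to `D`. -/
def IsResQ (ν : Coorientation ι) {k : ℕ} (η : AForm 𝓘 (k + 2)) (ξ : DForm F D k) : Prop :=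
  ∀ R T : ASec 𝓘, IsRadial ι R.1 → IsAngular ν T.1 →
    ∀ (V : Fin k → ASec 𝓘) (W : Fin k → VField F D), (∀ i, IsRelated ι (V i).1 (W i)) →
      ξ W = (η (Matrix.vecCons R (Matrix.vecCons T V))).comp ι

variable (ι) in
/-- `ξ` is the radial residue of `η` (where `η` has zero elliptic residue): the coefficient of
`d log r`, restricted to `D`. -/
def IsResR {k : ℕ} (η : AForm 𝓘 (k + 1)) (ξ : DForm F D k) : Prop :=
  ∀ R : ASec 𝓘, IsRadial ι R.1 →
    ∀ (V : Fin k → ASec 𝓘) (W : Fin k → VField F D), (∀ i, IsRelated ι (V i).1 (W i)) →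
      ξ W = (η (Matrix.vecCons R V)).comp ι

/-- `ξ` is the `θ`-residue of `η` (where `η` has zero elliptic residue): the coefficient of
`dθ`, restricted to `D`. -/
def IsResTheta (ν : Coorientation ι) {k : ℕ} (η : AForm 𝓘 (k + 1)) (ξ : DForm F D k) : Prop :=
  ∀ T : ASec 𝓘, IsAngular ν T.1 →
    ∀ (V : Fin k → ASec 𝓘) (W : Fin k → VField F D), (∀ i, IsRelated ι (V i).1 (W i)) →
      ξ W = (η (Matrix.vecCons T V)).comp ι

open Classical in
/-- The unique form with a given property (`0` if there is none). -/
def theForm {k : ℕ} (P : DForm F D k → Prop) : DForm F D k :=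
  if h : ∃! ξ, P ξ then h.choose else 0

/-- The elliptic residue `Res_q : Ω^{k+2}(𝒜) → Ω^k(D)`. -/
def resQ (ν : Coorientation ι) {k : ℕ} (η : AForm 𝓘 (k + 2)) : DForm F D k :=
  theForm (IsResQ ν η)

variable (ι) in
/-- The radial residue `Res_r : Ω₀^{k+1}(𝒜) → Ω^k(D)`. -/
def resR {k : ℕ} (η : AForm 𝓘 (k + 1)) : DForm F D k := theForm (IsResR ι η)

/-- The `θ`-residue `Res_θ : Ω₀^{k+1}(𝒜) → Ω^k(D)`. -/
def resTheta (ν : Coorientation ι) {k : ℕ} (η : AForm 𝓘 (k + 1)) : DForm F D k :=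
  theForm (IsResTheta ν η)

/-- The elliptic residue of an inhomogeneous form, degree by degree (forms of degree less than two
have residue zero). -/
def resQForms (ν : Coorientation ι) (a : Forms (Smooth E X) (ASec 𝓘)) : DForms F D :=
  fun k => resQ ν (a (k + 2))

/-! ### Pure spinors, cosymplectic structures and symplectic foliations -/

/-- Two inhomogeneous forms agree at the point `p`. -/
def AgreeAt (ρ ρ' : DForms F D) (p : D) : Prop := ∀ k W, ρ k W p = ρ' k W p

/-- The homogeneous form `η` is nonzero at the point `p`. -/
def NonzeroAt {k : ℕ} (η : DForm F D k) (p : D) : Prop := ∃ W, η W p ≠ 0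

/-- `η` is closed on the set `U`. -/
def IsClosedOn {k : ℕ} (η : DForm F D k) (U : Set D) : Prop := ∀ V, ∀ p ∈ U, extD η V p = 0

/-- Clifford action `(V + ξ) · ρ = ι_V ρ + ξ ∧ ρ`. -/
def clifford (V : VField F D) (ξ : DForm F D 1) (ρ : DForms F D) : DForms F D :=
  fun k => (ρ (k + 1)).curryLeft V + (homog ξ ⋏ ρ) k

/-- `ρ` is a global pure spinor: at each point it is nonzero and of the form `e^B ∧ Ω` with `Ω`
decomposable, and `dρ = v · ρ` locally, for a section `v` of `TD ⊕ T*D`. -/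
def IsGlobalPureSpinor (ρ : DForms F D) : Prop :=
  ∀ p : D, (∃ k, NonzeroAt (ρ k) p) ∧
    (∃ (B : DForm F D 2) (j : ℕ) (θ : Fin j → DForm F D 1),
      AgreeAt ρ (formExp B ⋏ formProd θ) p) ∧
    ∃ U : Set D, IsOpen U ∧ p ∈ U ∧ ∃ (V : VField F D) (ξ : DForm F D 1), ∀ q ∈ U,
      (∀ W, clifford V ξ ρ 0 W q = 0) ∧
      ∀ (k : ℕ) (W : Fin (k + 1) → VField F D),
        extD (ρ k) W q = clifford V ξ ρ (k + 1) W q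

/-- On the open set `U`, of dimension `k + 2ℓ`, the tuple `(α₁, …, αₖ, β)` is a `k`-cosymplectic
tuple: all forms are closed, `β` has constant rank `2ℓ`, and `α₁ ∧ … ∧ αₖ ∧ β^ℓ` vanishes
nowhere. -/
structure IsCosymplecticOn {k : ℕ} (ℓ : ℕ) (α : Fin k → DForm F D 1) (β : DForm F D 2)
    (U : Set D) : Prop where
  closed_one : ∀ i, IsClosedOn (α i) U
  closed_two : IsClosedOn β U
  rank_ge : ∀ p ∈ U, NonzeroAt (formPow (homog β) ℓ (2 * ℓ)) p
  rank_le : ∀ p ∈ U, ¬ NonzeroAt (formPow (homog β) (ℓ + 1) (2 * (ℓ + 1))) p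
  volume : ∀ p ∈ U, NonzeroAt ((formProd α ⋏ formPow (homog β) ℓ) (k + 2 * ℓ)) p

/-- `ρ` is a closed `k`-cosymplectic global pure spinor on the manifold `D` of dimension `k + 2ℓ`:
it is a closed global pure spinor with nowhere vanishing top degree part, and there are global
closed one-forms `α₁, …, αₖ` such that locally `ρ = e^β ∧ α₁ ∧ … ∧ αₖ` for a `k`-cosymplectic
tuple `(α₁, …, αₖ, β)`. -/
structure IsCosymplecticSpinor (k ℓ : ℕ) (ρ : DForms F D) : Prop where
  pure : IsGlobalPureSpinor ρ
  closed : ∀ j, IsClosedForm (ρ j)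
  top : ∀ p, NonzeroAt (ρ (k + 2 * ℓ)) p
  tuple : ∃ α : Fin k → DForm F D 1, (∀ i, IsClosedForm (α i)) ∧
    ∀ p : D, ∃ U : Set D, IsOpen U ∧ p ∈ U ∧ ∃ β : DForm F D 2,
      IsCosymplecticOn ℓ α β U ∧ ∀ q ∈ U, AgreeAt ρ (formExp β ⋏ formProd α) q

/-- The involutive module `𝓕` of vector fields, with the leafwise two-form `σ`, is a unimodular
symplectic foliation of corank `k`: `𝓕` is the common kernel of `k` global closed one-forms
which are linearly independent at each point, and `σ` is leafwise closed and nondegenerate. -/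
structure IsUnimodularSymplecticFoliation (k : ℕ)
    (𝓕 : LieRinehartSubalgebra (Smooth F D) (VField F D))
    (σ : Form (Smooth F D) 𝓕 2) : Prop where
  defining : ∃ α : Fin k → DForm F D 1, (∀ i, IsClosedForm (α i)) ∧
    (∀ p, NonzeroAt (formProd α k) p) ∧ ∀ V, V ∈ 𝓕 ↔ ∀ i, α i ![V] = 0
  closed : IsClosedForm σ
  nondegenerate : IsNondegenerate σ

end Manifold

end EllipticPoisson

end

open EllipticPoisson

open scoped Manifold ContDiff Nat

noncomputable section

namespace EllipticPoisson

/-! ### Exterior product, contraction and the antiderivation rule -/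

section WedgeHom

variable {A N : Type*} [CommRing A] [AddCommGroup N] [Module A N]

/-! Residues as contractions. Sections of the elliptic tangent bundle are tangent to `D`, and those
restricting to zero on `D` are, at each point of `D`, combinations of R = r∂_r and T = ∂_θ. Hence
Res_q = ι_T ι_R, Res_r = ι_R and Res_θ = ι_T, followed by descent to `D`; a form descends as soon as
R and T annihilate it along `D` (`existsUnique_restrict`).

Expansion of ρ. Contraction acts on e^ω as a derivation, so ι_T ι_R e^ω = ω(R,T) e^ω − ι_Rω ∧ ι_Tω ∧
e^ω (`inter_inter_wedge_formExp`), and ω(R,T) vanishes on `D` because Res_q(ω) = 0. The powers ω^k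
with k ≤ 2 contribute −α₁∧α₂, those with k > n vanish by dimension. The top component comes from
ωⁿ/n! and is nonzero because ω is nondegenerate (`inter_inter_formPow_ne_zero`).

Closedness. The forms d log r and dθ are closed and have constant values on R and T along `D`, so
brackets with R or T are negligible there (`functional_lie_normal`). Lie derivatives along R and T
then vanish along `D`, and Cartan's formula shows that ι_Rω, ι_Tω and ι_T ι_R e^ω are closed along
`D`.

Local form. The form ω itself does not descend. Put a = d log r, b = dθ + dμ and β = ω − a∧ι_Rω −
b∧ι_Tω. Then β is annihilated by R and T, is closed along `D`, and equals ω modulo ι_Rω and ι_Tω, so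
ρ = −α₁∧α₂∧e^β. To obtain the correct rank, let Y satisfy ω(Y,·) = −d log r. Then ι_Yβ = −b(Y) ι_Tω
along `D`, and Y does not vanish on `D` as a vector field, because ω(R,Y) = 1 while ω(R,·) kills R
and T. Straightening this field solves Yμ = −dθ(Y) near a point of `D`, which makes b(Y) = 0. Now R,
T and Y all annihilate β, and contracting a∧b∧ι_Rω∧β^(n−1), which is zero by degree, with them gives
β^(n−1) = 0 (`IsComplement.formPow_eq_zero`, `exists_localForm`).

Foliation. The common kernel of α₁ and α₂ consists of the fields whose lifts are ω-orthogonal to R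
and T. As ω(R,T) = 0 on `D`, ω descends to the symplectic reduction ⟨R,T⟩^⊥/⟨R,T⟩, which is the
tangent bundle of the foliation (`existsUnique_leafwise`, `isNondegenerate_leafwise`).

Foundations. Forms are alternating maps on modules of derivations, and exterior identities are
proved by induction on the degree through `inter_wedge`. Completing the square in the normal Hessian
gives functions y₁, y₂ with ideal generated by y₁² + y₂² (`exists_adaptedFrame`), hence the local
frame r∂_r, ∂_θ, ∂_x; partitions of unity make R, T and lifts of vector fields global
(`exists_glue_along`). The transport equation is solved by a smooth flow obtained from the inverse
function theorem in a space of curves. -/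

theorem Form.sum_apply {n : ℕ} {ι : Type*} (s : Finset ι) (f : ι → Form A N n) (v : Fin n → N) :
    (∑ i ∈ s, f i) v = ∑ i ∈ s, f i v := by
  induction s using Finset.cons_induction <;> simp_all

/-- The exterior product, up to the factor `j! k!`, as a sum over all permutations. -/
def permSum {j k n : ℕ} (h : j + k = n) (a : Form A N j) (b : Form A N k) (v : Fin n → N) : A :=
  ∑ σ : Equiv.Perm (Fin n), (Equiv.Perm.sign σ : ℤ) •
    (a (fun i => v (σ (Fin.cast h (Fin.castAdd k i)))) *
      b (fun i => v (σ (Fin.cast h (Fin.natAdd j i)))))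

/-- `wedgeHom` sums over cosets of S_j × S_k, the alternatization over all permutations; every coset
is met j! k! times. -/
theorem factorial_smul_wedgeHom {j k n : ℕ} (h : j + k = n) (a : Form A N j) (b : Form A N k)
    (v : Fin n → N) :
    (j ! * k !) • wedgeHom a b (v ∘ Fin.cast h) = permSum h a b v := by
  subst h
  have h1 := congrArg (fun f => LinearMap.mul' A A (f (v ∘ finSumFinEquiv)))
    (MultilinearMap.domCoprod_alternization_eq a b)
  simp only [MultilinearMap.alternatization_apply, Fintype.card_fin, map_sum] at h1
  have h2 : (j ! * k !) • wedgeHom a b (v ∘ Fin.cast rfl) =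
      LinearMap.mul' A A (((j ! * k !) • a.domCoprod b) (v ∘ finSumFinEquiv)) := by
    rw [AlternatingMap.smul_apply, map_nsmul]
    rfl
  rw [h2, ← h1, permSum]
  refine Fintype.sum_equiv finSumFinEquiv.permCongr _ _ fun σ => ?_
  rw [Equiv.Perm.sign_permCongr, Units.smul_def, map_zsmul]
  congr 1
  simp only [MultilinearMap.domDomCongr_apply, MultilinearMap.domCoprod_apply,
    LinearMap.mul'_apply, Equiv.permCongr_apply, Fin.cast_refl, AlternatingMap.coe_multilinearMap]
  congr 2
  · funext i
    simp
  · funext i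
    simp

/-- The permutation of `Fin (n + 1)` with `i ↦ 0`, and `τ` on the remaining indices. -/
def permInsert {n : ℕ} (i : Fin (n + 1)) (τ : Equiv.Perm (Fin n)) : Equiv.Perm (Fin (n + 1)) :=
  Equiv.Perm.decomposeFin.symm (0, τ) * i.cycleRange

theorem permInsert_self {n : ℕ} (i : Fin (n + 1)) (τ : Equiv.Perm (Fin n)) :
    permInsert i τ i = 0 := by
  simp [permInsert]

theorem permInsert_succAbove {n : ℕ} (i : Fin (n + 1)) (τ : Equiv.Perm (Fin n)) (m : Fin n) :
    permInsert i τ (i.succAbove m) = (τ m).succ := by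
  simp [permInsert, Fin.cycleRange_succAbove]

theorem sign_permInsert {n : ℕ} (i : Fin (n + 1)) (τ : Equiv.Perm (Fin n)) :
    (Equiv.Perm.sign (permInsert i τ) : ℤ) = (-1) ^ (i : ℕ) * (Equiv.Perm.sign τ : ℤ) := by
  simp [permInsert, Fin.sign_cycleRange, mul_comm]

theorem permInsert_bijective (n : ℕ) : Function.Bijective
    (fun x : Fin (n + 1) × Equiv.Perm (Fin n) => permInsert x.1 x.2) := by
  rw [Fintype.bijective_iff_injective_and_card]
  constructor
  · rintro ⟨i, τ⟩ ⟨i', τ'⟩ h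
    simp only at h
    have hi : i = i' := by
      have := permInsert_self i τ
      rw [h, ← permInsert_self i' τ'] at this
      exact (permInsert i' τ').injective this
    subst hi
    have : τ = τ' := by
      ext m
      have := permInsert_succAbove i τ m
      rw [h, permInsert_succAbove] at this
      simpa using congrArg Fin.val this.symm
    rw [this]
  · simp [Fintype.card_perm, Nat.factorial_succ]

/-- Permutations are grouped by the preimage of 0, so that the position receiving the first argument
becomes a summation index. -/
theorem sum_perm_succ {n : ℕ} {M : Type*} [AddCommMonoid M] (f : Equiv.Perm (Fin (n + 1)) → M) :
    ∑ σ, f σ = ∑ i : Fin (n + 1), ∑ τ : Equiv.Perm (Fin n), f (permInsert i τ) := by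
  rw [← Fintype.sum_prod_type']
  exact (Function.Bijective.sum_comp (permInsert_bijective n) f).symm

/-- Contraction of the first slot, zero in degree zero. -/
def contr (V : N) : ∀ {k : ℕ}, Form A N (k + 1) → Form A N k := fun a => a.curryLeft V

theorem comp_eq_insertNth {j : ℕ} {M : Type*} (f : Fin (j + 1) → M) (p : Fin (j + 1)) :
    f = p.insertNth (f p) (fun i => f (p.succAbove i)) := by
  rw [Fin.eq_insertNth_iff]
  exact ⟨rfl, rfl⟩

theorem permSum_cons {j k n : ℕ} (h : j + k = n + 1) (a : Form A N j) (b : Form A N k)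
    (V : N) (w : Fin n → N) :
    permSum h a b (Matrix.vecCons V w) =
    ∑ i : Fin (n + 1), ∑ τ : Equiv.Perm (Fin n), ((-1) ^ (i : ℕ) * (Equiv.Perm.sign τ : ℤ)) •
    (a (fun m => (Matrix.vecCons V w : Fin (n + 1) → N)
        (permInsert i τ (Fin.cast h (Fin.castAdd k m)))) *
      b (fun m => (Matrix.vecCons V w : Fin (n + 1) → N)
        (permInsert i τ (Fin.cast h (Fin.natAdd j m))))) := by
  rw [permSum, sum_perm_succ]
  simp_rw [sign_permInsert]

/-- The argument V sits in slot p of `a`; moving it to the front of `a` costs the same sign as its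
insertion into the permutation, so no sign remains. -/
theorem permInsert_left {j k n : ℕ} (h : j + 1 + k = n + 1) (h' : j + k = n)
    (a : Form A N (j + 1)) (b : Form A N k) (V : N) (w : Fin n → N) (τ : Equiv.Perm (Fin n))
    (p : Fin (j + 1)) :
    ((-1) ^ (Fin.cast h (Fin.castAdd k p) : ℕ) * (Equiv.Perm.sign τ : ℤ)) •
    (a (fun m => (Matrix.vecCons V w : Fin (n + 1) → N)
        (permInsert (Fin.cast h (Fin.castAdd k p)) τ (Fin.cast h (Fin.castAdd k m)))) *
      b (fun m => (Matrix.vecCons V w : Fin (n + 1) → N)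
        (permInsert (Fin.cast h (Fin.castAdd k p)) τ (Fin.cast h (Fin.natAdd (j + 1) m))))) =
    (Equiv.Perm.sign τ : ℤ) • (contr V a (fun i => w (τ (Fin.cast h' (Fin.castAdd k i)))) *
      b (fun i => w (τ (Fin.cast h' (Fin.natAdd j i))))) := by
  rw [comp_eq_insertNth (fun m => (Matrix.vecCons V w : Fin (n + 1) → N)
        (permInsert (Fin.cast h (Fin.castAdd k p)) τ (Fin.cast h (Fin.castAdd k m)))) p]
  rw [AlternatingMap.map_insertNth]
  have e1 : ∀ m, Fin.cast h (Fin.castAdd k (p.succAbove m)) =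
      (Fin.cast h (Fin.castAdd k p)).succAbove (Fin.cast h' (Fin.castAdd k m)) := by
    intro m
    ext
    simp only [Fin.succAbove, Fin.lt_def, Fin.val_cast, Fin.val_castAdd, Fin.val_castSucc]
    split_ifs <;> simp
  have e2 : ∀ m, Fin.cast h (Fin.natAdd (j + 1) m) =
      (Fin.cast h (Fin.castAdd k p)).succAbove (Fin.cast h' (Fin.natAdd j m)) := by
    intro m
    ext
    simp only [Fin.succAbove, Fin.lt_def, Fin.val_cast, Fin.val_castAdd, Fin.val_castSucc,
      Fin.val_natAdd]
    rw [if_neg (by omega)]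
    simp; omega
  simp only [e1, e2, permInsert_succAbove, permInsert_self, Matrix.cons_val_zero,
    Matrix.cons_val_succ, contr, AlternatingMap.curryLeft_apply_apply]
  simp only [Fin.val_cast, Fin.val_castAdd, smul_mul_assoc, smul_smul]
  congr 1
  rw [mul_right_comm, ← mul_pow]; simp

/-- Here V sits in slot p of `b`, at position j + p of the product: the signs for p cancel and
(-1)^j survives. -/
theorem permInsert_right {j k n : ℕ} (h : j + (k + 1) = n + 1) (h' : j + k = n)
    (a : Form A N j) (b : Form A N (k + 1)) (V : N) (w : Fin n → N) (τ : Equiv.Perm (Fin n))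
    (p : Fin (k + 1)) :
    ((-1) ^ (Fin.cast h (Fin.natAdd j p) : ℕ) * (Equiv.Perm.sign τ : ℤ)) •
    (a (fun m => (Matrix.vecCons V w : Fin (n + 1) → N)
        (permInsert (Fin.cast h (Fin.natAdd j p)) τ (Fin.cast h (Fin.castAdd (k + 1) m)))) *
      b (fun m => (Matrix.vecCons V w : Fin (n + 1) → N)
        (permInsert (Fin.cast h (Fin.natAdd j p)) τ (Fin.cast h (Fin.natAdd j m))))) =
    (-1) ^ j * ((Equiv.Perm.sign τ : ℤ) • (a (fun i => w (τ (Fin.cast h' (Fin.castAdd k i)))) *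
      contr V b (fun i => w (τ (Fin.cast h' (Fin.natAdd j i)))))) := by
  rw [comp_eq_insertNth (fun m => (Matrix.vecCons V w : Fin (n + 1) → N)
        (permInsert (Fin.cast h (Fin.natAdd j p)) τ (Fin.cast h (Fin.natAdd j m)))) p]
  rw [AlternatingMap.map_insertNth]
  have e1 : ∀ m, Fin.cast h (Fin.natAdd j (p.succAbove m)) =
      (Fin.cast h (Fin.natAdd j p)).succAbove (Fin.cast h' (Fin.natAdd j m)) := by
    intro m
    ext
    simp only [Fin.succAbove, Fin.lt_def, Fin.val_cast, Fin.val_natAdd, Fin.val_castSucc]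
    split_ifs <;> simp_all <;> omega
  have e2 : ∀ m, Fin.cast h (Fin.castAdd (k + 1) m) =
      (Fin.cast h (Fin.natAdd j p)).succAbove (Fin.cast h' (Fin.castAdd k m)) := by
    intro m
    ext
    simp only [Fin.succAbove, Fin.lt_def, Fin.val_cast, Fin.val_castAdd, Fin.val_castSucc,
      Fin.val_natAdd]
    rw [if_pos (by omega)]
    simp
  simp only [e1, e2, permInsert_succAbove, permInsert_self, Matrix.cons_val_zero,
    Matrix.cons_val_succ, contr, AlternatingMap.curryLeft_apply_apply]
  simp only [Fin.val_cast, Fin.val_natAdd, pow_add, zsmul_eq_mul]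
  push_cast
  have : ((-1 : A) ^ (p : ℕ)) * (-1) ^ (p : ℕ) = 1 := by rw [← mul_pow]; simp
  linear_combination ((-1) ^ j * (((Equiv.Perm.sign τ : ℤ) : A)) *
    a (fun i => w (τ (Fin.cast h' (Fin.castAdd k i)))) *
      b (Matrix.vecCons V fun i => w (τ (Fin.cast h' (Fin.natAdd j i))))) * this

/-- The factors j + 1 and k + 1 count the slots that V can occupy; they are absorbed by the
factorials when passing back to `wedgeHom`. -/
theorem permSum_succ_succ {j k n : ℕ} (h : j + 1 + (k + 1) = n + 1) (h₁ : j + (k + 1) = n)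
    (h₂ : j + 1 + k = n) (a : Form A N (j + 1)) (b : Form A N (k + 1)) (V : N) (w : Fin n → N) :
    permSum h a b (Matrix.vecCons V w) =
      (j + 1) * permSum h₁ (contr V a) b w +
        (-1) ^ (j + 1) * ((k + 1) * permSum h₂ a (contr V b) w) := by
  rw [permSum_cons, ← (finCongr h).sum_comp, Fin.sum_univ_add]
  simp only [finCongr_apply]
  congr 1
  · rw [Finset.sum_congr rfl fun p _ => Finset.sum_congr rfl fun τ _ =>
      permInsert_left h h₁ a b V w τ p]
    simp [permSum]
  · rw [Finset.sum_congr rfl fun p _ => Finset.sum_congr rfl fun τ _ =>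
      permInsert_right h h₂ a b V w τ p]
    simp [permSum, Finset.mul_sum, mul_left_comm]

theorem permSum_succ_zero {j n : ℕ} (h : j + 1 + 0 = n + 1) (h₁ : j + 0 = n)
    (a : Form A N (j + 1)) (b : Form A N 0) (V : N) (w : Fin n → N) :
    permSum h a b (Matrix.vecCons V w) = (j + 1) * permSum h₁ (contr V a) b w := by
  rw [permSum_cons, ← (finCongr h).sum_comp, Fin.sum_univ_add]
  simp only [finCongr_apply]
  rw [Finset.sum_congr rfl fun p _ => Finset.sum_congr rfl fun τ _ =>
      permInsert_left h h₁ a b V w τ p]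
  simp [permSum]

theorem permSum_zero_succ {k n : ℕ} (h : 0 + (k + 1) = n + 1) (h₂ : 0 + k = n)
    (a : Form A N 0) (b : Form A N (k + 1)) (V : N) (w : Fin n → N) :
    permSum h a b (Matrix.vecCons V w) = (k + 1) * permSum h₂ a (contr V b) w := by
  rw [permSum_cons, ← (finCongr h).sum_comp, Fin.sum_univ_add]
  simp only [finCongr_apply]
  rw [Finset.sum_congr (g := fun p => _) rfl fun p _ => Finset.sum_congr rfl fun τ _ =>
      permInsert_right h h₂ a b V w τ p]
  simp [permSum]

theorem wedgeHom_zero_zero (h : 0 + 0 = 0) (a : Form A N 0) (b : Form A N 0) (w : Fin 0 → N) :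
    wedgeHom a b (w ∘ Fin.cast h) = a w * b w := by
  have e := factorial_smul_wedgeHom h a b w
  simp only [Nat.factorial_zero, mul_one, one_smul] at e
  rw [e, permSum]
  simp only [Finset.univ_unique, Finset.sum_singleton, Equiv.Perm.default_eq, Equiv.Perm.sign_one]
  simp only [Units.val_one, one_smul]
  rw [Subsingleton.elim (fun i => w _) w, Subsingleton.elim (fun i => w _) w]

/-- Contraction of an inhomogeneous form with `V`. -/
def inter (V : N) (a : Forms A N) : Forms A N := fun k => contr V (a (k + 1))

/-- The parity involution, multiplication with `(-1)^k` in degree `k`. -/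
def parity (a : Forms A N) : Forms A N := fun k => (-1 : A) ^ k • a k

theorem inter_apply (V : N) (a : Forms A N) (k : ℕ) (w : Fin k → N) :
    inter V a k w = a (k + 1) (Matrix.vecCons V w) := rfl

variable [Algebra ℝ A]

/-- Positive integers are units in a real algebra; this is what divides out the factorials of
`permSum`. -/
theorem natCast_mul_cancel {n : ℕ} (hn : n ≠ 0) {x y : A} (h : (n : A) * x = n * y) : x = y := by
  have e : algebraMap ℝ A ((n : ℝ)⁻¹) * (n : A) = 1 := by
    rw [← map_natCast (algebraMap ℝ A), ← map_mul, inv_mul_cancel₀ (by exact_mod_cast hn), map_one]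
  calc x = algebraMap ℝ A ((n : ℝ)⁻¹) * (n : A) * x := by rw [e, one_mul]
    _ = algebraMap ℝ A ((n : ℝ)⁻¹) * (n : A) * y := by rw [mul_assoc, h, mul_assoc]
    _ = y := by rw [e, one_mul]

theorem wedgeHom_succ_succ {j k n : ℕ} (h : j + 1 + (k + 1) = n + 1) (h₁ : j + (k + 1) = n)
    (h₂ : j + 1 + k = n) (a : Form A N (j + 1)) (b : Form A N (k + 1)) (V : N) (w : Fin n → N) :
    wedgeHom a b ((Matrix.vecCons V w : Fin (n + 1) → N) ∘ Fin.cast h) =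
      wedgeHom (contr V a) b (w ∘ Fin.cast h₁) +
        (-1) ^ (j + 1) * wedgeHom a (contr V b) (w ∘ Fin.cast h₂) := by
  have e := permSum_succ_succ h h₁ h₂ a b V w
  rw [← factorial_smul_wedgeHom, ← factorial_smul_wedgeHom, ← factorial_smul_wedgeHom] at e
  refine natCast_mul_cancel (n := (j + 1)! * (k + 1)!) (by positivity) ?_
  rw [← nsmul_eq_mul, e]
  simp only [nsmul_eq_mul, Nat.factorial_succ]
  push_cast
  ring

theorem wedgeHom_succ_zero {j n : ℕ} (h : j + 1 + 0 = n + 1) (h₁ : j + 0 = n)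
    (a : Form A N (j + 1)) (b : Form A N 0) (V : N) (w : Fin n → N) :
    wedgeHom a b ((Matrix.vecCons V w : Fin (n + 1) → N) ∘ Fin.cast h) =
      wedgeHom (contr V a) b (w ∘ Fin.cast h₁) := by
  have e := permSum_succ_zero h h₁ a b V w
  rw [← factorial_smul_wedgeHom, ← factorial_smul_wedgeHom] at e
  refine natCast_mul_cancel (n := (j + 1)! * 0 !) (by positivity) ?_
  rw [← nsmul_eq_mul, e]
  simp only [nsmul_eq_mul, Nat.factorial_succ]
  push_cast
  ring

theorem wedgeHom_zero_succ {k n : ℕ} (h : 0 + (k + 1) = n + 1) (h₂ : 0 + k = n)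
    (a : Form A N 0) (b : Form A N (k + 1)) (V : N) (w : Fin n → N) :
    wedgeHom a b ((Matrix.vecCons V w : Fin (n + 1) → N) ∘ Fin.cast h) =
      wedgeHom a (contr V b) (w ∘ Fin.cast h₂) := by
  have e := permSum_zero_succ h h₂ a b V w
  rw [← factorial_smul_wedgeHom, ← factorial_smul_wedgeHom] at e
  refine natCast_mul_cancel (n := 0 ! * (k + 1)!) (by positivity) ?_
  rw [← nsmul_eq_mul, e]
  simp only [nsmul_eq_mul, Nat.factorial_succ]
  push_cast
  ring


/-- The contribution of `a j ∧ b k` to `a ∧ b` in degree `n`. -/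
def wedgeTerm (a b : Forms A N) {n : ℕ} (v : Fin n → N) (x : ℕ × ℕ) : A :=
  if h : x.1 + x.2 = n then wedgeHom (a x.1) (b x.2) (v ∘ Fin.cast h) else 0

theorem wedge_apply (a b : Forms A N) {n : ℕ} (v : Fin n → N) :
    (a ⋏ b) n v = ∑ x ∈ Finset.HasAntidiagonal.antidiagonal n, wedgeTerm a b v x := by
  rw [← Finset.sum_coe_sort, wedge, Form.sum_apply]
  refine Finset.sum_congr rfl fun x _ => ?_
  rw [wedgeTerm, dif_pos (Finset.HasAntidiagonal.mem_antidiagonal.mp x.2)]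
  rfl

theorem wedge_zero_apply (a b : Forms A N) (v : Fin 0 → N) : (a ⋏ b) 0 v = a 0 v * b 0 v := by
  rw [wedge_apply]
  simp only [Finset.Nat.antidiagonal_zero, Finset.sum_singleton, wedgeTerm, add_zero, dif_pos]
  exact wedgeHom_zero_zero _ _ _ _

/-- The cases of degree zero are set apart: there is no slot for V, and the truncated subtraction in
`x.1 - 1` would be meaningless. -/
theorem wedgeTerm_cons (a b : Forms A N) {n : ℕ} (V : N) (w : Fin n → N) {x : ℕ × ℕ}
    (hx : x.1 + x.2 = n + 1) :
    wedgeTerm a b (Matrix.vecCons V w : Fin (n + 1) → N) x =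
      (if x.1 = 0 then 0 else wedgeTerm (inter V a) b w (x.1 - 1, x.2)) +
      (if x.2 = 0 then 0 else wedgeTerm (parity a) (inter V b) w (x.1, x.2 - 1)) := by
  have hpar : ∀ {j k : ℕ} (c : Form A N k) (u : Fin (j + k) → N),
      wedgeHom (parity a j) c u = (-1) ^ j * wedgeHom (a j) c u := by
    intro j k c u
    have := AlternatingMap.domCoprod'.map_smul ((-1 : A) ^ j) (a j ⊗ₜ[A] c)
    rw [TensorProduct.smul_tmul', AlternatingMap.domCoprod'_apply,
      AlternatingMap.domCoprod'_apply] at this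
    simp only [wedgeHom, parity, this]
    simp
  obtain ⟨j, k⟩ := x
  rw [wedgeTerm, dif_pos hx]
  cases j with
  | zero =>
    cases k with
    | zero => simp at hx
    | succ k =>
      have h₂ : 0 + k = n := by simpa [← add_assoc] using hx
      rw [wedgeHom_zero_succ hx h₂]
      simp only [if_true, zero_add, Nat.add_eq_zero_iff, one_ne_zero, and_false, if_false,
        Nat.add_sub_cancel]
      rw [wedgeTerm, dif_pos (by simpa using h₂), hpar]
      simp [inter]
  | succ j =>
    cases k with
    | zero =>
      have h₁ : j + 0 = n := by simpa using hx
      rw [wedgeHom_succ_zero hx h₁]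
      simp only [if_true, add_zero, Nat.add_eq_zero_iff, one_ne_zero, and_false, if_false,
        Nat.add_sub_cancel]
      rw [wedgeTerm, dif_pos h₁]
      rfl
    | succ k =>
      have h₁ : j + (k + 1) = n := by simp only at hx; omega
      have h₂ : j + 1 + k = n := by simp only at hx; omega
      rw [wedgeHom_succ_succ hx h₁ h₂]
      simp only [Nat.add_eq_zero_iff, one_ne_zero, and_false, if_false,
        Nat.add_sub_cancel]
      rw [wedgeTerm, dif_pos h₁, wedgeTerm, dif_pos h₂, hpar]
      rfl

/-- Contraction is an antiderivation. Together with the product in degree zero this determines the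
exterior product, and shuffles play no further role. -/
theorem inter_wedge (V : N) (a b : Forms A N) :
    inter V (a ⋏ b) = inter V a ⋏ b + parity a ⋏ inter V b := by
  funext n
  ext w
  rw [inter_apply, wedge_apply, Finset.sum_congr rfl fun x hx =>
    wedgeTerm_cons a b V w (Finset.HasAntidiagonal.mem_antidiagonal.mp hx), Finset.sum_add_distrib,
    Finset.Nat.sum_antidiagonal_succ, Finset.Nat.sum_antidiagonal_succ']
  simp [wedge_apply]

end WedgeHom

/-! ### The graded algebra of inhomogeneous forms -/

section WedgeAlgebra

variable {A N : Type*} [CommRing A] [AddCommGroup N] [Module A N]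

/-- The induction step for all identities below: contract both sides, expand by `inter_wedge`, and
use the identity one degree lower. This is why those identities are stated in a fixed degree but for
all forms at once. -/
theorem Forms.ext_degree {a b : Forms A N} {n : ℕ}
    (h : ∀ V, inter V a n = inter V b n) : a (n + 1) = b (n + 1) := by
  ext v
  have := congrArg (fun f => f (Matrix.vecTail v)) (h (Matrix.vecHead v))
  simpa [inter_apply] using this

theorem Forms.neg_one_smul (a : Forms A N) : (-1 : A) • a = -a := by
  funext k; ext v; simp
theorem Forms.zero_smul (a : Forms A N) : (0 : A) • a = 0 := by
  funext k; ext v; simp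

theorem inter_add (V : N) (a b : Forms A N) : inter V (a + b) = inter V a + inter V b := rfl
theorem inter_sub (V : N) (a b : Forms A N) : inter V (a - b) = inter V a - inter V b := rfl
theorem inter_neg (V : N) (a : Forms A N) : inter V (-a) = -inter V a := rfl
theorem inter_zero (V : N) : inter V (0 : Forms A N) = 0 := rfl
theorem inter_smul (V : N) (c : A) (a : Forms A N) : inter V (c • a) = c • inter V a := rfl
theorem inter_sum {ι : Type*} (V : N) (s : Finset ι) (a : ι → Forms A N) :
    inter V (∑ i ∈ s, a i) = ∑ i ∈ s, inter V (a i) := by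
  induction s using Finset.cons_induction with
  | empty => rfl
  | cons i s hi ih => rw [Finset.sum_cons, Finset.sum_cons, inter_add, ih]

theorem inter_add_left (V W : N) (a : Forms A N) : inter (V + W) a = inter V a + inter W a := by
  funext k
  exact map_add (a (k + 1)).curryLeft V W

theorem inter_inter_self (V : N) (a : Forms A N) : inter V (inter V a) = 0 := by
  funext k
  exact AlternatingMap.curryLeft_same (a (k + 2)) V

theorem inter_comm (V W : N) (a : Forms A N) : inter V (inter W a) = -inter W (inter V a) := by
  have h := inter_inter_self (V + W) a
  simp only [inter_add_left, inter_add, inter_inter_self, zero_add, add_zero] at h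
  exact eq_neg_of_add_eq_zero_right h

theorem parity_add (a b : Forms A N) : parity (a + b) = parity a + parity b := by
  funext k; simp [parity]
theorem parity_smul (c : A) (a : Forms A N) : parity (c • a) = c • parity a := by
  funext k; simp [parity, smul_smul, mul_comm]
theorem parity_parity (a : Forms A N) : parity (parity a) = a := by
  funext k; simp [parity, smul_smul, ← mul_pow]
theorem inter_parity (V : N) (a : Forms A N) : inter V (parity a) = -parity (inter V a) := by
  funext k
  ext w
  simp only [inter_apply, parity, pow_succ, Pi.neg_apply, AlternatingMap.smul_apply,
    AlternatingMap.neg_apply]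
  simp
theorem parity_zero_apply (a : Forms A N) : parity a 0 = a 0 := by simp [parity]

theorem inter_homog_succ (V : N) {k : ℕ} (a : Form A N (k + 1)) :
    inter V (homog a) = homog (contr V a) := by
  funext j
  by_cases h : j = k
  · subst h
    simp [inter, homog]
  · simp only [inter, homog]
    rw [Pi.single_eq_of_ne h, Pi.single_eq_of_ne (by omega)]
    rfl

theorem inter_homog_zero (V : N) (a : Form A N 0) : inter V (homog a) = 0 := by
  funext j
  simp only [inter, homog]
  rw [Pi.single_eq_of_ne (by omega)]
  rfl

theorem inter_formOne (V : N) : inter V (formOne : Forms A N) = 0 := inter_homog_zero _ _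

theorem formOne_zero_apply (v : Fin 0 → N) : (formOne : Forms A N) 0 v = 1 := by
  simp [formOne, homog]

theorem parity_homog {k : ℕ} (a : Form A N k) : parity (homog a) = (-1 : A) ^ k • homog a := by
  funext j
  by_cases h : j = k
  · subst h; simp [parity, homog]
  · simp [parity, homog, Pi.single_eq_of_ne h]

theorem homog_self {k : ℕ} (a : Form A N k) : homog a k = a := by simp [homog]
theorem homog_ne {k j : ℕ} (h : j ≠ k) (a : Form A N k) : homog a j = 0 := by
  simp [homog, Pi.single_eq_of_ne h]
theorem homog_smul {k : ℕ} (c : A) (a : Form A N k) : homog (c • a) = c • homog a :=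
  Pi.single_smul _ _ _
theorem homog_neg {k : ℕ} (a : Form A N k) : homog (-a) = -homog a :=
  Pi.single_neg _ _
theorem homog_zero {k : ℕ} : homog (0 : Form A N k) = 0 :=
  Pi.single_zero _

theorem contr_one (V : N) (a : Form A N 1) (v : Fin 0 → N) : contr V a v = a ![V] := by
  rw [contr, AlternatingMap.curryLeft_apply_apply, Subsingleton.elim v ![]]

theorem inter_homog_one (V : N) (a : Form A N 1) : inter V (homog a) = a ![V] • formOne := by
  rw [inter_homog_succ, formOne, ← homog_smul]
  congr 1
  ext v
  simp [contr_one]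

theorem parity_homog_one (a : Form A N 1) : parity (homog a) = -homog a := by
  rw [parity_homog, pow_one, Forms.neg_one_smul]
theorem parity_homog_two (a : Form A N 2) : parity (homog a) = homog a := by
  simp [parity_homog]
theorem parity_formOne : parity (formOne : Forms A N) = formOne := by
  simp [formOne, parity_homog]

/-- `a` is concentrated in degree `d`. -/
def IsHomogeneous (d : ℕ) (a : Forms A N) : Prop := ∀ k, k ≠ d → a k = 0

theorem isHomogeneous_homog {d : ℕ} (a : Form A N d) : IsHomogeneous d (homog a) :=
  fun _ h => homog_ne h a

theorem IsHomogeneous.eq_homog {d : ℕ} {a : Forms A N} (h : IsHomogeneous d a) :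
    a = homog (a d) := by
  funext k
  by_cases hk : k = d
  · subst hk; rw [homog_self]
  · rw [h k hk, homog_ne hk]

variable [Algebra ℝ A]

theorem add_wedge_apply (n : ℕ) : ∀ a b c : Forms A N, ((a + b) ⋏ c) n = (a ⋏ c + b ⋏ c) n := by
  induction n with
  | zero => intro a b c; ext v; simp [wedge_zero_apply, add_mul]
  | succ n ih =>
    intro a b c
    refine Forms.ext_degree fun V => ?_
    simp only [inter_wedge, inter_add, parity_add]
    simp only [Pi.add_apply] at ih ⊢
    rw [ih, ih]
    abel
theorem add_wedge (a b c : Forms A N) : (a + b) ⋏ c = a ⋏ c + b ⋏ c :=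
  funext fun n => add_wedge_apply n a b c

theorem wedge_add_apply (n : ℕ) : ∀ a b c : Forms A N, (a ⋏ (b + c)) n = (a ⋏ b + a ⋏ c) n := by
  induction n with
  | zero => intro a b c; ext v; simp [wedge_zero_apply, mul_add]
  | succ n ih =>
    intro a b c
    refine Forms.ext_degree fun V => ?_
    simp only [inter_wedge, inter_add]
    simp only [Pi.add_apply] at ih ⊢
    rw [ih, ih]
    abel
theorem wedge_add (a b c : Forms A N) : a ⋏ (b + c) = a ⋏ b + a ⋏ c :=
  funext fun n => wedge_add_apply n a b c

theorem smul_wedge_apply (n : ℕ) : ∀ (f : A) (a c : Forms A N), ((f • a) ⋏ c) n = f • (a ⋏ c) n := by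
  induction n with
  | zero => intro a b c; ext v; simp [wedge_zero_apply, mul_assoc]
  | succ n ih =>
    intro f a c
    refine Forms.ext_degree (b := f • (a ⋏ c)) fun V => ?_
    simp only [inter_wedge, inter_smul, parity_smul]
    simp only [Pi.add_apply, Pi.smul_apply] at ih ⊢
    rw [ih, ih, smul_add]
theorem smul_wedge (f : A) (a c : Forms A N) : (f • a) ⋏ c = f • (a ⋏ c) :=
  funext fun n => smul_wedge_apply n f a c

theorem wedge_smul_apply (n : ℕ) : ∀ (f : A) (a c : Forms A N), (a ⋏ (f • c)) n = f • (a ⋏ c) n := by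
  induction n with
  | zero => intro a b c; ext v; simp [wedge_zero_apply, mul_left_comm]
  | succ n ih =>
    intro f a c
    refine Forms.ext_degree (b := f • (a ⋏ c)) fun V => ?_
    simp only [inter_wedge, inter_smul]
    simp only [Pi.add_apply, Pi.smul_apply] at ih ⊢
    rw [ih, ih, smul_add]
theorem wedge_smul (f : A) (a c : Forms A N) : a ⋏ (f • c) = f • (a ⋏ c) :=
  funext fun n => wedge_smul_apply n f a c

theorem neg_wedge (a c : Forms A N) : (-a) ⋏ c = -(a ⋏ c) := by
  rw [← Forms.neg_one_smul, smul_wedge, Forms.neg_one_smul]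
theorem wedge_neg (a c : Forms A N) : a ⋏ (-c) = -(a ⋏ c) := by
  rw [← Forms.neg_one_smul, wedge_smul, Forms.neg_one_smul]
theorem sub_wedge (a b c : Forms A N) : (a - b) ⋏ c = a ⋏ c - b ⋏ c := by
  rw [sub_eq_add_neg, add_wedge, neg_wedge, sub_eq_add_neg]
theorem wedge_sub (a b c : Forms A N) : a ⋏ (b - c) = a ⋏ b - a ⋏ c := by
  rw [sub_eq_add_neg, wedge_add, wedge_neg, sub_eq_add_neg]
theorem zero_wedge (c : Forms A N) : 0 ⋏ c = 0 := by
  have h := smul_wedge (0 : A) 0 c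
  rwa [Forms.zero_smul, Forms.zero_smul] at h
theorem wedge_zero (c : Forms A N) : c ⋏ 0 = 0 := by
  have h := wedge_smul (0 : A) c 0
  rwa [Forms.zero_smul, Forms.zero_smul] at h
theorem wedge_sum {ι : Type*} (s : Finset ι) (a : Forms A N) (b : ι → Forms A N) :
    a ⋏ (∑ i ∈ s, b i) = ∑ i ∈ s, a ⋏ b i := by
  induction s using Finset.cons_induction with
  | empty => simp [wedge_zero]
  | cons i s hi ih => rw [Finset.sum_cons, Finset.sum_cons, wedge_add, ih]

theorem parity_wedge_apply (n : ℕ) :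
    ∀ a b : Forms A N, (parity (a ⋏ b)) n = (parity a ⋏ parity b) n := by
  induction n with
  | zero => intro a b; ext v; simp [wedge_zero_apply, parity_zero_apply]
  | succ n ih =>
    intro a b
    refine Forms.ext_degree fun V => ?_
    simp only [inter_wedge, inter_parity, parity_add, neg_wedge, wedge_neg]
    simp only [Pi.add_apply, Pi.neg_apply, neg_add] at ih ⊢
    rw [ih, ih]
theorem parity_wedge (a b : Forms A N) : parity (a ⋏ b) = parity a ⋏ parity b :=
  funext fun n => parity_wedge_apply n a b

theorem wedge_assoc_apply (n : ℕ) :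
    ∀ a b c : Forms A N, ((a ⋏ b) ⋏ c) n = (a ⋏ (b ⋏ c)) n := by
  induction n with
  | zero => intro a b c; ext v; simp [wedge_zero_apply, mul_assoc]
  | succ n ih =>
    intro a b c
    refine Forms.ext_degree fun V => ?_
    simp only [inter_wedge, add_wedge, wedge_add, parity_wedge]
    simp only [Pi.add_apply]
    rw [ih, ih, ih]
    abel
theorem wedge_assoc (a b c : Forms A N) : (a ⋏ b) ⋏ c = a ⋏ (b ⋏ c) :=
  funext fun n => wedge_assoc_apply n a b c

theorem formOne_wedge_apply (n : ℕ) : ∀ a : Forms A N, (formOne ⋏ a) n = a n := by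
  induction n with
  | zero => intro a; ext v; simp [wedge_zero_apply, formOne_zero_apply]
  | succ n ih =>
    intro a
    refine Forms.ext_degree fun V => ?_
    have : parity (formOne : Forms A N) = formOne := by simp [formOne, parity_homog]
    simp only [inter_wedge, inter_formOne, zero_wedge, zero_add, this]
    exact ih _
theorem formOne_wedge (a : Forms A N) : formOne ⋏ a = a :=
  funext fun n => formOne_wedge_apply n a

/-- Contraction exchanges even and odd forms, so the two commutation rules have to be proved in a
single induction. -/
theorem wedge_comm_apply (n : ℕ) : ∀ a b : Forms A N,
    (parity a = a → (a ⋏ b) n = (b ⋏ a) n) ∧ (parity a = -a → (a ⋏ b) n = (parity b ⋏ a) n) := by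
  induction n with
  | zero =>
    refine fun a b => ⟨fun _ => ?_, fun _ => ?_⟩ <;> ext v <;>
      simp [wedge_zero_apply, parity_zero_apply, mul_comm]
  | succ n ih =>
    refine fun a b => ⟨fun h => ?_, fun h => ?_⟩
    · refine Forms.ext_degree fun V => ?_
      have h' : parity (inter V a) = -inter V a := by
        rw [← neg_eq_iff_eq_neg, ← inter_parity, h]
      simp only [inter_wedge, Pi.add_apply, h]
      rw [(ih _ _).2 h', (ih _ _).1 h, add_comm]
    · refine Forms.ext_degree fun V => ?_
      have h' : parity (inter V a) = inter V a := by
        rw [← neg_inj, ← inter_parity, h, inter_neg]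
      simp only [inter_wedge, Pi.add_apply, h, inter_parity, parity_parity, neg_wedge, Pi.neg_apply]
      rw [(ih _ _).1 h', (ih _ _).2 h, add_comm]
theorem wedge_comm_of_even {a : Forms A N} (h : parity a = a) (b : Forms A N) : a ⋏ b = b ⋏ a :=
  funext fun n => (wedge_comm_apply n a b).1 h
theorem wedge_comm_of_odd {a : Forms A N} (h : parity a = -a) (b : Forms A N) :
    a ⋏ b = parity b ⋏ a :=
  funext fun n => (wedge_comm_apply n a b).2 h

theorem wedge_formOne (a : Forms A N) : a ⋏ formOne = a := by
  rw [← wedge_comm_of_even parity_formOne, formOne_wedge]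

theorem homog_one_wedge_self (a : Form A N 1) : homog a ⋏ homog a = 0 := by
  have h := wedge_comm_of_odd (parity_homog_one a) (homog a)
  rw [parity_homog_one, neg_wedge] at h
  have h2 : (2 : ℕ) • (homog a ⋏ homog a) = 0 := by
    rw [two_smul]; nth_rewrite 1 [h]; exact neg_add_cancel _
  funext n
  ext v
  have h3 := congrArg (fun f : Forms A N => f n v) h2
  refine natCast_mul_cancel (n := 2) two_ne_zero ?_
  simpa using h3

theorem homog_one_wedge_comm (a b : Form A N 1) : homog a ⋏ homog b = -(homog b ⋏ homog a) := by
  rw [wedge_comm_of_odd (parity_homog_one a), parity_homog_one, neg_wedge]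

/-- An even form commutes with everything, so the m + 1 terms of the Leibniz rule coincide. -/
theorem inter_formPow {a : Forms A N} (h : parity a = a) (V : N) (m : ℕ) :
    inter V (formPow a (m + 1)) = (m + 1 : A) • (inter V a ⋏ formPow a m) := by
  have h' : parity (inter V a) = -inter V a := by rw [← neg_eq_iff_eq_neg, ← inter_parity, h]
  induction m with
  | zero => simp [formPow, wedge_formOne]
  | succ m ih =>
    rw [formPow, inter_wedge, ih, h, wedge_smul, ← wedge_assoc, wedge_comm_of_even h, wedge_assoc]
    conv_lhs => rw [← one_smul A (inter V a ⋏ _)]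
    rw [← formPow, ← add_smul]
    congr 1
    push_cast
    ring

/-- Used to replace `formExp` inside a product by a truncation that is correct up to the degree in
question. -/
theorem wedge_congr_degree {a a' b b' : Forms A N} {n : ℕ} (ha : ∀ k ≤ n, a k = a' k)
    (hb : ∀ k ≤ n, b k = b' k) : (a ⋏ b) n = (a' ⋏ b') n := by
  ext v
  rw [wedge_apply, wedge_apply]
  refine Finset.sum_congr rfl fun x hx => ?_
  have := Finset.HasAntidiagonal.mem_antidiagonal.mp hx
  rw [wedgeTerm, wedgeTerm, ha _ (by omega), hb _ (by omega)]

theorem homog_wedge_homog {j k n : ℕ} (a : Form A N j) (b : Form A N k) (h : n ≠ j + k) :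
    (homog a ⋏ homog b) n = 0 := by
  ext v
  rw [wedge_apply]
  refine Finset.sum_eq_zero fun x hx => ?_
  have := Finset.HasAntidiagonal.mem_antidiagonal.mp hx
  rw [wedgeTerm, dif_pos this]
  rcases eq_or_ne x.1 j with h1 | h1
  · have h2 : x.2 ≠ k := by omega
    rw [homog_ne h2]
    have h3 : AlternatingMap.domCoprod (homog a x.1) (0 : Form A N x.2) = 0 := by
      rw [← AlternatingMap.domCoprod'_apply, TensorProduct.tmul_zero, map_zero]
    simp [wedgeHom, h3]
  · rw [homog_ne h1]
    have h3 : AlternatingMap.domCoprod (0 : Form A N x.1) (homog b x.2) = 0 := by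
      rw [← AlternatingMap.domCoprod'_apply, TensorProduct.zero_tmul, map_zero]
    simp [wedgeHom, h3]

theorem IsHomogeneous.wedge {d e : ℕ} {a b : Forms A N} (ha : IsHomogeneous d a)
    (hb : IsHomogeneous e b) : IsHomogeneous (d + e) (a ⋏ b) := by
  intro k hk
  rw [ha.eq_homog, hb.eq_homog, homog_wedge_homog _ _ hk]

theorem isHomogeneous_formOne : IsHomogeneous 0 (formOne : Forms A N) := isHomogeneous_homog _

theorem IsHomogeneous.formPow {d : ℕ} {a : Forms A N} (ha : IsHomogeneous d a) (m : ℕ) :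
    IsHomogeneous (m * d) (formPow a m) := by
  induction m with
  | zero => rw [zero_mul]; exact isHomogeneous_formOne
  | succ m ih =>
    rw [add_mul, one_mul, add_comm]
    exact ha.wedge ih

theorem formPow_homog_two_ne (w : Form A N 2) {m k : ℕ} (h : k ≠ 2 * m) :
    formPow (homog w) m k = 0 :=
  (isHomogeneous_homog w).formPow m k (by omega)

end WedgeAlgebra

/-! ### The exponential of a two-form -/

section Exp

variable {A N : Type*} [CommRing A] [AddCommGroup N] [Module A N] [Algebra ℝ A]

theorem formExp_even (b : Form A N 2) (m : ℕ) :
    formExp b (2 * m) = ((m ! : ℝ)⁻¹) • formPow (homog b) m (2 * m) := by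
  rw [formExp, Finset.sum_eq_single m]
  · intro j _ hj
    rw [formPow_homog_two_ne b (by omega), smul_zero]
  · intro h
    exact absurd (Finset.mem_range.mpr (by omega)) h

theorem formExp_odd (b : Form A N 2) {k : ℕ} (hk : ∀ m, k ≠ 2 * m) : formExp b k = 0 := by
  rw [formExp]
  refine Finset.sum_eq_zero fun j _ => ?_
  rw [formPow_homog_two_ne b (hk j), smul_zero]

theorem Forms.real_smul_eq (c : ℝ) (a : Forms A N) : c • a = algebraMap ℝ A c • a := by
  funext k; ext v; simp [Algebra.smul_def]

theorem wedge_real_smul (c : ℝ) (a b : Forms A N) : a ⋏ (c • b) = c • (a ⋏ b) := by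
  rw [Forms.real_smul_eq, wedge_smul, ← Forms.real_smul_eq]

/-- The exponential series, truncated. -/
def expTrunc (b : Form A N 2) (K : ℕ) : Forms A N :=
  ∑ j ∈ Finset.range (K + 1), ((j ! : ℝ)⁻¹) • formPow (homog b) j

/-- The range of summation in `formExp` depends on the degree; a fixed truncation is a genuine
finite sum of inhomogeneous forms, to which the algebra applies. -/
theorem formExp_eq_expTrunc (b : Form A N 2) {k K : ℕ} (h : k ≤ K) :
    formExp b k = expTrunc b K k := by
  rw [formExp, expTrunc, Finset.sum_apply]
  simp only [Pi.smul_apply]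
  refine Finset.sum_subset (by simpa using h) fun j _ hj => ?_
  rw [formPow_homog_two_ne b (by simp at hj; omega), smul_zero]

/-- Contraction differentiates the exponential series term by term: the factor j + 1 from the power
lowers (j + 1)! to j!. -/
theorem inter_formExp (b : Form A N 2) (V : N) :
    inter V (formExp b) = inter V (homog b) ⋏ formExp b := by
  funext k
  rw [inter, formExp_eq_expTrunc b le_rfl, wedge_congr_degree (a' := inter V (homog b))
    (b' := expTrunc b k) (fun _ _ => rfl) (fun j hj => formExp_eq_expTrunc b hj)]
  -- Contraction lowers exponents by one and kills the constant term, so the order of truncation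
  -- drops by one.
  have : inter V (expTrunc b (k + 1)) = inter V (homog b) ⋏ expTrunc b k := by
    rw [expTrunc, expTrunc, inter_sum, Finset.sum_range_succ', wedge_sum]
    have h0 : inter V (((0 ! : ℝ)⁻¹) • formPow (homog b) 0) = 0 := by
      rw [Forms.real_smul_eq, inter_smul, formPow, inter_formOne, smul_zero]
    rw [h0, add_zero]
    refine Finset.sum_congr rfl fun j _ => ?_
    rw [Forms.real_smul_eq, inter_smul, inter_formPow (parity_homog_two b), wedge_real_smul,
      Forms.real_smul_eq, smul_smul]
    congr 1
    rw [show (j + 1 : A) = algebraMap ℝ A (j + 1) by rw [map_add, map_natCast, map_one], ← map_mul]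
    congr 1
    rw [Nat.factorial_succ]
    push_cast
    field_simp
  exact congrFun this k

theorem parity_formExp (b : Form A N 2) : parity (formExp b) = formExp b := by
  funext k
  rw [parity]
  rcases Nat.even_or_odd k with h | h
  · rw [h.neg_one_pow, one_smul]
  · rw [formExp_odd b (fun m hm => Nat.not_even_iff_odd.mpr h ⟨m, by omega⟩), smul_zero]

end Exp

/-! ### Forms related along a correspondence of modules -/

section Compat

variable {A A' N N' : Type*} [CommRing A] [AddCommGroup N] [Module A N]
  [CommRing A'] [AddCommGroup N'] [Module A' N']

/-- The forms `a'` on `N'` are induced by the forms `a` on `N`, along a ring homomorphism `f` and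
a correspondence `Rel` between elements of `N` and `N'`. -/
def Compat (f : A →+* A') (Rel : N → N' → Prop) (a : Forms A N) (a' : Forms A' N') : Prop :=
  ∀ (k : ℕ) (V : Fin k → N) (W : Fin k → N'), (∀ i, Rel (V i) (W i)) → a' k W = f (a k V)

variable {f : A →+* A'} {Rel : N → N' → Prop}

theorem Compat.inter {a : Forms A N} {a' : Forms A' N'} (h : Compat f Rel a a') {V : N} {V' : N'}
    (hV : Rel V V') : Compat f Rel (inter V a) (inter V' a') := by
  intro k w w' hw
  exact h (k + 1) _ _ (fun i => by refine Fin.cases hV (fun j => ?_) i; simpa using hw j)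

theorem Compat.add {a b : Forms A N} {a' b' : Forms A' N'} (ha : Compat f Rel a a')
    (hb : Compat f Rel b b') : Compat f Rel (a + b) (a' + b') := by
  intro k V W h
  simp [ha k V W h, hb k V W h]

theorem Compat.neg {a : Forms A N} {a' : Forms A' N'} (ha : Compat f Rel a a') :
    Compat f Rel (-a) (-a') := by
  intro k V W h
  simp [ha k V W h]

theorem Compat.parity {a : Forms A N} {a' : Forms A' N'} (ha : Compat f Rel a a') :
    Compat f Rel (parity a) (EllipticPoisson.parity a') := by
  intro k V W h
  simp [EllipticPoisson.parity, ha k V W h]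

theorem compat_formOne : Compat f Rel formOne formOne := by
  intro k V W h
  rcases Nat.eq_zero_or_pos k with rfl | hk
  · simp [formOne_zero_apply]
  · simp [formOne, homog_ne hk.ne']

theorem compat_homog {k : ℕ} {a : Form A N k} {a' : Form A' N' k}
    (h : ∀ V W, (∀ i, Rel (V i) (W i)) → a' W = f (a V)) :
    Compat f Rel (homog a) (homog a') := by
  intro j V W hVW
  by_cases hj : j = k
  · subst hj
    simpa [homog_self] using h V W hVW
  · simp [homog_ne hj]

variable [Algebra ℝ A] [Algebra ℝ A']

/-- Neither linearity nor functionality of `Rel` is needed: the induction on the degree contracts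
both sides with a related pair. This is what allows products to be computed before descending to
`D`. -/
theorem Compat.wedge {a b : Forms A N} {a' b' : Forms A' N'} (ha : Compat f Rel a a')
    (hb : Compat f Rel b b') : Compat f Rel (a ⋏ b) (a' ⋏ b') := by
  intro n
  induction n generalizing a b a' b' with
  | zero =>
    intro V W h
    rw [wedge_zero_apply, wedge_zero_apply, ha 0 V W h, hb 0 V W h, map_mul]
  | succ n ih =>
    intro V W h
    rw [← Matrix.cons_head_tail V, ← Matrix.cons_head_tail W, ← inter_apply, ← inter_apply,
      inter_wedge, inter_wedge]
    have h0 : Rel (Matrix.vecHead V) (Matrix.vecHead W) := h 0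
    have h1 : ∀ i, Rel (Matrix.vecTail V i) (Matrix.vecTail W i) := fun i => h i.succ
    simp only [Pi.add_apply, AlternatingMap.add_apply, map_add]
    rw [ih (ha.inter h0) hb _ _ h1, ih ha.parity (hb.inter h0) _ _ h1]

theorem Compat.formPow {a : Forms A N} {a' : Forms A' N'} (ha : Compat f Rel a a') (m : ℕ) :
    Compat f Rel (formPow a m) (EllipticPoisson.formPow a' m) := by
  induction m with
  | zero => exact compat_formOne
  | succ m ih => exact ha.wedge ih

theorem Compat.formExp {b : Form A N 2} {b' : Form A' N' 2}
    (hf : ∀ c : ℝ, f (algebraMap ℝ A c) = algebraMap ℝ A' c)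
    (h : Compat f Rel (homog b) (homog b')) : Compat f Rel (formExp b) (formExp b') := by
  intro k V W hVW
  simp only [EllipticPoisson.formExp, Form.sum_apply, map_sum]
  refine Finset.sum_congr rfl fun j _ => ?_
  simp only [AlternatingMap.smul_apply, Algebra.smul_def, map_mul, hf, h.formPow j k V W hVW]

end Compat

/-! ### Pointwise linear algebra with a finite frame -/

section Framed

variable {N : Type*} [AddCommGroup N] [Module ℝ N] {κ : Type*} [Fintype κ]

/-- The first slot of `η` only depends on the coordinates `ε` with respect to `e`. -/
def Framed (e : κ → N) (ε : κ → Form ℝ N 1) (η : Forms ℝ N) : Prop :=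
  ∀ V, inter V η = ∑ i, ε i ![V] • inter (e i) η

variable {e : κ → N} {ε : κ → Form ℝ N 1}

theorem Framed.inter {η : Forms ℝ N} (h : Framed e ε η) (W : N) : Framed e ε (inter W η) := by
  intro V
  rw [inter_comm, h V, inter_sum, ← Finset.sum_neg_distrib]
  refine Finset.sum_congr rfl fun i _ => ?_
  rw [inter_smul, inter_comm, smul_neg, neg_neg]

theorem Framed.wedge {a b : Forms ℝ N} (ha : Framed e ε a) (hb : Framed e ε b) :
    Framed e ε (a ⋏ b) := by
  intro V
  simp only [inter_wedge, smul_add, Finset.sum_add_distrib]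
  congr 1
  · have : ∀ c, ∑ i, ε i ![V] • (EllipticPoisson.inter (e i) a ⋏ c) =
        (∑ i, ε i ![V] • EllipticPoisson.inter (e i) a) ⋏ c := by
      intro c
      induction (Finset.univ : Finset κ) using Finset.cons_induction with
      | empty => simp [zero_wedge]
      | cons i s hi ih => rw [Finset.sum_cons, Finset.sum_cons, add_wedge, ih, smul_wedge]
    rw [ha V, this]
  · rw [hb V, wedge_sum]
    simp only [wedge_smul]

theorem framed_formOne : Framed e ε formOne := by
  intro V; simp [inter_formOne]

theorem Framed.formPow {a : Forms ℝ N} (ha : Framed e ε a) (m : ℕ) : Framed e ε (formPow a m) := by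
  induction m with
  | zero => exact framed_formOne
  | succ m ih => exact ha.wedge ih

/-- Euler's identity for the degree. Contraction with W yields ι_Wη from the coefficients and the
same sum for ι_Wη, of degree k, hence k + 1 in total. Duality of `e` and `ε` is not needed, only the
expansion. -/
theorem Framed.sum_wedge_inter {k : ℕ} : ∀ {η : Forms ℝ N}, Framed e ε η →
    (∑ i, homog (ε i) ⋏ EllipticPoisson.inter (e i) η) k = (k : ℝ) • η k := by
  induction k with
  | zero =>
    intro η _
    ext v
    simp [Form.sum_apply, wedge_zero_apply, homog_ne]
  | succ k ih =>
    intro η h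
    refine Forms.ext_degree (b := ((k + 1 : ℕ) : ℝ) • η) fun W => ?_
    rw [inter_sum]
    have h1 : ∀ i, EllipticPoisson.inter W (homog (ε i) ⋏ EllipticPoisson.inter (e i) η) =
        ε i ![W] • EllipticPoisson.inter (e i) η +
          homog (ε i) ⋏ EllipticPoisson.inter (e i) (EllipticPoisson.inter W η) := by
      intro i
      rw [inter_wedge, inter_homog_one, smul_wedge, formOne_wedge, parity_homog_one, neg_wedge,
        inter_comm W, wedge_neg, neg_neg]
    rw [Finset.sum_congr rfl fun i _ => h1 i, Finset.sum_add_distrib, ← h W, Pi.add_apply,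
      ih (h.inter W), inter_smul]
    ext v
    simp
    ring

theorem Framed.eq_zero_of_card_lt {k : ℕ} {η : Forms ℝ N} (h : Framed e ε η)
    (hk : Fintype.card κ < k) : η k = 0 := by
  classical
  -- The set S collects frame vectors that already annihilate η. Contracting with a vector of S
  -- gives zero; contracting with any other lowers the degree and enlarges S.
  suffices H : ∀ (k : ℕ) (η : Forms ℝ N) (S : Finset κ), Framed e ε η →
      (∀ i ∈ S, EllipticPoisson.inter (e i) η = 0) → Fintype.card κ < k + S.card → η k = 0 from
    H k η ∅ h (by simp) (by simpa using hk)
  intro k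
  induction k with
  | zero =>
    intro η S _ _ hS
    exact absurd (Finset.card_le_univ S) (by omega)
  | succ k ih =>
    intro η S hη hS hc
    refine Forms.ext_degree (b := 0) fun W => ?_
    rw [hη W, Finset.sum_apply]
    refine Finset.sum_eq_zero fun i _ => ?_
    by_cases hi : i ∈ S
    · rw [hS i hi]; simp
    · rw [Pi.smul_apply, ih _ (insert i S) (hη.inter _), smul_zero]
      · intro j hj
        rcases Finset.mem_insert.mp hj with rfl | hj
        · exact inter_inter_self _ _
        · rw [inter_comm, hS j hj, inter_zero, neg_zero]
      · rw [Finset.card_insert_of_notMem hi]; omega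

/-- The top exterior power of a nondegenerate two-form does not vanish. -/
theorem formPow_ne_zero_of_nondegenerate {b : Form ℝ N 2} {n : ℕ} (hn : Fintype.card κ = 2 * n)
    (hb : Framed e ε (homog b)) (hε : ∀ i, ε i ![e i] = 1)
    (hnd : ∀ i, ∃ V, ∀ W, b ![V, W] = ε i ![W]) {k : ℕ} (hk : k ≤ n) :
    formPow (homog b) k ≠ 0 := by
  induction k with
  | zero =>
    intro h
    have := congrArg (fun f : Forms ℝ N => f 0 ![]) h
    simp [formPow, formOne_zero_apply] at this
  | succ k ih =>
    intro h
    refine ih (by omega) ?_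
    -- If b^(k+1) = 0, contraction with the vector dual to `ε i` leaves ε_i ∧ b^k = 0; contracting
    -- further with `e i` exhibits b^k as ε_i ∧ ι_{e_i} b^k.
    have h1 : ∀ i, homog (ε i) ⋏ formPow (homog b) k = 0 := by
      intro i
      obtain ⟨V, hV⟩ := hnd i
      have h2 := inter_formPow (parity_homog_two b) V k
      rw [h, inter_zero] at h2
      have h3 : inter V (homog b) = homog (ε i) := by
        rw [inter_homog_succ]
        congr 1
        ext w
        rw [contr, AlternatingMap.curryLeft_apply_apply]
        have : w = ![w 0] := by funext j; fin_cases j; rfl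
        rw [this, ← hV]
      rw [h3] at h2
      exact (smul_eq_zero.mp h2.symm).resolve_left (by positivity)
    have h2 : ∀ i, formPow (homog b) k = homog (ε i) ⋏ inter (e i) (formPow (homog b) k) := by
      intro i
      have h3 := congrArg (inter (e i)) (h1 i)
      rw [inter_wedge, inter_homog_one, hε, one_smul, formOne_wedge, parity_homog_one, neg_wedge,
        inter_zero] at h3
      exact add_neg_eq_zero.mp h3
    funext d
    by_cases hd : d = 2 * k
    · subst hd
      -- Adding these 2n expressions for b^k and comparing with Euler's identity gives 2n b^k = 2k
      -- b^k, where k < n.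
      have h3 := (hb.formPow k).sum_wedge_inter (k := 2 * k)
      rw [← Finset.sum_congr rfl fun i _ => h2 i, Finset.sum_const, Finset.card_univ, hn] at h3
      ext v
      have h4 := congrArg (fun f => f v) h3
      simp only [nsmul_eq_mul, Pi.smul_apply, AlternatingMap.smul_apply, smul_eq_mul] at h4
      have h5 : ((2 * n : ℕ) : ℝ) * formPow (homog b) k (2 * k) v =
          ((2 * k : ℕ) : ℝ) * formPow (homog b) k (2 * k) v := by
        rw [← h4]
      have h6 : ((2 * n : ℕ) : ℝ) - ((2 * k : ℕ) : ℝ) ≠ 0 := by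
        rw [sub_ne_zero]; exact_mod_cast by omega
      exact (mul_eq_zero.mp (by linear_combination h5 :
        (((2 * n : ℕ) : ℝ) - ((2 * k : ℕ) : ℝ)) * formPow (homog b) k (2 * k) v = 0)).resolve_left h6
    · exact formPow_homog_two_ne b hd

end Framed

/-! ### Cartan calculus over a Lie-Rinehart algebra -/

section Cartan

variable {A L : Type*} [CommRing A] [LieRing L] [Module A L] [LieRingModule L A]
  [LieRinehartRing A L]

open Function

theorem update_comp_swap {ι M : Type*} [DecidableEq ι] {v : ι → M} {i j : ι} (h : v i = v j)
    (hij : i ≠ j) (x : M) : update v j x = update v i x ∘ Equiv.swap i j := by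
  funext l
  rcases eq_or_ne l i with rfl | hi
  · simp [update_of_ne hij, update_of_ne hij.symm, h]
  · rcases eq_or_ne l j with rfl | hj
    · simp
    · simp [Equiv.swap_apply_of_ne_of_ne hi hj, update_of_ne hi, update_of_ne hj]

theorem smul_lie_eq (c : A) (V W : L) : ⁅c • V, W⁆ = c • ⁅V, W⁆ - ⁅W, c⁆ • V := by
  rw [← lie_skew, LieRinehartRing.leibniz_smul_right, ← lie_skew V W, neg_add, smul_neg]
  rw [sub_eq_add_neg]

/-- The Lie derivative of a form. -/
def lieDer (V : L) {k : ℕ} (η : Form A L k) : Form A L k where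
  toFun W := ⁅V, η W⁆ - ∑ i, η (update W i ⁅V, W i⁆)
  map_update_add' := by
    intro inst W m x y
    obtain rfl : inst = instDecidableEqFin k := Subsingleton.elim _ _
    rw [← Finset.add_sum_erase _ _ (Finset.mem_univ m), ← Finset.add_sum_erase _ _ (Finset.mem_univ m),
      ← Finset.add_sum_erase _ _ (Finset.mem_univ m)]
    have h : ∀ z, ∑ i ∈ Finset.univ.erase m,
        η (update (update W m z) i ⁅V, (update W m z) i⁆) =
        ∑ i ∈ Finset.univ.erase m, η (update (update W i ⁅V, W i⁆) m z) := by
      intro z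
      refine Finset.sum_congr rfl fun i hi => ?_
      have hi := Finset.ne_of_mem_erase hi
      rw [update_of_ne hi, update_comm hi.symm]
    rw [h, h, h]
    simp only [update_idem, update_self, lie_add, η.map_update_add, Finset.sum_add_distrib]
    abel
  map_update_smul' := by
    intro inst W m c x
    obtain rfl : inst = instDecidableEqFin k := Subsingleton.elim _ _
    rw [← Finset.add_sum_erase _ _ (Finset.mem_univ m), ← Finset.add_sum_erase _ _ (Finset.mem_univ m)]
    have h : ∀ z, ∑ i ∈ Finset.univ.erase m,
        η (update (update W m z) i ⁅V, (update W m z) i⁆) =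
        ∑ i ∈ Finset.univ.erase m, η (update (update W i ⁅V, W i⁆) m z) := by
      intro z
      refine Finset.sum_congr rfl fun i hi => ?_
      have hi := Finset.ne_of_mem_erase hi
      rw [update_of_ne hi, update_comm hi.symm]
    rw [h, h]
    simp only [update_idem, update_self, η.map_update_add, η.map_update_smul,
      LieRinehartRing.leibniz_smul_right, smul_eq_mul, LieRinehartRing.leibniz_mul_right,
      ← Finset.mul_sum]
    ring
  map_eq_zero_of_eq' := by
    intro W i j h hij
    -- With equal entries in slots i and j only the terms bracketing these two slots survive; a
    -- transposition exchanges them, so they cancel.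
    rw [η.map_eq_zero_of_eq W h hij, lie_zero, zero_sub, neg_eq_zero,
      ← Finset.add_sum_erase _ _ (Finset.mem_univ i),
      ← Finset.add_sum_erase _ _ (Finset.mem_erase.mpr ⟨hij.symm, Finset.mem_univ j⟩),
      ← h, update_comp_swap h hij, η.map_swap _ hij, ← add_assoc, add_neg_cancel, zero_add]
    refine Finset.sum_eq_zero fun l hl => ?_
    have hl1 := Finset.ne_of_mem_erase hl
    have hl2 := Finset.ne_of_mem_erase (Finset.mem_of_mem_erase hl)
    refine η.map_eq_zero_of_eq _ (i := i) (j := j) ?_ hij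
    rw [update_of_ne hl2.symm, update_of_ne hl1.symm, h]

theorem lieDer_apply (V : L) {k : ℕ} (η : Form A L k) (W : Fin k → L) :
    lieDer V η W = ⁅V, η W⁆ - ∑ i, η (update W i ⁅V, W i⁆) := rfl

theorem update_cons_zero' {k : ℕ} {M : Type*} (V x : M) (W : Fin k → M) :
    update (Matrix.vecCons V W : Fin (k + 1) → M) 0 x = Matrix.vecCons x W :=
  Fin.update_cons_zero (α := fun _ => M) V W x

theorem update_cons_succ' {k : ℕ} {M : Type*} (V x : M) (W : Fin k → M) (i : Fin k) :
    update (Matrix.vecCons V W : Fin (k + 1) → M) i.succ x = Matrix.vecCons V (update W i x) :=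
  (Fin.cons_update (α := fun _ => M) V W i x).symm

theorem contr_apply {k : ℕ} (V : L) (η : Form A L (k + 1)) (W : Fin k → L) :
    contr V η W = η (Matrix.vecCons V W) := rfl

theorem lieDer_cons (V U : L) {k : ℕ} (η : Form A L (k + 1)) (W : Fin k → L) :
    lieDer V η (Matrix.vecCons U W) = lieDer V (contr U η) W - η (Matrix.vecCons ⁅V, U⁆ W) := by
  rw [lieDer_apply, lieDer_apply, Fin.sum_univ_succ, update_cons_zero']
  simp only [Matrix.cons_val_zero, Matrix.cons_val_succ, update_cons_succ', contr_apply]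
  ring

theorem map_update_eq {k : ℕ} (η : Form A L (k + 1)) (W : Fin (k + 1) → L) (j : Fin (k + 1))
    (x : L) : η (update W j x) = (-1) ^ (j : ℕ) * η (Matrix.vecCons x (W ∘ j.succAbove)) := by
  have h : update W j x = j.insertNth x (W ∘ j.succAbove) := by
    rw [Fin.eq_insertNth_iff]
    refine ⟨by simp, ?_⟩
    funext i
    simp [Fin.removeNth, update_of_ne (Fin.succAbove_ne j i)]
  rw [h, AlternatingMap.map_insertNth]
  rcases Nat.even_or_odd (j : ℕ) with h | h <;> simp [h.neg_one_pow]

theorem cons_comp_succAbove_succ {k : ℕ} (V : L) (W : Fin (k + 1) → L) (j : Fin (k + 1)) :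
    (Matrix.vecCons V W : Fin (k + 2) → L) ∘ j.succ.succAbove =
      Matrix.vecCons V (W ∘ j.succAbove) := by
  funext i
  refine Fin.cases ?_ (fun i => ?_) i
  · simp
  · simp

/-- Cartan's formula: the terms of the Koszul formula in which V differentiates or is bracketed form
the Lie derivative, the rest is the differential of the contraction. It replaces the Koszul sums
from here on. -/
theorem extD_cons {k : ℕ} (η : Form A L (k + 1)) (V : L) (W : Fin (k + 1) → L) :
    extD η (Matrix.vecCons V W) = lieDer V η W - extD (contr V η) W := by
  have h2 : ∑ i, η (update W i ⁅V, W i⁆) = ∑ j : Fin (k + 1), (-1) ^ (j : ℕ) *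
      η (Matrix.vecCons ⁅V, W j⁆ (W ∘ j.succAbove)) :=
    Finset.sum_congr rfl fun j _ => map_update_eq η W j _
  rw [lieDer_apply, extD, extD, h2, Fin.sum_univ_succ, Fin.sum_univ_succ (n := k + 1)]
  have h0 : (Matrix.vecCons V W : Fin (k + 2) → L) ∘ (0 : Fin (k + 2)).succAbove = W := by
    funext i; simp
  have h3 : (∑ i : Fin (k + 1), if i.castSucc < (0 : Fin (k + 2)) then
      (-1 : A) ^ ((0 : Fin (k + 2)) : ℕ) * η (update ((Matrix.vecCons V W : Fin (k + 2) → L) ∘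
        (0 : Fin (k + 2)).succAbove) i ⁅(Matrix.vecCons V W : Fin (k + 2) → L) i.castSucc,
          (Matrix.vecCons V W : Fin (k + 2) → L) 0⁆) else 0) = 0 :=
    Finset.sum_eq_zero fun i _ => if_neg (Fin.not_lt_zero _)
  rw [h3, h0, zero_add]
  simp only [cons_comp_succAbove_succ, Matrix.cons_val_zero, Matrix.cons_val_succ, Fin.val_succ,
    Fin.val_zero, pow_zero, one_mul, pow_succ, contr_apply]
  rw [Finset.sum_congr rfl fun j _ => Fin.sum_univ_succ _]
  simp only [Fin.castSucc_zero, Fin.succ_pos, if_true, update_cons_zero', update_cons_succ',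
    Matrix.cons_val_zero, Fin.castSucc_succ, Matrix.cons_val_succ, Fin.succ_lt_succ_iff,
    Finset.sum_add_distrib, mul_neg, mul_one, neg_mul, Finset.sum_neg_distrib]
  have h4 : ∀ (p : Prop) [Decidable p] (x : A), (if p then -x else 0) = -(if p then x else 0) := by
    intro p _ x; split_ifs <;> simp
  simp only [h4, Finset.sum_neg_distrib]
  ring

/-- A linear family of forms, vanishing when the parameter is repeated, is a form. -/
def uncurryForm {k : ℕ} (f : L →ₗ[A] Form A L (k + 1))
    (hf : ∀ V W, f V (Matrix.vecCons V W) = 0) : Form A L (k + 2) :=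
  { toMultilinearMap := (AlternatingMap.toMultilinearMapLM.comp f : L →ₗ[A] MultilinearMap A (fun _ : Fin (k + 1) => L) A).uncurryLeft
    map_eq_zero_of_eq' := by
      have key : ∀ (V : Fin (k + 2) → L) (j : Fin (k + 1)), V 0 = V j.succ →
          f (V 0) (Fin.tail V) = 0 := by
        intro V j h
        have h1 := map_update_eq (f (V 0)) (Fin.tail V) j (Fin.tail V j)
        rw [update_eq_self] at h1
        rw [h1, show Fin.tail V j = V 0 from h.symm, hf, mul_zero]
      intro V i j h hij
      induction i using Fin.cases with
      | zero =>
        induction j using Fin.cases with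
        | zero => exact absurd rfl hij
        | succ j => exact key V j h
      | succ i =>
        induction j using Fin.cases with
        | zero => exact key V i h.symm
        | succ j =>
          exact (f (V 0)).map_eq_zero_of_eq _ h (fun e => hij (congrArg Fin.succ e)) }

theorem uncurryForm_cons {k : ℕ} (f : L →ₗ[A] Form A L (k + 1))
    (hf : ∀ V W, f V (Matrix.vecCons V W) = 0) (V : L) (W : Fin (k + 1) → L) :
    uncurryForm f hf (Matrix.vecCons V W) = f V W := rfl

theorem extD_add {k : ℕ} (η ζ : Form A L k) (V : Fin (k + 1) → L) :
    extD (η + ζ) V = extD η V + extD ζ V := by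
  simp only [extD, AlternatingMap.add_apply, lie_add, mul_add, Finset.sum_add_distrib]
  have h4 : ∀ (p : Prop) [Decidable p] (x y : A), (if p then x + y else 0) =
      (if p then x else 0) + (if p then y else 0) := by
    intro p _ x y; split_ifs <;> simp
  simp only [h4, Finset.sum_add_distrib]
  ring

theorem extD_smul {k : ℕ} (c : A) (η : Form A L k) (V : Fin (k + 1) → L) :
    extD (c • η) V = c * extD η V +
      ∑ j : Fin (k + 1), (-1) ^ (j : ℕ) * (⁅V j, c⁆ * η (V ∘ j.succAbove)) := by
  have h4 : ∀ (p : Prop) [Decidable p] (x : A), (if p then c * x else 0) =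
      c * (if p then x else 0) := by
    intro p _ x; split_ifs <;> simp
  simp only [extD, AlternatingMap.smul_apply, smul_eq_mul, LieRinehartRing.leibniz_mul_right,
    mul_add, Finset.sum_add_distrib, mul_left_comm _ c, h4, ← Finset.mul_sum]
  ring

/-- The differential is rebuilt by recursion on the degree from Cartan's formula, so that
tensoriality and alternation are checked in one argument at a time instead of on the Koszul sum. -/
theorem exists_extD_form (k : ℕ) (η : Form A L k) : ∃ ζ : Form A L (k + 1), ∀ V, ζ V = extD η V := by
  induction k with
  | zero =>
    refine ⟨AlternatingMap.ofSubsingleton A L A (0 : Fin 1)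
      { toFun := fun V => ⁅V, η ![]⁆
        map_add' := fun V W => add_lie V W _
        map_smul' := fun c V => LieRinehartRing.lie_smul_eq_mul c _ V }, fun V => ?_⟩
    simp only [extD]
    simp
    congr 2
    exact Subsingleton.elim _ _
  | succ k ih =>
    choose d hd using ih
    have hF : ∀ V : L, ∀ W, (lieDer V η - d (contr V η)) W = extD η (Matrix.vecCons V W) := by
      intro V W
      rw [extD_cons, AlternatingMap.sub_apply, hd]
    let f : L →ₗ[A] Form A L (k + 1) :=
      { toFun := fun V => lieDer V η - d (contr V η)
        map_add' := fun V V' => by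
          ext W
          have : contr (V + V') η = contr V η + contr V' η := map_add η.curryLeft V V'
          simp only [AlternatingMap.sub_apply, AlternatingMap.add_apply, hd, lieDer_apply, add_lie,
            AlternatingMap.map_update_add, Finset.sum_add_distrib, this, extD_add]
          ring
        map_smul' := fun c V => by
          ext W
          have : contr (c • V) η = c • contr V η := map_smul η.curryLeft c V
          simp only [AlternatingMap.sub_apply, AlternatingMap.smul_apply, hd, lieDer_apply,
            LieRinehartRing.lie_smul_eq_mul, smul_lie_eq, AlternatingMap.map_update_sub,
            AlternatingMap.map_update_smul, Finset.sum_sub_distrib, this, extD_smul,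
            smul_eq_mul, RingHom.id_apply, ← Finset.mul_sum]
          -- The derivatives of c produced by the Lie derivative along c • V cancel those produced
          -- by differentiating c • ι_Vη.
          rw [Finset.sum_congr rfl fun j _ => show ⁅W j, c⁆ * η (update W j V) = (-1) ^ (j : ℕ) *
            (⁅W j, c⁆ * contr V η (W ∘ j.succAbove)) by rw [map_update_eq, contr_apply]; ring]
          ring }
    refine ⟨uncurryForm f ?_, fun V => ?_⟩
    -- Alternation: with V repeated, Cartan's formula applied once more to ι_Vη gives the same term,
    -- because ι_V ι_V η = 0 and [V, V] = 0.
    · intro V W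
      change (lieDer V η - d (contr V η)) (Matrix.vecCons V W) = 0
      rw [AlternatingMap.sub_apply, hd, lieDer_cons, lie_self]
      have h0 : η (Matrix.vecCons 0 W) = 0 := η.map_coord_zero 0 (by simp)
      rw [h0, sub_zero]
      cases k with
      | zero =>
        rw [lieDer_apply, extD]
        simp [Subsingleton.elim (Matrix.vecCons V W ∘ Fin.succ) W]
      | succ k =>
        rw [extD_cons]
        have h1 : contr V (contr V η) = 0 := AlternatingMap.curryLeft_same η V
        rw [h1]
        simp [extD]
    · rw [← Matrix.cons_head_tail V, uncurryForm_cons]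
      exact hF _ _

/-- The Lie algebroid differential, as a form. -/
def extDForm {k : ℕ} (η : Form A L k) : Form A L (k + 1) := (exists_extD_form k η).choose

theorem extDForm_apply {k : ℕ} (η : Form A L k) (V : Fin (k + 1) → L) :
    extDForm η V = extD η V := (exists_extD_form k η).choose_spec V

theorem isClosedForm_iff {k : ℕ} {η : Form A L k} : IsClosedForm η ↔ extDForm η = 0 := by
  constructor
  · intro h; ext V; rw [extDForm_apply, h V]; rfl
  · intro h V; rw [← extDForm_apply, h]; rfl

/-- The differential on inhomogeneous forms. -/
def dForms (a : Forms A L) : Forms A L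
  | 0 => 0
  | k + 1 => extDForm (a k)

/-- The Lie derivative on inhomogeneous forms. -/
def lieForms (V : L) (a : Forms A L) : Forms A L := fun k => lieDer V (a k)

theorem lieForms_add (V : L) (a b : Forms A L) :
    lieForms V (a + b) = lieForms V a + lieForms V b := by
  funext k; ext W
  simp only [lieForms, lieDer_apply, Pi.add_apply, AlternatingMap.add_apply, lie_add,
    Finset.sum_add_distrib]
  ring

theorem lie_neg_one_pow (V : L) (k : ℕ) (x : A) : ⁅V, (-1) ^ k * x⁆ = (-1) ^ k * ⁅V, x⁆ := by
  rcases Nat.even_or_odd k with h | h <;> simp [h.neg_one_pow]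

theorem lieForms_parity (V : L) (a : Forms A L) :
    lieForms V (parity a) = parity (lieForms V a) := by
  funext k; ext W
  simp only [lieForms, lieDer_apply, parity, AlternatingMap.smul_apply, smul_eq_mul,
    lie_neg_one_pow, ← Finset.mul_sum]
  ring

theorem dForms_add (a b : Forms A L) : dForms (a + b) = dForms a + dForms b := by
  funext k
  cases k with
  | zero => simp [dForms]
  | succ k => ext V; simp [dForms, extDForm_apply, extD_add]

theorem dForms_parity (a : Forms A L) : dForms (parity a) = -parity (dForms a) := by
  funext k
  cases k with
  | zero => simp [dForms, parity]
  | succ k =>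
    ext V
    have h : ∀ (V : L), ⁅V, (-1 : A) ^ k⁆ = 0 := by
      intro V
      have h1 : ⁅V, (1 : A)⁆ = 0 := by
        have := LieRinehartRing.leibniz_mul_right V (1 : A) 1
        simpa using this
      have := lie_neg_one_pow V k (1 : A)
      rwa [mul_one, h1, mul_zero] at this
    simp only [dForms, parity, extDForm_apply, extD_smul, h, zero_mul, mul_zero,
      Finset.sum_const_zero, add_zero, Pi.neg_apply, AlternatingMap.neg_apply,
      AlternatingMap.smul_apply, smul_eq_mul, pow_succ]
    ring

theorem inter_dForms (V : L) (a : Forms A L) :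
    inter V (dForms a) = lieForms V a - dForms (inter V a) := by
  funext k
  ext W
  cases k with
  | zero =>
    simp only [inter_apply, dForms, extDForm_apply, extD, lieForms, Pi.sub_apply,
      AlternatingMap.sub_apply, lieDer_apply]
    simp [Subsingleton.elim (Matrix.vecCons V W ∘ Fin.succ) W]
  | succ k =>
    simp only [inter_apply, dForms, extDForm_apply, extD_cons, lieForms, Pi.sub_apply,
      AlternatingMap.sub_apply]
    rfl

theorem inter_lieForms (U V : L) (a : Forms A L) :
    inter U (lieForms V a) = lieForms V (inter U a) - inter ⁅V, U⁆ a := by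
  funext k
  ext W
  simp only [inter_apply, lieForms, lieDer_cons, Pi.sub_apply, AlternatingMap.sub_apply]
  rfl

variable [Algebra ℝ A]

/-- Induction on the degree with the commutator rule `inter_lieForms`; in degree zero it is the
Leibniz rule for functions. -/
theorem lieForms_wedge_apply (V : L) (n : ℕ) : ∀ a b : Forms A L,
    lieForms V (a ⋏ b) n = (lieForms V a ⋏ b + a ⋏ lieForms V b) n := by
  induction n with
  | zero =>
    intro a b
    ext W
    simp only [lieForms, lieDer_apply, wedge_zero_apply, Pi.add_apply, AlternatingMap.add_apply,
      LieRinehartRing.leibniz_mul_right]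
    simp
    ring
  | succ n ih =>
    intro a b
    refine Forms.ext_degree fun U => ?_
    simp only [inter_lieForms, inter_wedge, inter_add, lieForms_add, sub_wedge,
      wedge_sub]
    simp only [Pi.add_apply, Pi.sub_apply] at ih ⊢
    rw [ih, ih, lieForms_parity]
    abel

theorem lieForms_wedge (V : L) (a b : Forms A L) :
    lieForms V (a ⋏ b) = lieForms V a ⋏ b + a ⋏ lieForms V b :=
  funext fun n => lieForms_wedge_apply V n a b

/-- By Cartan's formula, contraction turns the claim into the Leibniz rule for Lie derivatives and
the same claim for contracted factors. -/
theorem dForms_wedge_apply (n : ℕ) : ∀ a b : Forms A L,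
    dForms (a ⋏ b) n = (dForms a ⋏ b + parity a ⋏ dForms b) n := by
  induction n with
  | zero =>
    intro a b
    ext W
    simp [dForms, wedge_zero_apply]
  | succ n ih =>
    intro a b
    refine Forms.ext_degree fun U => ?_
    have hp : parity (dForms a) = -dForms (parity a) := by rw [dForms_parity, neg_neg]
    simp only [inter_dForms, inter_wedge, inter_add, dForms_add, lieForms_wedge, sub_wedge,
      wedge_sub, parity_parity, inter_parity, neg_wedge, hp]
    simp only [Pi.add_apply, Pi.sub_apply, Pi.neg_apply] at ih ⊢
    rw [ih, ih, parity_parity]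
    abel

theorem dForms_wedge (a b : Forms A L) :
    dForms (a ⋏ b) = dForms a ⋏ b + parity a ⋏ dForms b :=
  funext fun n => dForms_wedge_apply n a b

theorem dForms_formOne : dForms (formOne : Forms A L) = 0 := by
  funext k
  rcases k with _ | _ | k
  · rfl
  · ext V
    have h1 : ⁅V 0, (1 : A)⁆ = 0 := by
      have := LieRinehartRing.leibniz_mul_right (V 0) (1 : A) 1
      simpa using this
    simp [dForms, extDForm_apply, extD, formOne_zero_apply, h1]
  · ext V
    simp [dForms, extDForm_apply, formOne, homog_ne, extD]

theorem dForms_homog {k : ℕ} {η : Form A L k} (h : IsClosedForm η) : dForms (homog η) = 0 := by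
  funext j
  cases j with
  | zero => rfl
  | succ j =>
    ext V
    by_cases hj : j = k
    · subst hj
      simp [dForms, extDForm_apply, homog_self, h V]
    · simp [dForms, extDForm_apply, homog_ne hj, extD]

theorem dForms_formPow {a : Forms A L} (h : dForms a = 0) (m : ℕ) : dForms (formPow a m) = 0 := by
  induction m with
  | zero => exact dForms_formOne
  | succ m ih => rw [formPow, dForms_wedge, h, ih, zero_wedge, wedge_zero, add_zero]

variable [LieAlgebra ℝ L] [LieRinehartAlgebra ℝ A L]

theorem extD_real_smul {k : ℕ} (c : ℝ) (η : Form A L k) (V : Fin (k + 1) → L) :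
    extD (c • η) V = c • extD η V := by
  have h4 : ∀ (p : Prop) [Decidable p] (x : A), (if p then c • x else 0) =
      c • (if p then x else 0) := by
    intro p _ x; split_ifs <;> simp
  simp only [extD, AlternatingMap.smul_apply, lie_smul, mul_smul_comm, h4, ← Finset.smul_sum,
    smul_add]

theorem isClosedForm_formExp {b : Form A L 2} (h : IsClosedForm b) (k : ℕ) :
    IsClosedForm (formExp b k) := by
  intro V
  rcases Nat.even_or_odd' k with ⟨m, rfl | rfl⟩
  · rw [formExp_even, extD_real_smul, ← extDForm_apply]
    have : extDForm (formPow (homog b) m (2 * m)) = 0 :=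
      congrFun (dForms_formPow (dForms_homog h) m) (2 * m + 1)
    rw [this]; simp
  · rw [formExp_odd b (fun m hm => by omega)]
    simp [extD]

end Cartan

/-! ### Naturality of the differential -/

section CompatD

variable {A A' L L' : Type*} [CommRing A] [LieRing L] [Module A L] [LieRingModule L A]
  [CommRing A'] [LieRing L'] [Module A' L'] [LieRingModule L' A']

/-- Every term of the Koszul formula is respected by a correspondence compatible with brackets and
with the action on functions. This carries closedness from the elliptic tangent bundle to `D` and to
the leaves. -/
theorem extD_compat {f : A →+* A'} {Rel : L → L' → Prop}
    (hlie : ∀ V V', Rel V V' → ∀ a, f ⁅V, a⁆ = ⁅V', f a⁆)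
    (hbr : ∀ V V' W W', Rel V V' → Rel W W' → Rel ⁅V, W⁆ ⁅V', W'⁆)
    {k : ℕ} {η : Form A L k} {ξ : Form A' L' k}
    (h : ∀ V W, (∀ i, Rel (V i) (W i)) → ξ W = f (η V))
    {V : Fin (k + 1) → L} {W : Fin (k + 1) → L'} (hVW : ∀ i, Rel (V i) (W i)) :
    extD ξ W = f (extD η V) := by
  simp only [extD, map_add, map_sum, map_mul, map_pow, map_neg, map_one, apply_ite f, map_zero]
  congr 1
  · refine Finset.sum_congr rfl fun j _ => ?_
    rw [h (V ∘ j.succAbove) (W ∘ j.succAbove) (fun i => hVW _), hlie _ _ (hVW j)]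
  · refine Finset.sum_congr rfl fun j _ => Finset.sum_congr rfl fun i _ => ?_
    rw [h (Function.update (V ∘ j.succAbove) i ⁅V i.castSucc, V j⁆)]
    intro l
    rcases eq_or_ne l i with rfl | hl
    · simpa using hbr _ _ _ _ (hVW _) (hVW _)
    · simpa [Function.update_of_ne hl] using hVW _

end CompatD

/-! ### Smoothness of composition operators on continuous curves -/

section Nemytskii

open Topology Metric

variable {K : Type*} [TopologicalSpace K] [CompactSpace K]

/-- Pointwise application of a continuous family of linear maps, as a bounded bilinear map. -/
def applyFamily (K F G : Type*) [TopologicalSpace K] [CompactSpace K] [NormedAddCommGroup F]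
    [NormedSpace ℝ F] [NormedAddCommGroup G] [NormedSpace ℝ G] :
    C(K, F →L[ℝ] G) →L[ℝ] C(K, F) →L[ℝ] C(K, G) :=
  LinearMap.mkContinuous₂
    (LinearMap.mk₂ ℝ (fun (T : C(K, F →L[ℝ] G)) (h : C(K, F)) =>
      (⟨fun k => T k (h k), by fun_prop⟩ : C(K, G)))
      (fun _ _ _ => by ext; simp) (fun _ _ _ => by ext; simp) (fun _ _ _ => by ext; simp)
      (fun _ _ _ => by ext; simp)) 1 (fun T h => by
        rw [one_mul]
        refine (ContinuousMap.norm_le _ (by positivity)).mpr fun k => ?_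
        exact (ContinuousLinearMap.le_opNorm _ _).trans
          (mul_le_mul (T.norm_coe_le_norm k) (h.norm_coe_le_norm k) (norm_nonneg _) (norm_nonneg T)))

/-- The derivative of f is uniformly continuous near the compact range of γ, so the mean value
inequality bounds the remainder uniformly over `K`. -/
theorem hasFDerivAt_postcomp {F G : Type*} [NormedAddCommGroup F]
    [NormedSpace ℝ F] [NormedAddCommGroup G] [NormedSpace ℝ G] {f : F → G} (hf : ContDiff ℝ 1 f)
    (γ : C(K, F)) :
    HasFDerivAt (fun γ : C(K, F) => (⟨f, hf.continuous⟩ : C(F, G)).comp γ)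
      (applyFamily K F G ((⟨fderiv ℝ f, hf.continuous_fderiv one_ne_zero⟩ : C(F, F →L[ℝ] G)).comp γ))
      γ := by
  rw [hasFDerivAt_iff_isLittleO_nhds_zero, Asymptotics.isLittleO_iff]
  intro c hc
  have hK : IsCompact (Set.range γ) := isCompact_range γ.continuous
  have hu := hK.uniformContinuousAt_of_continuousAt (fderiv ℝ f)
    (fun a _ => (hf.continuous_fderiv one_ne_zero).continuousAt) (dist_mem_uniformity hc)
  obtain ⟨δ, hδ, hδ'⟩ := mem_uniformity_dist.mp hu
  filter_upwards [ball_mem_nhds (0 : C(K, F)) hδ] with h hh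
  rw [mem_ball_zero_iff] at hh
  refine (ContinuousMap.norm_le _ (by positivity)).mpr fun k => ?_
  have hk : ‖h k‖ < δ := (h.norm_coe_le_norm k).trans_lt hh
  have hmem : ∀ y ∈ ball (γ k) δ, ‖fderiv ℝ f y - fderiv ℝ f (γ k)‖ ≤ c := by
    intro y hy
    have := hδ' (a := γ k) (b := y) (by rwa [dist_comm]) ⟨k, rfl⟩
    rw [← dist_eq_norm, dist_comm]
    exact le_of_lt this
  have := (convex_ball (γ k) δ).norm_image_sub_le_of_norm_hasFDerivWithin_le'
    (f := f) (f' := fderiv ℝ f) (x := γ k) (y := γ k + h k) (C := c)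
    (fun y _ => ((hf.differentiable one_ne_zero) y).hasFDerivAt.hasFDerivWithinAt) hmem
    (mem_ball_self hδ) (by simpa [mem_ball, dist_eq_norm] using hk)
  rw [add_sub_cancel_left] at this
  exact this.trans (mul_le_mul_of_nonneg_left (h.norm_coe_le_norm k) hc.le)

universe u

/-- The derivative of a composition operator is again a composition operator, by the derivative of
f, followed by a bounded bilinear map. The target `G` is quantified inside because the induction
replaces it by `F →L[ℝ] G`. -/
theorem contDiff_postcomp_nat {F : Type u} [NormedAddCommGroup F] [NormedSpace ℝ F] (n : ℕ) :
    ∀ {G : Type u} [NormedAddCommGroup G] [NormedSpace ℝ G] {f : F → G} (hf : ContDiff ℝ ∞ f),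
      ContDiff ℝ n (fun γ : C(K, F) => (⟨f, hf.continuous⟩ : C(F, G)).comp γ) := by
  induction n with
  | zero =>
    intro G _ _ f hf
    rw [Nat.cast_zero, contDiff_zero]
    exact ContinuousMap.continuous_postcomp _
  | succ n ih =>
    intro G _ _ f hf
    have h1 : ContDiff ℝ 1 f := hf.of_le (by exact_mod_cast le_top)
    rw [Nat.cast_succ, contDiff_succ_iff_fderiv]
    refine ⟨fun γ => (hasFDerivAt_postcomp h1 γ).differentiableAt, by simp, ?_⟩
    have h2 : ContDiff ℝ ∞ (fderiv ℝ f) := hf.fderiv_right (by simp)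
    have h3 : fderiv ℝ (fun γ : C(K, F) => (⟨f, hf.continuous⟩ : C(F, G)).comp γ) =
        fun γ => applyFamily K F G ((⟨fderiv ℝ f, h2.continuous⟩ : C(F, F →L[ℝ] G)).comp γ) :=
      funext fun γ => (hasFDerivAt_postcomp h1 γ).fderiv
    rw [h3]
    exact (applyFamily K F G).contDiff.comp (ih h2)

theorem contDiff_postcomp {F G : Type u} [NormedAddCommGroup F] [NormedSpace ℝ F]
    [NormedAddCommGroup G] [NormedSpace ℝ G] {f : F → G} (hf : ContDiff ℝ ∞ f) :
    ContDiff ℝ ∞ (fun γ : C(K, F) => (⟨f, hf.continuous⟩ : C(F, G)).comp γ) :=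
  contDiff_infty.mpr fun n => contDiff_postcomp_nat n hf

end Nemytskii

/-! ### Integration of curves and smooth dependence on parameters -/

section Volterra

open MeasureTheory intervalIntegral

variable {F : Type*} [NormedAddCommGroup F] [NormedSpace ℝ F]

/-- A curve on the unit interval, extended by constants. -/
def extendCurve (γ : C(unitInterval, F)) : ℝ → F := Set.IccExtend zero_le_one γ

theorem continuous_extendCurve (γ : C(unitInterval, F)) : Continuous (extendCurve γ) :=
  γ.continuous.Icc_extend'

theorem extendCurve_coe (γ : C(unitInterval, F)) (t : unitInterval) : extendCurve γ t = γ t :=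
  Set.IccExtend_val _ _ _

theorem norm_extendCurve_le (γ : C(unitInterval, F)) (t : ℝ) : ‖extendCurve γ t‖ ≤ ‖γ‖ :=
  γ.norm_coe_le_norm _

/-- Integration of curves from `0`. -/
def volterra (F : Type*) [NormedAddCommGroup F] [NormedSpace ℝ F] :
    C(unitInterval, F) →L[ℝ] C(unitInterval, F) :=
  LinearMap.mkContinuous
    { toFun := fun γ => ⟨fun t => ∫ τ in (0 : ℝ)..t, extendCurve γ τ,
        (intervalIntegral.continuous_primitive
          (fun _ _ => (continuous_extendCurve γ).intervalIntegrable _ _) 0).comp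
            continuous_subtype_val⟩
      map_add' := fun γ γ' => by
        ext t
        exact intervalIntegral.integral_add ((continuous_extendCurve γ).intervalIntegrable _ _)
          ((continuous_extendCurve γ').intervalIntegrable _ _)
      map_smul' := fun c γ => by
        ext t
        exact intervalIntegral.integral_smul c _ } 1 (fun γ => by
    rw [one_mul]
    refine (ContinuousMap.norm_le _ (norm_nonneg _)).mpr fun t => ?_
    refine (intervalIntegral.norm_integral_le_of_norm_le_const
      (fun τ _ => norm_extendCurve_le γ τ)).trans ?_
    rw [sub_zero, abs_of_nonneg t.2.1]
    exact mul_le_of_le_one_right (norm_nonneg _) t.2.2)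

theorem volterra_apply (γ : C(unitInterval, F)) (t : unitInterval) :
    volterra F γ t = ∫ τ in (0 : ℝ)..t, extendCurve γ τ := rfl

universe u

/-- Smooth dependence of an integral on parameters. -/
theorem contDiff_integral_param {E : Type u} {G : Type u} [NormedAddCommGroup E] [NormedSpace ℝ E]
    [NormedAddCommGroup G] [NormedSpace ℝ G] [CompleteSpace G] {f : ℝ × E → G}
    (hf : ContDiff ℝ ∞ f) : ContDiff ℝ ∞ (fun x => ∫ t in (0 : ℝ)..1, f (t, x)) := by
  -- The curve t ↦ (t, x) is affine in x; the integral is this curve composed with f, followed by a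
  -- bounded linear map, and is therefore smooth in x.
  let c : E → C(unitInterval, ℝ × E) := fun x => ⟨fun t => ((t : ℝ), x), by fun_prop⟩
  let c₀ : C(unitInterval, ℝ × E) := ⟨fun t => ((t : ℝ), 0), by fun_prop⟩
  let c₁ : E →L[ℝ] C(unitInterval, ℝ × E) :=
    LinearMap.mkContinuous
      { toFun := fun x => ⟨fun _ => ((0 : ℝ), x), by fun_prop⟩
        map_add' := fun _ _ => by ext <;> simp
        map_smul' := fun _ _ => by ext <;> simp } 1 (fun x => by
          rw [one_mul]
          refine (ContinuousMap.norm_le _ (norm_nonneg _)).mpr fun t => ?_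
          simp [Prod.norm_def])
  have hc : c = fun x => c₀ + c₁ x := by
    funext x
    ext t
    · change (t : ℝ) = t + 0
      simp
    · change x = 0 + x
      simp
  have hcs : ContDiff ℝ ∞ c := by rw [hc]; exact contDiff_const.add c₁.contDiff
  let ev : C(unitInterval, G) →L[ℝ] G := ContinuousMap.evalCLM ℝ (1 : unitInterval)
  have h := (ev.comp (volterra G)).contDiff.comp ((contDiff_postcomp (K := unitInterval) hf).comp hcs)
  convert h using 1
  funext x
  change _ = ∫ τ in (0 : ℝ)..((1 : unitInterval) : ℝ), extendCurve _ τ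
  refine intervalIntegral.integral_congr fun t ht => ?_
  rw [Set.uIcc_of_le zero_le_one] at ht
  exact (extendCurve_coe (((⟨f, hf.continuous⟩ : C(ℝ × E, G))).comp (c x)) ⟨t, ht⟩).symm

end Volterra

/-! ### The inverse function theorem on an open set -/

section Inverse

variable {E F : Type*} [NormedAddCommGroup E] [NormedSpace ℝ E] [CompleteSpace E]
  [NormedAddCommGroup F] [NormedSpace ℝ F]

/-- The inverse function theorem, with a smooth inverse on an open set. -/
theorem exists_smooth_local_inverse {f : E → F} {O : Set E} (hO : IsOpen O)
    (hf : ContDiffOn ℝ ∞ f O) {a : E} (ha : a ∈ O) (f' : E ≃L[ℝ] F)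
    (hf' : HasFDerivAt f (f' : E →L[ℝ] F) a) :
    ∃ e : OpenPartialHomeomorph E F, a ∈ e.source ∧ e.source ⊆ O ∧ (∀ x, e x = f x) ∧
      ContDiffOn ℝ ∞ e.symm e.target := by
  have hfa : ContDiffAt ℝ ∞ f a := hf.contDiffAt (hO.mem_nhds ha)
  let e₀ := hfa.toOpenPartialHomeomorph f hf' (by simp)
  -- Shrinking to the open set where the derivative is invertible makes the inverse smooth on all of
  -- its domain, not merely at the image of a.
  let S : Set E := O ∩ fderiv ℝ f ⁻¹' Set.range ((↑) : (E ≃L[ℝ] F) → E →L[ℝ] F)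
  have hS : IsOpen S := (hf.continuousOn_fderiv_of_isOpen hO (by simp)).isOpen_inter_preimage hO
    ContinuousLinearEquiv.isOpen
  have haS : a ∈ S := ⟨ha, f', hf'.fderiv.symm⟩
  refine ⟨e₀.restrOpen S hS, ?_, ?_, fun x => rfl, ?_⟩
  · exact ⟨hfa.mem_toOpenPartialHomeomorph_source hf' (by simp), haS⟩
  · exact fun x hx => hx.2.1
  · intro y hy
    have hys : (e₀.restrOpen S hS).symm y ∈ (e₀.restrOpen S hS).source :=
      (e₀.restrOpen S hS).map_target hy
    obtain ⟨g, hg⟩ := hys.2.2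
    have h1 : ContDiffAt ℝ ∞ f ((e₀.restrOpen S hS).symm y) := hf.contDiffAt (hO.mem_nhds hys.2.1)
    refine ((e₀.restrOpen S hS).contDiffAt_symm hy (f₀' := g) ?_ h1).contDiffWithinAt
    rw [hg]
    exact (h1.differentiableAt (by simp)).hasFDerivAt

end Inverse

/-! ### Smooth local flows and the transport equation -/

section Flow

open MeasureTheory intervalIntegral Topology Metric

variable {F : Type*} [NormedAddCommGroup F] [NormedSpace ℝ F] 

/-- A curve traversed with speed `c`. -/
def rescale (c : unitInterval) (γ : C(unitInterval, F)) : C(unitInterval, F) :=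
  γ.comp ⟨fun t => c * t, by fun_prop⟩

theorem extendCurve_of_mem (γ : C(unitInterval, F)) {t : ℝ} (ht : t ∈ Set.Icc (0 : ℝ) 1) :
    extendCurve γ t = γ ⟨t, ht⟩ := extendCurve_coe γ ⟨t, ht⟩

theorem volterra_rescale (c : unitInterval) (γ : C(unitInterval, F)) (t : unitInterval) :
    (c : ℝ) • volterra F (rescale c γ) t = volterra F γ (c * t) := by
  rw [volterra_apply, volterra_apply]
  have h : ∫ τ in (0 : ℝ)..t, extendCurve (rescale c γ) τ =
      ∫ τ in (0 : ℝ)..t, extendCurve γ (c * τ) := by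
    refine integral_congr fun τ hτ => ?_
    rw [Set.uIcc_of_le t.2.1] at hτ
    have h1 : τ ∈ Set.Icc (0 : ℝ) 1 := ⟨hτ.1, hτ.2.trans t.2.2⟩
    rw [extendCurve_of_mem _ h1, extendCurve_of_mem γ (t := c * τ) (c * ⟨τ, h1⟩ : unitInterval).2]
    rfl
  rw [h, smul_integral_comp_mul_left, mul_zero]
  rfl

/-- The equation satisfied by integral curves, with time rescaled to the unit interval. -/
def flowEquation (V : C(F, F)) (z : (ℝ × F) × C(unitInterval, F)) :
    (ℝ × F) × C(unitInterval, F) :=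
  (z.1, z.2 - ContinuousMap.const _ z.1.2 - z.1.1 • volterra F (V.comp z.2))

theorem contDiff_flowEquation (V : C(F, F)) (hV : ContDiff ℝ ∞ V) :
    ContDiff ℝ ∞ (flowEquation V) := by
  have h1 : ContDiff ℝ ∞ fun γ : C(unitInterval, F) => V.comp γ := contDiff_postcomp hV
  have h2 : ContDiff ℝ ∞ fun x : F => ContinuousMap.const unitInterval x :=
    (ContinuousLinearMap.const ℝ unitInterval : F →L[ℝ] C(unitInterval, F)).contDiff
  refine contDiff_fst.prodMk ((contDiff_snd.sub (h2.comp (contDiff_snd.comp contDiff_fst))).sub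
    ((contDiff_fst.comp contDiff_fst).smul ?_))
  exact (volterra F).contDiff.comp (h1.comp contDiff_snd)

/-- At time zero the integral term has coefficient zero, so the derivative is block unitriangular;
it is invertible without any contraction estimate. -/
theorem hasFDerivAt_flowEquation (V : C(F, F)) (hV : ContDiff ℝ ∞ V) (x₀ : F) :
    ∃ f' : ((ℝ × F) × C(unitInterval, F)) ≃L[ℝ] ((ℝ × F) × C(unitInterval, F)),
      HasFDerivAt (flowEquation V) (f' : _ →L[ℝ] ((ℝ × F) × C(unitInterval, F)))
        ((0, x₀), ContinuousMap.const _ x₀) := by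
  have h1 : ContDiff ℝ ∞ fun γ : C(unitInterval, F) => volterra F (V.comp γ) :=
    (volterra F).contDiff.comp (contDiff_postcomp hV)
  let κ : F →L[ℝ] C(unitInterval, F) := ContinuousLinearMap.const ℝ unitInterval
  let w := volterra F (V.comp (ContinuousMap.const _ x₀))
  let l : (ℝ × F) →L[ℝ] C(unitInterval, F) :=
    -(κ.comp (ContinuousLinearMap.snd ℝ ℝ F)) - (ContinuousLinearMap.fst ℝ ℝ F).smulRight w
  refine ⟨(ContinuousLinearEquiv.refl ℝ (ℝ × F)).skewProd
    (ContinuousLinearEquiv.refl ℝ C(unitInterval, F)) l, ?_⟩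
  set a : (ℝ × F) × C(unitInterval, F) := ((0, x₀), ContinuousMap.const _ x₀)
  have h2 : HasFDerivAt (fun z : (ℝ × F) × C(unitInterval, F) => volterra F (V.comp z.2)) _ a :=
    ((h1.differentiable (by simp)) _).hasFDerivAt.comp a hasFDerivAt_snd
  have h3 : HasFDerivAt (fun z : (ℝ × F) × C(unitInterval, F) => z.1.1) _ a :=
    (hasFDerivAt_fst (𝕜 := ℝ) (p := a)).fst
  have h4 : HasFDerivAt (fun z : (ℝ × F) × C(unitInterval, F) => κ z.1.2) _ a :=
    κ.hasFDerivAt.comp a (hasFDerivAt_fst (𝕜 := ℝ) (p := a)).snd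
  have h5 : HasFDerivAt (flowEquation V) _ a :=
    (hasFDerivAt_fst (𝕜 := ℝ) (p := a)).prodMk ((hasFDerivAt_snd.sub h4).sub (h3.smul h2))
  refine h5.congr_fderiv ?_
  refine ContinuousLinearMap.ext fun z => Prod.ext rfl ?_
  change z.2 - κ z.1.2 - ((0 : ℝ) • _ + z.1.1 • w) = z.2 + (-κ z.1.2 - z.1.1 • w)
  rw [zero_smul, zero_add]
  abel

/-- Existence of a smooth local flow. -/
theorem exists_local_flow [CompleteSpace F] {V : F → F} (hV : ContDiff ℝ ∞ V) (x₀ : F) :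
    ∃ δ > 0, ∃ Φ : ℝ × F → F, ContDiffOn ℝ ∞ Φ (ball (0, x₀) δ) ∧
      (∀ x, (0, x) ∈ ball ((0 : ℝ), x₀) δ → Φ (0, x) = x) ∧
      ∀ s x, (s, x) ∈ ball ((0 : ℝ), x₀) δ →
        HasDerivAt (fun s => Φ (s, x)) (V (Φ (s, x))) s := by
  let Vc : C(F, F) := ⟨V, hV.continuous⟩
  set a : (ℝ × F) × C(unitInterval, F) := ((0, x₀), ContinuousMap.const _ x₀) with ha
  obtain ⟨f', hf'⟩ := hasFDerivAt_flowEquation Vc hV x₀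
  obtain ⟨e, hae, -, he, hes⟩ := exists_smooth_local_inverse isOpen_univ
    (contDiff_flowEquation Vc hV).contDiffOn (Set.mem_univ a) f' hf'
  have hea : e a = ((0, x₀), 0) := by
    rw [he]
    refine Prod.ext rfl ?_
    change ContinuousMap.const _ x₀ - ContinuousMap.const _ x₀ - (0 : ℝ) • _ = _
    rw [zero_smul, sub_zero, sub_self]
  have hta : ((0, x₀), 0) ∈ e.target := hea ▸ e.map_source hae
  obtain ⟨ε, hε, hεs⟩ := Metric.isOpen_iff.mp e.open_source a hae
  let j : ℝ × F → (ℝ × F) × C(unitInterval, F) := fun p => (p, 0)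
  have hj : ContDiff ℝ ∞ j := contDiff_id.prodMk contDiff_const
  have h1 : ∀ᶠ p in 𝓝 ((0 : ℝ), x₀), j p ∈ e.target ∧ e.symm (j p) ∈ ball a ε := by
    have hc : ContinuousAt (fun p => e.symm (j p)) ((0 : ℝ), x₀) :=
      (e.continuousAt_symm hta).comp (f := j) hj.continuous.continuousAt
    have h0 : e.symm (j (0, x₀)) = a := by rw [← e.left_inv hae, hea]
    exact (hj.continuous.continuousAt.eventually (e.open_target.mem_nhds hta)).and
      (hc.eventually (by dsimp only; rw [h0]; exact ball_mem_nhds a hε))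
  obtain ⟨δ, hδ, hδ'⟩ := Metric.eventually_nhds_iff_ball.mp h1
  -- For p = (s, x) the second component of the inverse is the curve γ on the unit interval with
  -- γ(t) = x + s ∫₀ᵗ V(γ).
  have hst : ∀ p ∈ ball ((0 : ℝ), x₀) δ, (e.symm (j p)).1 = p ∧
      ∀ t, (e.symm (j p)).2 t = p.2 + p.1 • volterra F (Vc.comp (e.symm (j p)).2) t := by
    intro p hp
    have h2 := e.right_inv (hδ' p hp).1
    rw [he] at h2
    have h3 : (e.symm (j p)).1 = p := congrArg Prod.fst h2
    refine ⟨h3, fun t => ?_⟩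
    have h4 := DFunLike.congr_fun (congrArg Prod.snd h2) t
    change (e.symm (j p)).2 t - (e.symm (j p)).1.2 - (e.symm (j p)).1.1 • _ = 0 at h4
    rw [h3, sub_sub, sub_eq_zero] at h4
    exact h4
  have hmem : ∀ {s x} (c : unitInterval), (s, x) ∈ ball ((0 : ℝ), x₀) δ →
      ((c : ℝ) * s, x) ∈ ball ((0 : ℝ), x₀) δ := by
    intro s x c h
    rw [mem_ball, Prod.dist_eq, max_lt_iff] at h ⊢
    refine ⟨lt_of_le_of_lt ?_ h.1, h.2⟩
    rw [dist_zero_right, dist_zero_right, norm_mul]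
    exact mul_le_of_le_one_left (norm_nonneg _) (by rw [Real.norm_of_nonneg c.2.1]; exact c.2.2)
  -- Uniqueness from local injectivity: the solution for time c s is the solution for time s
  -- traversed at speed c. This links the endpoints for different times s.
  have hres : ∀ s x (c : unitInterval), (s, x) ∈ ball ((0 : ℝ), x₀) δ →
      (e.symm (j ((c : ℝ) * s, x))).2 = rescale c (e.symm (j (s, x))).2 := by
    intro s x c h
    have hm := hmem c h
    set γ := (e.symm (j (s, x))).2 with hγ
    have hz : (((c : ℝ) * s, x), rescale c γ) ∈ e.source := by
      apply hεs
      have h2 := (hδ' _ h).2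
      rw [mem_ball, Prod.dist_eq, max_lt_iff] at h2 ⊢
      have h3 := (hδ' _ hm).2
      rw [mem_ball, Prod.dist_eq, max_lt_iff, (hst _ hm).1] at h3
      refine ⟨h3.1, lt_of_le_of_lt ?_ h2.2⟩
      rw [dist_eq_norm, ContinuousMap.norm_le _ dist_nonneg]
      intro t
      have := ContinuousMap.dist_apply_le_dist (f := γ) (g := a.2) (c * t)
      rw [dist_eq_norm] at this
      exact this
    have hez : e (((c : ℝ) * s, x), rescale c γ) = j ((c : ℝ) * s, x) := by
      rw [he]
      refine Prod.ext rfl (ContinuousMap.ext fun t => ?_)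
      change γ (c * t) - x - ((c : ℝ) * s) • volterra F (rescale c (Vc.comp γ)) t = 0
      rw [mul_comm (c : ℝ), mul_smul, volterra_rescale, (hst _ h).2 (c * t)]
      simp [hγ]
    rw [← hez, e.left_inv hz]
  -- The flow is the endpoint of the rescaled solution curve.
  refine ⟨δ, hδ, fun p => (e.symm (j p)).2 1, ?_, ?_, ?_⟩
  · have h2 : ContDiffOn ℝ ∞ (fun p => e.symm (j p)) (ball (0, x₀) δ) :=
      hes.comp hj.contDiffOn fun p hp => (hδ' p hp).1
    exact (((ContinuousMap.evalCLM ℝ (1 : unitInterval)).comp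
      (ContinuousLinearMap.snd ℝ (ℝ × F) C(unitInterval, F))).contDiff.comp_contDiffOn h2)
  · intro x hx
    dsimp only
    rw [(hst _ hx).2 1]
    simp
  · intro s x hx
    set Φx : ℝ → F := fun s => (e.symm (j (s, x))).2 1 with hΦx
    have hball : ∀ s, (s, x) ∈ ball ((0 : ℝ), x₀) δ ↔ s ∈ ball (0 : ℝ) δ := by
      intro s'
      rw [mem_ball, Prod.dist_eq, max_lt_iff] at hx ⊢
      rw [mem_ball]
      exact ⟨fun h => h.1, fun h => ⟨h, hx.2⟩⟩
    have hΦxc : ContinuousOn Φx (ball 0 δ) := by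
      have h2 : ContinuousOn (fun s : ℝ => e.symm (j (s, x))) (ball (0 : ℝ) δ) :=
        e.continuousOn_symm.comp (by fun_prop) fun s hs => (hδ' _ ((hball s).mpr hs)).1
      exact ((ContinuousMap.evalCLM ℝ (1 : unitInterval)).comp
        (ContinuousLinearMap.snd ℝ (ℝ × F) C(unitInterval, F))).continuous.comp_continuousOn h2
    have hVφ : ContinuousOn (fun s => V (Φx s)) (ball 0 δ) :=
      hV.continuous.comp_continuousOn hΦxc
    have hint : ∀ s ∈ ball (0 : ℝ) δ, Φx s = x + ∫ σ in (0 : ℝ)..s, V (Φx σ) := by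
      intro s' hs'
      rw [hΦx]
      dsimp only
      rw [(hst _ ((hball s').mpr hs')).2 1, volterra_apply]
      congr 1
      dsimp only
      have h3 : ∫ τ in (0 : ℝ)..((1 : unitInterval) : ℝ),
          extendCurve (Vc.comp (e.symm (j (s', x))).2) τ = ∫ τ in (0 : ℝ)..1, V (Φx (s' * τ)) := by
        refine integral_congr fun τ hτ => ?_
        rw [Set.Icc.coe_one, Set.uIcc_of_le zero_le_one] at hτ
        rw [extendCurve_of_mem _ hτ, hΦx]
        dsimp only
        rw [mul_comm, hres s' x ⟨τ, hτ⟩ ((hball s').mpr hs')]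
        simp [rescale, Vc]
      rw [h3, smul_integral_comp_mul_left (fun σ => V (Φx σ)), mul_zero, mul_one]
    have hs := (hball s).mp hx
    have hsub : Set.uIcc 0 s ⊆ ball (0 : ℝ) δ :=
      (convex_ball (0 : ℝ) δ).ordConnected.uIcc_subset (mem_ball_self hδ) hs
    have hd : HasDerivAt (fun s => x + ∫ σ in (0 : ℝ)..s, V (Φx σ)) (V (Φx s)) s :=
      (integral_hasDerivAt_right (hVφ.mono hsub).intervalIntegrable
        (hVφ.stronglyMeasurableAtFilter isOpen_ball s hs)
        (hVφ.continuousAt (isOpen_ball.mem_nhds hs))).const_add x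
    exact hd.congr_of_eventuallyEq
      (Filter.eventuallyEq_of_mem (isOpen_ball.mem_nhds hs) hint)

/-- In the time direction the derivative is given by the differential equation, in the space
direction by the initial condition. -/
theorem hasFDerivAt_local_flow {V : F → F} {x₀ : F} {δ : ℝ} (hδ : 0 < δ) {Φ : ℝ × F → F}
    (hΦ : ContDiffOn ℝ ∞ Φ (ball (0, x₀) δ))
    (h0 : ∀ x, (0, x) ∈ ball ((0 : ℝ), x₀) δ → Φ (0, x) = x)
    (hd : ∀ s x, (s, x) ∈ ball ((0 : ℝ), x₀) δ →
        HasDerivAt (fun s => Φ (s, x)) (V (Φ (s, x))) s) :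
    HasFDerivAt Φ ((ContinuousLinearMap.fst ℝ ℝ F).smulRight (V x₀) +
      ContinuousLinearMap.snd ℝ ℝ F) (0, x₀) := by
  have hm : ((0 : ℝ), x₀) ∈ ball ((0 : ℝ), x₀) δ := mem_ball_self hδ
  have hT : HasFDerivAt Φ (fderiv ℝ Φ (0, x₀)) (0, x₀) :=
    ((hΦ.contDiffAt (isOpen_ball.mem_nhds hm)).differentiableAt (by simp)).hasFDerivAt
  refine hT.congr_fderiv (ContinuousLinearMap.ext fun z => ?_)
  have h1 : fderiv ℝ Φ (0, x₀) (1, 0) = V x₀ := by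
    have h2 : HasDerivAt (fun s : ℝ => (s, x₀)) ((1 : ℝ), (0 : F)) 0 :=
      (hasDerivAt_id 0).prodMk (hasDerivAt_const 0 x₀)
    have h3 := HasFDerivAt.comp_hasDerivAt (0 : ℝ) hT h2
    have h4 := hd 0 x₀ hm
    rw [h0 x₀ hm] at h4
    exact h3.unique h4
  have h2 : fderiv ℝ Φ (0, x₀) (0, z.2) = z.2 := by
    have h3 : HasFDerivAt (fun x : F => ((0 : ℝ), x)) (ContinuousLinearMap.inr ℝ ℝ F) x₀ :=
      (hasFDerivAt_const (0 : ℝ) x₀).prodMk (hasFDerivAt_id x₀)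
    have h4 := HasFDerivAt.comp x₀ hT h3
    have h5 : HasFDerivAt (Φ ∘ fun x : F => ((0 : ℝ), x)) (ContinuousLinearMap.id ℝ F) x₀ := by
      refine (hasFDerivAt_id x₀).congr_of_eventuallyEq ?_
      have hc : Continuous fun x : F => ((0 : ℝ), x) := by fun_prop
      filter_upwards [hc.continuousAt.eventually (isOpen_ball.mem_nhds hm)] with x hx
      exact h0 x hx
    exact DFunLike.congr_fun (h4.unique h5) z.2
  have h3 : z = z.1 • ((1 : ℝ), (0 : F)) + (0, z.2) := by
    refine Prod.ext ?_ ?_ <;> simp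
  conv_lhs => rw [h3]
  rw [map_add, map_smul, h1, h2]
  rfl

/-- Local solvability of `Y μ = f` for a nonvanishing vector field `Y`. -/
theorem exists_solve_transport [CompleteSpace F] {Y : F → F} (hY : ContDiff ℝ ∞ Y) {f : F → ℝ}
    (hf : ContDiff ℝ ∞ f) {x₀ : F} (h0 : Y x₀ ≠ 0) :
    ∃ (O : Set F) (μ : F → ℝ), IsOpen O ∧ x₀ ∈ O ∧ ContDiffOn ℝ ∞ μ O ∧
      ∀ w ∈ O, fderiv ℝ μ w (Y w) = f w := by
  -- Characteristics: along the flow of (Y, f) on F × ℝ, started at height 0, the last coordinate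
  -- integrates f along the trajectories of Y.
  obtain ⟨δ, hδ, Φ, hΦ, hΦ0, hΦd⟩ := exists_local_flow (F := F × ℝ)
    (V := fun z => (Y z.1, f z.1)) ((hY.comp contDiff_fst).prodMk (hf.comp contDiff_fst)) (x₀, 0)
  obtain ⟨ℓ, hℓ⟩ := SeparatingDual.exists_eq_one (R := ℝ) h0
  -- A point y is split into the time ℓ(y − x₀) and a starting point on the transversal ℓ = ℓ(x₀);
  -- moving y along Y x₀ changes only the time.
  let a : F → ℝ × (F × ℝ) := fun y => (ℓ (y - x₀), (y - ℓ (y - x₀) • Y x₀, 0))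
  have ha : ContDiff ℝ ∞ a := by
    have h1 : ContDiff ℝ ∞ fun y => ℓ (y - x₀) := ℓ.contDiff.comp (contDiff_id.sub contDiff_const)
    exact h1.prodMk ((contDiff_id.sub (h1.smul contDiff_const)).prodMk contDiff_const)
  have ha0 : a x₀ = (0, (x₀, 0)) := by simp [a]
  have hadd : ∀ y (t : ℝ), a (y + t • Y x₀) = ((a y).1 + t, (a y).2) := by
    intro y t
    have : ℓ (y + t • Y x₀ - x₀) = ℓ (y - x₀) + t := by
      rw [add_sub_right_comm, map_add, map_smul, hℓ, smul_eq_mul, mul_one]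
    refine Prod.ext this (Prod.ext ?_ rfl)
    change y + t • Y x₀ - ℓ (y + t • Y x₀ - x₀) • Y x₀ = y - ℓ (y - x₀) • Y x₀
    rw [this, add_smul]
    abel
  let O := a ⁻¹' ball (0, (x₀, 0)) δ
  have hO : IsOpen O := isOpen_ball.preimage ha.continuous
  have hxO : x₀ ∈ O := by
    change a x₀ ∈ ball (0, (x₀, 0)) δ
    rw [ha0]
    exact mem_ball_self hδ
  have hK : ContDiffOn ℝ ∞ (fun y => Φ (a y)) O := hΦ.comp ha.contDiffOn fun y hy => hy
  have hKd : ∀ y ∈ O, HasFDerivAt (fun y => Φ (a y)) (fderiv ℝ (fun y => Φ (a y)) y) y :=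
    fun y hy => ((hK.contDiffAt (hO.mem_nhds hy)).differentiableAt (by simp)).hasFDerivAt
  have hKY : ∀ y ∈ O, fderiv ℝ (fun y => Φ (a y)) y (Y x₀) = (Y (Φ (a y)).1, f (Φ (a y)).1) := by
    intro y hy
    have h1 : HasDerivAt (fun t : ℝ => y + t • Y x₀) (Y x₀) 0 := by
      simpa using ((hasDerivAt_id (0 : ℝ)).smul_const (Y x₀)).const_add y
    have h2 : HasFDerivAt (fun y => Φ (a y)) (fderiv ℝ (fun y => Φ (a y)) y)
        (y + (0 : ℝ) • Y x₀) := by simpa using hKd y hy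
    have h3 := h2.comp_hasDerivAt (0 : ℝ) h1
    have h4 : HasDerivAt (fun s => Φ (s, (a y).2)) (Y (Φ (a y)).1, f (Φ (a y)).1) ((a y).1 + 0) := by
      simpa using hΦd (a y).1 (a y).2 hy
    have h5 := h4.comp_const_add (a y).1 0
    refine h3.unique (h5.congr_of_eventuallyEq (Filter.Eventually.of_forall fun t => ?_))
    change Φ (a (y + t • Y x₀)) = _
    rw [hadd]
  have hda : HasFDerivAt a (ℓ.prod ((ContinuousLinearMap.id ℝ F - ℓ.smulRight (Y x₀)).prod 0)) x₀ := by
    have h1 : HasFDerivAt (fun y => ℓ (y - x₀)) ℓ x₀ :=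
      ℓ.hasFDerivAt.comp x₀ ((hasFDerivAt_id x₀).sub_const x₀)
    exact h1.prodMk (((hasFDerivAt_id x₀).sub (h1.smul_const (Y x₀))).prodMk
      (hasFDerivAt_const (0 : ℝ) x₀))
  -- The straightening map has derivative the identity at x₀, hence is locally invertible; μ is the
  -- height coordinate composed with its inverse.
  have hG : HasFDerivAt (fun y => (Φ (a y)).1)
      ((ContinuousLinearEquiv.refl ℝ F : F ≃L[ℝ] F) : F →L[ℝ] F) x₀ := by
    have h1 := hasFDerivAt_local_flow (V := fun z => (Y z.1, f z.1)) hδ hΦ hΦ0 hΦd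
    rw [← ha0] at h1
    refine ((h1.comp x₀ hda).fst).congr_fderiv (ContinuousLinearMap.ext fun v => ?_)
    change ℓ v • Y x₀ + (v - ℓ v • Y x₀) = v
    abel
  obtain ⟨e, hxe, heO, he, hes⟩ := exists_smooth_local_inverse hO
    (contDiff_fst.comp_contDiffOn hK) hxO (ContinuousLinearEquiv.refl ℝ F) hG
  replace he : ∀ y, e y = (Φ (a y)).1 := he
  have hex : e x₀ = x₀ := by
    rw [he, ha0]
    exact congrArg Prod.fst (hΦ0 (x₀, 0) (mem_ball_self hδ))
  refine ⟨e.target, fun w => (Φ (a (e.symm w))).2, e.open_target, hex ▸ e.map_source hxe,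
    contDiff_snd.comp_contDiffOn (hK.comp hes fun w hw => heO (e.map_target hw)), ?_⟩
  intro w hw
  set μ : F → ℝ := fun w => (Φ (a (e.symm w))).2 with hμ
  set y := e.symm w with hy
  have hys : y ∈ e.source := e.map_target hw
  have hey : (Φ (a y)).1 = w := by rw [← he y, e.right_inv hw]
  have hμs : ContDiffOn ℝ ∞ μ e.target :=
    contDiff_snd.comp_contDiffOn (hK.comp hes fun w hw => heO (e.map_target hw))
  have h1 : HasFDerivAt μ (fderiv ℝ μ w) (Φ (a y)).1 := by
    rw [hey]
    exact ((hμs.contDiffAt (e.open_target.mem_nhds hw)).differentiableAt (by simp)).hasFDerivAt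
  have h2 := h1.comp y (hKd y (heO hys)).fst
  have h3 : HasFDerivAt (μ ∘ fun y => (Φ (a y)).1)
      ((ContinuousLinearMap.snd ℝ F ℝ).comp (fderiv ℝ (fun y => Φ (a y)) y)) y := by
    refine (hKd y (heO hys)).snd.congr_of_eventuallyEq ?_
    filter_upwards [e.open_source.mem_nhds hys] with z hz
    change (Φ (a (e.symm (Φ (a z)).1))).2 = _
    rw [← he z, e.left_inv hz]
  have h4 := DFunLike.congr_fun (h2.unique h3) (Y x₀)
  change fderiv ℝ μ w (fderiv ℝ (fun y => Φ (a y)) y (Y x₀)).1 =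
    (fderiv ℝ (fun y => Φ (a y)) y (Y x₀)).2 at h4
  rw [hKY y (heO hys)] at h4
  dsimp only at h4
  rw [hey] at h4
  exact h4

end Flow

/-! ### Hadamard's lemma -/

section Hadamard

open MeasureTheory Topology

variable {G : Type*} [NormedAddCommGroup G] [NormedSpace ℝ G]

/-- The derivative of `f`, averaged over the segment from `π y` to `y`. -/
def averageDeriv (f : G → ℝ) (π : G → G) (y : G) : G →L[ℝ] ℝ :=
  ∫ t in (0 : ℝ)..1, fderiv ℝ f (π y + t • (y - π y))

theorem contDiff_averageDeriv {f : G → ℝ} {π : G → G} (hf : ContDiff ℝ ∞ f)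
    (hπ : ContDiff ℝ ∞ π) : ContDiff ℝ ∞ (averageDeriv f π) := by
  have h : ContDiff ℝ ∞ (fun z : ℝ × G => fderiv ℝ f (π z.2 + z.1 • (z.2 - π z.2))) :=
    (hf.fderiv_right (m := ∞) (by simp)).comp ((hπ.comp contDiff_snd).add
      (contDiff_fst.smul (contDiff_snd.sub (hπ.comp contDiff_snd))))
  exact contDiff_integral_param h

theorem averageDeriv_of_eq {f : G → ℝ} {π : G → G} {y : G} (h : π y = y) :
    averageDeriv f π y = fderiv ℝ f y := by
  simp [averageDeriv, h]

/-- Hadamard's lemma. -/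
theorem eq_add_averageDeriv {f : G → ℝ} (hf : ContDiff ℝ ∞ f) (π : G → G) (y : G) :
    f y = f (π y) + averageDeriv f π y (y - π y) := by
  have hc : Continuous fun t : ℝ => fderiv ℝ f (π y + t • (y - π y)) :=
    (hf.continuous_fderiv (by simp)).comp (by fun_prop)
  have h1 : ∀ t ∈ Set.uIcc (0 : ℝ) 1, HasDerivAt (fun t : ℝ => f (π y + t • (y - π y)))
      (fderiv ℝ f (π y + t • (y - π y)) (y - π y)) t := by
    intro t _
    have h2 : HasDerivAt (fun t : ℝ => π y + t • (y - π y)) (y - π y) t := by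
      simpa using ((hasDerivAt_id t).smul_const (y - π y)).const_add (π y)
    exact ((hf.differentiable (by simp)) _).hasFDerivAt.comp_hasDerivAt t h2
  have h3 := intervalIntegral.integral_eq_sub_of_hasDerivAt h1
    ((hc.clm_apply continuous_const).intervalIntegrable _ _)
  rw [averageDeriv, ContinuousLinearMap.intervalIntegral_apply (hc.intervalIntegrable _ _), h3]
  simp

end Hadamard

/-! ### Locality: smooth functions and derivations near a point -/

section Germs

open Topology

variable {E : Type*} [NormedAddCommGroup E] [NormedSpace ℝ E]
  {M : Type*} [TopologicalSpace M] [ChartedSpace E M]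

/-- Evaluation of smooth functions at a point. -/
def evalAt (q : M) : Smooth E M →ₐ[ℝ] ℝ where
  toFun f := f q
  map_one' := rfl
  map_mul' _ _ := rfl
  map_zero' := rfl
  map_add' _ _ := rfl
  commutes' _ := rfl

theorem evalAt_apply (q : M) (f : Smooth E M) : evalAt q f = f q := rfl

theorem smooth_mul_apply (f g : Smooth E M) (q : M) : (f * g) q = f q * g q := rfl

theorem smooth_add_apply (f g : Smooth E M) (q : M) : (f + g) q = f q + g q := rfl

theorem smooth_sub_apply (f g : Smooth E M) (q : M) : (f - g) q = f q - g q := rfl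

theorem smooth_neg_apply (f : Smooth E M) (q : M) : (-f) q = -f q := rfl

theorem smooth_zero_apply (q : M) : (0 : Smooth E M) q = 0 := rfl

theorem smooth_real_smul_apply (c : ℝ) (f : Smooth E M) (q : M) : (c • f) q = c * f q := rfl

theorem smooth_sum_apply {κ : Type*} (s : Finset κ) (f : κ → Smooth E M) (q : M) :
    (∑ i ∈ s, f i) q = ∑ i ∈ s, f i q := map_sum (evalAt q) f s

theorem derivation_mul_apply (V : VField E M) (f g : Smooth E M) (q : M) :
    V (f * g) q = f q * V g q + g q * V f q := by
  rw [V.leibniz]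
  rfl

theorem derivation_smul_apply (f : Smooth E M) (V : VField E M) (g : Smooth E M) (q : M) :
    (f • V) g q = f q * V g q := rfl

theorem derivation_lie_apply (V W : VField E M) (f : Smooth E M) (q : M) :
    ⁅V, W⁆ f q = V (W f) q - W (V f) q := by
  rw [Derivation.commutator_apply]
  rfl

theorem derivation_const (V : VField E M) (c : ℝ) :
    V (algebraMap ℝ (Smooth E M) c) = 0 := V.map_algebraMap c

variable [FiniteDimensional ℝ E] [T2Space M] [IsManifold 𝓘(ℝ, E) ∞ M]

theorem exists_bump {p : M} {O : Set M} (hO : O ∈ 𝓝 p) :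
    ∃ χ : Smooth E M, (∀ᶠ x in 𝓝 p, χ x = 1) ∧ tsupport χ ⊆ O := by
  obtain ⟨f, -, hf⟩ := (SmoothBumpFunction.nhds_basis_tsupport (I := 𝓘(ℝ, E)) p).mem_iff.mp hO
  exact ⟨⟨f, f.contMDiff⟩, f.eventuallyEq_one, hf⟩

/-- Apply V to χ (f − g) = 0, where χ is a cutoff supported where f = g and equal to one at q. -/
theorem derivation_congr {f g : Smooth E M} {q : M} (V : VField E M)
    (h : ∀ᶠ x in 𝓝 q, f x = g x) : V f q = V g q := by
  obtain ⟨χ, h1, h2⟩ := exists_bump (E := E) h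
  have h3 : χ * (f - g) = 0 := by
    ext x
    by_cases hx : x ∈ tsupport χ
    · have : f x = g x := h2 hx
      rw [smooth_mul_apply, smooth_sub_apply, this, sub_self, mul_zero, smooth_zero_apply]
    · rw [smooth_mul_apply, image_eq_zero_of_notMem_tsupport hx, zero_mul, smooth_zero_apply]
  have h4 := derivation_mul_apply V χ (f - g) q
  rw [h3, map_zero, smooth_zero_apply, h1.self_of_nhds, one_mul, smooth_sub_apply,
    h.self_of_nhds, sub_self, zero_mul, add_zero, map_sub, smooth_sub_apply] at h4
  exact (sub_eq_zero.mp h4.symm)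

/-- A function which is smooth near `p` agrees near `p` with a smooth function. -/
theorem exists_smooth_eventuallyEq {p : M} {O : Set M} (hO : O ∈ 𝓝 p) {g : M → ℝ}
    (hg : ∀ x ∈ O, ContMDiffAt 𝓘(ℝ, E) 𝓘(ℝ, ℝ) ∞ g x) :
    ∃ f : Smooth E M, ∀ᶠ x in 𝓝 p, f x = g x := by
  obtain ⟨χ, h1, h2⟩ := exists_bump (E := E) hO
  refine ⟨⟨fun x => χ x * g x, contMDiff_of_tsupport fun x hx => ?_⟩, ?_⟩
  · exact (χ.contMDiff x).mul (hg x (h2 (tsupport_mul_subset_left hx)))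
  · filter_upwards [h1] with x hx
    change χ x * g x = g x
    rw [hx, one_mul]

theorem exists_smooth_inv {p : M} (f : Smooth E M) (hf : f p ≠ 0) :
    ∃ g : Smooth E M, ∀ᶠ x in 𝓝 p, g x * f x = 1 := by
  have hO : {x | f x ≠ 0} ∈ 𝓝 p := f.contMDiff.continuous.continuousAt.eventually_ne hf
  obtain ⟨g, hg⟩ := exists_smooth_eventuallyEq (E := E) hO (g := fun x => (f x)⁻¹)
    (fun x hx => (f.contMDiff x).inv₀ hx)
  refine ⟨g, ?_⟩
  filter_upwards [hg, hO] with x hx hx'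
  rw [hx, inv_mul_cancel₀ hx']

theorem exists_smooth_sqrt {p : M} (f : Smooth E M) (hf : 0 < f p) :
    ∃ g : Smooth E M, ∀ᶠ x in 𝓝 p, g x * g x = f x ∧ 0 < g x := by
  have hO : {x | 0 < f x} ∈ 𝓝 p := f.contMDiff.continuous.continuousAt.eventually_const_lt hf
  obtain ⟨g, hg⟩ := exists_smooth_eventuallyEq (E := E) hO (g := fun x => Real.sqrt (f x))
    (fun x hx => ((Real.contDiffAt_sqrt (ne_of_gt hx)).contMDiffAt).comp x (f.contMDiff x))
  refine ⟨g, ?_⟩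
  filter_upwards [hg, hO] with x hx hx'
  rw [hx]
  exact ⟨Real.mul_self_sqrt (le_of_lt hx'), Real.sqrt_pos.mpr hx'⟩

end Germs

/-- A chart near `p`, with functions cutting off outside of its domain. -/
structure CutoffChart (E : Type*) [NormedAddCommGroup E] [NormedSpace ℝ E]
    {M : Type*} [TopologicalSpace M] [ChartedSpace E M] (p : M)
    (G : Type*) [NormedAddCommGroup G] [NormedSpace ℝ G] where
  chart : OpenPartialHomeomorph M G
  mem_source : p ∈ chart.source
  smooth_chart : ContMDiffOn 𝓘(ℝ, E) 𝓘(ℝ, G) ∞ chart chart.source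
  smooth_symm : ContMDiffOn 𝓘(ℝ, G) 𝓘(ℝ, E) ∞ chart.symm chart.target
  bump : Smooth E M
  tsupport_bump : tsupport bump ⊆ chart.source
  radius : ℝ
  radius_pos : 0 < radius
  ball_subset : Metric.ball (chart p) radius ⊆ chart.target
  bump_eq_one : ∀ x ∈ chart.source, chart x ∈ Metric.ball (chart p) radius → bump x = 1
  bumpModel : G → ℝ
  contDiff_bumpModel : ContDiff ℝ ∞ bumpModel
  tsupport_bumpModel : tsupport bumpModel ⊆ chart.target
  bumpModel_eq_one : ∀ y ∈ Metric.ball (chart p) radius, bumpModel y = 1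

/-! ### Functions and derivations in a chart -/

namespace CutoffChart

open Topology Metric

variable {E : Type*} [NormedAddCommGroup E] [NormedSpace ℝ E]
  {M : Type*} [TopologicalSpace M] [ChartedSpace E M] {p : M}
  {G : Type*} [NormedAddCommGroup G] [NormedSpace ℝ G] (c : CutoffChart E p G)

/-- The domain on which nothing is cut off. -/
def dom : Set M := c.chart.source ∩ c.chart ⁻¹' ball (c.chart p) c.radius

theorem isOpen_dom : IsOpen c.dom := c.chart.isOpen_inter_preimage isOpen_ball

theorem mem_dom : p ∈ c.dom := ⟨c.mem_source, mem_ball_self c.radius_pos⟩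

theorem bump_of_mem {q : M} (hq : q ∈ c.dom) : c.bump q = 1 := c.bump_eq_one q hq.1 hq.2

theorem symm_mem_dom {y : G} (hy : y ∈ ball (c.chart p) c.radius) : c.chart.symm y ∈ c.dom :=
  ⟨c.chart.map_target (c.ball_subset hy), by
    rw [Set.mem_preimage, c.chart.right_inv (c.ball_subset hy)]; exact hy⟩

theorem contMDiffAt_chart {q : M} (hq : q ∈ c.chart.source) :
    ContMDiffAt 𝓘(ℝ, E) 𝓘(ℝ, G) ∞ c.chart q :=
  c.smooth_chart.contMDiffAt (c.chart.open_source.mem_nhds hq)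

theorem contDiffOn_comp_symm (f : Smooth E M) : ContDiffOn ℝ ∞ (f ∘ c.chart.symm) c.chart.target :=
  contMDiffOn_iff_contDiffOn.mp (f.contMDiff.comp_contMDiffOn c.smooth_symm)

theorem contMDiff_bump_mul {g : M → ℝ}
    (hg : ∀ x ∈ c.chart.source, ContMDiffAt 𝓘(ℝ, E) 𝓘(ℝ, ℝ) ∞ g x) :
    ContMDiff 𝓘(ℝ, E) 𝓘(ℝ, ℝ) ∞ (fun x => c.bump x * g x) :=
  contMDiff_of_tsupport fun x hx =>
    (c.bump.contMDiff x).mul (hg x (c.tsupport_bump (tsupport_mul_subset_left hx)))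

/-- The smooth function given by `f` in the chart. -/
def pull (f : G → ℝ) (hf : ContDiff ℝ ∞ f) : Smooth E M :=
  ⟨fun x => c.bump x * f (c.chart x), c.contMDiff_bump_mul (g := fun x => f (c.chart x))
    fun _ hx => hf.contMDiff.contMDiffAt.comp _ (c.contMDiffAt_chart hx)⟩

theorem pull_apply {f : G → ℝ} (hf : ContDiff ℝ ∞ f) {q : M} (hq : q ∈ c.dom) :
    c.pull f hf q = f (c.chart q) := by
  change c.bump q * _ = _
  rw [c.bump_of_mem hq, one_mul]

/-- The function `f` in the chart. -/
def push (f : Smooth E M) (y : G) : ℝ := c.bumpModel y * f (c.chart.symm y)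

theorem contDiff_push (f : Smooth E M) : ContDiff ℝ ∞ (c.push f) := by
  rw [← contMDiff_iff_contDiff]
  refine contMDiff_of_tsupport fun y hy => ?_
  have hy' := c.tsupport_bumpModel (tsupport_mul_subset_left hy)
  exact (c.contDiff_bumpModel.contMDiff y).mul
    ((c.contDiffOn_comp_symm f).contDiffAt (c.chart.open_target.mem_nhds hy')).contMDiffAt

theorem push_of_mem (f : Smooth E M) {y : G} (hy : y ∈ ball (c.chart p) c.radius) :
    c.push f y = f (c.chart.symm y) := by
  rw [push, c.bumpModel_eq_one y hy, one_mul]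

theorem push_apply (f : Smooth E M) {q : M} (hq : q ∈ c.dom) : c.push f (c.chart q) = f q := by
  rw [c.push_of_mem f hq.2, c.chart.left_inv hq.1]

/-- Partial derivatives in the chart. -/
def partialDeriv (e : G) : VField E M :=
  Derivation.mk'
    { toFun := fun f => ⟨fun x => c.bump x * fderiv ℝ (f ∘ c.chart.symm) (c.chart x) e,
        c.contMDiff_bump_mul (g := fun x => fderiv ℝ (f ∘ c.chart.symm) (c.chart x) e)
          fun x hx => by
            have h1 : ContDiffAt ℝ ∞ (fun y => fderiv ℝ (f ∘ c.chart.symm) y e) (c.chart x) :=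
              ((((c.contDiffOn_comp_symm f).contDiffAt (c.chart.open_target.mem_nhds
                (c.chart.map_source hx))).fderiv_right (m := ∞) (by simp)).clm_apply
                  contDiffAt_const)
            exact h1.contMDiffAt.comp x (c.contMDiffAt_chart hx)⟩
      map_add' := fun f g => by
        ext x
        by_cases hx : x ∈ c.chart.source
        · have hd : ∀ f : Smooth E M, DifferentiableAt ℝ (f ∘ c.chart.symm) (c.chart x) := fun f =>
            ((c.contDiffOn_comp_symm f).contDiffAt (c.chart.open_target.mem_nhds
                (c.chart.map_source hx))).differentiableAt (by simp)
          change c.bump x * fderiv ℝ (f ∘ c.chart.symm + g ∘ c.chart.symm) (c.chart x) e =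
            c.bump x * _ + c.bump x * _
          rw [fderiv_add (hd f) (hd g), add_apply, mul_add]
        · have h0 : c.bump x = 0 :=
            image_eq_zero_of_notMem_tsupport fun h => hx (c.tsupport_bump h)
          change c.bump x * _ = c.bump x * _ + c.bump x * _
          simp [h0]
      map_smul' := fun a f => by
        ext x
        change c.bump x * fderiv ℝ (a • (f ∘ c.chart.symm)) (c.chart x) e = a * (c.bump x * _)
        rw [fderiv_const_smul_field]
        exact mul_left_comm _ _ _ }
    (fun f g => by
      ext x
      by_cases hx : x ∈ c.chart.source
      · have hd : ∀ f : Smooth E M, DifferentiableAt ℝ (f ∘ c.chart.symm) (c.chart x) := fun f =>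
          ((c.contDiffOn_comp_symm f).contDiffAt (c.chart.open_target.mem_nhds
              (c.chart.map_source hx))).differentiableAt (by simp)
        change c.bump x * fderiv ℝ ((f ∘ c.chart.symm) * (g ∘ c.chart.symm)) (c.chart x) e =
          f x * (c.bump x * _) + g x * (c.bump x * _)
        rw [fderiv_mul (hd f) (hd g)]
        simp only [add_apply, smul_apply, smul_eq_mul, Function.comp_apply, c.chart.left_inv hx]
        ring
      · have h0 : c.bump x = 0 :=
          image_eq_zero_of_notMem_tsupport fun h => hx (c.tsupport_bump h)
        change c.bump x * _ = f x * (c.bump x * _) + g x * (c.bump x * _)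
        simp [h0])

theorem partialDeriv_apply (e : G) (f : Smooth E M) {q : M} (hq : q ∈ c.dom) :
    c.partialDeriv e f q = fderiv ℝ (c.push f) (c.chart q) e := by
  change c.bump q * _ = _
  rw [c.bump_of_mem hq, one_mul]
  have : c.push f =ᶠ[𝓝 (c.chart q)] f ∘ c.chart.symm :=
    Filter.eventuallyEq_of_mem (isOpen_ball.mem_nhds hq.2) fun y hy => c.push_of_mem f hy
  rw [this.fderiv_eq]

theorem push_pull {f : G → ℝ} (hf : ContDiff ℝ ∞ f) {y : G} (hy : y ∈ ball (c.chart p) c.radius) :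
    c.push (c.pull f hf) y = f y := by
  rw [c.push_of_mem _ hy, c.pull_apply hf (c.symm_mem_dom hy), c.chart.right_inv (c.ball_subset hy)]

theorem partialDeriv_pull (e : G) {f : G → ℝ} (hf : ContDiff ℝ ∞ f) {q : M} (hq : q ∈ c.dom) :
    c.partialDeriv e (c.pull f hf) q = fderiv ℝ f (c.chart q) e := by
  rw [c.partialDeriv_apply e _ hq]
  have : c.push (c.pull f hf) =ᶠ[𝓝 (c.chart q)] f :=
    Filter.eventuallyEq_of_mem (isOpen_ball.mem_nhds hq.2) fun y hy => c.push_pull hf hy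
  rw [this.fderiv_eq]

/-- Linear functions in the chart. -/
def coord (l : G →L[ℝ] ℝ) : Smooth E M := c.pull l l.contDiff

theorem coord_apply (l : G →L[ℝ] ℝ) {q : M} (hq : q ∈ c.dom) : c.coord l q = l (c.chart q) :=
  c.pull_apply _ hq

theorem partialDeriv_coord (e : G) (l : G →L[ℝ] ℝ) {q : M} (hq : q ∈ c.dom) :
    c.partialDeriv e (c.coord l) q = l e := by
  rw [coord, c.partialDeriv_pull e l.contDiff hq, ContinuousLinearMap.fderiv]

/-- A derivation is determined by its values on coordinates. -/
theorem derivation_eq_sum [FiniteDimensional ℝ E] [T2Space M] [IsManifold 𝓘(ℝ, E) ∞ M]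
    {κ : Type*} [Fintype κ] {l : κ → G →L[ℝ] ℝ} {e : κ → G}
    (hle : ∀ y, ∑ k, l k y • e k = y) (V : VField E M) (f : Smooth E M) {q : M} (hq : q ∈ c.dom) :
    V f q = ∑ k, V (c.coord (l k)) q * c.partialDeriv (e k) f q := by
  have hπ : ContDiff ℝ ∞ (fun _ : G => c.chart q) := contDiff_const
  have hg : ∀ k, ContDiff ℝ ∞ fun y => averageDeriv (c.push f) (fun _ => c.chart q) y (e k) :=
    fun k => (contDiff_averageDeriv (c.contDiff_push f) hπ).clm_apply contDiff_const
  -- Hadamard's expansion of f at q, written with globally defined functions; a derivation at q only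
  -- sees the linear factors.
  let f' : Smooth E M := algebraMap ℝ _ (f q) + ∑ k, (c.coord (l k) -
    algebraMap ℝ _ (c.coord (l k) q)) * c.pull _ (hg k)
  have h1 : ∀ᶠ x in 𝓝 q, f x = f' x := by
    filter_upwards [c.isOpen_dom.mem_nhds hq] with x hx
    have h2 := eq_add_averageDeriv (c.contDiff_push f) (fun _ => c.chart q) (c.chart x)
    rw [c.push_apply f hx, c.push_apply f hq] at h2
    rw [h2]
    change _ = f q + _
    congr 1
    rw [← evalAt_apply (E := E), map_sum]
    conv_lhs => rw [← hle (c.chart x - c.chart q), map_sum]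
    refine Finset.sum_congr rfl fun k _ => ?_
    rw [map_smul, evalAt_apply, smooth_mul_apply, smooth_sub_apply, c.coord_apply _ hx,
      c.pull_apply _ hx, map_sub, smul_eq_mul]
    change _ = (_ - c.coord (l k) q) * _
    rw [c.coord_apply _ hq]
  rw [derivation_congr V h1]
  have h2 : V f' = ∑ k, V ((c.coord (l k) - algebraMap ℝ _ (c.coord (l k) q)) *
      c.pull _ (hg k)) := by
    rw [map_add, derivation_const, zero_add, map_sum]
  rw [h2, smooth_sum_apply]
  refine Finset.sum_congr rfl fun k _ => ?_
  rw [derivation_mul_apply, map_sub, derivation_const, sub_zero, c.pull_apply _ hq,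
    c.partialDeriv_apply _ _ hq]
  change (c.coord (l k) q - c.coord (l k) q) * _ + _ = _
  rw [sub_self, zero_mul, zero_add, averageDeriv_of_eq rfl, mul_comm]

theorem exists_cutoffChart [FiniteDimensional ℝ E] [T2Space M] [IsManifold 𝓘(ℝ, E) ∞ M]
    [FiniteDimensional ℝ G] (e : OpenPartialHomeomorph M G) (hp : p ∈ e.source)
    (h1 : ContMDiffOn 𝓘(ℝ, E) 𝓘(ℝ, G) ∞ e e.source)
    (h2 : ContMDiffOn 𝓘(ℝ, G) 𝓘(ℝ, E) ∞ e.symm e.target) {O : Set M} (hO : O ∈ 𝓝 p) :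
    ∃ c : CutoffChart E p G, c.chart = e ∧ tsupport c.bump ⊆ O ∧ c.dom ⊆ O := by
  obtain ⟨χ, hχ, hχs⟩ := exists_bump (E := E) (Filter.inter_mem hO (e.open_source.mem_nhds hp))
  obtain ⟨ε, hε, hεs⟩ := Metric.isOpen_iff.mp e.open_target (e p) (e.map_source hp)
  have hev : ∀ᶠ y in 𝓝 (e p), χ (e.symm y) = 1 ∧ e.symm y ∈ O := by
    have hc : Filter.Tendsto e.symm (𝓝 (e p)) (𝓝 p) := by
      have := e.continuousAt_symm (e.map_source hp)
      rwa [ContinuousAt, e.left_inv hp] at this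
    exact hc.eventually (hχ.and hO)
  obtain ⟨r, hr, hrs⟩ := Metric.eventually_nhds_iff_ball.mp hev
  let f : ContDiffBump (e p) := ⟨ε / 3, ε / 2, by positivity, by linarith⟩
  refine ⟨⟨e, hp, h1, h2, χ, fun x hx => (hχs hx).2, min r (ε / 3), by positivity, ?_, ?_, f,
    f.contDiff, ?_, ?_⟩, rfl, fun x hx => (hχs hx).1, ?_⟩
  · exact (ball_subset_ball ((min_le_right _ _).trans (by linarith))).trans hεs
  · intro x hx hx'
    have := (hrs (e x) (ball_subset_ball (min_le_left _ _) hx')).1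
    rwa [e.left_inv hx] at this
  · rw [f.tsupport_eq]
    exact (closedBall_subset_ball (by change ε / 2 < ε; linarith)).trans hεs
  · exact fun y hy => f.one_of_mem_closedBall
      (ball_subset_closedBall (ball_subset_ball (min_le_right _ _) hy))
  · intro x hx
    have := (hrs (e x) (ball_subset_ball (min_le_left _ _) hx.2)).2
    rwa [e.left_inv hx.1] at this

end CutoffChart

/-! ### Coordinates adapted to a submanifold of codimension two -/

section SliceCharts

open Topology Metric

section Slice

variable {E : Type*} [NormedAddCommGroup E] [NormedSpace ℝ E] [FiniteDimensional ℝ E]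
  {F : Type*} [NormedAddCommGroup F] [NormedSpace ℝ F] [FiniteDimensional ℝ F]
  {X : Type*} [TopologicalSpace X] [ChartedSpace E X] [IsManifold 𝓘(ℝ, E) ∞ X]
  {D : Type*} [TopologicalSpace D] [ChartedSpace F D] [IsManifold 𝓘(ℝ, F) ∞ D]

/-- In the normal form of an immersion the complement has dimension two by a count of dimensions,
and may be taken to be ℝ × ℝ. -/
theorem exists_slice_chart (hEF : Module.finrank ℝ E = Module.finrank ℝ F + 2)
    {ι : D → X} {p : D} (h : Manifold.IsImmersionAt 𝓘(ℝ, F) 𝓘(ℝ, E) ∞ ι p) :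
    ∃ (cD : OpenPartialHomeomorph D F) (cX : OpenPartialHomeomorph X (F × ℝ × ℝ)),
      ContMDiffOn 𝓘(ℝ, F) 𝓘(ℝ, F) ∞ cD cD.source ∧
      ContMDiffOn 𝓘(ℝ, F) 𝓘(ℝ, F) ∞ cD.symm cD.target ∧
      ContMDiffOn 𝓘(ℝ, E) 𝓘(ℝ, F × ℝ × ℝ) ∞ cX cX.source ∧
      ContMDiffOn 𝓘(ℝ, F × ℝ × ℝ) 𝓘(ℝ, E) ∞ cX.symm cX.target ∧ p ∈ cD.source ∧
      ∀ q ∈ cD.source, ι q ∈ cX.source ∧ cX (ι q) = (cD q, 0, 0) := by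
  have : FiniteDimensional ℝ (F × h.complement) := LinearEquiv.finiteDimensional h.equiv.symm.toLinearEquiv
  have : FiniteDimensional ℝ h.complement := FiniteDimensional.of_surjective
    (LinearMap.snd ℝ F h.complement) Prod.snd_surjective
  have hfin : Module.finrank ℝ h.complement = Module.finrank ℝ (ℝ × ℝ) := by
    have h1 := h.equiv.toLinearEquiv.finrank_eq
    rw [Module.finrank_prod] at h1
    rw [Module.finrank_prod, Module.finrank_self]
    omega
  let e : E ≃L[ℝ] F × ℝ × ℝ := h.equiv.symm.trans
    ((ContinuousLinearEquiv.refl ℝ F).prodCongr (ContinuousLinearEquiv.ofFinrankEq hfin))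
  have hX := h.codChart_mem_maximalAtlas
  have hD := h.domChart_mem_maximalAtlas
  refine ⟨h.domChart, h.codChart.transHomeomorph e.toHomeomorph,
    contMDiffOn_of_mem_maximalAtlas hD, contMDiffOn_symm_of_mem_maximalAtlas hD, ?_, ?_,
    h.mem_domChart_source, ?_⟩
  · exact e.contDiff.contMDiff.comp_contMDiffOn (contMDiffOn_of_mem_maximalAtlas hX)
  · exact (contMDiffOn_symm_of_mem_maximalAtlas hX).comp e.symm.contDiff.contMDiff.contMDiffOn
      fun y hy => hy
  · intro q hq
    refine ⟨h.source_subset_preimage_source hq, ?_⟩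
    have h0 : h.domChart q ∈ (h.domChart.extend 𝓘(ℝ, F)).target := by
      simpa [OpenPartialHomeomorph.extend] using h.domChart.map_source hq
    have h1 := h.writtenInCharts h0
    simp only [OpenPartialHomeomorph.extend, Function.comp_apply, mfld_simps,
      h.domChart.left_inv hq] at h1
    change e (h.codChart (ι q)) = _
    rw [h1]
    simp [e]
    rfl

end Slice

section SliceCoords

variable {E : Type*} [NormedAddCommGroup E] [NormedSpace ℝ E]
  {F : Type*} [NormedAddCommGroup F] [NormedSpace ℝ F]
  {X : Type*} [TopologicalSpace X] [ChartedSpace E X]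
  {D : Type*} [TopologicalSpace D] [ChartedSpace F D]

/-- Coordinates `x`, `u`, `v` of `X` on a neighbourhood `U` of `p ∈ D`, in which `D` is given by
`u = v = 0`, with the coordinate vector fields. -/
structure SliceCoords (ι : C^∞⟮𝓘(ℝ, F), D; 𝓘(ℝ, E), X⟯) (p : D) where
  U : Set X
  isOpen : IsOpen U
  mem : ι p ∈ U
  u : Smooth E X
  v : Smooth E X
  x : Fin (Module.finrank ℝ F) → Smooth E X
  Nu : VField E X
  Nv : VField E X
  Nx : Fin (Module.finrank ℝ F) → VField E X
  Dx : Fin (Module.finrank ℝ F) → VField F D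
  u_comp : u.comp ι = 0
  v_comp : v.comp ι = 0
  Nu_u : ∀ q ∈ U, Nu u q = 1
  Nu_v : ∀ q ∈ U, Nu v q = 0
  Nu_x : ∀ k, ∀ q ∈ U, Nu (x k) q = 0
  Nv_u : ∀ q ∈ U, Nv u q = 0
  Nv_v : ∀ q ∈ U, Nv v q = 1
  Nv_x : ∀ k, ∀ q ∈ U, Nv (x k) q = 0
  Nx_u : ∀ k, ∀ q ∈ U, Nx k u q = 0
  Nx_v : ∀ k, ∀ q ∈ U, Nx k v q = 0
  Nx_x : ∀ k l, ∀ q ∈ U, Nx k (x l) q = if k = l then 1 else 0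
  span : ∀ (V : VField E X) (f : Smooth E X), ∀ q ∈ U,
    V f q = V u q * Nu f q + V v q * Nv f q + ∑ k, V (x k) q * Nx k f q
  vanish : ∀ f : Smooth E X, f.comp ι = 0 →
    ∃ f₁ f₂ : Smooth E X, ∀ q ∈ U, f q = u q * f₁ q + v q * f₂ q
  divide : ∀ f : Smooth E X, (∀ q ∈ U, v q = 0 → u q * f q = 0) →
    ∃ f' : Smooth E X, ∀ q ∈ U, f q = v q * f' q
  cancel : ∀ f : Smooth E X, (∀ q ∈ U, v q * f q = 0) → ∀ q ∈ U, f q = 0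
  mem_range : ∀ q ∈ U, u q = 0 → v q = 0 → q ∈ Set.range ι
  Nx_comp : ∀ k (f : Smooth E X) (q : D), ι q ∈ U → Nx k f (ι q) = Dx k (f.comp ι) q
  span_comp : ∀ (W : VField F D) (f : Smooth F D) (q : D), ι q ∈ U →
    W f q = ∑ k, W ((x k).comp ι) q * Dx k f q
  extend : ∀ f : Smooth F D, ∃ g : Smooth E X, ∀ q, ι q ∈ U → g (ι q) = f q

/-- Continuity extends an identity across the locus on which a coordinate could not be cancelled. -/
theorem eq_zero_of_forall_ne {h : ℝ → ℝ} (hc : Continuous h) {r : ℝ} (hr : 0 < r)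
    (h0 : ∀ t, |t| < r → t ≠ 0 → h t = 0) : h 0 = 0 := by
  have h1 : Filter.Tendsto h (𝓝[≠] 0) (𝓝 (h 0)) := hc.continuousAt.tendsto.mono_left nhdsWithin_le_nhds
  refine tendsto_nhds_unique h1 (tendsto_const_nhds.congr' ?_)
  filter_upwards [self_mem_nhdsWithin, mem_nhdsWithin_of_mem_nhds (ball_mem_nhds (0 : ℝ) hr)]
    with t ht ht'
  exact (h0 t (by simpa using ht') ht).symm

theorem mem_ball_triple {y c : F} {a b r : ℝ} :
    ((y, a, b) : F × ℝ × ℝ) ∈ ball (c, (0 : ℝ), (0 : ℝ)) r ↔ dist y c < r ∧ |a| < r ∧ |b| < r := by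
  simp [mem_ball, Prod.dist_eq, max_lt_iff]

theorem exists_sliceCoords [FiniteDimensional ℝ E] [FiniteDimensional ℝ F]
    [IsManifold 𝓘(ℝ, E) ∞ X] [IsManifold 𝓘(ℝ, F) ∞ D] [T2Space X]
    (hEF : Module.finrank ℝ E = Module.finrank ℝ F + 2)
    (ι : C^∞⟮𝓘(ℝ, F), D; 𝓘(ℝ, E), X⟯)
    (hι : Manifold.IsSmoothEmbedding 𝓘(ℝ, F) 𝓘(ℝ, E) ∞ ι) (p : D) :
    Nonempty (SliceCoords ι p) := by
  have : T2Space D := hι.isEmbedding.t2Space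
  obtain ⟨eD, eX, hD1, hD2, hX1, hX2, hpD, hDX⟩ :=
    exists_slice_chart hEF (hι.isImmersion.isImmersionAt p)
  obtain ⟨cD, hcD, -⟩ := CutoffChart.exists_cutoffChart (E := F) eD hpD hD1 hD2 Filter.univ_mem
  -- Here the embedding enters, beyond the immersion: the chart domain of `D` is cut out by an open
  -- set of X, so no other part of `D` meets it.
  obtain ⟨O₁, hO₁, hO₁D⟩ := hι.isEmbedding.isOpen_iff.mp cD.isOpen_dom
  have hOn : O₁ ∩ (eX.source ∩ eX ⁻¹' (Prod.fst ⁻¹' eD.target)) ∈ 𝓝 (ι p) := by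
    refine (hO₁.inter (eX.isOpen_inter_preimage (eD.open_target.preimage continuous_fst))).mem_nhds
      ⟨?_, (hDX p hpD).1, ?_⟩
    · change p ∈ ι ⁻¹' O₁
      rw [hO₁D]
      exact cD.mem_dom
    · rw [Set.mem_preimage, Set.mem_preimage, (hDX p hpD).2]
      exact eD.map_source hpD
  obtain ⟨cX, hcX, hcXt, hcXd⟩ :=
    CutoffChart.exists_cutoffChart (E := E) eX (hDX p hpD).1 hX1 hX2 hOn
  subst hcD hcX
  have hmemD : ∀ {q}, ι q ∈ O₁ → q ∈ cD.dom := fun {q} hq => by rw [← hO₁D]; exact hq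
  have hdomD : ∀ {q}, ι q ∈ cX.dom → q ∈ cD.dom := fun {q} hq => hmemD (hcXd hq).1
  have hcXp : cX.chart (ι p) = (cD.chart p, 0, 0) := (hDX p hpD).2
  have hball : ∀ {y : F} {a b : ℝ}, (y, a, b) ∈ ball (cX.chart (ι p)) cX.radius ↔
      dist y (cD.chart p) < cX.radius ∧ |a| < cX.radius ∧ |b| < cX.radius := by
    intro y a b
    rw [hcXp, mem_ball_triple]
  let b := Module.finBasis ℝ F
  let lx : Fin (Module.finrank ℝ F) → F →L[ℝ] ℝ := fun k => LinearMap.toContinuousLinearMap (b.coord k)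
  let lu : F × ℝ × ℝ →L[ℝ] ℝ :=
    (ContinuousLinearMap.fst ℝ ℝ ℝ).comp (ContinuousLinearMap.snd ℝ F (ℝ × ℝ))
  let lv : F × ℝ × ℝ →L[ℝ] ℝ :=
    (ContinuousLinearMap.snd ℝ ℝ ℝ).comp (ContinuousLinearMap.snd ℝ F (ℝ × ℝ))
  let lX : Fin (Module.finrank ℝ F) → F × ℝ × ℝ →L[ℝ] ℝ :=
    fun k => (lx k).comp (ContinuousLinearMap.fst ℝ F (ℝ × ℝ))
  let eu : F × ℝ × ℝ := (0, 1, 0)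
  let ev : F × ℝ × ℝ := (0, 0, 1)
  let ex : Fin (Module.finrank ℝ F) → F × ℝ × ℝ := fun k => (b k, 0, 0)
  have hlxs : ∀ y : F, ∑ k, lx k y • b k = y := fun y => b.sum_repr y
  have hlx : ∀ k l, lx l (b k) = if k = l then 1 else 0 := fun k l => by
    change b.repr (b k) l = _
    rw [b.repr_self, Finsupp.single_apply]
  have hu : ∀ {q}, q ∈ cX.dom → cX.coord lu q = (cX.chart q).2.1 := fun hq => cX.coord_apply lu hq
  have hv : ∀ {q}, q ∈ cX.dom → cX.coord lv q = (cX.chart q).2.2 := fun hq => cX.coord_apply lv hq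
  have hcomp0 : ∀ l : F × ℝ × ℝ →L[ℝ] ℝ, (∀ y, l (y, 0, 0) = 0) → (cX.coord l).comp ι = 0 := by
    intro l hl
    ext q
    change cX.bump (ι q) * l (cX.chart (ι q)) = 0
    by_cases hq : ι q ∈ tsupport cX.bump
    · rw [(hDX q (hmemD (hcXt hq).1).1).2, hl, mul_zero]
    · rw [image_eq_zero_of_notMem_tsupport hq, zero_mul]
  have hpr : ∀ {f : Smooth E X}, f.comp ι = 0 → ∀ y, (y, (0 : ℝ), (0 : ℝ)) ∈
      ball (cX.chart (ι p)) cX.radius → cX.chart.symm (y, 0, 0) ∈ Set.range ι := by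
    intro f hf y hy
    have h1 := hcXd (cX.symm_mem_dom hy)
    have h2 : y ∈ cD.chart.target := by
      have := h1.2.2
      rw [Set.mem_preimage, Set.mem_preimage, cX.chart.right_inv (cX.ball_subset hy)] at this
      exact this
    refine ⟨cD.chart.symm y, ?_⟩
    have h3 := hDX _ (cD.chart.map_target h2)
    rw [cD.chart.right_inv h2] at h3
    rw [← h3.2, cX.chart.left_inv h3.1]
  refine ⟨{
    U := cX.dom
    isOpen := cX.isOpen_dom
    mem := cX.mem_dom
    u := cX.coord lu
    v := cX.coord lv
    x := fun k => cX.coord (lX k)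
    Nu := cX.partialDeriv eu
    Nv := cX.partialDeriv ev
    Nx := fun k => cX.partialDeriv (ex k)
    Dx := fun k => cD.partialDeriv (b k)
    u_comp := hcomp0 lu fun _ => rfl
    v_comp := hcomp0 lv fun _ => rfl
    Nu_u := fun q hq => cX.partialDeriv_coord eu lu hq
    Nu_v := fun q hq => cX.partialDeriv_coord eu lv hq
    Nu_x := fun k q hq => (cX.partialDeriv_coord eu (lX k) hq).trans (map_zero (lx k))
    Nv_u := fun q hq => cX.partialDeriv_coord ev lu hq
    Nv_v := fun q hq => cX.partialDeriv_coord ev lv hq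
    Nv_x := fun k q hq => (cX.partialDeriv_coord ev (lX k) hq).trans (map_zero (lx k))
    Nx_u := fun k q hq => cX.partialDeriv_coord (ex k) lu hq
    Nx_v := fun k q hq => cX.partialDeriv_coord (ex k) lv hq
    Nx_x := fun k l q hq => (cX.partialDeriv_coord (ex k) (lX l) hq).trans (hlx k l)
    span := ?_
    vanish := ?_
    divide := ?_
    cancel := ?_
    mem_range := ?_
    Nx_comp := ?_
    span_comp := ?_
    extend := ?_ }⟩
  · intro V f q hq
    have hle : ∀ y : F × ℝ × ℝ, ∑ k : Fin (Module.finrank ℝ F) ⊕ Bool,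
        (Sum.elim lX (fun i => bif i then lu else lv) k y) •
          (Sum.elim ex (fun i => bif i then eu else ev) k) = y := by
      intro y
      rw [Fintype.sum_sum_type, Fintype.sum_bool]
      change ∑ k, lx k y.1 • ((b k, 0, 0) : F × ℝ × ℝ) + (y.2.1 • (0, 1, 0) + y.2.2 • (0, 0, 1)) = y
      refine Prod.ext ?_ (Prod.ext ?_ ?_)
      · simp [Prod.fst_sum, hlxs]
      · simp [Prod.fst_sum, Prod.snd_sum]
      · simp [Prod.snd_sum]
    have := cX.derivation_eq_sum hle V f hq
    rw [Fintype.sum_sum_type, Fintype.sum_bool, add_comm] at this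
    exact this
  · intro f hf
    -- Hadamard's lemma along the segment from the projection to `D`, where f vanishes; the
    -- displacement has only u and v components.
    let pr : F × ℝ × ℝ → F × ℝ × ℝ := fun z => (z.1, 0, 0)
    have hprs : ContDiff ℝ ∞ pr := contDiff_fst.prodMk contDiff_const
    have hg : ∀ e, ContDiff ℝ ∞ fun z => averageDeriv (cX.push f) pr z e := fun e =>
      (contDiff_averageDeriv (cX.contDiff_push f) hprs).clm_apply contDiff_const
    refine ⟨cX.pull _ (hg eu), cX.pull _ (hg ev), fun q hq => ?_⟩
    rw [hu hq, hv hq, cX.pull_apply _ hq, cX.pull_apply _ hq, ← cX.push_apply f hq,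
      eq_add_averageDeriv (cX.contDiff_push f) pr (cX.chart q)]
    set z := cX.chart q with hz
    have hzb : (z.1, z.2.1, z.2.2) ∈ ball (cX.chart (ι p)) cX.radius := hq.2
    rw [hball] at hzb
    have hpb : pr z ∈ ball (cX.chart (ι p)) cX.radius :=
      hball.mpr ⟨hzb.1, by simpa using cX.radius_pos, by simpa using cX.radius_pos⟩
    obtain ⟨q', hq'⟩ := hpr hf z.1 hpb
    have h0 : cX.push f (pr z) = 0 := by
      rw [cX.push_of_mem f hpb]
      change f (cX.chart.symm (z.1, 0, 0)) = 0
      rw [← hq']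
      exact DFunLike.congr_fun hf q'
    have h1 : z - pr z = z.2.1 • eu + z.2.2 • ev := by
      refine Prod.ext ?_ (Prod.ext ?_ ?_) <;> simp [pr, eu, ev]
    rw [h0, h1, zero_add, map_add, map_smul, map_smul, smul_eq_mul, smul_eq_mul]
  · intro f hf
    -- Now the projection is to v = 0. There f vanishes where u ≠ 0 by hypothesis, and where u = 0
    -- by continuity.
    let pr : F × ℝ × ℝ → F × ℝ × ℝ := fun z => (z.1, z.2.1, 0)
    have hprs : ContDiff ℝ ∞ pr :=
      contDiff_fst.prodMk ((contDiff_fst.comp contDiff_snd).prodMk contDiff_const)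
    have hg : ContDiff ℝ ∞ fun z => averageDeriv (cX.push f) pr z ev :=
      (contDiff_averageDeriv (cX.contDiff_push f) hprs).clm_apply contDiff_const
    refine ⟨cX.pull _ hg, fun q hq => ?_⟩
    rw [hv hq, cX.pull_apply _ hq, ← cX.push_apply f hq,
      eq_add_averageDeriv (cX.contDiff_push f) pr (cX.chart q)]
    set z := cX.chart q with hz
    have hzb : (z.1, z.2.1, z.2.2) ∈ ball (cX.chart (ι p)) cX.radius := hq.2
    rw [hball] at hzb
    have hne : ∀ t : ℝ, |t| < cX.radius → t ≠ 0 → cX.push f (z.1, t, 0) = 0 := by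
      intro t ht ht0
      have hpb : (z.1, t, (0 : ℝ)) ∈ ball (cX.chart (ι p)) cX.radius :=
        hball.mpr ⟨hzb.1, ht, by simpa using cX.radius_pos⟩
      have hd := cX.symm_mem_dom hpb
      have hr := cX.chart.right_inv (cX.ball_subset hpb)
      have h1 := hf _ hd
      rw [hu hd, hv hd, hr] at h1
      rw [cX.push_of_mem f hpb]
      exact (mul_eq_zero.mp (h1 rfl)).resolve_left ht0
    have h0 : cX.push f (pr z) = 0 := by
      by_cases hz0 : z.2.1 = 0
      · change cX.push f (z.1, z.2.1, 0) = 0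
        rw [hz0]
        refine eq_zero_of_forall_ne (h := fun t => cX.push f (z.1, t, 0)) ?_ cX.radius_pos hne
        exact (cX.contDiff_push f).continuous.comp (by fun_prop)
      · exact hne _ hzb.2.1 hz0
    have h1 : z - pr z = z.2.2 • ev := by
      refine Prod.ext ?_ (Prod.ext ?_ ?_) <;> simp [pr, ev]
    rw [h0, h1, zero_add, map_smul, smul_eq_mul]
  · intro f hf q hq
    set z := cX.chart q with hz
    have hzb : (z.1, z.2.1, z.2.2) ∈ ball (cX.chart (ι p)) cX.radius := hq.2
    rw [hball] at hzb
    have hne : ∀ t : ℝ, |t| < cX.radius → t ≠ 0 → cX.push f (z.1, z.2.1, t) = 0 := by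
      intro t ht ht0
      have hpb : (z.1, z.2.1, t) ∈ ball (cX.chart (ι p)) cX.radius :=
        hball.mpr ⟨hzb.1, hzb.2.1, ht⟩
      have hd := cX.symm_mem_dom hpb
      have h1 := hf _ hd
      rw [hv hd, cX.chart.right_inv (cX.ball_subset hpb)] at h1
      rw [cX.push_of_mem f hpb]
      exact (mul_eq_zero.mp h1).resolve_left ht0
    rw [← cX.push_apply f hq]
    change cX.push f (z.1, z.2.1, z.2.2) = 0
    by_cases hz0 : z.2.2 = 0
    · rw [hz0]
      refine eq_zero_of_forall_ne (h := fun t => cX.push f (z.1, z.2.1, t)) ?_ cX.radius_pos hne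
      exact (cX.contDiff_push f).continuous.comp (by fun_prop)
    · exact hne _ hzb.2.2 hz0
  · intro q hq h1 h2
    rw [hu hq] at h1
    rw [hv hq] at h2
    have h3 : cX.chart q = ((cX.chart q).1, 0, 0) := Prod.ext rfl (Prod.ext h1 h2)
    have h4 := hpr (f := 0) rfl (cX.chart q).1 (h3 ▸ hq.2)
    rwa [← h3, cX.chart.left_inv hq.1] at h4
  · intro k f q hq
    have hqD := hdomD hq
    rw [cX.partialDeriv_apply _ _ hq, cD.partialDeriv_apply _ _ hqD, (hDX q hqD.1).2]
    let j : F → F × ℝ × ℝ := fun y => (y, 0, 0)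
    have hj : HasFDerivAt j (ContinuousLinearMap.inl ℝ F (ℝ × ℝ)) (cD.chart q) :=
      (hasFDerivAt_id _).prodMk (hasFDerivAt_const ((0 : ℝ), (0 : ℝ)) _)
    have hF : HasFDerivAt (cX.push f) (fderiv ℝ (cX.push f) (cD.chart q, 0, 0)) (j (cD.chart q)) :=
      (((cX.contDiff_push f).differentiable (by simp)) _).hasFDerivAt
    have heq : cD.push (f.comp ι) =ᶠ[𝓝 (cD.chart q)] cX.push f ∘ j := by
      have hjc : Continuous j := by fun_prop
      have hb2 : j (cD.chart q) ∈ ball (cX.chart (ι p)) cX.radius := by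
        have := hq.2
        rw [Set.mem_preimage, (hDX q hqD.1).2] at this
        exact this
      filter_upwards [isOpen_ball.mem_nhds hqD.2,
        hjc.continuousAt.eventually (isOpen_ball.mem_nhds hb2)] with y hy hy'
      rw [cD.push_of_mem _ hy, Function.comp_apply, cX.push_of_mem _ hy']
      have h3 := hDX _ (cD.symm_mem_dom hy).1
      rw [cD.chart.right_inv (cD.ball_subset hy)] at h3
      change f (ι (cD.chart.symm y)) = f (cX.chart.symm (y, 0, 0))
      rw [← h3.2, cX.chart.left_inv h3.1]
    rw [heq.fderiv_eq, (hF.comp (cD.chart q) hj).fderiv]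
    rfl
  · intro W f q hq
    rw [cD.derivation_eq_sum hlxs W f (hdomD hq)]
    refine Finset.sum_congr rfl fun k _ => ?_
    congr 1
    refine derivation_congr W ?_
    filter_upwards [(cX.isOpen_dom.preimage ι.contMDiff.continuous).mem_nhds hq] with q' hq'
    rw [cD.coord_apply _ (hdomD hq')]
    change _ = cX.coord (lX k) (ι q')
    rw [cX.coord_apply _ hq', (hDX q' (hdomD hq').1).2]
    rfl
  · intro f
    refine ⟨cX.pull (fun z => cD.push f z.1) ((cD.contDiff_push f).comp contDiff_fst),
      fun q hq => ?_⟩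
    rw [cX.pull_apply _ hq, (hDX q (hdomD hq).1).2]
    exact cD.push_apply f (hdomD hq)

end SliceCoords

end SliceCharts

open Topology

/-! ### The normal Hessian of the divisor ideal -/

section Adapted

variable {E : Type*} [NormedAddCommGroup E] [NormedSpace ℝ E]
  {F : Type*} [NormedAddCommGroup F] [NormedSpace ℝ F]
  {X : Type*} [TopologicalSpace X] [ChartedSpace E X]
  {D : Type*} [TopologicalSpace D] [ChartedSpace F D]
  {ι : C^∞⟮𝓘(ℝ, F), D; 𝓘(ℝ, E), X⟯}

/-- Coordinates `x`, `y₁`, `y₂` of `X` on a neighbourhood `U` of `p ∈ D`, in which the ideal is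
generated by `y₁² + y₂²`, with the coordinate vector fields. -/
structure AdaptedFrame (ι : C^∞⟮𝓘(ℝ, F), D; 𝓘(ℝ, E), X⟯) (J : Ideal (Smooth E X))
    (ν : Coorientation ι) (p : D) where
  U : Set X
  isOpen : IsOpen U
  mem : ι p ∈ U
  y₁ : Smooth E X
  y₂ : Smooth E X
  x : Fin (Module.finrank ℝ F) → Smooth E X
  N₁ : VField E X
  N₂ : VField E X
  Nx : Fin (Module.finrank ℝ F) → VField E X
  Dx : Fin (Module.finrank ℝ F) → VField F D
  y₁_comp : y₁.comp ι = 0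
  y₂_comp : y₂.comp ι = 0
  N₁_y₁ : ∀ q ∈ U, N₁ y₁ q = 1
  N₁_y₂ : ∀ q ∈ U, N₁ y₂ q = 0
  N₁_x : ∀ k, ∀ q ∈ U, N₁ (x k) q = 0
  N₂_y₁ : ∀ q ∈ U, N₂ y₁ q = 0
  N₂_y₂ : ∀ q ∈ U, N₂ y₂ q = 1
  N₂_x : ∀ k, ∀ q ∈ U, N₂ (x k) q = 0
  Nx_y₁ : ∀ k, ∀ q ∈ U, Nx k y₁ q = 0
  Nx_y₂ : ∀ k, ∀ q ∈ U, Nx k y₂ q = 0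
  Nx_x : ∀ k l, ∀ q ∈ U, Nx k (x l) q = if k = l then 1 else 0
  span : ∀ (V : VField E X) (f : Smooth E X), ∀ q ∈ U,
    V f q = V y₁ q * N₁ f q + V y₂ q * N₂ f q + ∑ k, V (x k) q * Nx k f q
  vanish : ∀ f : Smooth E X, f.comp ι = 0 →
    ∃ f₁ f₂ : Smooth E X, ∀ q ∈ U, f q = y₁ q * f₁ q + y₂ q * f₂ q
  divide : ∀ f₁ f₂ : Smooth E X, (∀ q, y₁ q * f₁ q + y₂ q * f₂ q = 0) →
    ∃ b : Smooth E X, ∀ q ∈ U, f₁ q = -(b q * y₂ q) ∧ f₂ q = b q * y₁ q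
  cancel : ∀ f : Smooth E X, (∀ q, f q * (y₁ q ^ 2 + y₂ q ^ 2) = 0) → ∀ q ∈ U, f q = 0
  ideal_eq : ∀ f ∈ J, ∃ h : Smooth E X, ∀ q ∈ U, f q = h q * (y₁ q ^ 2 + y₂ q ^ 2)
  ideal_mem : ∃ g ∈ J, ∀ q ∈ U, g q = y₁ q ^ 2 + y₂ q ^ 2
  pos : ∀ q ∈ U, 0 < ν.form ![N₁, N₂] q
  Nx_comp : ∀ k (f : Smooth E X) (q : D), ι q ∈ U → Nx k f (ι q) = Dx k (f.comp ι) q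
  span_comp : ∀ (W : VField F D) (f : Smooth F D) (q : D), ι q ∈ U →
    W f q = ∑ k, W ((x k).comp ι) q * Dx k f q
  extend : ∀ f : Smooth F D, ∃ g : Smooth E X, ∀ q, ι q ∈ U → g (ι q) = f q

/-- At a common zero of u and w only the terms differentiating each of them exactly once survive. -/
theorem hessian_mul (V : VField E X) (u w h : Smooth E X) {q : X} (hu : u q = 0) (hw : w q = 0) :
    V (V (u * (w * h))) q = 2 * h q * V u q * V w q := by
  have h1 : V (u * (w * h)) = u * (w * V h + h * V w) + (w * h) * V u := by
    rw [V.leibniz, V.leibniz]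
    rfl
  rw [h1, map_add, smooth_add_apply, derivation_mul_apply, derivation_mul_apply,
    derivation_mul_apply, smooth_add_apply, smooth_mul_apply, smooth_mul_apply, smooth_mul_apply,
    hu, hw]
  ring

variable [FiniteDimensional ℝ E] [T2Space X] [IsManifold 𝓘(ℝ, E) ∞ X]

theorem SliceCoords.isTangentAt {p : D} (S : SliceCoords ι p) {q : D} (hq : ι q ∈ S.U)
    {V : VField E X} (hu : V S.u (ι q) = 0) (hv : V S.v (ι q) = 0) : IsTangentAt ι V q := by
  intro f hf
  obtain ⟨f₁, f₂, h⟩ := S.vanish f hf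
  have h1 : ∀ᶠ x in 𝓝 (ι q), f x = (S.u * f₁ + S.v * f₂) x := by
    filter_upwards [S.isOpen.mem_nhds hq] with x hx using h x hx
  have h2 : S.u (ι q) = 0 := DFunLike.congr_fun S.u_comp q
  have h3 : S.v (ι q) = 0 := DFunLike.congr_fun S.v_comp q
  rw [derivation_congr V h1, map_add, smooth_add_apply, derivation_mul_apply,
    derivation_mul_apply, hu, hv, h2, h3]
  ring

theorem Coorientation.form_swap (ν : Coorientation ι) (V W : VField E X) :
    ν.form ![V, W] = -ν.form ![W, V] := by
  have h := ν.form.map_swap ![W, V] (i := 0) (j := 1) (by decide)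
  rw [← h]
  congr 1
  funext i
  fin_cases i <;> rfl

theorem Coorientation.form_apply (ν : Coorientation ι) (q : X) (f₁ f₂ g₁ g₂ : Smooth E X)
    (N₁ N₂ : VField E X) :
    ν.form ![f₁ • N₁ + f₂ • N₂, g₁ • N₁ + g₂ • N₂] q =
      (f₁ q * g₂ q - f₂ q * g₁ q) * ν.form ![N₁, N₂] q := by
  have hadd : ∀ V V' W : VField E X, ν.form ![V + V', W] = ν.form ![V, W] + ν.form ![V', W] :=
    fun V V' W => ν.form.map_vecCons_add _ _ _
  have hsm : ∀ (f : Smooth E X) (V W : VField E X), ν.form ![f • V, W] = f • ν.form ![V, W] :=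
    fun f V W => ν.form.map_vecCons_smul _ _ _
  have hself : ∀ V : VField E X, ν.form ![V, V] = 0 := fun V =>
    ν.form.map_eq_zero_of_eq _ (i := 0) (j := 1) rfl (by decide)
  have h1 : ν.form ![f₁ • N₁ + f₂ • N₂, g₁ • N₁ + g₂ • N₂] =
      (f₁ * g₂ - f₂ * g₁) * ν.form ![N₁, N₂] := by
    rw [hadd, hsm, hsm, ν.form_swap N₁, hadd, ν.form_swap N₂, hadd, hsm, hsm, hsm, hsm, hself, hself,
      ν.form_swap N₂ N₁]
    simp only [smul_eq_mul]
    ring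
  rw [h1]
  rfl

/-- Modulo fields tangent at the point, every vector field is a combination of `Nu` and `Nv`; if the
coorientation vanished on this pair it would vanish identically at the point. -/
theorem SliceCoords.form_ne_zero {p : D} (S : SliceCoords ι p) (ν : Coorientation ι) :
    ν.form ![S.Nu, S.Nv] (ι p) ≠ 0 := by
  intro h0
  obtain ⟨V, W, hVW⟩ := ν.nonvanishing p
  have hz : ∀ V : VField E X, ∃ Z, IsTangentAt ι Z p ∧ V = (V S.u • S.Nu + V S.v • S.Nv) + Z := by
    intro V
    refine ⟨V - (V S.u • S.Nu + V S.v • S.Nv), S.isTangentAt S.mem ?_ ?_, by abel⟩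
    · change V S.u (ι p) - (V S.u (ι p) * S.Nu S.u (ι p) + V S.v (ι p) * S.Nv S.u (ι p)) = 0
      rw [S.Nu_u _ S.mem, S.Nv_u _ S.mem]
      ring
    · change V S.v (ι p) - (V S.u (ι p) * S.Nu S.v (ι p) + V S.v (ι p) * S.Nv S.v (ι p)) = 0
      rw [S.Nu_v _ S.mem, S.Nv_v _ S.mem]
      ring
  obtain ⟨Z, hZ, hV⟩ := hz V
  obtain ⟨Z', hZ', hW⟩ := hz W
  apply hVW
  have hadd : ∀ V V' W : VField E X, ν.form ![V + V', W] = ν.form ![V, W] + ν.form ![V', W] :=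
    fun V V' W => ν.form.map_vecCons_add _ _ _
  rw [hV, hadd, smooth_add_apply, ν.conormal _ _ _ hZ, hW, ν.form_swap, hadd, smooth_neg_apply,
    smooth_add_apply, ν.conormal _ _ _ hZ', ν.form_apply, h0]
  ring

/-- The normal Hessian of a generator of an elliptic ideal is positive definite. -/
theorem SliceCoords.exists_quadratic {p : D} (S : SliceCoords ι p) {J : Ideal (Smooth E X)}
    (hJ : IsEllipticIdeal ι J) : ∃ g ∈ J, ∃ g₁₁ g₁₂ g₂₂ : Smooth E X,
      (∀ᶠ x in 𝓝 (ι p), g x = S.u x ^ 2 * g₁₁ x + 2 * (S.u x * S.v x * g₁₂ x) + S.v x ^ 2 * g₂₂ x) ∧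
      (∃ U ∈ 𝓝 (ι p), ∀ f ∈ J, ∃ h : Smooth E X, ∀ x ∈ U, f x = h x * g x) ∧
      0 < g₁₁ (ι p) ∧ 0 < g₁₁ (ι p) * g₂₂ (ι p) - g₁₂ (ι p) ^ 2 := by
  obtain ⟨U, hU, hpU, g, hg, hgen, hess⟩ := hJ.generator p
  have hgι : g.comp ι = 0 := by
    ext q
    have : ι q ∈ {x : X | ∀ f ∈ J, f x = 0} := by
      rw [hJ.zeroLocus]
      exact ⟨q, rfl⟩
    exact this g hg
  have hu0 : ∀ q, S.u (ι q) = 0 := DFunLike.congr_fun S.u_comp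
  have hv0 : ∀ q, S.v (ι q) = 0 := DFunLike.congr_fun S.v_comp
  obtain ⟨f₁, f₂, hf⟩ := S.vanish g hgι
  have hO : U ∩ S.U ∈ 𝓝 (ι p) := (hU.inter S.isOpen).mem_nhds ⟨hpU, S.mem⟩
  obtain ⟨χ, hχ1, hχ⟩ := exists_bump (E := E) hO
  -- As `D` is critical for g, the first-order coefficients f₁ and f₂ vanish along `D`, so after a
  -- cutoff they can be expanded once more in u and v.
  have hd : ∀ (V : VField E X) (q : D), ι q ∈ U ∩ S.U →
      V S.u (ι q) * f₁ (ι q) + V S.v (ι q) * f₂ (ι q) = 0 := by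
    intro V q hq
    have h1 : ∀ᶠ x in 𝓝 (ι q), g x = (S.u * f₁ + S.v * f₂) x := by
      filter_upwards [S.isOpen.mem_nhds hq.2] with x hx using hf x hx
    have h2 := (hess q hq.1 V).1
    rw [derivation_congr V h1, map_add, smooth_add_apply, derivation_mul_apply,
      derivation_mul_apply, hu0, hv0] at h2
    linarith
  have hχf : ∀ f : Smooth E X, (∀ q, ι q ∈ U ∩ S.U → f (ι q) = 0) → (χ * f).comp ι = 0 := by
    intro f h
    ext q
    change χ (ι q) * f (ι q) = 0
    by_cases hq : ι q ∈ tsupport χ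
    · rw [h q (hχ hq), mul_zero]
    · rw [image_eq_zero_of_notMem_tsupport hq, zero_mul]
  obtain ⟨a₁, a₂, ha⟩ := S.vanish _ (hχf f₁ fun q hq => by
    have := hd S.Nu q hq
    rwa [S.Nu_u _ hq.2, S.Nu_v _ hq.2, one_mul, zero_mul, add_zero] at this)
  obtain ⟨b₁, b₂, hb⟩ := S.vanish _ (hχf f₂ fun q hq => by
    have := hd S.Nv q hq
    rwa [S.Nv_u _ hq.2, S.Nv_v _ hq.2, one_mul, zero_mul, zero_add] at this)
  have hgq : ∀ᶠ x in 𝓝 (ι p), g x = S.u x ^ 2 * a₁ x +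
      2 * (S.u x * S.v x * ((2⁻¹ : ℝ) • (a₂ + b₁)) x) + S.v x ^ 2 * b₂ x := by
    filter_upwards [hχ1, S.isOpen.mem_nhds S.mem] with x hx hxU
    have h1 := ha x hxU
    have h2 := hb x hxU
    rw [smooth_mul_apply, hx, one_mul] at h1 h2
    rw [hf x hxU, h1, h2, smooth_real_smul_apply, smooth_add_apply]
    ring
  refine ⟨g, hg, a₁, (2⁻¹ : ℝ) • (a₂ + b₁), b₂, hgq, ⟨U, hU.mem_nhds hpU, hgen⟩, ?_⟩
  set m := (2⁻¹ : ℝ) • (a₂ + b₁) with hm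
  have hform : ∀ V : VField E X, V (V g) (ι p) = 2 * (a₁ (ι p) * V S.u (ι p) ^ 2 +
      2 * (m (ι p) * V S.u (ι p) * V S.v (ι p)) + b₂ (ι p) * V S.v (ι p) ^ 2) := by
    intro V
    have h1 : ∀ᶠ x in 𝓝 (ι p), g x = (S.u * (S.u * a₁) + (S.u * (S.v * m) + S.u * (S.v * m)) +
        S.v * (S.v * b₂)) x := by
      filter_upwards [hgq] with x hx
      rw [hx]
      simp only [smooth_add_apply, smooth_mul_apply]
      ring
    have h2 := h1.eventually_nhds.mono fun x hx => derivation_congr V hx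
    rw [derivation_congr V h2]
    simp only [map_add, smooth_add_apply]
    rw [hessian_mul V _ _ _ (hu0 p) (hu0 p), hessian_mul V _ _ _ (hu0 p) (hv0 p),
      hessian_mul V _ _ _ (hv0 p) (hv0 p)]
    ring
  have hpos : ∀ α β : ℝ, (α ≠ 0 ∨ β ≠ 0) →
      0 < a₁ (ι p) * α ^ 2 + 2 * (m (ι p) * α * β) + b₂ (ι p) * β ^ 2 := by
    intro α β hαβ
    let V : VField E X := α • S.Nu + β • S.Nv
    have hVu : V S.u (ι p) = α := by
      change α * S.Nu S.u (ι p) + β * S.Nv S.u (ι p) = α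
      rw [S.Nu_u _ S.mem, S.Nv_u _ S.mem]
      ring
    have hVv : V S.v (ι p) = β := by
      change α * S.Nu S.v (ι p) + β * S.Nv S.v (ι p) = β
      rw [S.Nu_v _ S.mem, S.Nv_v _ S.mem]
      ring
    rcases (hess p hpU V).2 with h | h
    · have h1 := h S.u S.u_comp
      have h2 := h S.v S.v_comp
      rw [hVu] at h1
      rw [hVv] at h2
      exact absurd hαβ (by simp [h1, h2])
    · rw [hform, hVu, hVv] at h
      linarith
  have ha0 : 0 < a₁ (ι p) := by
    have := hpos 1 0 (Or.inl one_ne_zero)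
    linarith
  refine ⟨ha0, ?_⟩
  -- In the direction (−m, a₁) the quadratic form takes the value a₁ (a₁ b₂ − m²).
  have := hpos (-m (ι p)) (a₁ (ι p)) (Or.inr ha0.ne')
  have h2 : 0 < a₁ (ι p) * (a₁ (ι p) * b₂ (ι p) - m (ι p) ^ 2) := by nlinarith
  exact (mul_pos_iff_of_pos_left ha0).mp h2

end Adapted

/-! ### Morse-Bott normal form with a prescribed orientation -/

section AdaptedExists

variable {E : Type*} [NormedAddCommGroup E] [NormedSpace ℝ E]
  {F : Type*} [NormedAddCommGroup F] [NormedSpace ℝ F]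
  {X : Type*} [TopologicalSpace X] [ChartedSpace E X]
  {D : Type*} [TopologicalSpace D] [ChartedSpace F D]
  {ι : C^∞⟮𝓘(ℝ, F), D; 𝓘(ℝ, E), X⟯}
  [FiniteDimensional ℝ E] [T2Space X] [IsManifold 𝓘(ℝ, E) ∞ X]

/-- Completing the square in a quadratic form, with a prescribed sign for the last coefficient. -/
theorem exists_complete_square {p : X} {a m b : Smooth E X} (ha : 0 < a p)
    (hd : 0 < a p * b p - m p ^ 2) {c : ℝ} (hc : c ≠ 0) :
    ∃ s₁ t₁ s₂ t₂ : Smooth E X, 0 < s₁ p ∧ 0 < s₂ p * c ∧ ∀ᶠ x in 𝓝 p,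
      s₁ x * t₁ x = 1 ∧ s₂ x * t₂ x = 1 ∧ s₁ x ^ 2 = a x ∧
      (m x * t₁ x) ^ 2 + s₂ x ^ 2 = b x := by
  obtain ⟨s₁, hs₁⟩ := exists_smooth_sqrt (E := E) a ha
  obtain ⟨t₁, ht₁⟩ := exists_smooth_inv (E := E) s₁ hs₁.self_of_nhds.2.ne'
  have h1 := hs₁.self_of_nhds
  have h2 := ht₁.self_of_nhds
  have hd' : 0 < (b - m * t₁ * (m * t₁)) p := by
    change 0 < b p - m p * t₁ p * (m p * t₁ p)
    have h3 : a p * (t₁ p * t₁ p) = 1 := by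
      rw [← h1.1]
      linear_combination (t₁ p * s₁ p + 1) * h2
    have h4 : 0 < t₁ p * t₁ p := by
      by_contra h
      nlinarith [mul_nonneg ha.le (mul_self_nonneg (t₁ p)), mul_self_nonneg (t₁ p)]
    have h5 : b p - m p * t₁ p * (m p * t₁ p) = (a p * b p - m p ^ 2) * (t₁ p * t₁ p) := by
      linear_combination -(b p) * h3
    rw [h5]
    exact mul_pos hd h4
  obtain ⟨s, hs⟩ := exists_smooth_sqrt (E := E) _ hd'
  -- The square root s₂ is only determined up to sign; σ = ±1 is chosen so that the new frame is
  -- positive for the coorientation.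
  have key : ∀ σ : ℝ, σ * σ = 1 → 0 < σ * c → ∃ s₁ t₁ s₂ t₂ : Smooth E X, 0 < s₁ p ∧
      0 < s₂ p * c ∧ ∀ᶠ x in 𝓝 p, s₁ x * t₁ x = 1 ∧ s₂ x * t₂ x = 1 ∧ s₁ x ^ 2 = a x ∧
      (m x * t₁ x) ^ 2 + s₂ x ^ 2 = b x := by
    intro σ hσ hσc
    have hpos : 0 < (σ • s) p * c := by
      rw [smooth_real_smul_apply]
      nlinarith [hs.self_of_nhds.2]
    obtain ⟨t₂, ht₂⟩ := exists_smooth_inv (E := E) (p := p) (σ • s) (by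
      intro h
      rw [h, zero_mul] at hpos
      exact lt_irrefl _ hpos)
    refine ⟨s₁, t₁, σ • s, t₂, h1.2, hpos, ?_⟩
    filter_upwards [hs₁, ht₁, hs, ht₂] with x e₁ e₂ e₃ e₄
    refine ⟨by rw [mul_comm, e₂], by rw [mul_comm, e₄], by rw [sq, e₁.1], ?_⟩
    have e₅ : s x * s x = b x - m x * t₁ x * (m x * t₁ x) := e₃.1
    rw [smooth_real_smul_apply]
    linear_combination e₅ + (s x) ^ 2 * hσ
  rcases lt_or_gt_of_ne hc with h | h
  · exact key (-1) (by norm_num) (by linarith)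
  · exact key 1 (by norm_num) (by linarith)

/-- Completing the square: with y₁ = s₁ u + (m/s₁) v and y₂ = s₂ v the generator of the ideal
becomes y₁² + y₂². The coordinate fields are then corrected to be dual to y₁, y₂ and x. -/
theorem exists_adaptedFrame {p : D} (S : SliceCoords ι p) {J : Ideal (Smooth E X)}
    (hJ : IsEllipticIdeal ι J) (ν : Coorientation ι) : Nonempty (AdaptedFrame ι J ν p) := by
  obtain ⟨g, hg, a, m, b, hgq, ⟨U₁, hU₁, hgen⟩, ha, hd⟩ := S.exists_quadratic hJ
  obtain ⟨s₁, t₁, s₂, t₂, hs₁, hs₂, hst⟩ := exists_complete_square ha hd (S.form_ne_zero ν)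
  have hu0 : ∀ q, S.u (ι q) = 0 := DFunLike.congr_fun S.u_comp
  have hv0 : ∀ q, S.v (ι q) = 0 := DFunLike.congr_fun S.v_comp
  let y₁ : Smooth E X := s₁ * S.u + m * t₁ * S.v
  let y₂ : Smooth E X := s₂ * S.v
  have hy₁0 : ∀ q, y₁ (ι q) = 0 := fun q => by
    change s₁ _ * S.u _ + m _ * t₁ _ * S.v _ = 0
    rw [hu0, hv0]
    ring
  have hy₂0 : ∀ q, y₂ (ι q) = 0 := fun q => by
    change s₂ _ * S.v _ = 0
    rw [hv0]
    ring
  -- The Jacobian determinant of (y₁, y₂) with respect to (u, v); `N₁` and `N₂` below come from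
  -- Cramer's rule.
  let Δ : Smooth E X := S.Nu y₁ * S.Nv y₂ - S.Nu y₂ * S.Nv y₁
  have hΔp : Δ (ι p) = s₁ (ι p) * s₂ (ι p) := by
    change S.Nu (s₁ * S.u + m * t₁ * S.v) _ * S.Nv (s₂ * S.v) _ -
      S.Nu (s₂ * S.v) _ * S.Nv (s₁ * S.u + m * t₁ * S.v) _ = _
    simp only [map_add, smooth_add_apply, derivation_mul_apply, hu0, hv0, S.Nu_u _ S.mem,
      S.Nu_v _ S.mem, S.Nv_u _ S.mem, S.Nv_v _ S.mem]
    ring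
  have hΔ0 : Δ (ι p) ≠ 0 := by
    rw [hΔp]
    refine mul_ne_zero hs₁.ne' fun h => ?_
    rw [h, zero_mul] at hs₂
    exact lt_irrefl _ hs₂
  obtain ⟨δ, hδ⟩ := exists_smooth_inv (E := E) Δ hΔ0
  let N₁ : VField E X := (δ * S.Nv y₂) • S.Nu + (-(δ * S.Nu y₂)) • S.Nv
  let N₂ : VField E X := (-(δ * S.Nv y₁)) • S.Nu + (δ * S.Nu y₁) • S.Nv
  have hN₁ : ∀ f q, N₁ f q = δ q * (S.Nv y₂ q * S.Nu f q - S.Nu y₂ q * S.Nv f q) := fun f q => by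
    change δ q * S.Nv y₂ q * S.Nu f q + -(δ q * S.Nu y₂ q) * S.Nv f q = _
    ring
  have hN₂ : ∀ f q, N₂ f q = δ q * (S.Nu y₁ q * S.Nv f q - S.Nv y₁ q * S.Nu f q) := fun f q => by
    change -(δ q * S.Nv y₁ q) * S.Nu f q + δ q * S.Nu y₁ q * S.Nv f q = _
    ring
  let Nx : Fin (Module.finrank ℝ F) → VField E X :=
    fun k => S.Nx k - S.Nx k y₁ • N₁ - S.Nx k y₂ • N₂
  have hNx : ∀ k f q, Nx k f q = S.Nx k f q - S.Nx k y₁ q * N₁ f q - S.Nx k y₂ q * N₂ f q :=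
    fun k f q => rfl
  have hform : ∀ᶠ q in 𝓝 (ι p), δ q * Δ q = 1 → 0 < ν.form ![N₁, N₂] q := by
    have hval : ∀ q, ν.form ![N₁, N₂] q = δ q * (δ q * Δ q) * ν.form ![S.Nu, S.Nv] q := by
      intro q
      rw [ν.form_apply]
      simp only [smooth_mul_apply, smooth_neg_apply, smooth_sub_apply, Δ]
      ring
    have hp : 0 < ν.form ![N₁, N₂] (ι p) := by
      rw [hval, hδ.self_of_nhds, mul_one]
      have h1 := hδ.self_of_nhds
      rw [hΔp] at h1
      set w := ν.form ![S.Nu, S.Nv] (ι p)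
      have h3 : 0 < s₁ (ι p) * (s₂ (ι p) * w) := mul_pos hs₁ hs₂
      have h2 : (δ (ι p) * w) * (s₁ (ι p) * s₂ (ι p)) ^ 2 = s₁ (ι p) * (s₂ (ι p) * w) := by
        linear_combination (s₁ (ι p) * s₂ (ι p) * w) * h1
      rw [← h2] at h3
      exact pos_of_mul_pos_left h3 (sq_nonneg _)
    filter_upwards [(ν.form ![N₁, N₂]).contMDiff.continuous.continuousAt.eventually_const_lt hp]
      with q hq _ using hq
  have hevS : ∀ᶠ q in 𝓝 (ι p), q ∈ S.U := S.isOpen.mem_nhds S.mem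
  have hevU : ∀ᶠ q in 𝓝 (ι p), q ∈ U₁ := hU₁
  obtain ⟨O, hO, hOo, hOp⟩ := eventually_nhds_iff.mp
    (hgq.and (hst.and (hδ.and (hform.and (hevS.and hevU)))))
  -- The identities hold on O. Multiplying by χ, supported in O and equal to one on U, extends them
  -- to the whole slice domain, as required by `S.divide` and `S.cancel`.
  obtain ⟨χ, hχ1, hχ⟩ := exists_bump (E := E) (hOo.mem_nhds hOp)
  obtain ⟨U, hU, hUo, hUp⟩ := eventually_nhds_iff.mp (hχ1.and
    (hOo.eventually_mem hOp))
  have hUS : ∀ q ∈ U, q ∈ S.U := fun q hq => (hO q (hU q hq).2).2.2.2.2.1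
  have hχ0 : ∀ q, q ∉ O → χ q = 0 := fun q hq =>
    image_eq_zero_of_notMem_tsupport fun h => hq (hχ h)
  have hδΔ : ∀ q ∈ O, δ q * (S.Nu y₁ q * S.Nv y₂ q - S.Nu y₂ q * S.Nv y₁ q) = 1 :=
    fun q hq => (hO q hq).2.2.1
  have hy₁ : ∀ q, y₁ q = s₁ q * S.u q + m q * t₁ q * S.v q := fun q => rfl
  have hy₂ : ∀ q, y₂ q = s₂ q * S.v q := fun q => rfl
  have hv : ∀ q ∈ O, S.v q = t₂ q * y₂ q := fun q hq => by
    rw [hy₂]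
    linear_combination -(S.v q) * (hO q hq).2.1.2.1
  have hu : ∀ q ∈ O, S.u q = t₁ q * y₁ q - m q * t₁ q * t₁ q * (t₂ q * y₂ q) := fun q hq => by
    rw [← hv q hq, hy₁]
    linear_combination -(S.u q) * (hO q hq).2.1.1
  have hgy : ∀ q ∈ O, g q = y₁ q ^ 2 + y₂ q ^ 2 := fun q hq => by
    obtain ⟨h1, ⟨h2, h3, h4, h5⟩, -⟩ := hO q hq
    rw [h1, hy₁, hy₂, ← h4, ← h5]
    linear_combination -2 * S.u q * S.v q * m q * h2
  have hN₁y₁ : ∀ q ∈ O, N₁ y₁ q = 1 := fun q hq => by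
    rw [hN₁]; linear_combination hδΔ q hq
  have hN₁y₂ : ∀ q, N₁ y₂ q = 0 := fun q => by rw [hN₁]; ring
  have hN₂y₁ : ∀ q, N₂ y₁ q = 0 := fun q => by rw [hN₂]; ring
  have hN₂y₂ : ∀ q ∈ O, N₂ y₂ q = 1 := fun q hq => by
    rw [hN₂]; linear_combination hδΔ q hq
  have hN₁x : ∀ k, ∀ q ∈ U, N₁ (S.x k) q = 0 := fun k q hq => by
    rw [hN₁, S.Nu_x k q (hUS q hq), S.Nv_x k q (hUS q hq)]; ring
  have hN₂x : ∀ k, ∀ q ∈ U, N₂ (S.x k) q = 0 := fun k q hq => by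
    rw [hN₂, S.Nu_x k q (hUS q hq), S.Nv_x k q (hUS q hq)]; ring
  refine ⟨{
    U := U
    isOpen := hUo
    mem := hUp
    y₁ := y₁
    y₂ := y₂
    x := S.x
    N₁ := N₁
    N₂ := N₂
    Nx := Nx
    Dx := S.Dx
    y₁_comp := ContMDiffMap.ext hy₁0
    y₂_comp := ContMDiffMap.ext hy₂0
    N₁_y₁ := fun q hq => hN₁y₁ q (hU q hq).2
    N₁_y₂ := fun q _ => hN₁y₂ q
    N₁_x := hN₁x
    N₂_y₁ := fun q _ => hN₂y₁ q
    N₂_y₂ := fun q hq => hN₂y₂ q (hU q hq).2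
    N₂_x := hN₂x
    Nx_y₁ := fun k q hq => by rw [hNx, hN₁y₁ q (hU q hq).2, hN₂y₁]; ring
    Nx_y₂ := fun k q hq => by rw [hNx, hN₁y₂, hN₂y₂ q (hU q hq).2]; ring
    Nx_x := fun k l q hq => by
      rw [hNx, hN₁x l q hq, hN₂x l q hq, S.Nx_x k l q (hUS q hq)]; ring
    span := ?_
    vanish := ?_
    divide := ?_
    cancel := ?_
    ideal_eq := ?_
    ideal_mem := ⟨g, hg, fun q hq => hgy q (hU q hq).2⟩
    pos := fun q hq => (hO q (hU q hq).2).2.2.2.1 (hO q (hU q hq).2).2.2.1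
    Nx_comp := ?_
    span_comp := fun W f q hq => S.span_comp W f q (hUS _ hq)
    extend := fun f => (S.extend f).imp fun g hg q hq => hg q (hUS _ hq) }⟩
  · intro V f q hq
    have hqS := hUS q hq
    simp only [hNx, mul_sub, Finset.sum_sub_distrib, ← mul_assoc, ← Finset.sum_mul]
    rw [S.span V f q hqS, S.span V y₁ q hqS, S.span V y₂ q hqS, hN₁, hN₂]
    linear_combination -(V S.u q * S.Nu f q + V S.v q * S.Nv f q) * hδΔ q (hU q hq).2
  · intro f hf
    obtain ⟨f₁, f₂, h⟩ := S.vanish f hf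
    refine ⟨t₁ * f₁, t₂ * f₂ - m * t₁ * t₁ * t₂ * f₁, fun q hq => ?_⟩
    rw [h q (hUS q hq), hv q (hU q hq).2, hu q (hU q hq).2]
    simp only [smooth_mul_apply, smooth_sub_apply]
    ring
  · intro f₁ f₂ h
    -- Where v = 0 one has y₂ = 0 and y₁ = s₁ u, so the relation reduces to u f₁ = 0; hence f₁ is
    -- divisible by v.
    obtain ⟨f', hf'⟩ := S.divide (χ * f₁) (by
      intro q hq hvq
      rw [smooth_mul_apply]
      by_cases hqO : q ∈ O
      · have h1 := h q
        rw [hy₁, hy₂, hvq] at h1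
        have h2 : S.u q * f₁ q = 0 := by
          linear_combination t₁ q * h1 - S.u q * f₁ q * (hO q hqO).2.1.1
        linear_combination χ q * h2
      · rw [hχ0 q hqO]; ring)
    refine ⟨-(t₂ * f'), fun q hq => ?_⟩
    have h0 := S.cancel (χ * (χ * f₂ + t₂ * f' * y₁)) (by
      intro q hq
      simp only [smooth_mul_apply, smooth_add_apply]
      by_cases hqO : q ∈ O
      · have h1 := h q
        have h2 : χ q * f₁ q = S.v q * f' q := hf' q hq
        have h3 : y₂ q * (χ q * f₂ q + t₂ q * f' q * y₁ q) = 0 := by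
          linear_combination χ q * h1 - y₁ q * h2 - y₁ q * f' q * hv q hqO
        rw [hv q hqO]
        linear_combination χ q * t₂ q * h3
      · rw [hχ0 q hqO]; ring) q (hUS q hq)
    have h1 := hf' q (hUS q hq)
    simp only [smooth_mul_apply, smooth_add_apply, (hU q hq).1, one_mul] at h0 h1
    rw [hv q (hU q hq).2] at h1
    simp only [smooth_mul_apply, smooth_neg_apply]
    exact ⟨by rw [h1]; ring, by linear_combination h0⟩
  · intro f h q hq
    have h0 := S.cancel (χ * f) (by
      intro q hq
      rw [smooth_mul_apply]
      by_cases hqO : q ∈ O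
      · rcases mul_eq_zero.mp (h q) with h1 | h1
        · rw [h1]; ring
        · have h2 : y₂ q = 0 := by nlinarith [sq_nonneg (y₁ q), sq_nonneg (y₂ q)]
          rw [hv q hqO, h2]; ring
      · rw [hχ0 q hqO]; ring) q (hUS q hq)
    rwa [smooth_mul_apply, (hU q hq).1, one_mul] at h0
  · intro f hf
    obtain ⟨h, hh⟩ := hgen f hf
    exact ⟨h, fun q hq => by rw [hh q (hO q (hU q hq).2).2.2.2.2.2, hgy q (hU q hq).2]⟩
  · intro k f q hq
    have h0 : ∀ y : Smooth E X, (∀ q, y (ι q) = 0) → S.Nx k y (ι q) = 0 := fun y hy => by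
      rw [S.Nx_comp k y q (hUS _ hq), show y.comp ι = 0 from ContMDiffMap.ext hy, map_zero]
      rfl
    rw [hNx, h0 y₁ hy₁0, h0 y₂ hy₂0, S.Nx_comp k f q (hUS _ hq)]
    ring

end AdaptedExists

/-! ### Sections of the elliptic tangent bundle -/

section Sections

variable {E : Type*} [NormedAddCommGroup E] [NormedSpace ℝ E]
  {X : Type*} [TopologicalSpace X] [ChartedSpace E X] {J : Ideal (Smooth E X)}

theorem asec_add_apply (V W : ASec J) (f : Smooth E X) (q : X) :
    (V + W).1 f q = V.1 f q + W.1 f q := rfl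

theorem asec_sub_apply (V W : ASec J) (f : Smooth E X) (q : X) :
    (V - W).1 f q = V.1 f q - W.1 f q := rfl

theorem asec_smul_apply (h : Smooth E X) (V : ASec J) (f : Smooth E X) (q : X) :
    (h • V).1 f q = h q * V.1 f q := rfl

theorem asec_sum_apply {κ : Type*} (s : Finset κ) (V : κ → ASec J) (f : Smooth E X) (q : X) :
    (∑ k ∈ s, V k).1 f q = ∑ k ∈ s, (V k).1 f q := by
  let ev : ASec J →+ ℝ :=
    { toFun := fun V => V.1 f q, map_zero' := rfl, map_add' := fun _ _ => rfl }
  exact map_sum ev V s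

theorem asec_lie_apply (V W : ASec J) (f : Smooth E X) (q : X) :
    ⁅V, W⁆.1 f q = V.1 (W.1 f) q - W.1 (V.1 f) q := derivation_lie_apply V.1 W.1 f q

theorem asec_lie_smooth (V : ASec J) (f : Smooth E X) : ⁅V, f⁆ = V.1 f := rfl

theorem asec_ext {V W : ASec J} (h : ∀ f q, V.1 f q = W.1 f q) : V = W :=
  Subtype.ext (Derivation.ext fun f => ContMDiffMap.ext fun q => h f q)

variable [FiniteDimensional ℝ E] [T2Space X] [IsManifold 𝓘(ℝ, E) ∞ X]

/-- Functionals which depend only on the germ at `q`. -/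
theorem germ_congr {q : X} (l : ASec J →+ ℝ) (hl : ∀ (f : Smooth E X) V, l (f • V) = f q * l V)
    {V W : ASec J} (h : ∀ᶠ x in 𝓝 q, ∀ f, V.1 f x = W.1 f x) : l V = l W := by
  obtain ⟨χ, h1, h2⟩ := exists_bump (E := E) h
  have h3 : χ • V = χ • W := asec_ext fun f x => by
    rw [asec_smul_apply, asec_smul_apply]
    by_cases hx : x ∈ tsupport χ
    · rw [h2 hx]
    · rw [image_eq_zero_of_notMem_tsupport hx, zero_mul, zero_mul]
  have h4 := hl χ V
  rw [h3, hl, h1.self_of_nhds, one_mul, one_mul] at h4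
  exact h4.symm

end Sections

/-! ### The local frame and the dual forms d log r and dθ -/

namespace AdaptedFrame

variable {E : Type*} [NormedAddCommGroup E] [NormedSpace ℝ E]
  {F : Type*} [NormedAddCommGroup F] [NormedSpace ℝ F]
  {X : Type*} [TopologicalSpace X] [ChartedSpace E X]
  {D : Type*} [TopologicalSpace D] [ChartedSpace F D]
  {ι : C^∞⟮𝓘(ℝ, F), D; 𝓘(ℝ, E), X⟯}
  [FiniteDimensional ℝ E] [T2Space X] [IsManifold 𝓘(ℝ, E) ∞ X]
  {J : Ideal (Smooth E X)} {ν : Coorientation ι} {p : D} (A : AdaptedFrame ι J ν p)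

theorem exists_cutoff : ∃ (χ : Smooth E X) (O : Set X), IsOpen O ∧ ι p ∈ O ∧ O ⊆ A.U ∧
    (∀ q ∈ O, χ q = 1) ∧ tsupport χ ⊆ A.U := by
  obtain ⟨χ, h1, h2⟩ := exists_bump (E := E) (A.isOpen.mem_nhds A.mem)
  obtain ⟨O, hO, hOo, hOp⟩ := eventually_nhds_iff.mp (h1.and (A.isOpen.eventually_mem A.mem))
  exact ⟨χ, O, hOo, hOp, fun q hq => (hO q hq).2, fun q hq => (hO q hq).1, h2⟩

/-- A cutoff function. -/
def bump : Smooth E X := A.exists_cutoff.choose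

/-- The square of the cutoff function. -/
def cut : Smooth E X := A.bump * A.bump

/-- The domain of the frame. -/
def dom : Set X := A.exists_cutoff.choose_spec.choose

theorem isOpen_dom : IsOpen A.dom := A.exists_cutoff.choose_spec.choose_spec.1

theorem mem_dom : ι p ∈ A.dom := A.exists_cutoff.choose_spec.choose_spec.2.1

theorem dom_subset : A.dom ⊆ A.U := A.exists_cutoff.choose_spec.choose_spec.2.2.1

theorem tsupport_bump : tsupport A.bump ⊆ A.U := A.exists_cutoff.choose_spec.choose_spec.2.2.2.2

theorem bump_of_notMem {q : X} (hq : q ∉ A.U) : A.bump q = 0 :=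
  image_eq_zero_of_notMem_tsupport fun h => hq (A.tsupport_bump h)

theorem cut_apply (q : X) : A.cut q = A.bump q * A.bump q := rfl

theorem cut_of_mem {q : X} (hq : q ∈ A.dom) : A.cut q = 1 := by
  have : A.bump q = 1 := A.exists_cutoff.choose_spec.choose_spec.2.2.2.1 q hq
  rw [cut_apply, this, one_mul]

theorem cut_of_notMem {q : X} (hq : q ∉ A.U) : A.cut q = 0 := by
  rw [cut_apply, A.bump_of_notMem hq, zero_mul]

theorem cancel_dom {f : Smooth E X} (h : ∀ q ∈ A.dom, f q * (A.y₁ q ^ 2 + A.y₂ q ^ 2) = 0) :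
    ∀ q ∈ A.dom, f q = 0 := by
  intro q hq
  obtain ⟨χ, h1, h2⟩ := exists_bump (E := E) (A.isOpen_dom.mem_nhds hq)
  have h3 := A.cancel (χ * f) (fun x => by
    rw [smooth_mul_apply, mul_assoc]
    by_cases hx : x ∈ tsupport χ
    · rw [h x (h2 hx), mul_zero]
    · rw [image_eq_zero_of_notMem_tsupport hx, zero_mul]) q (A.dom_subset hq)
  rwa [smooth_mul_apply, h1.self_of_nhds, one_mul] at h3

/-- The coefficients `a`, `b` of `r ∂_r` and `∂_θ` in `V`. -/
structure IsCoeff (V : ASec J) (a b : Smooth E X) : Prop where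
  eq₁ : ∀ q, A.cut q * V.1 A.y₁ q = a q * A.y₁ q - b q * A.y₂ q
  eq₂ : ∀ q, A.cut q * V.1 A.y₂ q = a q * A.y₂ q + b q * A.y₁ q
  zero : ∀ q ∉ A.U, a q = 0 ∧ b q = 0

variable {A} in
-- Combining the two equations with factors y₁ and y₂ isolates each coefficient times y₁² + y₂²,
-- which can be cancelled. Normalisation to zero off the domain makes the coefficients unique
-- everywhere, hence linear in V.
theorem IsCoeff.unique {V : ASec J} {a b a' b' : Smooth E X} (h : A.IsCoeff V a b)
    (h' : A.IsCoeff V a' b') : a = a' ∧ b = b' := by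
  have ha : ∀ q ∈ A.U, (a - a') q = 0 := A.cancel _ fun q => by
    rw [smooth_sub_apply]
    linear_combination A.y₁ q * (h'.eq₁ q - h.eq₁ q) + A.y₂ q * (h'.eq₂ q - h.eq₂ q)
  have hb : ∀ q ∈ A.U, (b - b') q = 0 := A.cancel _ fun q => by
    rw [smooth_sub_apply]
    linear_combination A.y₂ q * (h.eq₁ q - h'.eq₁ q) + A.y₁ q * (h'.eq₂ q - h.eq₂ q)
  constructor
  · ext q
    by_cases hq : q ∈ A.U
    · exact sub_eq_zero.mp (ha q hq)
    · rw [(h.zero q hq).1, (h'.zero q hq).1]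
  · ext q
    by_cases hq : q ∈ A.U
    · exact sub_eq_zero.mp (hb q hq)
    · rw [(h.zero q hq).2, (h'.zero q hq).2]

/-- V multiplies y₁² + y₂² by some h. Then (V y₁, V y₂) − (h/2)(y₁, y₂) is a relation between y₁ and
y₂, hence a multiple of (−y₂, y₁); the coefficients are h/2 and this multiple. -/
theorem exists_isCoeff (V : ASec J) : ∃ ab : Smooth E X × Smooth E X, A.IsCoeff V ab.1 ab.2 := by
  obtain ⟨g, hg, hgU⟩ := A.ideal_mem
  obtain ⟨h, hh⟩ := A.ideal_eq (V.1 g) (V.2 g hg)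
  have h1 : ∀ q ∈ A.U, 2 * (A.y₁ q * V.1 A.y₁ q + A.y₂ q * V.1 A.y₂ q) =
      h q * (A.y₁ q ^ 2 + A.y₂ q ^ 2) := by
    intro q hq
    have h2 : ∀ᶠ x in 𝓝 q, g x = (A.y₁ * A.y₁ + A.y₂ * A.y₂) x := by
      filter_upwards [A.isOpen.mem_nhds hq] with x hx
      rw [hgU x hx, smooth_add_apply, smooth_mul_apply, smooth_mul_apply, sq, sq]
    rw [← hh q hq, derivation_congr V.1 h2, map_add, smooth_add_apply, derivation_mul_apply,
      derivation_mul_apply]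
    ring
  obtain ⟨b, hb⟩ := A.divide (A.bump * (V.1 A.y₁ - ((2 : ℝ)⁻¹ • h) * A.y₁))
    (A.bump * (V.1 A.y₂ - ((2 : ℝ)⁻¹ • h) * A.y₂)) (by
      intro q
      simp only [smooth_mul_apply, smooth_sub_apply, smooth_real_smul_apply]
      by_cases hq : q ∈ A.U
      · linear_combination A.bump q / 2 * h1 q hq
      · rw [A.bump_of_notMem hq]; ring)
  simp only [smooth_mul_apply, smooth_sub_apply, smooth_real_smul_apply] at hb
  -- One factor of the cutoff makes the relation global, a second one makes both coefficients vanish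
  -- off the domain; this is why `cut` is a square.
  refine ⟨(A.cut * ((2 : ℝ)⁻¹ • h), A.bump * b), ?_, ?_, ?_⟩
  · intro q
    simp only [smooth_mul_apply, smooth_real_smul_apply, cut_apply]
    by_cases hq : q ∈ A.U
    · linear_combination A.bump q * (hb q hq).1
    · rw [A.bump_of_notMem hq]; ring
  · intro q
    simp only [smooth_mul_apply, smooth_real_smul_apply, cut_apply]
    by_cases hq : q ∈ A.U
    · linear_combination A.bump q * (hb q hq).2
    · rw [A.bump_of_notMem hq]; ring
  · intro q hq
    simp only [smooth_mul_apply, cut_apply, A.bump_of_notMem hq, zero_mul, and_self]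

theorem isCoeff_choose (V : ASec J) :
    A.IsCoeff V (A.exists_isCoeff V).choose.1 (A.exists_isCoeff V).choose.2 :=
  (A.exists_isCoeff V).choose_spec

theorem IsCoeff.add {V V' : ASec J} {a b a' b' : Smooth E X} (h : A.IsCoeff V a b)
    (h' : A.IsCoeff V' a' b') : A.IsCoeff (V + V') (a + a') (b + b') where
  eq₁ q := by
    rw [asec_add_apply, smooth_add_apply, smooth_add_apply]
    linear_combination h.eq₁ q + h'.eq₁ q
  eq₂ q := by
    rw [asec_add_apply, smooth_add_apply, smooth_add_apply]
    linear_combination h.eq₂ q + h'.eq₂ q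
  zero q hq := by
    rw [smooth_add_apply, smooth_add_apply, (h.zero q hq).1, (h.zero q hq).2, (h'.zero q hq).1,
      (h'.zero q hq).2, add_zero, and_self]

theorem IsCoeff.smul {V : ASec J} {a b : Smooth E X} (f : Smooth E X) (h : A.IsCoeff V a b) :
    A.IsCoeff (f • V) (f * a) (f * b) where
  eq₁ q := by
    rw [asec_smul_apply, smooth_mul_apply, smooth_mul_apply]
    linear_combination f q * h.eq₁ q
  eq₂ q := by
    rw [asec_smul_apply, smooth_mul_apply, smooth_mul_apply]
    linear_combination f q * h.eq₂ q
  zero q hq := by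
    rw [smooth_mul_apply, smooth_mul_apply, (h.zero q hq).1, (h.zero q hq).2, mul_zero, and_self]

/-- The coefficient of `r ∂_r`, that is, the form `d log r`. -/
def rad : ASec J →ₗ[Smooth E X] Smooth E X where
  toFun V := (A.exists_isCoeff V).choose.1
  map_add' V W := ((A.isCoeff_choose (V + W)).unique
    ((A.isCoeff_choose V).add A (A.isCoeff_choose W))).1
  map_smul' f V := ((A.isCoeff_choose (f • V)).unique ((A.isCoeff_choose V).smul A f)).1

/-- The coefficient of `∂_θ`, that is, the form `dθ`. -/
def ang : ASec J →ₗ[Smooth E X] Smooth E X where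
  toFun V := (A.exists_isCoeff V).choose.2
  map_add' V W := ((A.isCoeff_choose (V + W)).unique
    ((A.isCoeff_choose V).add A (A.isCoeff_choose W))).2
  map_smul' f V := ((A.isCoeff_choose (f • V)).unique ((A.isCoeff_choose V).smul A f)).2

theorem isCoeff (V : ASec J) : A.IsCoeff V (A.rad V) (A.ang V) := A.isCoeff_choose V

theorem apply_y₁ (V : ASec J) {q : X} (hq : q ∈ A.dom) :
    V.1 A.y₁ q = A.rad V q * A.y₁ q - A.ang V q * A.y₂ q := by
  rw [← (A.isCoeff V).eq₁, A.cut_of_mem hq, one_mul]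

theorem apply_y₂ (V : ASec J) {q : X} (hq : q ∈ A.dom) :
    V.1 A.y₂ q = A.rad V q * A.y₂ q + A.ang V q * A.y₁ q := by
  rw [← (A.isCoeff V).eq₂, A.cut_of_mem hq, one_mul]

theorem eq_zero_of_dom {a b : Smooth E X}
    (h₁ : ∀ q ∈ A.dom, a q * A.y₁ q - b q * A.y₂ q = 0)
    (h₂ : ∀ q ∈ A.dom, a q * A.y₂ q + b q * A.y₁ q = 0) :
    ∀ q ∈ A.dom, a q = 0 ∧ b q = 0 := fun q hq =>
  ⟨A.cancel_dom (f := a) (fun q hq => by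
    linear_combination A.y₁ q * h₁ q hq + A.y₂ q * h₂ q hq) q hq,
   A.cancel_dom (f := b) (fun q hq => by
    linear_combination -A.y₂ q * h₁ q hq + A.y₁ q * h₂ q hq) q hq⟩

/-- Computing [V, W] y₁ and [V, W] y₂ in two ways gives a linear system for the two defects of
closedness, with determinant y₁² + y₂². -/
theorem closed (V W : ASec J) : ∀ q ∈ A.dom,
    (V.1 (A.rad W) - W.1 (A.rad V) - A.rad ⁅V, W⁆) q = 0 ∧
      (V.1 (A.ang W) - W.1 (A.ang V) - A.ang ⁅V, W⁆) q = 0 := by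
  have h1 : ∀ (V : ASec J) q, q ∈ A.dom → ∀ᶠ x in 𝓝 q,
      V.1 A.y₁ x = (A.rad V * A.y₁ - A.ang V * A.y₂) x := fun V q hq => by
    filter_upwards [A.isOpen_dom.mem_nhds hq] with x hx using A.apply_y₁ V hx
  have h2 : ∀ (V : ASec J) q, q ∈ A.dom → ∀ᶠ x in 𝓝 q,
      V.1 A.y₂ x = (A.rad V * A.y₂ + A.ang V * A.y₁) x := fun V q hq => by
    filter_upwards [A.isOpen_dom.mem_nhds hq] with x hx using A.apply_y₂ V hx
  refine A.eq_zero_of_dom (fun q hq => ?_) fun q hq => ?_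
  · have h3 := A.apply_y₁ ⁅V, W⁆ hq
    rw [asec_lie_apply, derivation_congr V.1 (h1 W q hq), derivation_congr W.1 (h1 V q hq)] at h3
    simp only [map_sub, smooth_sub_apply, derivation_mul_apply, A.apply_y₁ _ hq,
      A.apply_y₂ _ hq] at h3 ⊢
    linear_combination h3
  · have h3 := A.apply_y₂ ⁅V, W⁆ hq
    rw [asec_lie_apply, derivation_congr V.1 (h2 W q hq), derivation_congr W.1 (h2 V q hq)] at h3
    simp only [map_add, smooth_add_apply, smooth_sub_apply, derivation_mul_apply, A.apply_y₁ _ hq,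
      A.apply_y₂ _ hq] at h3 ⊢
    linear_combination h3

/-- Near a point of the domain f = k (y₁² + y₂²), and V f = (V k + k h)(y₁² + y₂²); membership in
the ideal is a local condition. -/
theorem smul_mem (hJ : IsEllipticIdeal ι J) {V : VField E X} {h : Smooth E X}
    (hV : ∀ q ∈ A.U, 2 * (A.y₁ q * V A.y₁ q + A.y₂ q * V A.y₂ q) =
      h q * (A.y₁ q ^ 2 + A.y₂ q ^ 2)) : A.cut • V ∈ preserving J := by
  intro f hf
  obtain ⟨g, hg, hgU⟩ := A.ideal_mem
  obtain ⟨k, hk⟩ := A.ideal_eq f hf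
  refine hJ.local_mem _ fun x => ?_
  by_cases hx : x ∈ A.U
  · refine ⟨(A.cut * (V k + k * h)) * g, J.mul_mem_left _ hg, ?_⟩
    filter_upwards [A.isOpen.mem_nhds hx] with q hq
    have h1 : ∀ᶠ x in 𝓝 q, f x = (k * (A.y₁ * A.y₁ + A.y₂ * A.y₂)) x := by
      filter_upwards [A.isOpen.mem_nhds hq] with x hx
      rw [hk x hx]
      simp only [smooth_mul_apply, smooth_add_apply, sq]
    rw [derivation_smul_apply, derivation_congr V h1]
    simp only [derivation_mul_apply, map_add, smooth_mul_apply, smooth_add_apply, hgU q hq]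
    linear_combination A.cut q * k q * hV q hq
  · refine ⟨0, J.zero_mem, ?_⟩
    have h1 : ∀ᶠ y in 𝓝 x, y ∉ tsupport A.bump :=
      (isClosed_tsupport _).isOpen_compl.eventually_mem fun h => hx (A.tsupport_bump h)
    filter_upwards [h1] with y hy
    rw [derivation_smul_apply, cut_apply, image_eq_zero_of_notMem_tsupport hy]
    simp [smooth_zero_apply]

variable (hJ : IsEllipticIdeal ι J)

/-- The vector field `r ∂_r`, cut off. -/
def R₀ : ASec J := ⟨A.cut • (A.y₁ • A.N₁ + A.y₂ • A.N₂), A.smul_mem hJ (h := algebraMap ℝ _ 2)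
  fun q hq => by
    change 2 * (A.y₁ q * (A.y₁ q * A.N₁ A.y₁ q + A.y₂ q * A.N₂ A.y₁ q) +
      A.y₂ q * (A.y₁ q * A.N₁ A.y₂ q + A.y₂ q * A.N₂ A.y₂ q)) = 2 * _
    rw [A.N₁_y₁ q hq, A.N₁_y₂ q hq, A.N₂_y₁ q hq, A.N₂_y₂ q hq]
    ring⟩

/-- The vector field `∂_θ`, cut off. -/
def T₀ : ASec J := ⟨A.cut • (A.y₁ • A.N₂ - A.y₂ • A.N₁), A.smul_mem hJ (h := 0)
  fun q hq => by
    change 2 * (A.y₁ q * (A.y₁ q * A.N₂ A.y₁ q - A.y₂ q * A.N₁ A.y₁ q) +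
      A.y₂ q * (A.y₁ q * A.N₂ A.y₂ q - A.y₂ q * A.N₁ A.y₂ q)) = 0 * _
    rw [A.N₁_y₁ q hq, A.N₁_y₂ q hq, A.N₂_y₁ q hq, A.N₂_y₂ q hq]
    ring⟩

/-- The coordinate vector fields tangent to `D`, cut off. -/
def E₀ (k : Fin (Module.finrank ℝ F)) : ASec J := ⟨A.cut • A.Nx k, A.smul_mem hJ (h := 0)
  fun q hq => by
    rw [A.Nx_y₁ k q hq, A.Nx_y₂ k q hq, smooth_zero_apply]
    ring⟩

theorem R₀_apply (f : Smooth E X) (q : X) :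
    (A.R₀ hJ).1 f q = A.cut q * (A.y₁ q * A.N₁ f q + A.y₂ q * A.N₂ f q) := rfl

theorem T₀_apply (f : Smooth E X) (q : X) :
    (A.T₀ hJ).1 f q = A.cut q * (A.y₁ q * A.N₂ f q - A.y₂ q * A.N₁ f q) := rfl

theorem E₀_apply (k) (f : Smooth E X) (q : X) : (A.E₀ hJ k).1 f q = A.cut q * A.Nx k f q := rfl

theorem isCoeff_R₀ : A.IsCoeff (A.R₀ hJ) (A.cut * A.cut) 0 where
  eq₁ q := by
    rw [R₀_apply, smooth_mul_apply, smooth_zero_apply]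
    by_cases hq : q ∈ A.U
    · rw [A.N₁_y₁ q hq, A.N₂_y₁ q hq]; ring
    · rw [A.cut_of_notMem hq]; ring
  eq₂ q := by
    rw [R₀_apply, smooth_mul_apply, smooth_zero_apply]
    by_cases hq : q ∈ A.U
    · rw [A.N₁_y₂ q hq, A.N₂_y₂ q hq]; ring
    · rw [A.cut_of_notMem hq]; ring
  zero q hq := by
    rw [smooth_mul_apply, A.cut_of_notMem hq, zero_mul, smooth_zero_apply, and_self]

theorem isCoeff_T₀ : A.IsCoeff (A.T₀ hJ) 0 (A.cut * A.cut) where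
  eq₁ q := by
    rw [T₀_apply, smooth_mul_apply, smooth_zero_apply]
    by_cases hq : q ∈ A.U
    · rw [A.N₁_y₁ q hq, A.N₂_y₁ q hq]; ring
    · rw [A.cut_of_notMem hq]; ring
  eq₂ q := by
    rw [T₀_apply, smooth_mul_apply, smooth_zero_apply]
    by_cases hq : q ∈ A.U
    · rw [A.N₁_y₂ q hq, A.N₂_y₂ q hq]; ring
    · rw [A.cut_of_notMem hq]; ring
  zero q hq := by
    rw [smooth_mul_apply, A.cut_of_notMem hq, zero_mul, smooth_zero_apply, and_self]

theorem rad_R₀ {q : X} (hq : q ∈ A.dom) : A.rad (A.R₀ hJ) q = 1 := by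
  rw [((A.isCoeff _).unique (A.isCoeff_R₀ hJ)).1, smooth_mul_apply, A.cut_of_mem hq, one_mul]

theorem ang_R₀ (q : X) : A.ang (A.R₀ hJ) q = 0 := by
  rw [((A.isCoeff _).unique (A.isCoeff_R₀ hJ)).2, smooth_zero_apply]

theorem rad_T₀ (q : X) : A.rad (A.T₀ hJ) q = 0 := by
  rw [((A.isCoeff _).unique (A.isCoeff_T₀ hJ)).1, smooth_zero_apply]

theorem ang_T₀ {q : X} (hq : q ∈ A.dom) : A.ang (A.T₀ hJ) q = 1 := by
  rw [((A.isCoeff _).unique (A.isCoeff_T₀ hJ)).2, smooth_mul_apply, A.cut_of_mem hq, one_mul]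

theorem R₀_x (k) (q : X) : (A.R₀ hJ).1 (A.x k) q = 0 := by
  rw [R₀_apply]
  by_cases hq : q ∈ A.U
  · rw [A.N₁_x k q hq, A.N₂_x k q hq]; ring
  · rw [A.cut_of_notMem hq]; ring

theorem T₀_x (k) (q : X) : (A.T₀ hJ).1 (A.x k) q = 0 := by
  rw [T₀_apply]
  by_cases hq : q ∈ A.U
  · rw [A.N₁_x k q hq, A.N₂_x k q hq]; ring
  · rw [A.cut_of_notMem hq]; ring

theorem E₀_x (k l) {q : X} (hq : q ∈ A.dom) : (A.E₀ hJ k).1 (A.x l) q = if k = l then 1 else 0 := by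
  rw [E₀_apply, A.Nx_x k l q (A.dom_subset hq), A.cut_of_mem hq, one_mul]

/-- The expansion of a section in the frame. -/
def expand (V : ASec J) : ASec J :=
  A.rad V • A.R₀ hJ + A.ang V • A.T₀ hJ + ∑ k, V.1 (A.x k) • A.E₀ hJ k

theorem apply_eq (V : ASec J) (f : Smooth E X) {q : X} (hq : q ∈ A.dom) :
    V.1 f q = (A.expand hJ V).1 f q := by
  rw [expand, asec_add_apply, asec_add_apply, asec_sum_apply]
  simp only [asec_smul_apply, R₀_apply, T₀_apply, E₀_apply, A.cut_of_mem hq, one_mul]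
  rw [A.span V.1 f q (A.dom_subset hq), A.apply_y₁ V hq, A.apply_y₂ V hq]
  ring

/-- Such a functional depends only on the germ at q, and near q the section coincides with its
expansion in the frame. Values of forms at a point are treated slot by slot in this way. -/
theorem functional_eq (V : ASec J) {q : X} (hq : q ∈ A.dom) (l : ASec J →+ ℝ)
    (hl : ∀ (f : Smooth E X) V, l (f • V) = f q * l V) :
    l V = A.rad V q * l (A.R₀ hJ) + A.ang V q * l (A.T₀ hJ) +
      ∑ k, V.1 (A.x k) q * l (A.E₀ hJ k) := by
  have h : ∀ᶠ x in 𝓝 q, ∀ f, V.1 f x = (A.expand hJ V).1 f x := by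
    filter_upwards [A.isOpen_dom.mem_nhds hq] with x hx f using A.apply_eq hJ V f hx
  rw [germ_congr l hl h, expand, map_add, map_add, map_sum, hl, hl]
  simp only [hl]

end AdaptedFrame

/-! ### Radial and angular sections in terms of the frame -/

section Pointwise

variable {E : Type*} [NormedAddCommGroup E] [NormedSpace ℝ E]
  {F : Type*} [NormedAddCommGroup F] [NormedSpace ℝ F]
  {X : Type*} [TopologicalSpace X] [ChartedSpace E X]
  {D : Type*} [TopologicalSpace D] [ChartedSpace F D]

/-- `V` represents `r ∂_r` at the point `q` of `D`. -/
structure IsRadialAt (ι : C^∞⟮𝓘(ℝ, F), D; 𝓘(ℝ, E), X⟯) (V : VField E X) (q : D) : Prop where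
  vanishes : ∀ f : Smooth E X, V f (ι q) = 0
  linearization : ∀ (W : VField E X) (f : Smooth E X), f.comp ι = 0 → W (V f) (ι q) = W f (ι q)

/-- `V` represents `∂_θ` at the point `q` of `D`. -/
structure IsAngularAt {ι : C^∞⟮𝓘(ℝ, F), D; 𝓘(ℝ, E), X⟯} (ν : Coorientation ι) (V : VField E X)
    (q : D) : Prop where
  vanishes : ∀ f : Smooth E X, V f (ι q) = 0
  linearization : ∀ (W : VField E X) (f : Smooth E X), f.comp ι = 0 →
    W (V (V f)) (ι q) = -W f (ι q)
  positive : ∀ W : VField E X, 0 ≤ ν.form ![W, ⁅W, V⁆] (ι q)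

end Pointwise

namespace AdaptedFrame

variable {E : Type*} [NormedAddCommGroup E] [NormedSpace ℝ E]
  {F : Type*} [NormedAddCommGroup F] [NormedSpace ℝ F]
  {X : Type*} [TopologicalSpace X] [ChartedSpace E X]
  {D : Type*} [TopologicalSpace D] [ChartedSpace F D]
  {ι : C^∞⟮𝓘(ℝ, F), D; 𝓘(ℝ, E), X⟯}
  [FiniteDimensional ℝ E] [T2Space X] [IsManifold 𝓘(ℝ, E) ∞ X]
  {J : Ideal (Smooth E X)} {ν : Coorientation ι} {p : D} (A : AdaptedFrame ι J ν p)

theorem y₁_ι (q : D) : A.y₁ (ι q) = 0 := DFunLike.congr_fun A.y₁_comp q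

theorem y₂_ι (q : D) : A.y₂ (ι q) = 0 := DFunLike.congr_fun A.y₂_comp q

variable {A} in
theorem derivation_at {f f₁ f₂ : Smooth E X}
    (hf : ∀ x ∈ A.dom, f x = A.y₁ x * f₁ x + A.y₂ x * f₂ x) (W : VField E X) {q : D}
    (hq : ι q ∈ A.dom) :
    W f (ι q) = W A.y₁ (ι q) * f₁ (ι q) + W A.y₂ (ι q) * f₂ (ι q) := by
  have h : ∀ᶠ x in 𝓝 (ι q), f x = (A.y₁ * f₁ + A.y₂ * f₂) x := by
    filter_upwards [A.isOpen_dom.mem_nhds hq] with x hx using hf x hx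
  rw [derivation_congr W h, map_add, smooth_add_apply, derivation_mul_apply,
    derivation_mul_apply, A.y₁_ι, A.y₂_ι]
  ring

variable {A} in
theorem section_apply {f f₁ f₂ : Smooth E X}
    (hf : ∀ x ∈ A.dom, f x = A.y₁ x * f₁ x + A.y₂ x * f₂ x) (V : ASec J) :
    ∀ x ∈ A.dom, V.1 f x = A.y₁ x * (A.rad V * f₁ + A.ang V * f₂ + V.1 f₁) x +
      A.y₂ x * (A.rad V * f₂ - A.ang V * f₁ + V.1 f₂) x := by
  intro x hx
  have h : ∀ᶠ z in 𝓝 x, f z = (A.y₁ * f₁ + A.y₂ * f₂) z := by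
    filter_upwards [A.isOpen_dom.mem_nhds hx] with z hz using hf z hz
  rw [derivation_congr V.1 h]
  simp only [map_add, smooth_add_apply, smooth_sub_apply, smooth_mul_apply, derivation_mul_apply,
    A.apply_y₁ V hx, A.apply_y₂ V hx]
  ring

theorem exists_coeff {f : Smooth E X} (hf : f.comp ι = 0) :
    ∃ f₁ f₂ : Smooth E X, ∀ x ∈ A.dom, f x = A.y₁ x * f₁ x + A.y₂ x * f₂ x := by
  obtain ⟨f₁, f₂, h⟩ := A.vanish f hf
  exact ⟨f₁, f₂, fun x hx => h x (A.dom_subset hx)⟩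

theorem isTangentAt_of_eq_zero {V : VField E X} {q : D} (hq : ι q ∈ A.dom)
    (h₁ : V A.y₁ (ι q) = 0) (h₂ : V A.y₂ (ι q) = 0) : IsTangentAt ι V q := by
  intro f hf
  obtain ⟨f₁, f₂, h⟩ := A.exists_coeff hf
  rw [derivation_at h V hq, h₁, h₂]
  ring

theorem isTangentAt (V : ASec J) {q : D} (hq : ι q ∈ A.dom) : IsTangentAt ι V.1 q :=
  A.isTangentAt_of_eq_zero hq
    (by rw [A.apply_y₁ V hq, A.y₁_ι, A.y₂_ι]; ring) (by rw [A.apply_y₂ V hq, A.y₁_ι, A.y₂_ι]; ring)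

theorem apply_ι (V : ASec J) (f : Smooth E X) {q : D} (hq : ι q ∈ A.dom) :
    V.1 f (ι q) = ∑ k, V.1 (A.x k) (ι q) * A.Dx k (f.comp ι) q := by
  have hq' := A.dom_subset hq
  rw [A.span V.1 f _ hq', A.apply_y₁ V hq, A.apply_y₂ V hq, A.y₁_ι, A.y₂_ι]
  simp only [A.Nx_comp _ f q hq']
  ring

theorem form_eq (V W : VField E X) {q : D} (hq : ι q ∈ A.dom) :
    ν.form ![V, W] (ι q) = (V A.y₁ (ι q) * W A.y₂ (ι q) - V A.y₂ (ι q) * W A.y₁ (ι q)) *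
      ν.form ![A.N₁, A.N₂] (ι q) := by
  have hq' := A.dom_subset hq
  have hz : ∀ V : VField E X, ∃ Z, IsTangentAt ι Z q ∧
      V = (V A.y₁ • A.N₁ + V A.y₂ • A.N₂) + Z := by
    intro V
    refine ⟨V - (V A.y₁ • A.N₁ + V A.y₂ • A.N₂), A.isTangentAt_of_eq_zero hq ?_ ?_, by abel⟩
    · change V A.y₁ _ - (V A.y₁ _ * A.N₁ A.y₁ _ + V A.y₂ _ * A.N₂ A.y₁ _) = 0
      rw [A.N₁_y₁ _ hq', A.N₂_y₁ _ hq']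
      ring
    · change V A.y₂ _ - (V A.y₁ _ * A.N₁ A.y₂ _ + V A.y₂ _ * A.N₂ A.y₂ _) = 0
      rw [A.N₁_y₂ _ hq', A.N₂_y₂ _ hq']
      ring
  obtain ⟨Z, hZ, hV⟩ := hz V
  obtain ⟨Z', hZ', hW⟩ := hz W
  have hadd : ∀ V V' W : VField E X, ν.form ![V + V', W] = ν.form ![V, W] + ν.form ![V', W] :=
    fun V V' W => ν.form.map_vecCons_add _ _ _
  conv_lhs => rw [hV, hadd, smooth_add_apply, ν.conormal _ _ _ hZ, hW, ν.form_swap, hadd,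
    smooth_neg_apply, smooth_add_apply, ν.conormal _ _ _ hZ', ν.form_apply]
  ring

theorem section_y₁ (V : ASec J) :
    ∀ x ∈ A.dom, V.1 A.y₁ x = A.y₁ x * A.rad V x + A.y₂ x * (-A.ang V) x :=
  fun x hx => by rw [A.apply_y₁ V hx, smooth_neg_apply]; ring

theorem section_y₂ (V : ASec J) :
    ∀ x ∈ A.dom, V.1 A.y₂ x = A.y₁ x * A.ang V x + A.y₂ x * A.rad V x :=
  fun x hx => by rw [A.apply_y₂ V hx]; ring

/-- At q the linearisation acts on the normal coordinates as a + ib, with a and b the coefficients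
of V; the vanishing of V at q removes the components along `D`. -/
theorem isRadialAt_iff (V : ASec J) {q : D} (hq : ι q ∈ A.dom) :
    IsRadialAt ι V.1 q ↔ A.rad V (ι q) = 1 ∧ A.ang V (ι q) = 0 ∧ ∀ k, V.1 (A.x k) (ι q) = 0 := by
  have hq' := A.dom_subset hq
  constructor
  · intro h
    have h1 := h.linearization A.N₁ A.y₁ A.y₁_comp
    have h2 := h.linearization A.N₂ A.y₁ A.y₁_comp
    rw [derivation_at (A.section_y₁ V) _ hq] at h1 h2
    simp only [A.N₁_y₁ _ hq', A.N₁_y₂ _ hq', A.N₂_y₁ _ hq', A.N₂_y₂ _ hq', smooth_neg_apply] at h1 h2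
    exact ⟨by linarith, by linarith, fun k => h.vanishes _⟩
  · rintro ⟨ha, hb, hx⟩
    have hv : ∀ f, V.1 f (ι q) = 0 := fun f => by
      rw [A.apply_ι V f hq]
      simp only [hx, zero_mul, Finset.sum_const_zero]
    refine ⟨hv, fun W f hf => ?_⟩
    obtain ⟨f₁, f₂, h⟩ := A.exists_coeff hf
    rw [derivation_at (section_apply h V) W hq, derivation_at h W hq]
    simp only [smooth_add_apply, smooth_sub_apply, smooth_mul_apply, ha, hb, hv]
    ring

/-- In the same notation (a + ib)² = −1, that is a² − b² = −1 and ab = 0; the sign condition selects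
a = 0, b = 1. -/
theorem isAngularAt_iff (V : ASec J) {q : D} (hq : ι q ∈ A.dom) :
    IsAngularAt ν V.1 q ↔ A.rad V (ι q) = 0 ∧ A.ang V (ι q) = 1 ∧ ∀ k, V.1 (A.x k) (ι q) = 0 := by
  have hq' := A.dom_subset hq
  have hpos := A.pos _ hq'
  have hlie : (∀ f, V.1 f (ι q) = 0) → ∀ (W : VField E X) f, ⁅W, V.1⁆ f (ι q) = W (V.1 f) (ι q) :=
    fun hv W f => by rw [derivation_lie_apply, hv, sub_zero]
  constructor
  · intro h
    have h1 := h.linearization A.N₁ A.y₁ A.y₁_comp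
    have h2 := h.linearization A.N₂ A.y₁ A.y₁_comp
    rw [derivation_at (section_apply (A.section_y₁ V) V) _ hq] at h1 h2
    simp only [A.N₁_y₁ _ hq', A.N₁_y₂ _ hq', A.N₂_y₁ _ hq', A.N₂_y₂ _ hq', smooth_neg_apply,
      smooth_add_apply, smooth_sub_apply, smooth_mul_apply, h.vanishes] at h1 h2
    have h3 := h.positive A.N₁
    rw [A.form_eq _ _ hq, hlie h.vanishes, hlie h.vanishes, derivation_at (A.section_y₁ V) _ hq,
      derivation_at (A.section_y₂ V) _ hq, A.N₁_y₁ _ hq', A.N₁_y₂ _ hq'] at h3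
    set a := A.rad V (ι q)
    set b := A.ang V (ι q)
    have h4 : a * b = 0 := by linarith
    have h5 : 0 ≤ b := by
      by_contra hb
      nlinarith [mul_pos (neg_pos.mpr (not_le.mp hb)) hpos]
    have ha : a = 0 := by
      rcases mul_eq_zero.mp h4 with h | h
      · exact h
      · rw [h] at h1
        nlinarith [sq_nonneg a]
    refine ⟨ha, ?_, fun k => h.vanishes _⟩
    rw [ha] at h1
    nlinarith
  · rintro ⟨ha, hb, hx⟩
    have hv : ∀ f, V.1 f (ι q) = 0 := fun f => by
      rw [A.apply_ι V f hq]
      simp only [hx, zero_mul, Finset.sum_const_zero]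
    refine ⟨hv, fun W f hf => ?_, fun W => ?_⟩
    · obtain ⟨f₁, f₂, h⟩ := A.exists_coeff hf
      rw [derivation_at (section_apply (section_apply h V) V) W hq, derivation_at h W hq]
      simp only [smooth_add_apply, smooth_sub_apply, smooth_mul_apply, ha, hb, hv]
      ring
    · rw [A.form_eq _ _ hq, hlie hv, hlie hv, derivation_at (A.section_y₁ V) _ hq,
        derivation_at (A.section_y₂ V) _ hq, smooth_neg_apply, ha, hb]
      have : 0 ≤ (W A.y₁ (ι q) ^ 2 + W A.y₂ (ι q) ^ 2) * ν.form ![A.N₁, A.N₂] (ι q) := by positivity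
      linarith

variable (hJ : IsEllipticIdeal ι J)

theorem isRadialAt_R₀ {q : D} (hq : ι q ∈ A.dom) : IsRadialAt ι (A.R₀ hJ).1 q :=
  (A.isRadialAt_iff _ hq).mpr ⟨A.rad_R₀ hJ hq, A.ang_R₀ hJ _, fun k => A.R₀_x hJ k _⟩

theorem isAngularAt_T₀ {q : D} (hq : ι q ∈ A.dom) : IsAngularAt ν (A.T₀ hJ).1 q :=
  (A.isAngularAt_iff _ hq).mpr ⟨A.rad_T₀ hJ _, A.ang_T₀ hJ hq, fun k => A.T₀_x hJ k _⟩

end AdaptedFrame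

/-! ### Radial and angular conditions as pointwise conditions -/

section Global

variable {E : Type*} [NormedAddCommGroup E] [NormedSpace ℝ E]
  {F : Type*} [NormedAddCommGroup F] [NormedSpace ℝ F]
  {X : Type*} [TopologicalSpace X] [ChartedSpace E X]
  {D : Type*} [TopologicalSpace D] [ChartedSpace F D]
  {ι : C^∞⟮𝓘(ℝ, F), D; 𝓘(ℝ, E), X⟯}
  [FiniteDimensional ℝ E] [T2Space X] [IsManifold 𝓘(ℝ, E) ∞ X]
  {J : Ideal (Smooth E X)} {ν : Coorientation ι}

theorem isTangent_section (A : ∀ p, AdaptedFrame ι J ν p) (V : ASec J) : IsTangent ι V.1 :=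
  fun p => (A p).isTangentAt V (A p).mem_dom

/-- As V vanishes along `D`, the bracket [W, V] acts there on f as W (V f), so the condition
involves one point at a time. -/
theorem isRadial_iff (V : VField E X) : IsRadial ι V ↔ ∀ q, IsRadialAt ι V q := by
  have key : ∀ (W : VField E X) (f : Smooth E X) q, f.comp ι = 0 → (∀ f, V f (ι q) = 0) →
      (⁅W, V⁆ - W) f (ι q) = W (V f) (ι q) - W f (ι q) := fun W f q hf hv => by
    change ⁅W, V⁆ f (ι q) - W f (ι q) = _
    rw [derivation_lie_apply, hv, sub_zero]
  constructor
  · intro h q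
    have hv : ∀ f, V f (ι q) = 0 := fun f => DFunLike.congr_fun (h.vanishes f) q
    refine ⟨hv, fun W f hf => ?_⟩
    have h1 := h.linearization W q f hf
    rw [key W f q hf hv] at h1
    exact sub_eq_zero.mp h1
  · intro h
    refine ⟨fun f => ContMDiffMap.ext fun q => (h q).vanishes f, fun W q f hf => ?_⟩
    rw [key W f q hf (h q).vanishes, (h q).linearization W f hf, sub_self]

theorem isAngular_iff (V : VField E X) : IsAngular ν V ↔ ∀ q, IsAngularAt ν V q := by
  have key : ∀ (W : VField E X) (f : Smooth E X) q, f.comp ι = 0 → (∀ f, V f (ι q) = 0) →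
      (⁅⁅W, V⁆, V⁆ + W) f (ι q) = W (V (V f)) (ι q) + W f (ι q) := fun W f q hf hv => by
    change ⁅⁅W, V⁆, V⁆ f (ι q) + W f (ι q) = _
    rw [derivation_lie_apply, derivation_lie_apply, hv, hv, sub_zero, sub_zero]
  constructor
  · intro h q
    have hv : ∀ f, V f (ι q) = 0 := fun f => DFunLike.congr_fun (h.vanishes f) q
    refine ⟨hv, fun W f hf => ?_, fun W => h.positive W q⟩
    have h1 := h.linearization W q f hf
    rw [key W f q hf hv] at h1
    exact eq_neg_of_add_eq_zero_left h1
  · intro h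
    refine ⟨fun f => ContMDiffMap.ext fun q => (h q).vanishes f, fun W q f hf => ?_,
      fun W q => (h q).positive W⟩
    rw [key W f q hf (h q).vanishes, (h q).linearization W f hf, neg_add_cancel]

end Global

/-! ### Gluing along D: extension, restriction and lifting -/

section Glue

variable {E : Type*} [NormedAddCommGroup E] [NormedSpace ℝ E]
  {X : Type*} [TopologicalSpace X] [ChartedSpace E X]
  [FiniteDimensional ℝ E] [T2Space X] [IsManifold 𝓘(ℝ, E) ∞ X]

theorem finsum_partition {s : Set X} {κ : Type*} (ρ : SmoothPartitionOfUnity κ 𝓘(ℝ, E) X s)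
    (x : X) (t : Finset κ) (ht : ρ.finsupport x ⊆ t) (g : κ → ℝ) :
    ∑ᶠ i, ρ i x * g i = ∑ i ∈ t, ρ i x * g i := by
  refine finsum_eq_sum_of_support_subset _ fun i hi => ht ?_
  rw [ρ.mem_finsupport]
  exact fun h => hi (by simp [h])

/-- Gluing vector fields by a partition of unity. -/
theorem exists_glue_derivation {κ : Type*}
    (ρ : SmoothPartitionOfUnity κ 𝓘(ℝ, E) X) (V : κ → VField E X) :
    ∃ W : VField E X, ∀ f x, W f x = ∑ᶠ i, ρ i x * V i f x := by
  refine ⟨Derivation.mk'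
    { toFun := fun f => ⟨fun x => ∑ᶠ i, ρ i x • V i f x,
        ρ.contMDiff_finsum_smul fun i x _ => (V i f).contMDiff x⟩
      map_add' := fun f g => ?_
      map_smul' := fun c f => ?_ } fun f g => ?_, fun f x => rfl⟩
  · ext x
    change ∑ᶠ i, ρ i x * V i (f + g) x = ∑ᶠ i, ρ i x * V i f x + ∑ᶠ i, ρ i x * V i g x
    rw [finsum_partition ρ x _ subset_rfl, finsum_partition ρ x _ subset_rfl,
      finsum_partition ρ x _ subset_rfl, ← Finset.sum_add_distrib]
    refine Finset.sum_congr rfl fun i _ => ?_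
    rw [map_add]
    exact mul_add _ _ _
  · ext x
    change ∑ᶠ i, ρ i x * V i (c • f) x = c * ∑ᶠ i, ρ i x * V i f x
    rw [finsum_partition ρ x _ subset_rfl, finsum_partition ρ x _ subset_rfl, Finset.mul_sum]
    refine Finset.sum_congr rfl fun i _ => ?_
    rw [Derivation.map_smul]
    exact mul_left_comm _ _ _
  · ext x
    change ∑ᶠ i, ρ i x * V i (f * g) x =
      f x * ∑ᶠ i, ρ i x * V i g x + g x * ∑ᶠ i, ρ i x * V i f x
    simp only [finsum_partition ρ x _ subset_rfl, derivation_mul_apply, Finset.mul_sum,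
      ← Finset.sum_add_distrib]
    exact Finset.sum_congr rfl fun i _ => by ring

variable {F : Type*} [NormedAddCommGroup F] [NormedSpace ℝ F]
  {D : Type*} [TopologicalSpace D] [ChartedSpace F D]
  {ι : C^∞⟮𝓘(ℝ, F), D; 𝓘(ℝ, E), X⟯} {J : Ideal (Smooth E X)}

theorem IsEllipticIdeal.isClosed_range (hJ : IsEllipticIdeal ι J) : IsClosed (Set.range ι) := by
  rw [← hJ.zeroLocus]
  have : {x : X | ∀ f ∈ J, f x = 0} = ⋂ f ∈ J, {x | f x = 0} := by
    ext x
    simp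
  rw [this]
  exact isClosed_biInter fun f _ => isClosed_eq f.contMDiff.continuous continuous_const

variable [SigmaCompactSpace X]

/-- Gluing sections along `D`: values of functionals at points of `D` which are constant on the
solutions of a locally solvable condition are attained by a global section. -/
theorem exists_glue_along (hJ : IsEllipticIdeal ι J) (Q : D → ASec J → Prop)
    (hQ : ∀ p, ∃ V : ASec J, ∃ U ∈ 𝓝 (ι p), ∀ q, ι q ∈ U → Q q V) :
    ∃ V : ASec J, ∀ (q : D) (l : ASec J →+ ℝ) (c : ℝ),
      (∀ (f : Smooth E X) V, l (f • V) = f (ι q) * l V) → (∀ V, Q q V → l V = c) → l V = c := by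
  -- Off `D`, which is closed, the condition is empty and the zero section serves.
  have hloc : ∀ x : X, ∃ V : ASec J, ∃ U : Set X, IsOpen U ∧ x ∈ U ∧ ∀ q, ι q ∈ U → Q q V := by
    intro x
    by_cases hx : x ∈ Set.range ι
    · obtain ⟨p, rfl⟩ := hx
      obtain ⟨V, U, hU, h⟩ := hQ p
      obtain ⟨O, hOU, hO, hp⟩ := mem_nhds_iff.mp hU
      exact ⟨V, O, hO, hp, fun q hq => h q (hOU hq)⟩
    · exact ⟨0, (Set.range ι)ᶜ, hJ.isClosed_range.isOpen_compl, hx,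
        fun q hq => absurd ⟨q, rfl⟩ hq⟩
  choose V U hUo hU hQU using hloc
  obtain ⟨ρ, hρ⟩ := SmoothPartitionOfUnity.exists_isSubordinate 𝓘(ℝ, E) isClosed_univ U hUo
    fun x _ => Set.mem_iUnion.mpr ⟨x, hU x⟩
  obtain ⟨W, hW⟩ := exists_glue_derivation ρ fun i => (V i).1
  have hWx : ∀ x, ∀ᶠ y in 𝓝 x, ∀ f, W f y = ∑ i ∈ ρ.fintsupport x, ρ i y * (V i).1 f y := by
    intro x
    filter_upwards [ρ.eventually_finsupport_subset (x₀ := x)] with y hy f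
    rw [hW, finsum_partition ρ y _ hy]
  have hWJ : W ∈ preserving J := by
    intro f hf
    refine hJ.local_mem _ fun x => ⟨∑ i ∈ ρ.fintsupport x, ρ i * (V i).1 f,
      J.sum_mem fun i _ => J.mul_mem_left _ ((V i).2 f hf), ?_⟩
    filter_upwards [hWx x] with y hy
    rw [hy, smooth_sum_apply]
    rfl
  refine ⟨⟨W, hWJ⟩, fun q l c hl hc => ?_⟩
  have h1 : ∀ᶠ y in 𝓝 (ι q), ∀ f, W f y =
      (∑ i ∈ ρ.fintsupport (ι q), (ρ i : Smooth E X) • V i : ASec J).1 f y := by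
    filter_upwards [hWx (ι q)] with y hy f
    rw [hy, asec_sum_apply]
    rfl
  rw [germ_congr (V := ⟨W, hWJ⟩) l hl h1, map_sum]
  -- Every section contributing at q has the same value c under l, and the weights add up to one.
  have h2 : ∀ i ∈ ρ.fintsupport (ι q), l ((ρ i : Smooth E X) • V i) = ρ i (ι q) * c := by
    intro i hi
    rw [hl, hc (V i) (hQU i q (hρ i ((ρ.mem_fintsupport_iff _ _).mp hi)))]
  rw [Finset.sum_congr rfl h2, ← Finset.sum_mul,
    ρ.sum_finsupport' _ (Set.mem_univ _) (ρ.finsupport_subset_fintsupport _), one_mul]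

variable {ν : Coorientation ι}

/-- The local extensions form a convex condition, which is void off the closed set `D`. -/
theorem exists_extension (hJ : IsEllipticIdeal ι J) (A : ∀ p, AdaptedFrame ι J ν p)
    (f : Smooth F D) : ∃ g : Smooth E X, g.comp ι = f := by
  obtain ⟨g, hg⟩ := exists_contMDiffMap_forall_mem_convex_of_local (n := (⊤ : ℕ∞)) 𝓘(ℝ, E) (F := ℝ)
    (t := fun x : X => {c : ℝ | ∀ q, ι q = x → c = f q})
    (fun x c hc c' hc' a b _ _ hab q hq => by
      rw [hc q hq, hc' q hq, ← add_smul, hab, one_smul])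
    (fun x => by
      by_cases hx : x ∈ Set.range ι
      · obtain ⟨p, rfl⟩ := hx
        obtain ⟨g, hg⟩ := (A p).extend f
        exact ⟨(A p).U, (A p).isOpen.mem_nhds (A p).mem, g, g.contMDiff.contMDiffOn,
          fun y hy q hq => by rw [← hq]; exact hg q (by rwa [hq])⟩
      · exact ⟨(Set.range ι)ᶜ, hJ.isClosed_range.isOpen_compl.mem_nhds hx, fun _ => 0,
          contMDiffOn_const, fun y hy q hq => absurd ⟨q, hq⟩ hy⟩)
  exact ⟨g, ContMDiffMap.ext fun q => hg (ι q) q rfl⟩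

/-- Sections are tangent to `D`, so the derivative of an extension along `D` does not depend on the
extension chosen. -/
theorem exists_related (hJ : IsEllipticIdeal ι J) (A : ∀ p, AdaptedFrame ι J ν p) (V : ASec J) :
    ∃ W : VField F D, IsRelated ι V.1 W := by
  choose e he using exists_extension hJ A
  have key : ∀ (f : Smooth F D) (g : Smooth E X), g.comp ι = f → ∀ q, V.1 (e f) (ι q) = V.1 g (ι q) := by
    intro f g hg q
    have h1 : (e f - g).comp ι = 0 := by
      ext q
      change e f (ι q) - g (ι q) = 0
      have h2 := DFunLike.congr_fun (he f) q
      have h3 := DFunLike.congr_fun hg q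
      change e f (ι q) = f q at h2
      change g (ι q) = f q at h3
      rw [h2, h3, sub_self]
    have h2 := isTangent_section A V q _ h1
    rw [map_sub, smooth_sub_apply] at h2
    exact sub_eq_zero.mp h2
  have hadd : ∀ f g : Smooth F D, (e f + e g).comp ι = f + g := fun f g => by
    conv_rhs => rw [← he f, ← he g]
    rfl
  have hmul : ∀ f g : Smooth F D, (e f * e g).comp ι = f * g := fun f g => by
    conv_rhs => rw [← he f, ← he g]
    rfl
  have hsmul : ∀ (c : ℝ) (f : Smooth F D), (c • e f).comp ι = c • f := fun c f => by
    conv_rhs => rw [← he f]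
    rfl
  refine ⟨Derivation.mk'
    { toFun := fun f => (V.1 (e f)).comp ι
      map_add' := fun f g => ?_
      map_smul' := fun c f => ?_ } fun f g => ?_, fun f => ?_⟩
  · ext q
    change V.1 (e (f + g)) (ι q) = V.1 (e f) (ι q) + V.1 (e g) (ι q)
    rw [key _ _ (hadd f g), map_add, smooth_add_apply]
  · ext q
    change V.1 (e (c • f)) (ι q) = c * V.1 (e f) (ι q)
    rw [key _ _ (hsmul c f), Derivation.map_smul, smooth_real_smul_apply]
  · ext q
    change V.1 (e (f * g)) (ι q) = f q * V.1 (e g) (ι q) + g q * V.1 (e f) (ι q)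
    rw [key _ _ (hmul f g), derivation_mul_apply]
    have h2 := DFunLike.congr_fun (he f) q
    have h3 := DFunLike.congr_fun (he g) q
    change e f (ι q) = f q at h2
    change e g (ι q) = g q at h3
    rw [h2, h3]
  · ext q
    exact (key (f.comp ι) f rfl q).symm

/-- Point evaluation of a section on a function, as a functional. -/
def evalOn (q : X) (f : Smooth E X) : ASec J →+ ℝ where
  toFun V := V.1 f q
  map_zero' := rfl
  map_add' _ _ := rfl

/-- Point evaluation of a linear form on sections, as a functional. -/
def evalFun (q : X) (l : ASec J →ₗ[Smooth E X] Smooth E X) : ASec J →+ ℝ where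
  toFun V := l V q
  map_zero' := by rw [map_zero]; rfl
  map_add' V W := by rw [map_add]; rfl

theorem evalFun_smul (q : X) (l : ASec J →ₗ[Smooth E X] Smooth E X) (f : Smooth E X) (V : ASec J) :
    evalFun q l (f • V) = f q * evalFun q l V :=
  congrArg (evalAt q) (l.map_smul f V)

/-- Near a point W is a combination of the coordinate fields of `D`, which lift to `E₀`; the values
on functions at points of `D` are prescribed, so the local lifts glue. -/
theorem exists_lift (hJ : IsEllipticIdeal ι J) (A : ∀ p, AdaptedFrame ι J ν p) (W : VField F D) :
    ∃ V : ASec J, IsRelated ι V.1 W := by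
  obtain ⟨V, hV⟩ := exists_glue_along hJ (fun q V => ∀ f, V.1 f (ι q) = W (f.comp ι) q)
    (fun p => by
      choose e he using exists_extension hJ A
      refine ⟨∑ k, e (W (((A p).x k).comp ι)) • (A p).E₀ hJ k, (A p).dom,
        (A p).isOpen_dom.mem_nhds (A p).mem_dom, fun q hq f => ?_⟩
      have hq' := (A p).dom_subset hq
      rw [asec_sum_apply, (A p).span_comp W _ q hq']
      refine Finset.sum_congr rfl fun k _ => ?_
      have h1 := DFunLike.congr_fun (he (W (((A p).x k).comp ι))) q
      change e (W (((A p).x k).comp ι)) (ι q) = _ at h1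
      rw [asec_smul_apply, (A p).E₀_apply, (A p).cut_of_mem hq, one_mul, h1,
        (A p).Nx_comp k f q hq'])
  exact ⟨V, fun f => ContMDiffMap.ext fun q =>
    hV q (evalOn (ι q) f) _ (fun _ _ => rfl) fun V h => h f⟩

/-- Being radial at a point prescribes the values of d log r, dθ and dx_k there, which survive
gluing. -/
theorem exists_radial (hJ : IsEllipticIdeal ι J) (A : ∀ p, AdaptedFrame ι J ν p) :
    ∃ R : ASec J, IsRadial ι R.1 := by
  obtain ⟨V, hV⟩ := exists_glue_along hJ (fun q V => IsRadialAt ι V.1 q)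
    (fun p => ⟨(A p).R₀ hJ, (A p).dom, (A p).isOpen_dom.mem_nhds (A p).mem_dom,
      fun q hq => (A p).isRadialAt_R₀ hJ hq⟩)
  refine ⟨V, (isRadial_iff _).mpr fun q => ((A q).isRadialAt_iff V (A q).mem_dom).mpr ⟨?_, ?_, ?_⟩⟩
  · exact hV q (evalFun (ι q) (A q).rad) 1
      (evalFun_smul _ _)
      fun V h => (((A q).isRadialAt_iff V (A q).mem_dom).mp h).1
  · exact hV q (evalFun (ι q) (A q).ang) 0
      (evalFun_smul _ _)
      fun V h => (((A q).isRadialAt_iff V (A q).mem_dom).mp h).2.1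
  · exact fun k => hV q (evalOn (ι q) ((A q).x k)) 0 (fun _ _ => rfl)
      fun V h => (((A q).isRadialAt_iff V (A q).mem_dom).mp h).2.2 k

theorem exists_angular (hJ : IsEllipticIdeal ι J) (A : ∀ p, AdaptedFrame ι J ν p) :
    ∃ T : ASec J, IsAngular ν T.1 := by
  obtain ⟨V, hV⟩ := exists_glue_along hJ (fun q V => IsAngularAt ν V.1 q)
    (fun p => ⟨(A p).T₀ hJ, (A p).dom, (A p).isOpen_dom.mem_nhds (A p).mem_dom,
      fun q hq => (A p).isAngularAt_T₀ hJ hq⟩)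
  refine ⟨V, (isAngular_iff _).mpr fun q => ((A q).isAngularAt_iff V (A q).mem_dom).mpr ⟨?_, ?_, ?_⟩⟩
  · exact hV q (evalFun (ι q) (A q).rad) 0
      (evalFun_smul _ _)
      fun V h => (((A q).isAngularAt_iff V (A q).mem_dom).mp h).1
  · exact hV q (evalFun (ι q) (A q).ang) 1
      (evalFun_smul _ _)
      fun V h => (((A q).isAngularAt_iff V (A q).mem_dom).mp h).2.1
  · exact fun k => hV q (evalOn (ι q) ((A q).x k)) 0 (fun _ _ => rfl)
      fun V h => (((A q).isAngularAt_iff V (A q).mem_dom).mp h).2.2 k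

end Glue

/-! ### The transport equation on D -/

section Transport

variable {F : Type*} [NormedAddCommGroup F] [NormedSpace ℝ F] [FiniteDimensional ℝ F]
  {D : Type*} [TopologicalSpace D] [ChartedSpace F D] [T2Space D] [IsManifold 𝓘(ℝ, F) ∞ D]

/-- Local solvability of `W μ = f` for a vector field `W` which does not vanish at `p`. -/
theorem exists_transport (W : VField F D) (f : Smooth F D) {p : D} {h : Smooth F D}
    (hW : W h p ≠ 0) : ∃ μ : Smooth F D, ∀ᶠ q in 𝓝 p, W μ q = f q := by
  have hc := IsManifold.chart_mem_maximalAtlas (I := 𝓘(ℝ, F)) (n := ∞) p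
  obtain ⟨c, -, -, -⟩ := CutoffChart.exists_cutoffChart (E := F) (chartAt F p)
    (mem_chart_source F p) (contMDiffOn_of_mem_maximalAtlas hc)
    (contMDiffOn_symm_of_mem_maximalAtlas hc) Filter.univ_mem
  let b := Module.finBasis ℝ F
  let l : Fin (Module.finrank ℝ F) → F →L[ℝ] ℝ := fun k => LinearMap.toContinuousLinearMap (b.coord k)
  have hlb : ∀ y : F, ∑ k, l k y • b k = y := fun y => b.sum_repr y
  -- The chart expression of W, cut off; it agrees with W on the chart's inner domain.
  let Y : F → F := fun y => ∑ k, c.push (W (c.coord (l k))) y • b k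
  have hY : ContDiff ℝ ∞ Y := ContDiff.sum fun k _ => (c.contDiff_push _).smul contDiff_const
  have hWY : ∀ (g : Smooth F D), ∀ q ∈ c.dom,
      W g q = fderiv ℝ (c.push g) (c.chart q) (Y (c.chart q)) := by
    intro g q hq
    rw [c.derivation_eq_sum hlb W g hq, map_sum]
    refine Finset.sum_congr rfl fun k _ => ?_
    rw [map_smul, c.push_apply _ hq, c.partialDeriv_apply _ _ hq, smul_eq_mul]
  have hY0 : Y (c.chart p) ≠ 0 := fun h0 => hW (by rw [hWY h p c.mem_dom, h0, map_zero])
  obtain ⟨O, μ, hO, hpO, hμ, hμY⟩ := exists_solve_transport hY (c.contDiff_push f) hY0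
  obtain ⟨m, hm⟩ := exists_smooth_eventuallyEq (E := F) (M := F) (hO.mem_nhds hpO) (g := μ)
    fun x hx => (hμ.contDiffAt (hO.mem_nhds hx)).contMDiffAt
  obtain ⟨O', hO', hO'o, hpO'⟩ := eventually_nhds_iff.mp (hm.and (hO.eventually_mem hpO))
  have hms : ContDiff ℝ ∞ m := contMDiff_iff_contDiff.mp m.contMDiff
  refine ⟨c.pull m hms, ?_⟩
  filter_upwards [c.isOpen_dom.mem_nhds c.mem_dom,
    (c.contMDiffAt_chart c.mem_source).continuousAt.eventually (hO'o.mem_nhds hpO')] with q hq hqO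
  rw [hWY _ q hq]
  have h1 : c.push (c.pull m hms) =ᶠ[𝓝 (c.chart q)] μ := by
    filter_upwards [Metric.isOpen_ball.mem_nhds hq.2, hO'o.mem_nhds hqO] with y hy hy'
    rw [c.push_pull hms hy, (hO' y hy').1]
  rw [h1.fderiv_eq, hμY _ (hO' _ hqO).2, c.push_apply f hq]

end Transport

/-! ### Descent of forms along a partial surjection -/

section Descend

variable {A B L M : Type*} [CommRing A] [AddCommGroup L] [Module A L]
  [CommRing B] [AddCommGroup M] [Module B M]

/-- `Rel` is a partial surjective map `L → M`, linear along `r`. -/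
structure IsRestriction (r : A →+* B) (Rel : L → M → Prop) : Prop where
  surj_fun : Function.Surjective r
  surj : ∀ W, ∃ V, Rel V W
  add : ∀ {V V' W W'}, Rel V W → Rel V' W' → Rel (V + V') (W + W')
  smul : ∀ (f : A) {V W}, Rel V W → Rel (f • V) (r f • W)

variable {r : A →+* B} {Rel : L → M → Prop}

theorem IsRestriction.sub (h : IsRestriction r Rel) {V V' : L} {W W' : M} (hV : Rel V W)
    (hV' : Rel V' W') : Rel (V - V') (W - W') := by
  have h1 := h.add hV (h.smul (-1) hV')
  rwa [map_neg, map_one, neg_one_smul, neg_one_smul, ← sub_eq_add_neg, ← sub_eq_add_neg] at h1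

/-- A form on `L` whose restriction vanishes as soon as one argument restricts to zero induces a
form on `M`. -/
theorem IsRestriction.existsUnique_form (h : IsRestriction r Rel) {k : ℕ} (η : Form A L k)
    (hη : ∀ (V : Fin k → L) (W : Fin k → M), (∀ i, Rel (V i) (W i)) → ∀ i, W i = 0 → r (η V) = 0) :
    ∃! ξ : Form B M k, ∀ V W, (∀ i, Rel (V i) (W i)) → ξ W = r (η V) := by
  classical
  have hupd : ∀ {V : Fin k → L} {W : Fin k → M} (_ : ∀ i, Rel (V i) (W i)) (i : Fin k) {v w}
      (_ : Rel v w), ∀ j, Rel (Function.update V i v j) (Function.update W i w j) := by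
    intro V W hVW i v w hvw j
    by_cases hj : j = i
    · subst hj; simpa using hvw
    · simpa [hj] using hVW j
  have hind : ∀ (V V' : Fin k → L) (W : Fin k → M), (∀ i, Rel (V i) (W i)) →
      (∀ i, Rel (V' i) (W i)) → r (η V) = r (η V') := by
    intro V V' W hV hV'
    -- The lifts are exchanged one argument at a time; at each exchange the difference restricts to
    -- zero in that argument.
    have key : ∀ s : Finset (Fin k), r (η (s.piecewise V V')) = r (η V') := by
      intro s
      induction s using Finset.induction_on with
      | empty => rw [Finset.piecewise_empty]
      | insert j s hj ih =>
        rw [← ih, Finset.piecewise_insert]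
        set P := s.piecewise V V' with hP
        have hPW : ∀ i, Rel (P i) (W i) := fun i => by
          by_cases hi : i ∈ s
          · rw [hP, Finset.piecewise_eq_of_mem _ _ _ hi]; exact hV i
          · rw [hP, Finset.piecewise_eq_of_notMem _ _ _ hi]; exact hV' i
        have h1 : P = Function.update P j (V' j) := by
          rw [← Finset.piecewise_eq_of_notMem s V V' hj, Function.update_eq_self]
        conv_rhs => rw [h1]
        rw [← sub_eq_zero, ← map_sub, ← η.map_update_sub]
        refine hη _ _ (hupd hPW j (h.sub (hV j) (hV' j))) j ?_
        simp
    have := key Finset.univ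
    rwa [Finset.piecewise_univ] at this
  choose s hs using h.surj
  have hval : ∀ (V : Fin k → L) (W : Fin k → M), (∀ i, Rel (V i) (W i)) →
      r (η fun i => s (W i)) = r (η V) := fun V W hVW => hind _ _ W (fun i => hs _) hVW
  let ξ : Form B M k :=
    { toFun := fun W => r (η fun i => s (W i))
      map_update_add' := by
        intro _ W i x y
        have hd : ∀ x, r (η fun j => s (Function.update W i x j)) =
            r (η (Function.update (fun j => s (W j)) i (s x))) := fun x =>
          hval _ _ (by convert hupd (fun j => hs (W j)) i (hs x))
        rw [hd x, hd y, ← map_add, ← η.map_update_add]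
        exact hval _ _ (by convert hupd (fun j => hs (W j)) i (h.add (hs x) (hs y)))
      map_update_smul' := by
        intro _ W i c x
        obtain ⟨f, rfl⟩ := h.surj_fun c
        have hd : r (η fun j => s (Function.update W i x j)) =
            r (η (Function.update (fun j => s (W j)) i (s x))) :=
          hval _ _ (by convert hupd (fun j => hs (W j)) i (hs x))
        rw [hd, smul_eq_mul, ← map_mul, ← smul_eq_mul, ← η.map_update_smul]
        exact hval _ _ (by convert hupd (fun j => hs (W j)) i (h.smul f (hs x)))
      map_eq_zero_of_eq' := by
        intro W i j hij hne
        have h1 : η (fun i => s (W i)) = 0 := η.map_eq_zero_of_eq _ (congrArg s hij) hne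
        change r (η fun i => s (W i)) = 0
        rw [h1, map_zero] }
  refine ⟨ξ, fun V W hVW => hval V W hVW, ?_⟩
  · intro ξ hξ
    ext W
    exact hξ _ _ fun i => hs (W i)

end Descend

section CompatMore

variable {A A' N N' : Type*} [CommRing A] [AddCommGroup N] [Module A N]
  [CommRing A'] [AddCommGroup N'] [Module A' N'] {f : A →+* A'} {Rel : N → N' → Prop}

theorem compat_zero : Compat f Rel 0 0 := by
  intro k V W _
  simp

theorem Compat.sub {a b : Forms A N} {a' b' : Forms A' N'} (ha : Compat f Rel a a')
    (hb : Compat f Rel b b') : Compat f Rel (a - b) (a' - b') := by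
  rw [sub_eq_add_neg, sub_eq_add_neg]
  exact ha.add hb.neg

theorem Compat.smul (c : A) {a : Forms A N} {a' : Forms A' N'} (ha : Compat f Rel a a') :
    Compat f Rel (c • a) (f c • a') := by
  intro k V W h
  simp [ha k V W h]

theorem Compat.sum {κ : Type*} (s : Finset κ) {a : κ → Forms A N} {a' : κ → Forms A' N'}
    (h : ∀ i, Compat f Rel (a i) (a' i)) : Compat f Rel (∑ i ∈ s, a i) (∑ i ∈ s, a' i) := by
  classical
  induction s using Finset.induction_on with
  | empty => exact compat_zero
  | insert i s hi ih =>
    rw [Finset.sum_insert hi, Finset.sum_insert hi]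
    exact (h i).add ih

/-- Identities on `D` are proved by showing that both sides are induced by the same form upstairs.
-/
theorem Compat.unique (hs : ∀ W, ∃ V, Rel V W) {a : Forms A N} {b b' : Forms A' N'}
    (h : Compat f Rel a b) (h' : Compat f Rel a b') : b = b' := by
  choose s hs using hs
  funext k
  ext W
  rw [h k _ W fun i => hs (W i), h' k _ W fun i => hs (W i)]

theorem IsRestriction.compat_smul_zero {a : Forms A N} {c : A} (hc : f c = 0) :
    Compat f Rel (c • a) 0 := by
  intro k V W _
  simp [hc]

end CompatMore

/-! ### Values of forms at a point -/

section Evaluation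

variable {A N : Type*} [CommRing A] [Algebra ℝ A] [AddCommGroup N] [Module A N] [Module ℝ N]
  [IsScalarTower ℝ A N] (e : A →ₐ[ℝ] ℝ)

/-- The value of a form at a point, the point being given by a real character of the algebra. -/
def evForm {k : ℕ} (a : Form A N k) : Form ℝ N k where
  toFun V := e (a V)
  map_update_add' := by
    intro _ V i x y
    rw [a.map_update_add, map_add]
  map_update_smul' := by
    intro _ V i c x
    rw [← algebraMap_smul A c x, a.map_update_smul, smul_eq_mul, map_mul, AlgHom.commutes]
    rfl
  map_eq_zero_of_eq' := by
    intro V i j hij hne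
    rw [a.map_eq_zero_of_eq V hij hne, map_zero]

/-- The value of an inhomogeneous form at a point. -/
def evForms (a : Forms A N) : Forms ℝ N := fun k => evForm e (a k)

theorem evForms_apply (a : Forms A N) (k : ℕ) (V : Fin k → N) : evForms e a k V = e (a k V) := rfl

theorem compat_evForms (a : Forms A N) : Compat (e : A →+* ℝ) (· = ·) a (evForms e a) := by
  intro k V W h
  rw [show V = W from funext h]
  rfl

variable {e} in
theorem Compat.eq_evForms {a : Forms A N} {a' : Forms ℝ N}
    (h : Compat (e : A →+* ℝ) (· = ·) a a') : a' = evForms e a :=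
  h.unique (fun W => ⟨W, rfl⟩) (compat_evForms e a)

theorem evForms_wedge (a b : Forms A N) : evForms e (a ⋏ b) = evForms e a ⋏ evForms e b :=
  ((compat_evForms e a).wedge (compat_evForms e b)).eq_evForms.symm

theorem evForms_add (a b : Forms A N) : evForms e (a + b) = evForms e a + evForms e b :=
  ((compat_evForms e a).add (compat_evForms e b)).eq_evForms.symm

theorem evForms_neg (a : Forms A N) : evForms e (-a) = -evForms e a :=
  (compat_evForms e a).neg.eq_evForms.symm

theorem evForms_sub (a b : Forms A N) : evForms e (a - b) = evForms e a - evForms e b :=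
  ((compat_evForms e a).sub (compat_evForms e b)).eq_evForms.symm

theorem evForms_zero : evForms e (0 : Forms A N) = 0 := compat_zero.eq_evForms.symm

theorem evForms_inter (V : N) (a : Forms A N) : evForms e (inter V a) = inter V (evForms e a) :=
  ((compat_evForms e a).inter rfl).eq_evForms.symm

theorem evForms_homog {k : ℕ} (a : Form A N k) : evForms e (homog a) = homog (evForm e a) :=
  (compat_homog (f := (e : A →+* ℝ)) (Rel := (· = ·)) fun V W h => by
    rw [show V = W from funext h]; rfl).eq_evForms.symm

theorem evForms_formPow (a : Forms A N) (m : ℕ) :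
    evForms e (formPow a m) = formPow (evForms e a) m :=
  ((compat_evForms e a).formPow m).eq_evForms.symm

theorem compat_evForm {k : ℕ} (a : Form A N k) :
    Compat (e : A →+* ℝ) (· = ·) (homog a) (homog (evForm e a)) := by
  rw [← evForms_homog]
  exact compat_evForms e _

theorem evForms_formExp (b : Form A N 2) : evForms e (formExp b) = formExp (evForm e b) :=
  ((compat_evForm e b).formExp fun c => e.commutes c).eq_evForms.symm

variable {A' N' : Type*} [CommRing A'] [Algebra ℝ A'] [AddCommGroup N'] [Module A' N'] [Module ℝ N']
  [IsScalarTower ℝ A' N'] {e}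

theorem Compat.evForms {f : A →+* A'} {Rel : N → N' → Prop} {a : Forms A N} {a' : Forms A' N'}
    (h : Compat f Rel a a') (e' : A' →ₐ[ℝ] ℝ) (he : ∀ x, e' (f x) = e x) :
    Compat (RingHom.id ℝ) Rel (evForms e a) (EllipticPoisson.evForms e' a') := by
  intro k V W hVW
  rw [evForms_apply, evForms_apply, h k V W hVW, he]
  rfl

end Evaluation

local instance moduleASec {E : Type*} [NormedAddCommGroup E] [NormedSpace ℝ E]
    {X : Type*} [TopologicalSpace X] [ChartedSpace E X] (J : Ideal (Smooth E X)) :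
    Module (Smooth E X) (ASec J) := inferInstance

local instance moduleRealASec {E : Type*} [NormedAddCommGroup E] [NormedSpace ℝ E]
    {X : Type*} [TopologicalSpace X] [ChartedSpace E X] (J : Ideal (Smooth E X)) :
    Module ℝ (ASec J) := inferInstance

local instance towerASec {E : Type*} [NormedAddCommGroup E] [NormedSpace ℝ E]
    {X : Type*} [TopologicalSpace X] [ChartedSpace E X] (J : Ideal (Smooth E X)) :
    IsScalarTower ℝ (Smooth E X) (ASec J) := inferInstance

/-! ### Restriction from the elliptic tangent bundle to D -/

section Restrict

variable {E : Type*} [NormedAddCommGroup E] [NormedSpace ℝ E]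
  {F : Type*} [NormedAddCommGroup F] [NormedSpace ℝ F]
  {X : Type*} [TopologicalSpace X] [ChartedSpace E X]
  {D : Type*} [TopologicalSpace D] [ChartedSpace F D]
  (ι : C^∞⟮𝓘(ℝ, F), D; 𝓘(ℝ, E), X⟯) (J : Ideal (Smooth E X))

/-- Restriction of functions to `D`. -/
def restrict : Smooth E X →+* Smooth F D where
  toFun f := f.comp ι
  map_one' := rfl
  map_mul' _ _ := rfl
  map_zero' := rfl
  map_add' _ _ := rfl

theorem restrict_apply (f : Smooth E X) (q : D) : restrict ι f q = f (ι q) := rfl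

/-- The section `V` of the elliptic tangent bundle restricts to the vector field `W` on `D`. -/
def Related (V : ASec J) (W : VField F D) : Prop := IsRelated ι V.1 W

variable {ι J}

/-- The value at a point of a form as a function of one of its arguments. -/
def slotFun (x : X) {k : ℕ} (η : AForm J k) (W : Fin k → ASec J) (i : Fin k) : ASec J →+ ℝ where
  toFun V := η (Function.update W i V) x
  map_zero' := by rw [η.map_update_zero]; rfl
  map_add' V V' := by rw [η.map_update_add]; rfl

theorem slotFun_smul (x : X) {k : ℕ} (η : AForm J k) (W : Fin k → ASec J) (i : Fin k)
    (f : Smooth E X) (V : ASec J) : slotFun x η W i (f • V) = f x * slotFun x η W i V :=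
  congrArg (evalAt x) (η.map_update_smul W i f V)

theorem related_apply {V : ASec J} {W : VField F D} (h : Related ι J V W) (f : Smooth E X) :
    restrict ι ⁅V, f⁆ = ⁅W, restrict ι f⁆ := h f

theorem related_lie {V V' : ASec J} {W W' : VField F D} (h : Related ι J V W)
    (h' : Related ι J V' W') : Related ι J ⁅V, V'⁆ ⁅W, W'⁆ := by
  intro f
  ext q
  change ⁅V, V'⁆.1 f (ι q) = _
  rw [asec_lie_apply, derivation_lie_apply, ← h' f, ← h f, ← h, ← h']
  rfl

theorem related_zero_of_radial {R : ASec J} (hR : IsRadial ι R.1) : Related ι J R 0 := hR.vanishes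

variable {ν : Coorientation ι}

theorem related_zero_of_angular {T : ASec J} (hT : IsAngular ν T.1) : Related ι J T 0 := hT.vanishes

theorem restrict_eq_zero_iff {f : Smooth E X} : restrict ι f = 0 ↔ ∀ q, f (ι q) = 0 :=
  ⟨fun h q => DFunLike.congr_fun h q, fun h => ContMDiffMap.ext h⟩

theorem theForm_eq {k : ℕ} {P : DForm F D k → Prop} (h : ∃! ξ, P ξ) : P (theForm P) := by
  rw [theForm, dif_pos h]
  exact h.choose_spec.1

variable [FiniteDimensional ℝ E] [T2Space X] [IsManifold 𝓘(ℝ, E) ∞ X]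

theorem radial_coeff {R : ASec J} (hR : IsRadial ι R.1) {p : D} (A : AdaptedFrame ι J ν p) {q : D}
    (hq : ι q ∈ A.dom) :
    A.rad R (ι q) = 1 ∧ A.ang R (ι q) = 0 ∧ ∀ k, R.1 (A.x k) (ι q) = 0 :=
  (A.isRadialAt_iff R hq).mp ((isRadial_iff _).mp hR q)

theorem angular_coeff {T : ASec J} (hT : IsAngular ν T.1) {p : D} (A : AdaptedFrame ι J ν p) {q : D}
    (hq : ι q ∈ A.dom) :
    A.rad T (ι q) = 0 ∧ A.ang T (ι q) = 1 ∧ ∀ k, T.1 (A.x k) (ι q) = 0 :=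
  (A.isAngularAt_iff T hq).mp ((isAngular_iff _).mp hT q)

/-- The expansion of a section at a point of `D`, in terms of a radial and an angular section. -/
theorem frame_expand (hJ : IsEllipticIdeal ι J) {R T : ASec J} (hR : IsRadial ι R.1)
    (hT : IsAngular ν T.1) {p : D} (A : AdaptedFrame ι J ν p) {q : D} (hq : ι q ∈ A.dom)
    (l : ASec J →+ ℝ) (hl : ∀ (f : Smooth E X) V, l (f • V) = f (ι q) * l V) (V : ASec J) :
    l V = A.rad V (ι q) * l R + A.ang V (ι q) * l T +
      ∑ k, V.1 (A.x k) (ι q) * l (A.E₀ hJ k) := by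
  obtain ⟨hR1, hR2, hR3⟩ := radial_coeff hR A hq
  obtain ⟨hT1, hT2, hT3⟩ := angular_coeff hT A hq
  have h1 := A.functional_eq hJ R hq l hl
  have h2 := A.functional_eq hJ T hq l hl
  simp only [hR1, hR2, hR3, hT1, hT2, hT3, zero_mul, one_mul, Finset.sum_const_zero, add_zero,
    zero_add] at h1 h2
  rw [A.functional_eq hJ V hq l hl, h1, h2]

theorem radial_unique (hJ : IsEllipticIdeal ι J) (A : ∀ p, AdaptedFrame ι J ν p) {R R' : ASec J}
    (hR : IsRadial ι R.1) (hR' : IsRadial ι R'.1) {q : D} (l : ASec J →+ ℝ)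
    (hl : ∀ (f : Smooth E X) V, l (f • V) = f (ι q) * l V) : l R = l R' := by
  obtain ⟨hR1, hR2, hR3⟩ := radial_coeff hR (A q) (A q).mem_dom
  obtain ⟨hT1, hT2, hT3⟩ := radial_coeff hR' (A q) (A q).mem_dom
  rw [(A q).functional_eq hJ R (A q).mem_dom l hl, (A q).functional_eq hJ R' (A q).mem_dom l hl]
  simp only [hR1, hR2, hR3, hT1, hT2, hT3]

theorem angular_unique (hJ : IsEllipticIdeal ι J) (A : ∀ p, AdaptedFrame ι J ν p) {R R' : ASec J}
    (hR : IsAngular ν R.1) (hR' : IsAngular ν R'.1) {q : D} (l : ASec J →+ ℝ)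
    (hl : ∀ (f : Smooth E X) V, l (f • V) = f (ι q) * l V) : l R = l R' := by
  obtain ⟨hR1, hR2, hR3⟩ := angular_coeff hR (A q) (A q).mem_dom
  obtain ⟨hT1, hT2, hT3⟩ := angular_coeff hR' (A q) (A q).mem_dom
  rw [(A q).functional_eq hJ R (A q).mem_dom l hl, (A q).functional_eq hJ R' (A q).mem_dom l hl]
  simp only [hR1, hR2, hR3, hT1, hT2, hT3]

/-- Sections vanishing at q as vector fields have no coordinate components, which leaves the span of
R and T. -/
theorem functional_of_related_zero (hJ : IsEllipticIdeal ι J) (A : ∀ p, AdaptedFrame ι J ν p)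
    {R T : ASec J} (hR : IsRadial ι R.1) (hT : IsAngular ν T.1) {V : ASec J} {q : D}
    (hV : ∀ f, V.1 f (ι q) = 0) (l : ASec J →+ ℝ)
    (hl : ∀ (f : Smooth E X) V, l (f • V) = f (ι q) * l V) :
    l V = (A q).rad V (ι q) * l R + (A q).ang V (ι q) * l T := by
  rw [frame_expand hJ hR hT (A q) (A q).mem_dom l hl V]
  simp only [hV, zero_mul, Finset.sum_const_zero, add_zero]

/-- Residues do not depend on the choice of radial section. -/
theorem restrict_radial (hJ : IsEllipticIdeal ι J) (A : ∀ p, AdaptedFrame ι J ν p) {R R' : ASec J}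
    (hR : IsRadial ι R.1) (hR' : IsRadial ι R'.1) {k : ℕ} (η : AForm J k) (W : Fin k → ASec J)
    (i : Fin k) : restrict ι (η (Function.update W i R)) = restrict ι (η (Function.update W i R')) :=
  ContMDiffMap.ext fun q =>
    radial_unique hJ A hR hR' (slotFun (ι q) η W i) (slotFun_smul _ η W i)

/-- Residues do not depend on the choice of angular section. -/
theorem restrict_angular (hJ : IsEllipticIdeal ι J) (A : ∀ p, AdaptedFrame ι J ν p) {R R' : ASec J}
    (hR : IsAngular ν R.1) (hR' : IsAngular ν R'.1) {k : ℕ} (η : AForm J k) (W : Fin k → ASec J)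
    (i : Fin k) : restrict ι (η (Function.update W i R)) = restrict ι (η (Function.update W i R')) :=
  ContMDiffMap.ext fun q =>
    angular_unique hJ A hR hR' (slotFun (ι q) η W i) (slotFun_smul _ η W i)

variable [SigmaCompactSpace X]

theorem isRestriction_related (hJ : IsEllipticIdeal ι J) (A : ∀ p, AdaptedFrame ι J ν p) :
    IsRestriction (restrict ι) (Related ι J) where
  surj_fun := exists_extension hJ A
  surj := exists_lift hJ A
  add := by
    intro V V' W W' h h' f
    ext q
    change V.1 f (ι q) + V'.1 f (ι q) = W (f.comp ι) q + W' (f.comp ι) q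
    rw [← h f, ← h' f]
    rfl
  smul := by
    intro g V W h f
    ext q
    change g (ι q) * V.1 f (ι q) = g (ι q) * W (f.comp ι) q
    rw [← h f]
    rfl

/-- Forms annihilated along `D` by the radial and the angular sections restrict to `D`. -/
theorem existsUnique_restrict (hJ : IsEllipticIdeal ι J) (A : ∀ p, AdaptedFrame ι J ν p)
    {R T : ASec J} (hR : IsRadial ι R.1) (hT : IsAngular ν T.1) {k : ℕ} (η : AForm J k)
    (hη : ∀ W i, W i = R ∨ W i = T → restrict ι (η W) = 0) :
    ∃! ξ : DForm F D k, ∀ V W, (∀ i, Related ι J (V i) (W i)) → ξ W = restrict ι (η V) := by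
  refine (isRestriction_related hJ A).existsUnique_form η fun V W hVW i hi => ?_
  rw [restrict_eq_zero_iff]
  intro q
  have h0 : ∀ f, (V i).1 f (ι q) = 0 := fun f => by
    have := hVW i f
    rw [hi] at this
    exact DFunLike.congr_fun this q
  have h1 := functional_of_related_zero hJ A hR hT h0 (slotFun (ι q) η V i) (slotFun_smul _ η V i)
  have h2 : slotFun (ι q) η V i (V i) = η V (ι q) := by
    change η (Function.update V i (V i)) (ι q) = _
    rw [Function.update_eq_self]
  have h3 : ∀ U, U = R ∨ U = T → slotFun (ι q) η V i U = 0 := fun U hU =>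
    restrict_eq_zero_iff.mp (hη (Function.update V i U) i (by rwa [Function.update_self])) q
  rw [← h2, h1, h3 R (Or.inl rfl), h3 T (Or.inr rfl), mul_zero, mul_zero, add_zero]

/-! ### Existence and uniqueness of the residues -/

section Residues

variable (hJ : IsEllipticIdeal ι J) (A : ∀ p, AdaptedFrame ι J ν p) {R T : ASec J}
  (hR : IsRadial ι R.1) (hT : IsAngular ν T.1)

include hJ A hR hT

/-- Two radial (or two angular) sections agree along `D` up to what forms can detect, so testing on
one pair suffices. -/
theorem isResQ_iff {k : ℕ} (η : AForm J (k + 2)) (ξ : DForm F D k) : IsResQ ν η ξ ↔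
    ∀ V W, (∀ i, Related ι J (V i) (W i)) →
      ξ W = restrict ι (η (Matrix.vecCons R (Matrix.vecCons T V))) := by
  constructor
  · exact fun h V W hVW => h R T hR hT V W hVW
  · intro h R' T' hR' hT' V W hVW
    rw [h V W hVW]
    have h1 := restrict_radial hJ A hR hR' η (Matrix.vecCons R (Matrix.vecCons T V)) 0
    have h2 := restrict_angular hJ A hT hT' η (Matrix.vecCons R' (Matrix.vecCons T V)) 1
    simp only [Matrix.vecCons] at h1 h2 ⊢
    rw [Fin.update_cons_zero, Fin.update_cons_zero] at h1
    rw [← Fin.succ_zero_eq_one, ← Fin.cons_update, ← Fin.cons_update, Fin.update_cons_zero,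
      Fin.update_cons_zero] at h2
    rw [h1, h2]
    rfl

omit hT in
theorem isResR_iff {k : ℕ} (η : AForm J (k + 1)) (ξ : DForm F D k) : IsResR ι η ξ ↔
    ∀ V W, (∀ i, Related ι J (V i) (W i)) → ξ W = restrict ι (η (Matrix.vecCons R V)) := by
  constructor
  · exact fun h V W hVW => h R hR V W hVW
  · intro h R' hR' V W hVW
    rw [h V W hVW]
    have h1 := restrict_radial hJ A hR hR' η (Matrix.vecCons R V) 0
    simp only [Matrix.vecCons] at h1 ⊢
    rw [Fin.update_cons_zero, Fin.update_cons_zero] at h1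
    rw [h1]
    rfl

omit hR in
theorem isResTheta_iff {k : ℕ} (η : AForm J (k + 1)) (ξ : DForm F D k) : IsResTheta ν η ξ ↔
    ∀ V W, (∀ i, Related ι J (V i) (W i)) → ξ W = restrict ι (η (Matrix.vecCons T V)) := by
  constructor
  · exact fun h V W hVW => h T hT V W hVW
  · intro h R' hR' V W hVW
    rw [h V W hVW]
    have h1 := restrict_angular hJ A hT hR' η (Matrix.vecCons T V) 0
    simp only [Matrix.vecCons] at h1 ⊢
    rw [Fin.update_cons_zero, Fin.update_cons_zero] at h1
    rw [h1]
    rfl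

/-- By alternation ι_T ι_R η is annihilated by R and T, hence descends without further hypothesis.
-/
theorem existsUnique_resQ {k : ℕ} (η : AForm J (k + 2)) : ∃! ξ : DForm F D k, IsResQ ν η ξ := by
  simp only [isResQ_iff hJ A hR hT]
  refine existsUnique_restrict hJ A hR hT (contr T (contr R η)) fun W i hi => ?_
  have h : contr T (contr R η) W = 0 := by
    rcases hi with hi | hi
    · refine η.map_eq_zero_of_eq (i := 0) (j := i.succ.succ) _ ?_ (Fin.succ_ne_zero _).symm
      simpa using hi.symm
    · refine η.map_eq_zero_of_eq (i := 1) (j := i.succ.succ) _ ?_ ?_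
      · simpa using hi.symm
      · rw [← Fin.succ_zero_eq_one, (Fin.succ_injective _).ne_iff]
        exact (Fin.succ_ne_zero _).symm
  rw [h, map_zero]

theorem compat_resQForms (a : Forms (Smooth E X) (ASec J)) :
    Compat (restrict ι) (Related ι J) (inter T (inter R a)) (resQForms ν a) := fun k V W h =>
  (isResQ_iff hJ A hR hT _ _).mp (theForm_eq (existsUnique_resQ hJ A hR hT (a (k + 2)))) V W h

theorem restrict_eq_zero_of_resQ {η : AForm J 2} (h : resQ ν (k := 0) η = 0) :
    restrict ι (η ![R, T]) = 0 := by
  have h1 := (isResQ_iff hJ A hR hT η _).mp (theForm_eq (existsUnique_resQ hJ A hR hT η))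
    ![] ![] (fun i => i.elim0)
  rw [← h1]
  exact DFunLike.congr_fun h ![]

/-- The vanishing of η(R, T) along `D` is exactly what makes ι_R η annihilated by T there. -/
theorem existsUnique_resR {η : AForm J 2} (h : restrict ι (η ![R, T]) = 0) :
    ∃! ξ : DForm F D 1, IsResR ι η ξ := by
  simp only [isResR_iff hJ A hR]
  refine existsUnique_restrict hJ A hR hT (contr R η) fun W i hi => ?_
  rw [Subsingleton.elim i 0] at hi
  have hW : W = ![W 0] := by ext i; rw [Subsingleton.elim i 0]; rfl
  rw [hW]
  rcases hi with hi | hi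
  · rw [hi]
    have : contr R η ![R] = 0 := η.map_eq_zero_of_eq (i := 0) (j := 1) _ rfl (by simp)
    rw [this, map_zero]
  · rw [hi]; exact h

theorem existsUnique_resTheta {η : AForm J 2} (h : restrict ι (η ![R, T]) = 0) :
    ∃! ξ : DForm F D 1, IsResTheta ν η ξ := by
  simp only [isResTheta_iff hJ A hT]
  refine existsUnique_restrict hJ A hR hT (contr T η) fun W i hi => ?_
  rw [Subsingleton.elim i 0] at hi
  have hW : W = ![W 0] := by ext i; rw [Subsingleton.elim i 0]; rfl
  rw [hW]
  rcases hi with hi | hi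
  · rw [hi]
    have h1 : contr T η ![R] = -η ![R, T] := by
      have := η.map_swap (i := 0) (j := 1) ![R, T] (by simp)
      rw [← this]
      exact congrArg η (funext fun i => by fin_cases i <;> rfl)
    rw [h1, map_neg, h, neg_zero]
  · rw [hi]
    have : contr T η ![T] = 0 := η.map_eq_zero_of_eq (i := 0) (j := 1) _ rfl (by simp)
    rw [this, map_zero]

theorem compat_resR {η : AForm J 2} (h : restrict ι (η ![R, T]) = 0) :
    Compat (restrict ι) (Related ι J) (inter R (homog η)) (homog (resR ι η)) := by
  rw [inter_homog_succ]
  exact compat_homog ((isResR_iff hJ A hR _ _).mp (theForm_eq (existsUnique_resR hJ A hR hT h)))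

theorem compat_resTheta {η : AForm J 2} (h : restrict ι (η ![R, T]) = 0) :
    Compat (restrict ι) (Related ι J) (inter T (homog η)) (homog (resTheta ν η)) := by
  rw [inter_homog_succ]
  exact compat_homog
    ((isResTheta_iff hJ A hT _ _).mp (theForm_eq (existsUnique_resTheta hJ A hR hT h)))

end Residues

end Restrict

/-! ### Double contraction of the exponential -/

section OneForm

variable {A N : Type*} [CommRing A] [AddCommGroup N] [Module A N]

/-- A linear functional as a one-form. -/
def oneForm (l : N →ₗ[A] A) : Form A N 1 := AlternatingMap.ofSubsingleton A N A (0 : Fin 1) l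

variable [Algebra ℝ A]

/-- Two applications of the derivation rule; the sign arises from moving T past the one-form ι_R b.
-/
theorem inter_inter_wedge_formExp (b : Form A N 2) (R T : N) : inter T (inter R (formExp b)) =
    b ![R, T] • formExp b - inter R (homog b) ⋏ inter T (homog b) ⋏ formExp b := by
  rw [inter_formExp, inter_wedge, inter_formExp, inter_homog_succ, inter_homog_one, smul_wedge,
    formOne_wedge, parity_homog_one, neg_wedge, ← sub_eq_add_neg]
  rfl

/-- These are the terms of degree at most four; the quadratic one contributes the product of
residues because 1/2! cancels the factor 2. -/
theorem inter_inter_expTrunc_two (b : Form A N 2) (R T : N) :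
    inter T (inter R (∑ k ∈ Finset.range 3, ((k ! : ℝ)⁻¹) • formPow (homog b) k)) =
      b ![R, T] • (formOne + homog b) - inter R (homog b) ⋏ inter T (homog b) := by
  have h1 : inter T (inter R (homog b)) = b ![R, T] • formOne := by
    rw [inter_homog_succ, inter_homog_one]
    rfl
  have h2 : inter R (homog b ⋏ homog b) = (2 : A) • (inter R (homog b) ⋏ homog b) := by
    rw [inter_wedge, parity_homog_two, wedge_comm_of_even (parity_homog_two b), ← two_smul A]
  have h3 : inter T (inter R (homog b ⋏ homog b)) =
      (2 : A) • (b ![R, T] • homog b - inter R (homog b) ⋏ inter T (homog b)) := by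
    rw [h2, inter_smul, inter_wedge, h1, smul_wedge, formOne_wedge, inter_homog_succ R,
      parity_homog_one, neg_wedge, sub_eq_add_neg]
  have h4 : (algebraMap ℝ A) (2⁻¹) * 2 = 1 := by
    rw [show (2 : A) = algebraMap ℝ A 2 from (map_ofNat _ 2).symm, ← map_mul]
    norm_num
  simp only [Finset.sum_range_succ, Finset.sum_range_zero, formPow, wedge_formOne, zero_add,
    inter_add, Nat.factorial, Nat.cast_one, inv_one, one_smul, Nat.mul_one, Nat.cast_ofNat,
    Forms.real_smul_eq, inter_smul, inter_formOne, h1, h3, smul_smul,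
    map_one, Nat.succ_eq_add_one, Nat.reduceAdd]
  rw [h4, one_smul, smul_add]
  abel

end OneForm

/-! ### Top-degree forms in a frame -/

section Real

variable {N : Type*} [AddCommGroup N] [Module ℝ N] {κ : Type*} [Fintype κ]
  {e : κ → N} {ε : κ → Form ℝ N 1}

/-- A form of top degree is determined by its contraction with two independent vectors. -/
theorem Framed.inter_inter_ne_zero {η : Forms ℝ N} (h : Framed e ε η) {d : ℕ}
    (hd : IsHomogeneous d η) (hκ : Fintype.card κ ≤ d) {a b : Form ℝ N 1} {R T : N}
    (ha : Framed e ε (homog a)) (hb : Framed e ε (homog b)) (haR : a ![R] = 1) (hbT : b ![T] = 1)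
    (hbR : b ![R] = 0) (hη : η ≠ 0) : EllipticPoisson.inter T (EllipticPoisson.inter R η) ≠ 0 := by
  -- Nothing lives above the top degree, so c ∧ η = 0; contracting with Z recovers η from ι_Zη
  -- whenever c(Z) = 1. Since b(R) = 0, this applies first to (b, T) under ι_R, then to (a, R).
  have top : ∀ {c : Form ℝ N 1}, Framed e ε (homog c) → homog c ⋏ η = 0 := by
    intro c hc
    funext k
    by_cases hk : k = 1 + d
    · exact (hc.wedge h).eq_zero_of_card_lt (by omega)
    · exact (isHomogeneous_homog c).wedge hd k hk
  have key : ∀ {c : Form ℝ N 1} {Z : N}, Framed e ε (homog c) → c ![Z] = 1 →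
      η = homog c ⋏ EllipticPoisson.inter Z η := by
    intro c Z hc hcZ
    have h1 := congrArg (EllipticPoisson.inter Z) (top hc)
    rw [inter_wedge, inter_homog_one, hcZ, one_smul, formOne_wedge, parity_homog_one, neg_wedge,
      inter_zero] at h1
    exact add_neg_eq_zero.mp h1
  intro h0
  refine hη ?_
  have h1 := key ha haR
  have h2 := congrArg (EllipticPoisson.inter R) (key hb hbT)
  rw [inter_wedge, inter_homog_one, hbR, Forms.zero_smul, zero_wedge, zero_add, inter_comm, h0,
    neg_zero, wedge_zero] at h2
  rw [h1, h2, wedge_zero]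

/-- In the presence of a frame the exponential is a finite sum. -/
theorem formExp_eq_sum_of_framed {b : Form ℝ N 2} (h : Framed e ε (homog b)) {n : ℕ}
    (hn : Fintype.card κ ≤ 2 * n) :
    formExp b = ∑ k ∈ Finset.range (n + 1), ((k ! : ℝ)⁻¹) • formPow (homog b) k := by
  funext k
  rw [formExp_eq_expTrunc b (le_max_left k n), expTrunc]
  refine congrFun (Finset.sum_subset (Finset.range_subset_range.mpr
    (by have := le_max_right k n; omega)) fun j _ hj => ?_).symm k
  have : formPow (homog b) j = 0 := by
    funext i
    by_cases hi : i = 2 * j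
    · exact (h.formPow j).eq_zero_of_card_lt (by simp at hj; omega)
    · exact formPow_homog_two_ne b hi
  rw [this, smul_zero]

end Real

/-! ### Frame and coframe at points of D, and the nonvanishing top power -/

section Coframe

variable {E : Type*} [NormedAddCommGroup E] [NormedSpace ℝ E]
  {F : Type*} [NormedAddCommGroup F] [NormedSpace ℝ F]
  {X : Type*} [TopologicalSpace X] [ChartedSpace E X]
  {D : Type*} [TopologicalSpace D] [ChartedSpace F D]
  {ι : C^∞⟮𝓘(ℝ, F), D; 𝓘(ℝ, E), X⟯} {J : Ideal (Smooth E X)}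

/-- The differential of a function, as a form on the elliptic tangent bundle. -/
def dForm (f : Smooth E X) : AForm J 1 := oneForm
  { toFun := fun V => V.1 f
    map_add' := fun _ _ => rfl
    map_smul' := fun _ _ => rfl }

theorem dForm_apply (f : Smooth E X) (V : Fin 1 → ASec J) : dForm f V = (V 0).1 f := rfl

/-- The value of a form at a point. -/
abbrev formAt (x : X) (a : Forms (Smooth E X) (ASec J)) : Forms ℝ (ASec J) := evForms (evalAt x) a

/-- The value of a form on `D` at a point. -/
abbrev dformAt (q : D) (a : DForms F D) : Forms ℝ (VField F D) := evForms (evalAt q) a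

theorem agreeAt_iff {ρ ρ' : DForms F D} {q : D} : AgreeAt ρ ρ' q ↔ dformAt q ρ = dformAt q ρ' := by
  constructor
  · intro h
    funext k
    ext W
    exact h k W
  · intro h k W
    exact congrArg (fun a : Forms ℝ (VField F D) => a k W) h

theorem nonzeroAt_iff {k : ℕ} {ρ : DForms F D} {q : D} : NonzeroAt (ρ k) q ↔ dformAt q ρ k ≠ 0 := by
  constructor
  · rintro ⟨W, hW⟩ h
    exact hW (congrArg (fun a : Form ℝ (VField F D) k => a W) h)
  · intro h
    by_contra h'
    refine h (AlternatingMap.ext fun W => ?_)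
    by_contra hW
    exact h' ⟨W, hW⟩

theorem Compat.at {a : Forms (Smooth E X) (ASec J)} {b : DForms F D}
    (h : Compat (restrict ι) (Related ι J) a b) (q : D) :
    Compat (RingHom.id ℝ) (Related ι J) (formAt (ι q) a) (dformAt q b) :=
  h.evForms (evalAt q) fun _ => rfl

variable {ν : Coorientation ι} [FiniteDimensional ℝ E] [T2Space X] [IsManifold 𝓘(ℝ, E) ∞ X]

/-- The frame at a point of `D` given by a radial, an angular and coordinate sections. -/
def frameAt (hJ : IsEllipticIdeal ι J) (R T : ASec J) {p : D} (A : AdaptedFrame ι J ν p) :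
    Fin 2 ⊕ Fin (Module.finrank ℝ F) → ASec J := Sum.elim ![R, T] (A.E₀ hJ)

/-- The coframe dual to `frameAt`. -/
def coframeAt {p : D} (A : AdaptedFrame ι J ν p) (x : X) :
    Fin 2 ⊕ Fin (Module.finrank ℝ F) → Form ℝ (ASec J) 1 := fun i => evForm (evalAt x)
  (Sum.elim ![oneForm A.rad, oneForm A.ang] (fun k => dForm (A.x k)) i)

variable (hJ : IsEllipticIdeal ι J)

theorem framed_formAt {R T : ASec J} (hR : IsRadial ι R.1) (hT : IsAngular ν T.1) {p : D}
    (A : AdaptedFrame ι J ν p) {q : D} (hq : ι q ∈ A.dom) (a : Forms (Smooth E X) (ASec J)) :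
    Framed (frameAt hJ R T A) (coframeAt A (ι q)) (formAt (ι q) a) := by
  intro V
  funext k
  ext W
  have key := frame_expand hJ hR hT A hq (slotFun (ι q) (a (k + 1)) (Fin.cons 0 W) 0)
    (slotFun_smul _ _ _ _) V
  have hs : ∀ U, slotFun (ι q) (a (k + 1)) (Fin.cons 0 W) 0 U = formAt (ι q) a (k + 1) (Fin.cons U W) := by
    intro U
    change a (k + 1) (Function.update (Fin.cons 0 W) 0 U) (ι q) = _
    rw [Fin.update_cons_zero]
    rfl
  simp only [hs] at key
  rw [Fintype.sum_sum_type, Fin.sum_univ_two, Pi.add_apply, Pi.add_apply, Finset.sum_apply,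
    AlternatingMap.add_apply, AlternatingMap.add_apply, Form.sum_apply]
  exact key

theorem coframeAt_frameAt {R T : ASec J} (hR : IsRadial ι R.1) (hT : IsAngular ν T.1) {p : D}
    (A : AdaptedFrame ι J ν p) {q : D} (hq : ι q ∈ A.dom) (i) :
    coframeAt A (ι q) i ![frameAt hJ R T A i] = 1 := by
  rcases i with i | k
  · fin_cases i
    · exact (radial_coeff hR A hq).1
    · exact (angular_coeff hT A hq).2.1
  · have := A.E₀_x hJ k k hq
    rwa [if_pos rfl] at this

/-- Each coframe element is the value of a global linear form on sections, so nondegeneracy over the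
functions already provides the dual vector. -/
theorem coframeAt_nondegenerate {wA : AForm J 2} (hw : IsNondegenerate wA) {p : D}
    (A : AdaptedFrame ι J ν p) (x : X) (i) :
    ∃ V, ∀ W, evForm (evalAt x) wA ![V, W] = coframeAt A x i ![W] := by
  obtain ⟨l, hl⟩ : ∃ l : ASec J →ₗ[Smooth E X] Smooth E X, ∀ W, coframeAt A x i ![W] = l W x := by
    rcases i with i | k
    · fin_cases i
      · exact ⟨A.rad, fun W => rfl⟩
      · exact ⟨A.ang, fun W => rfl⟩
    · exact ⟨{ toFun := fun V => V.1 (A.x k)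
               map_add' := fun _ _ => rfl
               map_smul' := fun _ _ => rfl }, fun W => rfl⟩
  obtain ⟨V, hV, -⟩ := hw l
  exact ⟨V, fun W => by rw [hl, ← hV]; rfl⟩

/-- The top exterior power of a nondegenerate form has non-vanishing residue. -/
theorem inter_inter_formPow_ne_zero (hJ : IsEllipticIdeal ι J) {n : ℕ} (hn : Module.finrank ℝ F + 2 = 2 * n) {R T : ASec J}
    (hR : IsRadial ι R.1) (hT : IsAngular ν T.1) {q : D} (A : AdaptedFrame ι J ν q)
    {wA : AForm J 2} (hw : IsNondegenerate wA) :
    inter T (inter R (formPow (homog (evForm (evalAt (ι q)) wA)) n)) ≠ 0 := by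
  have hc : Fintype.card (Fin 2 ⊕ Fin (Module.finrank ℝ F)) = 2 * n := by
    rw [Fintype.card_sum, Fintype.card_fin, Fintype.card_fin]; omega
  have hf : ∀ {k : ℕ} (a : AForm J k), Framed (frameAt hJ R T A) (coframeAt A (ι q))
      (homog (evForm (evalAt (ι q)) a)) := fun a => by
    rw [← evForms_homog]
    exact framed_formAt hJ hR hT A A.mem_dom _
  refine ((hf wA).formPow n).inter_inter_ne_zero (d := 2 * n)
    (fun k hk => formPow_homog_two_ne _ hk) hc.le (hf (oneForm A.rad)) (hf (oneForm A.ang))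
    (radial_coeff hR A A.mem_dom).1 (angular_coeff hT A A.mem_dom).2.1
    (radial_coeff hR A A.mem_dom).2.1 ?_
  exact formPow_ne_zero_of_nondegenerate hc (hf wA) (coframeAt_frameAt hJ hR hT A A.mem_dom)
    (coframeAt_nondegenerate hw A _) le_rfl

theorem formExp_formAt (hJ : IsEllipticIdeal ι J) {n : ℕ} (hn : Module.finrank ℝ F + 2 = 2 * n) {R T : ASec J}
    (hR : IsRadial ι R.1) (hT : IsAngular ν T.1) {q : D} (A : AdaptedFrame ι J ν q)
    (wA : AForm J 2) :
    formAt (ι q) (formExp wA) =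
      formAt (ι q) (∑ k ∈ Finset.range (n + 1), ((k ! : ℝ)⁻¹) • formPow (homog wA) k) := by
  have hc : Fintype.card (Fin 2 ⊕ Fin (Module.finrank ℝ F)) ≤ 2 * n := by
    rw [Fintype.card_sum, Fintype.card_fin, Fintype.card_fin]; omega
  have hf : Framed (frameAt hJ R T A) (coframeAt A (ι q)) (homog (evForm (evalAt (ι q)) wA)) := by
    rw [← evForms_homog]
    exact framed_formAt hJ hR hT A A.mem_dom _
  rw [formAt, evForms_formExp, formExp_eq_sum_of_framed hf hc]
  refine Compat.eq_evForms (Compat.sum _ fun k => ?_)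
  rw [Forms.real_smul_eq ((k ! : ℝ)⁻¹) (formPow (homog wA) k)]
  have := ((compat_evForm (evalAt (ι q)) wA).formPow k).smul (algebraMap ℝ _ ((k ! : ℝ)⁻¹))
  exact this

end Coframe

/-! ### Lie derivatives along the normal directions -/

section Normal

variable {E : Type*} [NormedAddCommGroup E] [NormedSpace ℝ E] [FiniteDimensional ℝ E]
  {F : Type*} [NormedAddCommGroup F] [NormedSpace ℝ F] [FiniteDimensional ℝ F]
  {X : Type*} [TopologicalSpace X] [ChartedSpace E X] [T2Space X] [IsManifold 𝓘(ℝ, E) ∞ X]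
  {D : Type*} [TopologicalSpace D] [ChartedSpace F D] [T2Space D] [IsManifold 𝓘(ℝ, F) ∞ D]
  {ι : C^∞⟮𝓘(ℝ, F), D; 𝓘(ℝ, E), X⟯} {J : Ideal (Smooth E X)} {ν : Coorientation ι}

theorem apply_eq_zero_of_eventually_const {p : D} (A : AdaptedFrame ι J ν p) (V : ASec J)
    {f : Smooth E X} {q : D} (hq : ι q ∈ A.dom) {c : ℝ} (hf : ∀ᶠ x in 𝓝 q, f (ι x) = c) :
    V.1 f (ι q) = 0 := by
  rw [A.apply_ι V f hq]
  refine Finset.sum_eq_zero fun k _ => ?_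
  have : ∀ᶠ x in 𝓝 q, f.comp ι x = algebraMap ℝ (Smooth F D) c x := hf
  rw [derivation_congr _ this, derivation_const, smooth_zero_apply, mul_zero]

theorem eventually_mem_dom {p : D} (A : AdaptedFrame ι J ν p) {q : D} (hq : ι q ∈ A.dom) :
    ∀ᶠ x in 𝓝 q, ι x ∈ A.dom :=
  ι.contMDiff.continuous.continuousAt.eventually (A.isOpen_dom.mem_nhds hq)

/-- The section `Z` vanishes along `D` and has constant coefficients in each adapted frame. -/
structure IsNormalSection (ν : Coorientation ι) (Z : ASec J) : Prop where
  related : Related ι J Z 0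
  rad : ∃ c : ℝ, ∀ {p : D} (A : AdaptedFrame ι J ν p) {q : D}, ι q ∈ A.dom → A.rad Z (ι q) = c
  ang : ∃ c : ℝ, ∀ {p : D} (A : AdaptedFrame ι J ν p) {q : D}, ι q ∈ A.dom → A.ang Z (ι q) = c

theorem isNormalSection_of_radial {R : ASec J} (hR : IsRadial ι R.1) : IsNormalSection ν R :=
  ⟨related_zero_of_radial hR, ⟨1, fun A _ hq => (radial_coeff hR A hq).1⟩,
    ⟨0, fun A _ hq => (radial_coeff hR A hq).2.1⟩⟩

theorem isNormalSection_of_angular {T : ASec J} (hT : IsAngular ν T.1) : IsNormalSection ν T :=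
  ⟨related_zero_of_angular hT, ⟨0, fun A _ hq => (angular_coeff hT A hq).1⟩,
    ⟨1, fun A _ hq => (angular_coeff hT A hq).2.1⟩⟩

variable (hJ : IsEllipticIdeal ι J) (A : ∀ p, AdaptedFrame ι J ν p)

include hJ A

/-- Bracketing with a normal section is negligible along `D`. -/
theorem functional_lie_normal {Z : ASec J} (hZ : IsNormalSection ν Z) (V : ASec J) {q : D}
    (l : ASec J →+ ℝ) (hl : ∀ (f : Smooth E X) V, l (f • V) = f (ι q) * l V) : l ⁅Z, V⁆ = 0 := by
  have hq := (A q).mem_dom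
  have hz : ∀ f, Z.1 f (ι q) = 0 := fun f => DFunLike.congr_fun (hZ.related f) q
  have hc : ∀ {f : Smooth E X} {c : ℝ}, (∀ q', ι q' ∈ (A q).dom → f (ι q') = c) →
      V.1 f (ι q) = 0 := fun h =>
    apply_eq_zero_of_eventually_const (A q) V hq ((eventually_mem_dom (A q) hq).mono h)
  obtain ⟨c, hrad⟩ := hZ.rad
  obtain ⟨c', hang⟩ := hZ.ang
  -- By closedness of d log r its value on [Z, V] is Z(d log r(V)) − V(d log r(Z)): the first term
  -- vanishes as Z does on `D`, the second because d log r(Z) is constant along `D` and V is tangent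
  -- to `D`.
  have h1 : (A q).rad ⁅Z, V⁆ (ι q) = 0 := by
    have := ((A q).closed Z V _ hq).1
    rw [smooth_sub_apply, smooth_sub_apply, hz, hc fun q' => hrad (A q)] at this
    linarith
  have h2 : (A q).ang ⁅Z, V⁆ (ι q) = 0 := by
    have := ((A q).closed Z V _ hq).2
    rw [smooth_sub_apply, smooth_sub_apply, hz, hc fun q' => hang (A q)] at this
    linarith
  have h3 : ∀ k, ⁅Z, V⁆.1 ((A q).x k) (ι q) = 0 := fun k => by
    rw [asec_lie_apply, hz, zero_sub, neg_eq_zero]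
    exact hc (c := 0) fun q' _ => DFunLike.congr_fun (hZ.related _) q'
  rw [(A q).functional_eq hJ _ hq l hl, h1, h2]
  simp only [h3, zero_mul, Finset.sum_const_zero, add_zero]

/-- The Lie derivative along a normal section vanishes along `D`. -/
theorem restrict_lieForms {Z : ASec J} (hZ : IsNormalSection ν Z) (a : Forms (Smooth E X) (ASec J))
    (k : ℕ) (W : Fin k → ASec J) : restrict ι (lieForms Z a k W) = 0 := by
  rw [restrict_eq_zero_iff]
  intro q
  rw [lieForms, lieDer_apply, smooth_sub_apply, smooth_sum_apply, asec_lie_smooth]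
  have h1 : Z.1 (a k W) (ι q) = 0 := DFunLike.congr_fun (hZ.related _) q
  have h2 : ∀ i, a k (Function.update W i ⁅Z, W i⁆) (ι q) = 0 := fun i =>
    functional_lie_normal hJ A hZ (W i) (slotFun (ι q) (a k) W i) (slotFun_smul _ _ _ _)
  simp only [h1, h2, Finset.sum_const_zero, sub_zero]

variable [SigmaCompactSpace X]

/-- Only the values of the differential along `D` matter, by naturality of the Koszul formula under
lifting. -/
theorem Compat.isClosedForm {a : Forms (Smooth E X) (ASec J)} {b : DForms F D}
    (h : Compat (restrict ι) (Related ι J) a b)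
    (ha : ∀ k W, restrict ι (dForms a k W) = 0) (k : ℕ) : IsClosedForm (b k) := by
  intro W
  choose s hs using exists_lift hJ A
  rw [extD_compat (f := restrict ι) (Rel := Related ι J) (fun _ _ h => related_apply h)
    (fun _ _ _ _ h h' => related_lie h h') (h k) fun i => hs (W i), ← extDForm_apply]
  exact ha (k + 1) _

/-- For closed a, Cartan's formula identifies d ι_Z a with the Lie derivative of a, which vanishes
along `D`. -/
theorem restrict_dForms_inter {Z : ASec J} (hZ : IsNormalSection ν Z)
    {a : Forms (Smooth E X) (ASec J)} (ha : dForms a = 0) (k : ℕ) (W : Fin k → ASec J) :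
    restrict ι (dForms (inter Z a) k W) = 0 := by
  have h := inter_dForms Z a
  rw [ha, inter_zero] at h
  rw [← sub_eq_zero.mp h.symm]
  exact restrict_lieForms hJ A hZ a k W

theorem restrict_dForms_inter_inter {R T : ASec J} (hR : IsNormalSection ν R)
    (hT : IsNormalSection ν T) {a : Forms (Smooth E X) (ASec J)} (ha : dForms a = 0) (k : ℕ)
    (W : Fin k → ASec J) : restrict ι (dForms (inter T (inter R a)) k W) = 0 := by
  have h := inter_dForms T (inter R a)
  have h' : dForms (inter T (inter R a)) = lieForms T (inter R a) - inter T (dForms (inter R a)) := by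
    rw [h]; abel
  rw [h', Pi.sub_apply, AlternatingMap.sub_apply, map_sub, restrict_lieForms hJ A hT, zero_sub,
    neg_eq_zero]
  exact restrict_dForms_inter hJ A hR ha (k + 1) _

end Normal

/-! ### Expansion and top degree of the residue of the exponential -/

section Spinor

variable {E : Type*} [NormedAddCommGroup E] [NormedSpace ℝ E] [FiniteDimensional ℝ E]
  {F : Type*} [NormedAddCommGroup F] [NormedSpace ℝ F]
  {X : Type*} [TopologicalSpace X] [ChartedSpace E X] [T2Space X] [IsManifold 𝓘(ℝ, E) ∞ X]
  {D : Type*} [TopologicalSpace D] [ChartedSpace F D]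
  {ι : C^∞⟮𝓘(ℝ, F), D; 𝓘(ℝ, E), X⟯} {J : Ideal (Smooth E X)} {ν : Coorientation ι}
  (hJ : IsEllipticIdeal ι J) (A : ∀ p, AdaptedFrame ι J ν p) {R T : ASec J}
  (hR : IsRadial ι R.1) (hT : IsAngular ν T.1)

omit [FiniteDimensional ℝ E] [T2Space X] [IsManifold 𝓘(ℝ, E) ∞ X] in
theorem restrict_eq_of_formAt {a b : Forms (Smooth E X) (ASec J)}
    (h : ∀ q, formAt (ι q) a = formAt (ι q) b) (k : ℕ) (V : Fin k → ASec J) :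
    restrict ι (a k V) = restrict ι (b k V) :=
  ContMDiffMap.ext fun q => congrArg (fun c : Forms ℝ (ASec J) => c k V) (h q)

include hJ A hR hT

/-- If n were 1, the top power of ω would be ω itself, whose contraction ω(R, T) could not vanish.
The point q is needed: `D` might be empty. -/
theorem two_le_of_restrict {n : ℕ} (hn : Module.finrank ℝ F + 2 = 2 * n) {wA : AForm J 2}
    (hw : IsNondegenerate wA) (h0 : restrict ι (wA ![R, T]) = 0) (q : D) : 2 ≤ n := by
  by_contra hlt
  obtain rfl : n = 1 := by omega
  refine inter_inter_formPow_ne_zero hJ hn hR hT (A q) hw ?_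
  have h1 : evForm (evalAt (ι q)) wA ![R, T] = 0 := restrict_eq_zero_iff.mp h0 q
  rw [formPow, formPow, wedge_formOne, inter_homog_succ, inter_homog_one]
  change evForm (evalAt (ι q)) wA ![R, T] • _ = _
  rw [h1, zero_smul]

variable [SigmaCompactSpace X]

theorem resQForms_add (a b : Forms (Smooth E X) (ASec J)) :
    resQForms ν (a + b) = resQForms ν a + resQForms ν b :=
  (compat_resQForms hJ A hR hT (a + b)).unique (exists_lift hJ A)
    ((compat_resQForms hJ A hR hT a).add (compat_resQForms hJ A hR hT b))

theorem resQForms_congr {a b : Forms (Smooth E X) (ASec J)}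
    (h : ∀ q, formAt (ι q) a = formAt (ι q) b) : resQForms ν a = resQForms ν b := by
  refine (compat_resQForms hJ A hR hT a).unique (exists_lift hJ A) fun k V W hVW => ?_
  rw [compat_resQForms hJ A hR hT b k V W hVW]
  refine restrict_eq_of_formAt (fun q => ?_) k V
  rw [formAt, formAt, evForms_inter, evForms_inter, evForms_inter, evForms_inter]
  exact congrArg (fun c => inter T (inter R c)) (h q).symm

variable {wA : AForm J 2} (h0 : restrict ι (wA ![R, T]) = 0)

include h0

theorem resQForms_expTrunc_two :
    resQForms ν (∑ k ∈ Finset.range 3, ((k ! : ℝ)⁻¹) • formPow (homog wA) k) =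
      -(homog (resR ι wA) ⋏ homog (resTheta ν wA)) := by
  refine (compat_resQForms hJ A hR hT _).unique (exists_lift hJ A) ?_
  rw [inter_inter_expTrunc_two, ← zero_sub (homog (resR ι wA) ⋏ _)]
  exact (IsRestriction.compat_smul_zero h0).sub
    ((compat_resR hJ A hR hT h0).wedge (compat_resTheta hJ A hR hT h0))

/-- The expansion of the residue of the exponential. -/
theorem resQForms_formExp_eq {n : ℕ} (hn : Module.finrank ℝ F + 2 = 2 * n)
    (hw : IsNondegenerate wA) :
    resQForms ν (formExp wA) = -(homog (resR ι wA) ⋏ homog (resTheta ν wA)) +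
      resQForms ν (∑ k ∈ Finset.Icc 3 n, ((k ! : ℝ)⁻¹) • formPow (homog wA) k) := by
  funext k
  ext W q
  have h2 := two_le_of_restrict hJ A hR hT hn hw h0 q
  rw [resQForms_congr hJ A hR hT fun q => formExp_formAt hJ hn hR hT (A q) wA,
    ← resQForms_expTrunc_two hJ A hR hT h0, ← resQForms_add hJ A hR hT]
  congr 5
  rw [Finset.range_eq_Ico, ← Finset.sum_Ico_consecutive _ (Nat.zero_le 3) (by omega : 3 ≤ n + 1),
    Finset.range_eq_Ico]
  rfl

omit h0 in
-- In this degree ρ is the double contraction of ωⁿ/n!, which is nonzero by nondegeneracy.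
theorem nonzeroAt_resQForms {n k : ℕ} (hn : Module.finrank ℝ F + 2 = 2 * n)
    (hw : IsNondegenerate wA) (hk : k + 2 = 2 * n) (q : D) :
    NonzeroAt (resQForms ν (formExp wA) k) q := by
  rw [nonzeroAt_iff]
  intro hz
  have hc := (compat_resQForms hJ A hR hT (formExp wA)).at q
  refine inter_inter_formPow_ne_zero hJ hn hR hT (A q) hw ?_
  funext j
  by_cases hj : j = k
  · subst hj
    ext V
    -- Every section restricts to a field on `D`, so the vanishing of the residue on `D` forces the
    -- vanishing upstairs on all arguments.
    choose s hs using exists_related hJ A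
    have h1 := hc j V (fun i => s (V i)) fun i => hs (V i)
    rw [hz] at h1
    have h2 : inter T (inter R (formExp (evForm (evalAt (ι q)) wA))) j V = 0 := by
      rw [← evForms_formExp, ← evForms_inter, ← evForms_inter]
      exact h1.symm
    have h3 : formExp (evForm (evalAt (ι q)) wA) (j + 1 + 1) =
        ((n ! : ℝ)⁻¹) • formPow (homog (evForm (evalAt (ι q)) wA)) n (j + 1 + 1) := by
      rw [show j + 1 + 1 = 2 * n from hk]
      exact formExp_even _ n
    rw [inter_apply, inter_apply, h3, AlternatingMap.smul_apply, smul_eq_mul] at h2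
    exact (mul_eq_zero.mp h2).resolve_left (by positivity)
  · have : formPow (homog (evForm (evalAt (ι q)) wA)) n (j + 1 + 1) = 0 :=
      formPow_homog_two_ne _ (by omega)
    ext V
    rw [inter_apply, inter_apply, this]
    rfl

end Spinor

/-! ### Closedness of the residues -/

section Closed

variable {E : Type*} [NormedAddCommGroup E] [NormedSpace ℝ E] [FiniteDimensional ℝ E]
  {F : Type*} [NormedAddCommGroup F] [NormedSpace ℝ F] [FiniteDimensional ℝ F]
  {X : Type*} [TopologicalSpace X] [ChartedSpace E X] [T2Space X] [IsManifold 𝓘(ℝ, E) ∞ X]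
  {D : Type*} [TopologicalSpace D] [ChartedSpace F D] [T2Space D] [IsManifold 𝓘(ℝ, F) ∞ D]
  {ι : C^∞⟮𝓘(ℝ, F), D; 𝓘(ℝ, E), X⟯} {J : Ideal (Smooth E X)} {ν : Coorientation ι}
  [SigmaCompactSpace X]
  (hJ : IsEllipticIdeal ι J) (A : ∀ p, AdaptedFrame ι J ν p) {R T : ASec J}
  (hR : IsRadial ι R.1) (hT : IsAngular ν T.1) {wA : AForm J 2} (hcl : IsClosedForm wA)

include hJ A hR hT hcl

theorem isClosedForm_resQForms (k : ℕ) : IsClosedForm (resQForms ν (formExp wA) k) := by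
  have hd : dForms (formExp wA) = 0 := by
    funext k
    cases k with
    | zero => rfl
    | succ k => exact isClosedForm_iff.mp (isClosedForm_formExp hcl k)
  exact (compat_resQForms hJ A hR hT (formExp wA)).isClosedForm hJ A
    (restrict_dForms_inter_inter hJ A (isNormalSection_of_radial hR)
      (isNormalSection_of_angular hT) hd) k

theorem isClosedForm_resR (h0 : restrict ι (wA ![R, T]) = 0) : IsClosedForm (resR ι wA : DForm F D 1) := by
  have := (compat_resR hJ A hR hT h0).isClosedForm hJ A
    (restrict_dForms_inter hJ A (isNormalSection_of_radial hR) (dForms_homog hcl)) 1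
  rwa [homog_self] at this

theorem isClosedForm_resTheta (h0 : restrict ι (wA ![R, T]) = 0) : IsClosedForm (resTheta ν wA) := by
  have := (compat_resTheta hJ A hR hT h0).isClosedForm hJ A
    (restrict_dForms_inter hJ A (isNormalSection_of_angular hT) (dForms_homog hcl)) 1
  rwa [homog_self] at this

end Closed

/-! ### The two-form complementary to the residues -/

section Splitting

variable {A N : Type*} [CommRing A] [AddCommGroup N] [Module A N] [Algebra ℝ A]

theorem wedge_eq_zero_of_odd {r : Forms A N} (hr : parity r = -r) (hrr : r ⋏ r = 0)
    (c d : Forms A N) : r ⋏ (c ⋏ (d ⋏ r)) = 0 := by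
  have h1 : (c ⋏ d) ⋏ r = r ⋏ parity (c ⋏ d) := by
    have := wedge_comm_of_odd hr (parity (c ⋏ d))
    rw [parity_parity] at this
    exact this.symm
  rw [← wedge_assoc c, h1, ← wedge_assoc, hrr, zero_wedge]

theorem wedge_formExp_apply {c : Forms A N} {d : ℕ} (hc : IsHomogeneous d c) (b : Form A N 2)
    (l : ℕ) : (c ⋏ formExp b) (d + 2 * l) = ((l ! : ℝ)⁻¹) • (c ⋏ formPow (homog b) l) (d + 2 * l) := by
  rw [wedge_congr_degree (a' := c) (b' := expTrunc b (d + 2 * l)) (fun _ _ => rfl)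
    fun j hj => formExp_eq_expTrunc b hj, expTrunc, wedge_sum, Finset.sum_apply,
    Finset.sum_eq_single l]
  · rw [wedge_real_smul]
    rfl
  · intro j _ hj
    have h := hc.wedge ((isHomogeneous_homog b).formPow j) (d + 2 * l) (by
      intro h
      apply hj
      nlinarith)
    rw [wedge_real_smul, Pi.smul_apply, h, smul_zero]
  · intro h
    exact absurd (Finset.mem_range.mpr (by omega)) h

theorem wedge_formExp_congr {c : Forms A N} {b b' : Form A N 2}
    (h : ∀ j, c ⋏ formPow (homog b) j = c ⋏ formPow (homog b') j) :
    c ⋏ formExp b = c ⋏ formExp b' := by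
  funext k
  rw [wedge_congr_degree (a' := c) (b' := expTrunc b k) (fun _ _ => rfl)
    fun j hj => formExp_eq_expTrunc b hj, wedge_congr_degree (a' := c) (b' := expTrunc b' k)
    (fun _ _ => rfl) fun j hj => formExp_eq_expTrunc b' hj, expTrunc, expTrunc, wedge_sum, wedge_sum]
  simp only [wedge_real_smul, h]

variable {w β : Form A N 2} {R T Y : N} {a b : Form A N 1}

/-- `β` is the part of `w` complementary to the pairs of conjugate one-forms `a`, `w(R, ·)` and
`b`, `w(T, ·)`. -/
structure IsComplement (w : Form A N 2) (R T Y : N) (a b : Form A N 1) (β : Form A N 2) : Prop where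
  eq : homog β = homog w - homog a ⋏ inter R (homog w) - homog b ⋏ inter T (homog w)
  wRT : w ![R, T] = 0
  wRY : w ![R, Y] = 1
  wTY : w ![T, Y] = 0
  wY : inter Y (homog w) = -homog a
  aR : a ![R] = 1
  aT : a ![T] = 0
  aY : a ![Y] = 0
  bR : b ![R] = 0
  bT : b ![T] = 1
  bY : b ![Y] = 0

omit [Algebra ℝ A] in
theorem inter_inter_homog_two (w : Form A N 2) (V W : N) :
    inter W (inter V (homog w)) = w ![V, W] • formOne := by
  rw [inter_homog_succ, inter_homog_one]
  rfl

omit [Algebra ℝ A] in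
theorem apply_swap (w : Form A N 2) (V W : N) : w ![W, V] = -w ![V, W] := by
  have := w.map_swap (i := 0) (j := 1) ![V, W] (by simp)
  rw [← this]
  exact congrArg w (funext fun i => by fin_cases i <;> rfl)

omit [Algebra ℝ A] in
theorem apply_self (w : Form A N 2) (V : N) : w ![V, V] = 0 :=
  w.map_eq_zero_of_eq (i := 0) (j := 1) _ rfl (by simp)

theorem inter_homog_wedge (a : Form A N 1) (V : N) (c : Forms A N) :
    inter V (homog a ⋏ c) = a ![V] • c - homog a ⋏ inter V c := by
  rw [inter_wedge, inter_homog_one, smul_wedge, formOne_wedge, parity_homog_one, neg_wedge,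
    sub_eq_add_neg]

namespace IsComplement

variable (h : IsComplement w R T Y a b β)

include h

theorem inter_eq (V : N) : inter V (homog β) = inter V (homog w) - a ![V] • inter R (homog w) +
    w ![R, V] • homog a - b ![V] • inter T (homog w) + w ![T, V] • homog b := by
  rw [h.eq, inter_sub, inter_sub, inter_homog_wedge, inter_homog_wedge, inter_inter_homog_two,
    inter_inter_homog_two, wedge_smul, wedge_smul, wedge_formOne, wedge_formOne]
  abel

theorem inter_R : inter R (homog β) = 0 := by
  rw [h.inter_eq, h.aR, h.bR, apply_self, apply_swap w R T, h.wRT, neg_zero, Forms.zero_smul,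
    Forms.zero_smul, Forms.zero_smul, one_smul]
  abel

theorem inter_T : inter T (homog β) = 0 := by
  rw [h.inter_eq, h.aT, h.bT, apply_self, h.wRT, Forms.zero_smul,
    Forms.zero_smul, Forms.zero_smul, one_smul]
  abel

/-- Here −a + w(R, Y) a cancels, and b(Y) = 0 removes the last term; arranging the latter is the
purpose of the function μ in `exists_localForm`. -/
theorem inter_Y : inter Y (homog β) = 0 := by
  rw [h.inter_eq, h.aY, h.bY, h.wRY, h.wTY, h.wY, Forms.zero_smul,
    Forms.zero_smul, Forms.zero_smul, one_smul]
  abel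

/-- The forms w and β differ by terms containing ι_R w or ι_T w, odd forms with zero square, which
die against their product. -/
theorem wedge_formPow (j : ℕ) :
    (inter R (homog w) ⋏ inter T (homog w)) ⋏ formPow (homog w) j =
      (inter R (homog w) ⋏ inter T (homog w)) ⋏ formPow (homog β) j := by
  have odd : ∀ V, parity (inter V (homog w)) = -inter V (homog w) := fun V => by
    rw [inter_homog_succ, parity_homog_one]
  have sq : ∀ V, inter V (homog w) ⋏ inter V (homog w) = 0 := fun V => by
    rw [inter_homog_succ, homog_one_wedge_self]
  have hTw : inter T (homog w) ⋏ (homog b ⋏ inter T (homog w)) = 0 := by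
    have := wedge_eq_zero_of_odd (odd T) (sq T) formOne (homog b)
    rwa [formOne_wedge] at this
  have hw : (inter R (homog w) ⋏ inter T (homog w)) ⋏ homog w =
      (inter R (homog w) ⋏ inter T (homog w)) ⋏ homog β := by
    rw [h.eq, wedge_sub, wedge_sub, wedge_assoc _ _ (homog a ⋏ _),
      wedge_eq_zero_of_odd (odd R) (sq R), wedge_assoc _ _ (homog b ⋏ _), hTw, wedge_zero, sub_zero,
      sub_zero]
  induction j with
  | zero => rfl
  | succ j ih =>
    generalize inter R (homog w) ⋏ inter T (homog w) = c at hw ih ⊢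
    rw [formPow, formPow, ← wedge_assoc, hw, wedge_assoc,
      wedge_comm_of_even (parity_homog_two β), wedge_comm_of_even (parity_homog_two β),
      ← wedge_assoc, ih, wedge_assoc]

theorem inter_inter_formExp :
    inter T (inter R (formExp w)) =
      -((inter R (homog w) ⋏ inter T (homog w)) ⋏ formExp β) := by
  rw [inter_inter_wedge_formExp, h.wRT, Forms.zero_smul, zero_sub, ← wedge_assoc,
    wedge_formExp_congr h.wedge_formPow]

end IsComplement

end Splitting

/-! ### The rank bound -/

section Rank

variable {N : Type*} [AddCommGroup N] [Module ℝ N] {κ : Type*} [Fintype κ]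
  {e : κ → N} {ε : κ → Form ℝ N 1} {w β : Form ℝ N 2} {R T Y : N} {a b : Form ℝ N 1}

/-- The form a ∧ b ∧ ι_R w ∧ β^(l+1) has degree 2l + 5, above the dimension. Contracting with R, T
and Y in turn strips off the three one-forms, since all three vectors annihilate β. -/
theorem IsComplement.formPow_eq_zero (h : IsComplement w R T Y a b β) (ha : Framed e ε (homog a))
    (hb : Framed e ε (homog b)) (hw : Framed e ε (homog w)) (hβ : Framed e ε (homog β)) {l : ℕ}
    (hl : Fintype.card κ ≤ 2 * (l + 2)) : formPow (homog β) (l + 1) = 0 := by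
  have hi : ∀ {V : N}, inter V (homog β) = 0 → inter V (formPow (homog β) (l + 1)) = 0 := fun hV => by
    rw [inter_formPow (parity_homog_two β), hV, zero_wedge, smul_zero]
  have h0 : homog a ⋏ homog b ⋏ inter R (homog w) ⋏ formPow (homog β) (l + 1) = 0 := by
    funext k
    by_cases hk : k = 1 + (1 + (1 + 2 * (l + 1)))
    · exact (ha.wedge (hb.wedge ((hw.inter R).wedge (hβ.formPow (l + 1))))).eq_zero_of_card_lt
        (by omega)
    · refine (isHomogeneous_homog a).wedge ((isHomogeneous_homog b).wedge (IsHomogeneous.wedge ?_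
        fun k hk => formPow_homog_two_ne β hk)) k hk
      rw [inter_homog_succ]
      exact isHomogeneous_homog _
  rw [inter_homog_succ] at h0
  have hR : contr R w ![R] = 0 := apply_self w R
  have hT : contr R w ![T] = 0 := h.wRT
  have hY : contr R w ![Y] = 1 := h.wRY
  have h1 := congrArg (inter R) h0
  rw [inter_homog_wedge, h.aR, one_smul, inter_homog_wedge, h.bR, Forms.zero_smul,
    inter_homog_wedge, hR, Forms.zero_smul, hi h.inter_R, wedge_zero, sub_zero, wedge_zero, sub_zero,
    wedge_zero, sub_zero, inter_zero] at h1
  have h2 := congrArg (inter T) h1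
  rw [inter_homog_wedge, h.bT, one_smul, inter_homog_wedge, hT, Forms.zero_smul, hi h.inter_T,
    wedge_zero, sub_zero, wedge_zero, sub_zero, inter_zero] at h2
  have h3 := congrArg (inter Y) h2
  rwa [inter_homog_wedge, hY, one_smul, hi h.inter_Y, wedge_zero, sub_zero, inter_zero] at h3

end Rank

/-! ### Closedness of the complement at a point -/

section DOne

variable {A L : Type*} [CommRing A] [LieRing L] [Module A L] [LieRingModule L A]
  [LieRinehartRing A L]

omit [LieRinehartRing A L] in
theorem extD_one (η : Form A L 1) (V : Fin 2 → L) :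
    extD η V = ⁅V 0, η ![V 1]⁆ - ⁅V 1, η ![V 0]⁆ - η ![⁅V 0, V 1⁆] := by
  have h0 : V ∘ Fin.succ = ![V 1] := by
    ext i; fin_cases i; rfl
  have h1 : V ∘ Fin.succAbove (1 : Fin 2) = ![V 0] := by
    ext i; fin_cases i; rfl
  have h2 : Function.update ![V 0] (0 : Fin 1) ⁅V 0, V 1⁆ = ![⁅V 0, V 1⁆] := by
    ext i; fin_cases i; rfl
  simp [extD, Fin.sum_univ_two]
  erw [h0, h1, h2]
  ring

variable [Algebra ℝ A] [Module ℝ L] [IsScalarTower ℝ A L]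

theorem evForms_dForms_homog {e : A →ₐ[ℝ] ℝ} {k : ℕ} {η : Form A L k}
    (h : ∀ V, e (extD η V) = 0) : evForms e (dForms (homog η)) = 0 := by
  funext j
  ext V
  cases j with
  | zero => exact map_zero e
  | succ j =>
    change e (extDForm (homog η j) V) = 0
    by_cases hj : j = k
    · subst hj
      rw [homog_self, extDForm_apply, h]
    · rw [homog_ne hj, extDForm_apply]
      simp [extD]

/-- Differentiate w = β + a ∧ r + b ∧ s: w is closed, and a, b, r, s have vanishing differential at
the point. -/
theorem evForms_dForms_complement {e : A →ₐ[ℝ] ℝ} {w β : Form A L 2} {a b : Form A L 1}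
    {r s : Forms A L} (h : homog β = homog w - homog a ⋏ r - homog b ⋏ s) (hcl : IsClosedForm w)
    (ha : ∀ V, e (extD a V) = 0) (hb : ∀ V, e (extD b V) = 0)
    (hr : evForms e (dForms r) = 0) (hs : evForms e (dForms s) = 0) :
    evForms e (dForms (homog β)) = 0 := by
  have h1 : homog w = homog β + homog a ⋏ r + homog b ⋏ s := by
    rw [h]
    abel
  have h2 := congrArg (fun c => evForms e (dForms c)) h1
  simp only [dForms_add, dForms_wedge, evForms_add, evForms_wedge, dForms_homog hcl,
    evForms_zero, evForms_dForms_homog ha, evForms_dForms_homog hb, hr, hs] at h2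
  simpa only [zero_wedge, wedge_zero, add_zero] using h2.symm

end DOne

theorem apply_eq_zero_of_inter {A N : Type*} [CommRing A] [AddCommGroup N] [Module A N]
    {β : Form A N 2} {V : N} (h : inter V (homog β) = 0) {W : Fin 2 → N} {i : Fin 2}
    (hi : W i = V) : β W = 0 := by
  have h1 : ∀ U, β ![V, U] = 0 := fun U => by
    have := congrArg (fun c : Forms A N => c 1 ![U]) h
    rwa [inter_homog_succ, homog_self] at this
  have hW : W = ![W 0, W 1] := by ext i; fin_cases i <;> rfl
  rw [hW]
  fin_cases i
  · rw [show W 0 = V from hi, h1]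
  · rw [show W 1 = V from hi, apply_swap, h1, neg_zero]

/-! ### Construction of the local two-form -/

section LocalForm

variable {E : Type*} [NormedAddCommGroup E] [NormedSpace ℝ E] [FiniteDimensional ℝ E]
  {F : Type*} [NormedAddCommGroup F] [NormedSpace ℝ F]
  {X : Type*} [TopologicalSpace X] [ChartedSpace E X] [T2Space X] [IsManifold 𝓘(ℝ, E) ∞ X]
  {D : Type*} [TopologicalSpace D] [ChartedSpace F D]
  {ι : C^∞⟮𝓘(ℝ, F), D; 𝓘(ℝ, E), X⟯} {J : Ideal (Smooth E X)} {ν : Coorientation ι}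

omit [FiniteDimensional ℝ E] [T2Space X] [IsManifold 𝓘(ℝ, E) ∞ X] in
theorem extD_dForm (f : Smooth E X) (V : Fin 2 → ASec J) : extD (dForm f : AForm J 1) V = 0 := by
  rw [extD_one, dForm_apply, dForm_apply, dForm_apply]
  ext q
  change (V 0).1 ((V 1).1 f) q - (V 1).1 ((V 0).1 f) q - ⁅V 0, V 1⁆.1 f q = 0
  rw [asec_lie_apply, sub_self]

theorem extD_rad {p : D} (A : AdaptedFrame ι J ν p) (V : Fin 2 → ASec J) {x : X} (hx : x ∈ A.dom) :
    extD (oneForm A.rad) V x = 0 := by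
  rw [extD_one]
  exact (A.closed (V 0) (V 1) x hx).1

theorem extD_ang {p : D} (A : AdaptedFrame ι J ν p) (V : Fin 2 → ASec J) {x : X} (hx : x ∈ A.dom) :
    extD (oneForm A.ang) V x = 0 := by
  rw [extD_one]
  exact (A.closed (V 0) (V 1) x hx).2

variable (ι) in
/-- At the point `q` of `D`, the form `β` is the restriction of a complement of the residues in
the two-form `wA`. -/
def IsLocalForm (wA : AForm J 2) (R T : ASec J) (β : DForm F D 2) (q : D) : Prop :=
  ∃ (Y : ASec J) (a b : AForm J 1) (β₀ : AForm J 2),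
    IsComplement (evForm (evalAt (ι q)) wA) R T Y (evForm (evalAt (ι q)) a)
      (evForm (evalAt (ι q)) b) (evForm (evalAt (ι q)) β₀) ∧
    ∀ V W, (∀ i, Related ι J (V i) (W i)) → β W q = β₀ V (ι q)

variable [FiniteDimensional ℝ F] [T2Space D] [IsManifold 𝓘(ℝ, F) ∞ D] [SigmaCompactSpace X]
  (hJ : IsEllipticIdeal ι J) (A : ∀ p, AdaptedFrame ι J ν p) {R T : ASec J}
  (hR : IsRadial ι R.1) (hT : IsAngular ν T.1) {wA : AForm J 2} (hcl : IsClosedForm wA)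
  (hw : IsNondegenerate wA) (h0 : restrict ι (wA ![R, T]) = 0)

include hJ A hR hT hcl hw h0

/-- Correcting dθ by an exact form keeps the complement closed and makes Y a third vector in its
kernel. -/
theorem exists_localForm (p : D) : ∃ U : Set D, IsOpen U ∧ p ∈ U ∧ ∃ β : DForm F D 2,
    IsClosedOn β U ∧ ∀ q ∈ U, IsLocalForm ι wA R T β q := by
  -- The sign is chosen so that ω(R, Y) = d log r(R) = 1 and ω(T, Y) = 0 along `D` near p.
  obtain ⟨Y, hY, -⟩ := hw (-(A p).rad)
  replace hY : ∀ W, wA ![Y, W] = -(A p).rad W := hY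
  obtain ⟨W₀, hW₀⟩ := exists_related hJ A Y
  have hRY : ∀ V, wA ![V, Y] = (A p).rad V := fun V => by rw [apply_swap, hY, neg_neg]
  have hYY : (A p).rad Y = 0 := by rw [← hRY, apply_self]
  -- the section `Y` does not vanish at `p`
  obtain ⟨k, hk⟩ : ∃ k, Y.1 ((A p).x k) (ι p) ≠ 0 := by
    by_contra! hk
    have h1 := frame_expand hJ hR hT (A p) (A p).mem_dom (slotFun (ι p) wA ![R, Y] 1)
      (slotFun_smul _ _ _ _) Y
    have h2 : ∀ U, slotFun (ι p) wA ![R, Y] 1 U = wA ![R, U] (ι p) := fun U =>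
      congrArg (fun V => wA V (ι p)) (funext fun i => by fin_cases i <;> rfl)
    have h3 : wA ![R, T] (ι p) = 0 := restrict_eq_zero_iff.mp h0 p
    simp only [h2, hk, h3, apply_self, hRY, zero_mul, Finset.sum_const_zero, mul_zero, add_zero,
      smooth_zero_apply, (radial_coeff hR (A p) (A p).mem_dom).1] at h1
    exact one_ne_zero h1
  -- Solve Yμ = −dθ(Y) on `D`, so that b = dθ + dμ satisfies b(Y) = 0.
  obtain ⟨μ, hμ⟩ := exists_transport W₀ (-restrict ι ((A p).ang Y)) (p := p)
    (h := ((A p).x k).comp ι) (by rw [← hW₀]; exact hk)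
  obtain ⟨O, hO, hOo, hOp⟩ := eventually_nhds_iff.mp
    (hμ.and (eventually_mem_dom (A p) (A p).mem_dom))
  obtain ⟨χ₀, hχ1, hχO⟩ := exists_bump (E := F) (hOo.mem_nhds hOp)
  obtain ⟨U, hU, hUo, hUp⟩ := eventually_nhds_iff.mp (hχ1.and (hOo.eventually_mem hOp))
  obtain ⟨χ, hχ⟩ := exists_extension hJ A χ₀
  obtain ⟨m, hm⟩ := exists_extension hJ A μ
  have hχq : ∀ q, χ (ι q) = χ₀ q := fun q => DFunLike.congr_fun hχ q
  let a : AForm J 1 := oneForm (A p).rad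
  let b : AForm J 1 := oneForm (A p).ang + dForm m
  let B : Forms (Smooth E X) (ASec J) :=
    homog wA - homog a ⋏ inter R (homog wA) - homog b ⋏ inter T (homog wA)
  let β₀ : AForm J 2 := B 2
  have hB : homog β₀ = B := by
    refine (IsHomogeneous.eq_homog (d := 2) (a := B) fun j hj => ?_).symm
    have h1 : ∀ (c : AForm J 1) (Z : ASec J), (homog c ⋏ inter Z (homog wA)) j = 0 := fun c Z => by
      rw [inter_homog_succ]
      exact homog_wedge_homog _ _ (by omega)
    change homog wA j - _ - _ = 0
    rw [homog_ne hj, h1, h1, sub_zero, sub_zero]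
  have hcompl : ∀ q ∈ O, IsComplement (evForm (evalAt (ι q)) wA) R T Y (evForm (evalAt (ι q)) a)
      (evForm (evalAt (ι q)) b) (evForm (evalAt (ι q)) β₀) := by
    intro q hq
    obtain ⟨hq1, hq2⟩ := hO q hq
    obtain ⟨hR1, hR2, -⟩ := radial_coeff hR (A p) hq2
    obtain ⟨hT1, hT2, -⟩ := angular_coeff hT (A p) hq2
    have hz : ∀ {Z : ASec J}, Related ι J Z 0 → Z.1 m (ι q) = 0 := fun hZ =>
      DFunLike.congr_fun (hZ m) q
    refine
      { eq := ?_
        wRT := restrict_eq_zero_iff.mp h0 q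
        wRY := ?_
        wTY := ?_
        wY := ?_
        aR := hR1
        aT := hT1
        aY := ?_
        bR := ?_
        bT := ?_
        bY := ?_ }
    · rw [← evForms_homog, hB, evForms_sub, evForms_sub, evForms_wedge, evForms_wedge,
        evForms_inter, evForms_inter, evForms_homog, evForms_homog, evForms_homog]
    · change wA ![R, Y] (ι q) = 1
      rw [hRY, hR1]
    · change wA ![T, Y] (ι q) = 0
      rw [hRY, hT1]
    · rw [← evForms_homog, ← evForms_inter, ← evForms_homog, ← evForms_neg]
      congr 1
      rw [inter_homog_succ, ← homog_neg]
      congr 1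
      ext V : 1
      have hV : V = ![V 0] := by ext i; fin_cases i; rfl
      rw [hV]
      exact hY (V 0)
    · change (A p).rad Y (ι q) = 0
      rw [hYY]
      rfl
    · change (A p).ang R (ι q) + R.1 m (ι q) = 0
      rw [hR2, hz (related_zero_of_radial hR), add_zero]
    · change (A p).ang T (ι q) + T.1 m (ι q) = 1
      rw [hT2, hz (related_zero_of_angular hT), add_zero]
    · change (A p).ang Y (ι q) + Y.1 m (ι q) = 0
      have h1 : Y.1 m (ι q) = W₀ μ q := by
        rw [← hm, ← hW₀ m]
        rfl
      rw [h1, hq1]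
      exact add_neg_cancel _
  have hdB : ∀ q ∈ O, formAt (ι q) (dForms (homog β₀)) = 0 := by
    intro q hq
    have hq2 := (hO q hq).2
    have hn : ∀ {Z : ASec J}, IsNormalSection ν Z →
        formAt (ι q) (dForms (inter Z (homog wA))) = 0 := fun hZ => by
      funext k
      ext V
      exact restrict_eq_zero_iff.mp (restrict_dForms_inter hJ A hZ (dForms_homog hcl) k V) q
    refine evForms_dForms_complement (e := evalAt (ι q)) hB hcl
      (fun V => extD_rad (A p) V hq2) (fun V => ?_) (hn (isNormalSection_of_radial hR))
      (hn (isNormalSection_of_angular hT))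
    rw [extD_add, extD_dForm, add_zero]
    exact extD_ang (A p) V hq2
  -- The form β₀ is annihilated by R and T only over O; the cutoff χ, equal to one over U, makes it
  -- descend to all of `D`.
  obtain ⟨β, hβ, -⟩ := existsUnique_restrict hJ A hR hT (χ • β₀) (by
    intro W i hi
    rw [restrict_eq_zero_iff]
    intro q
    change χ (ι q) * β₀ W (ι q) = 0
    by_cases hq : q ∈ tsupport χ₀
    · have hc := hcompl q (hχO hq)
      have : evForm (evalAt (ι q)) β₀ W = 0 := by
        rcases hi with hi | hi
        · exact apply_eq_zero_of_inter hc.inter_R hi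
        · exact apply_eq_zero_of_inter hc.inter_T hi
      rw [show β₀ W (ι q) = 0 from this, mul_zero]
    · rw [hχq, image_eq_zero_of_notMem_tsupport hq, zero_mul])
  refine ⟨U, hUo, hUp, β, ?_, fun q hq => ⟨Y, a, b, β₀, hcompl q (hU q hq).2, fun V W hVW => ?_⟩⟩
  · intro W q hq
    choose s hs using exists_lift hJ A
    rw [extD_compat (f := restrict ι) (Rel := Related ι J) (fun _ _ h => related_apply h)
      (fun _ _ _ _ h h' => related_lie h h') hβ fun i => hs (W i), extD_smul, restrict_apply,
      smooth_add_apply, smooth_mul_apply, smooth_sum_apply]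
    have h1 : extD β₀ (fun i => s (W i)) (ι q) = 0 := by
      have := congrArg (fun c : Forms ℝ (ASec J) => c 3 fun i => s (W i)) (hdB q (hU q hq).2)
      rw [← extDForm_apply]
      change evalAt (ι q) (extDForm (homog β₀ 2) _) = 0 at this
      rwa [homog_self] at this
    have h2 : ∀ V : ASec J, V.1 χ (ι q) = 0 := fun V =>
      apply_eq_zero_of_eventually_const (A p) V (hO q (hU q hq).2).2 (c := 1)
        ((hUo.eventually_mem hq).mono fun x hx => by rw [hχq, (hU x hx).1])
    rw [h1, mul_zero, zero_add]
    refine Finset.sum_eq_zero fun j _ => ?_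
    rw [smooth_mul_apply, smooth_mul_apply, asec_lie_smooth, h2, zero_mul, mul_zero]
  · rw [hβ V W hVW]
    change χ (ι q) * β₀ V (ι q) = _
    rw [hχq, (hU q hq).1, one_mul]

end LocalForm

/-! ### Nonvanishing in top degree -/

section Volume

variable {F : Type*} [NormedAddCommGroup F] [NormedSpace ℝ F]
  {D : Type*} [TopologicalSpace D] [ChartedSpace F D]

theorem formProd_two {A N : Type*} [CommRing A] [AddCommGroup N] [Module A N] [Algebra ℝ A]
    (a b : Form A N 1) : formProd ![a, b] = homog a ⋏ homog b := by
  change homog a ⋏ homog b ⋏ formOne = _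
  rw [wedge_formOne]

theorem dformAt_neg_eq_zero {a : DForms F D} {k : ℕ} {q : D} (h : dformAt q a k = 0) :
    dformAt q (-a) k = 0 := by
  rw [dformAt] at h ⊢
  rw [evForms_neg, Pi.neg_apply, h, neg_zero]

theorem nonzeroAt_neg {a : DForms F D} {k : ℕ} {q : D} :
    NonzeroAt ((-a) k) q ↔ NonzeroAt (a k) q := by
  rw [nonzeroAt_iff, nonzeroAt_iff, not_iff_not]
  exact ⟨fun h => by simpa using dformAt_neg_eq_zero h, dformAt_neg_eq_zero⟩

theorem nonzeroAt_congr {a b : DForms F D} {k : ℕ} {q : D} (h : AgreeAt a b q) :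
    NonzeroAt (a k) q ↔ NonzeroAt (b k) q := by
  rw [nonzeroAt_iff, nonzeroAt_iff, agreeAt_iff.mp h]

/-- By homogeneity a single power of β contributes in degree 2 + 2l, so its nonvanishing gives both
the volume condition and the lower bound on the rank. -/
theorem nonzeroAt_formPow {c₁ c₂ : DForm F D 1} {β : DForm F D 2} {l : ℕ} {q : D}
    (h : NonzeroAt ((homog c₁ ⋏ homog c₂ ⋏ formExp β) (2 + 2 * l)) q) :
    NonzeroAt ((formProd ![c₁, c₂] ⋏ formPow (homog β) l) (2 + 2 * l)) q ∧
      NonzeroAt (formPow (homog β) l (2 * l)) q := by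
  have hd : IsHomogeneous 2 (homog c₁ ⋏ homog c₂) :=
    (isHomogeneous_homog c₁).wedge (isHomogeneous_homog c₂)
  rw [← wedge_assoc, wedge_formExp_apply hd] at h
  have h1 : NonzeroAt (((homog c₁ ⋏ homog c₂) ⋏ formPow (homog β) l) (2 + 2 * l)) q := by
    obtain ⟨W, hW⟩ := h
    exact ⟨W, fun h0 => hW (by
      rw [AlternatingMap.smul_apply, smooth_real_smul_apply, h0, mul_zero])⟩
  refine ⟨by rwa [formProd_two], ?_⟩
  rw [nonzeroAt_iff] at h1 ⊢
  intro h0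
  refine h1 ?_
  have h2 : dformAt q (formPow (homog β) l) = 0 := by
    funext j
    by_cases hj : j = 2 * l
    · rw [hj, h0]; rfl
    · ext W
      rw [evForms_apply, formPow_homog_two_ne β hj]
      rfl
  rw [dformAt, evForms_wedge]
  rw [dformAt] at h2
  rw [h2, wedge_zero]
  rfl

end Volume

/-! ### Pointwise properties of the local form -/

section LocalForm

variable {E : Type*} [NormedAddCommGroup E] [NormedSpace ℝ E] [FiniteDimensional ℝ E]
  {F : Type*} [NormedAddCommGroup F] [NormedSpace ℝ F]
  {X : Type*} [TopologicalSpace X] [ChartedSpace E X] [T2Space X] [IsManifold 𝓘(ℝ, E) ∞ X]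
  {D : Type*} [TopologicalSpace D] [ChartedSpace F D]
  {ι : C^∞⟮𝓘(ℝ, F), D; 𝓘(ℝ, E), X⟯} {J : Ideal (Smooth E X)} {ν : Coorientation ι}
  [SigmaCompactSpace X]
  (hJ : IsEllipticIdeal ι J) (A : ∀ p, AdaptedFrame ι J ν p) {R T : ASec J}
  (hR : IsRadial ι R.1) (hT : IsAngular ν T.1) {wA : AForm J 2}
  {β : DForm F D 2} {q : D} (hβ : IsLocalForm ι wA R T β q)

include hJ A hR hT hβ

/-- Once ω is replaced by its complement in the exponential, each of the three factors descends to
`D` at q, and descent is unique. -/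
theorem IsLocalForm.agreeAt (h0 : restrict ι (wA ![R, T]) = 0) :
    AgreeAt (resQForms ν (formExp wA))
      (-(homog (resR ι wA) ⋏ homog (resTheta ν wA) ⋏ formExp β)) q := by
  obtain ⟨Y, a, b, β₀, hc, hres⟩ := hβ
  have h1 := (compat_resQForms hJ A hR hT (formExp wA)).at q
  rw [formAt, evForms_inter, evForms_inter, evForms_formExp, hc.inter_inter_formExp] at h1
  have hr := (compat_resR hJ A hR hT h0).at q
  have ht := (compat_resTheta hJ A hR hT h0).at q
  rw [formAt, evForms_inter, evForms_homog, dformAt, evForms_homog] at hr ht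
  have hb : Compat (RingHom.id ℝ) (Related ι J) (homog (evForm (evalAt (ι q)) β₀))
      (homog (evForm (evalAt q) β)) := compat_homog hres
  have h2 := ((hr.wedge ht).wedge (hb.formExp fun c => rfl)).neg
  rw [agreeAt_iff, h1.unique (exists_lift hJ A) h2, wedge_assoc, dformAt, evForms_neg,
    evForms_wedge, evForms_wedge, evForms_homog, evForms_homog, evForms_formExp]

theorem IsLocalForm.not_nonzeroAt {l : ℕ} (hl : Module.finrank ℝ F + 2 = 2 * (l + 2)) (k : ℕ) :
    ¬ NonzeroAt (formPow (homog β) (l + 1) k) q := by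
  obtain ⟨Y, a, b, β₀, hc, hres⟩ := hβ
  have hf : ∀ {k : ℕ} (c : AForm J k), Framed (frameAt hJ R T (A q)) (coframeAt (A q) (ι q))
      (homog (evForm (evalAt (ι q)) c)) := fun c => by
    rw [← evForms_homog]
    exact framed_formAt hJ hR hT (A q) (A q).mem_dom _
  have hz := hc.formPow_eq_zero (hf a) (hf b) (hf wA) (hf β₀) (l := l) (by
    rw [Fintype.card_sum, Fintype.card_fin, Fintype.card_fin]; omega)
  have hb : Compat (RingHom.id ℝ) (Related ι J) (homog (evForm (evalAt (ι q)) β₀))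
      (homog (evForm (evalAt q) β)) := compat_homog hres
  have h1 := hb.formPow (l + 1)
  rw [hz] at h1
  rw [nonzeroAt_iff, not_not, dformAt, evForms_formPow, evForms_homog,
    h1.unique (exists_lift hJ A) compat_zero]
  rfl

/-- Along the common kernel of the residues, the local form is the restriction of `wA`. -/
theorem IsLocalForm.apply_eq (h0 : restrict ι (wA ![R, T]) = 0) {V V' : ASec J} {W W' : VField F D}
    (hV : Related ι J V W) (hV' : Related ι J V' W') (h₁ : resR ι wA ![W] = 0)
    (h₂ : resTheta ν wA ![W] = 0) (h₁' : resR ι wA ![W'] = 0) (h₂' : resTheta ν wA ![W'] = 0) :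
    β ![W, W'] q = wA ![V, V'] (ι q) := by
  obtain ⟨Y, a, b, β₀, hc, hres⟩ := hβ
  have hr := (isResR_iff hJ A hR wA _).mp (theForm_eq (existsUnique_resR hJ A hR hT h0))
  have ht := (isResTheta_iff hJ A hT wA _).mp (theForm_eq (existsUnique_resTheta hJ A hR hT h0))
  have hRV : ∀ {V W}, Related ι J V W → resR ι wA ![W] = 0 →
      evForm (evalAt (ι q)) wA ![R, V] = 0 := fun {V W} h hz => by
    have := hr ![V] ![W] (fun i => by fin_cases i; exact h)
    exact DFunLike.congr_fun (this.symm.trans hz) q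
  have hTV : ∀ {V W}, Related ι J V W → resTheta ν wA ![W] = 0 →
      evForm (evalAt (ι q)) wA ![T, V] = 0 := fun {V W} h hz => by
    have := ht ![V] ![W] (fun i => by fin_cases i; exact h)
    exact DFunLike.congr_fun (this.symm.trans hz) q
  rw [hres ![V, V'] ![W, W'] (fun i => by fin_cases i; exacts [hV, hV'])]
  have h1 := congrArg (fun c : Forms ℝ (ASec J) => c 1 ![V']) (hc.inter_eq V)
  have h2 : ∀ (Z : ASec J) (c : Form ℝ (ASec J) 2), inter Z (homog c) 1 ![V'] = c ![Z, V'] := by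
    intro Z c
    rw [inter_homog_succ, homog_self]
    rfl
  simp only [Pi.add_apply, Pi.sub_apply, Pi.smul_apply, AlternatingMap.sub_apply, AlternatingMap.smul_apply, h2, hRV hV h₁, hTV hV h₂, hRV hV' h₁',
    hTV hV' h₂', smul_zero, zero_smul, add_zero, sub_zero, Pi.zero_apply] at h1
  exact h1

end LocalForm

/-! ### Bilinearity of low-degree forms -/

section Bilinear

variable {A L : Type*} [CommRing A] [AddCommGroup L] [Module A L]

theorem apply_add_one (a : Form A L 1) (V W : L) : a ![V + W] = a ![V] + a ![W] :=
  a.map_vecCons_add _ _ _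

theorem apply_smul_one (a : Form A L 1) (c : A) (V : L) : a ![c • V] = c * a ![V] :=
  a.map_vecCons_smul _ _ _

theorem apply_add_left (w : Form A L 2) (V V' W : L) : w ![V + V', W] = w ![V, W] + w ![V', W] :=
  w.map_vecCons_add _ _ _

theorem apply_smul_left (w : Form A L 2) (c : A) (V W : L) : w ![c • V, W] = c * w ![V, W] :=
  w.map_vecCons_smul _ _ _

theorem apply_neg_left (w : Form A L 2) (V W : L) : w ![-V, W] = -w ![V, W] := by
  rw [← neg_one_smul A V, apply_smul_left, neg_one_mul]

theorem apply_sub_left (w : Form A L 2) (V V' W : L) : w ![V - V', W] = w ![V, W] - w ![V', W] := by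
  rw [sub_eq_add_neg, apply_add_left, apply_neg_left, sub_eq_add_neg]

theorem apply_add_right (w : Form A L 2) (V W W' : L) : w ![V, W + W'] = w ![V, W] + w ![V, W'] := by
  rw [apply_swap, apply_add_left, apply_swap w V W, apply_swap w V W']
  ring

theorem apply_smul_right (w : Form A L 2) (c : A) (V W : L) : w ![V, c • W] = c * w ![V, W] := by
  rw [apply_swap, apply_smul_left, apply_swap w V W]
  ring

theorem apply_sub_right (w : Form A L 2) (V W W' : L) : w ![V, W - W'] = w ![V, W] - w ![V, W'] := by
  rw [apply_swap, apply_sub_left, apply_swap w V W, apply_swap w V W']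
  ring

/-- The projection removing R, T components and the one removing Y, Y' components are adjoint with
respect to w. This gives uniqueness in the symplectic reduction. -/
theorem apply_projection (w : Form A L 2) (R T Y Y' U Z : L) :
    w ![U - w ![U, Y] • R - w ![U, Y'] • T, Z] =
      w ![U, Z - w ![R, Z] • Y - w ![T, Z] • Y'] := by
  simp only [apply_sub_right, apply_smul_right, apply_sub_left, apply_smul_left]
  ring

end Bilinear

/-! ### The foliation defined by two closed one-forms -/

section Kernel

variable {A L : Type*} [CommRing A] [LieRing L] [Module A L] [LieRingModule L A]

/-- The common kernel of two closed one-forms. -/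
def commonKernel (α₁ α₂ : Form A L 1) (h₁ : IsClosedForm α₁) (h₂ : IsClosedForm α₂) :
    LieRinehartSubalgebra A L where
  carrier := {V | α₁ ![V] = 0 ∧ α₂ ![V] = 0}
  add_mem' := by
    rintro V W ⟨hV, hV'⟩ ⟨hW, hW'⟩
    constructor
    · rw [apply_add_one, hV, hW, add_zero]
    · rw [apply_add_one, hV', hW', add_zero]
  zero_mem' := ⟨α₁.map_coord_zero 0 rfl, α₂.map_coord_zero 0 rfl⟩
  smul_mem' := by
    rintro c V ⟨hV, hV'⟩
    constructor
    · rw [apply_smul_one, hV, mul_zero]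
    · rw [apply_smul_one, hV', mul_zero]
  lie_mem' := by
    have key : ∀ {α : Form A L 1}, IsClosedForm α → ∀ V W, α ![V] = 0 → α ![W] = 0 →
        α ![⁅V, W⁆] = 0 := fun {α} h V W hV hW => by
      have h1 := h ![V, W]
      rw [extD_one] at h1
      simpa [hV, hW] using h1
    rintro V W ⟨hV, hV'⟩ ⟨hW, hW'⟩
    exact ⟨key h₁ V W hV hW, key h₂ V W hV' hW'⟩

theorem mem_commonKernel {α₁ α₂ : Form A L 1} {h₁ : IsClosedForm α₁} {h₂ : IsClosedForm α₂} {V : L} :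
    V ∈ commonKernel α₁ α₂ h₁ h₂ ↔ α₁ ![V] = 0 ∧ α₂ ![V] = 0 := Iff.rfl

end Kernel

/-! ### Symplectic reduction: the leafwise form -/

section Leafwise

variable {E : Type*} [NormedAddCommGroup E] [NormedSpace ℝ E] [FiniteDimensional ℝ E]
  {F : Type*} [NormedAddCommGroup F] [NormedSpace ℝ F]
  {X : Type*} [TopologicalSpace X] [ChartedSpace E X] [T2Space X] [IsManifold 𝓘(ℝ, E) ∞ X]
  {D : Type*} [TopologicalSpace D] [ChartedSpace F D]
  {ι : C^∞⟮𝓘(ℝ, F), D; 𝓘(ℝ, E), X⟯} {J : Ideal (Smooth E X)} {ν : Coorientation ι}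
  [SigmaCompactSpace X]
  (hJ : IsEllipticIdeal ι J) (A : ∀ p, AdaptedFrame ι J ν p) {R T : ASec J}
  (hR : IsRadial ι R.1) (hT : IsAngular ν T.1) {wA : AForm J 2}
  (hw : IsNondegenerate wA) (h0 : restrict ι (wA ![R, T]) = 0)

include hJ A

theorem related_unique {V : ASec J} {W W' : VField F D} (h : Related ι J V W)
    (h' : Related ι J V W') : W = W' := by
  refine Derivation.ext fun f => ?_
  obtain ⟨g, rfl⟩ := exists_extension hJ A f
  rw [← h g, ← h' g]

include hR hT hw

/-- Nondegeneracy gives a local solution of ω(·, Y) = d log r; the required values at points of `D`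
are prescribed, so the solutions glue. -/
theorem exists_dual_radial : ∃ Y : ASec J, restrict ι (wA ![R, Y]) = 1 ∧
    restrict ι (wA ![T, Y]) = 0 := by
  obtain ⟨Y, hY⟩ := exists_glue_along hJ
    (fun q V => wA ![R, V] (ι q) = 1 ∧ wA ![T, V] (ι q) = 0) fun p => by
      obtain ⟨Y, hY, -⟩ := hw (-(A p).rad)
      replace hY : ∀ W, wA ![W, Y] = (A p).rad W := fun W => by
        rw [apply_swap, hY]
        exact neg_neg _
      refine ⟨Y, (A p).dom, (A p).isOpen_dom.mem_nhds (A p).mem_dom, fun q hq => ?_⟩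
      rw [hY, hY]
      exact ⟨(radial_coeff hR (A p) hq).1, (angular_coeff hT (A p) hq).1⟩
  have hs : ∀ (q : D) (Z U : ASec J), slotFun (ι q) wA ![Z, 0] 1 U = wA ![Z, U] (ι q) := fun q Z U =>
    congrArg (fun V => wA V (ι q)) (funext fun i => by fin_cases i <;> rfl)
  refine ⟨Y, ContMDiffMap.ext fun q => ?_, ContMDiffMap.ext fun q => ?_⟩
  · have := hY q (slotFun (ι q) wA ![R, 0] 1) 1 (slotFun_smul _ _ _ _) fun V hV => by rw [hs]; exact hV.1
    rwa [hs] at this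
  · have := hY q (slotFun (ι q) wA ![T, 0] 1) 0 (slotFun_smul _ _ _ _) fun V hV => by rw [hs]; exact hV.2
    rwa [hs] at this

theorem exists_dual_angular : ∃ Y : ASec J, restrict ι (wA ![R, Y]) = 0 ∧
    restrict ι (wA ![T, Y]) = 1 := by
  obtain ⟨Y, hY⟩ := exists_glue_along hJ
    (fun q V => wA ![R, V] (ι q) = 0 ∧ wA ![T, V] (ι q) = 1) fun p => by
      obtain ⟨Y, hY, -⟩ := hw (-(A p).ang)
      replace hY : ∀ W, wA ![W, Y] = (A p).ang W := fun W => by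
        rw [apply_swap, hY]
        exact neg_neg _
      refine ⟨Y, (A p).dom, (A p).isOpen_dom.mem_nhds (A p).mem_dom, fun q hq => ?_⟩
      rw [hY, hY]
      exact ⟨(radial_coeff hR (A p) hq).2.1, (angular_coeff hT (A p) hq).2.1⟩
  have hs : ∀ (q : D) (Z U : ASec J), slotFun (ι q) wA ![Z, 0] 1 U = wA ![Z, U] (ι q) := fun q Z U =>
    congrArg (fun V => wA V (ι q)) (funext fun i => by fin_cases i <;> rfl)
  refine ⟨Y, ContMDiffMap.ext fun q => ?_, ContMDiffMap.ext fun q => ?_⟩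
  · have := hY q (slotFun (ι q) wA ![R, 0] 1) 0 (slotFun_smul _ _ _ _) fun V hV => by rw [hs]; exact hV.1
    rwa [hs] at this
  · have := hY q (slotFun (ι q) wA ![T, 0] 1) 1 (slotFun_smul _ _ _ _) fun V hV => by rw [hs]; exact hV.2
    rwa [hs] at this

omit hw
variable {𝓕 : LieRinehartSubalgebra (Smooth F D) (VField F D)}
  (h𝓕 : ∀ V W, Related ι J V W → (W ∈ 𝓕 ↔
    restrict ι (wA ![R, V]) = 0 ∧ restrict ι (wA ![T, V]) = 0))

include h𝓕

omit hR hT h𝓕 in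
theorem isRestriction_leafwise :
    IsRestriction (restrict ι) (fun (V : ASec J) (W : 𝓕) => Related ι J V W.1) where
  surj_fun := exists_extension hJ A
  surj W := exists_lift hJ A W.1
  add h h' := (isRestriction_related hJ A).add h h'
  smul f _ _ h := (isRestriction_related hJ A).smul f h

/-- The leafwise two-form. -/
theorem existsUnique_leafwise : ∃! σ : Form (Smooth F D) 𝓕 2, ∀ (V : Fin 2 → ASec J) (W : Fin 2 → 𝓕),
    (∀ i, Related ι J (V i) (W i).1) → σ W = restrict ι (wA V) := by
  refine (isRestriction_leafwise hJ A).existsUnique_form wA fun V W hVW i hi => ?_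
  rw [restrict_eq_zero_iff]
  intro q
  have hV : ∀ f, (V i).1 f (ι q) = 0 := fun f => by
    have := hVW i f
    rw [hi] at this
    exact DFunLike.congr_fun this q
  have h1 := functional_of_related_zero hJ A hR hT hV (slotFun (ι q) wA V i) (slotFun_smul _ _ _ _)
  have h2 : slotFun (ι q) wA V i (V i) = wA V (ι q) := by
    change wA (Function.update V i (V i)) (ι q) = _
    rw [Function.update_eq_self]
  -- The ambiguity of lifts is spanned by R and T, which are ω-orthogonal to lifts of fields in 𝓕.
  have h3 : ∀ (Z : ASec J), (∀ j, restrict ι (wA ![Z, V j]) = 0) → slotFun (ι q) wA V i Z = 0 := by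
    intro Z hZ
    have hj : ∀ j, wA ![Z, V j] (ι q) = 0 := fun j => restrict_eq_zero_iff.mp (hZ j) q
    change wA (Function.update V i Z) (ι q) = 0
    fin_cases i
    · rw [show Function.update V ((fun i => i) ⟨0, by simp⟩) Z = ![Z, V 1] by
        ext j : 1; fin_cases j <;> rfl, hj]
    · rw [show Function.update V ((fun i => i) ⟨1, by simp⟩) Z = ![V 0, Z] by
        ext j : 1; fin_cases j <;> rfl, apply_swap, smooth_neg_apply, hj, neg_zero]
  rw [← h2, h1, h3 R fun j => ((h𝓕 _ _ (hVW j)).mp (W j).2).1,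
    h3 T fun j => ((h𝓕 _ _ (hVW j)).mp (W j).2).2, mul_zero, mul_zero, add_zero]

omit hR hT in
/-- The projection of the elliptic tangent bundle to the foliation. -/
theorem exists_projection {Y₁ Y₂ : ASec J} (h11 : restrict ι (wA ![R, Y₁]) = 1)
    (h12 : restrict ι (wA ![T, Y₁]) = 0) (h21 : restrict ι (wA ![R, Y₂]) = 0)
    (h22 : restrict ι (wA ![T, Y₂]) = 1) : ∃ s : ASec J → 𝓕,
    (∀ Z, Related ι J (Z - wA ![R, Z] • Y₁ - wA ![T, Z] • Y₂) (s Z).1) ∧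
    (∀ Z Z', s (Z + Z') = s Z + s Z') ∧
    (∀ (f : Smooth E X) Z, s (f • Z) = restrict ι f • s Z) ∧
    ∀ Z (W : 𝓕), Related ι J Z W.1 → s Z = W := by
  -- Subtracting components along Y₁ and Y₂ makes the result ω-orthogonal to R and T along `D`,
  -- hence a lift of a field in 𝓕.
  let P : ASec J → ASec J := fun Z => Z - wA ![R, Z] • Y₁ - wA ![T, Z] • Y₂
  have hPadd : ∀ Z Z', P (Z + Z') = P Z + P Z' := fun Z Z' => by
    simp only [P, apply_add_right, add_smul]
    abel
  have hPsmul : ∀ (f : Smooth E X) Z, P (f • Z) = f • P Z := fun f Z => by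
    simp only [P, apply_smul_right, mul_smul, smul_sub]
  have hPmem : ∀ Z W, Related ι J (P Z) W → W ∈ 𝓕 := fun Z W h => (h𝓕 _ _ h).mpr (by
    simp only [P, apply_sub_right, apply_smul_right, map_sub, map_mul, h11, h12, h21, h22]
    constructor <;> ring)
  have hs : ∀ Z, ∃ W : 𝓕, Related ι J (P Z) W.1 := fun Z => by
    obtain ⟨W, hW⟩ := exists_related hJ A (P Z)
    exact ⟨⟨W, hPmem Z W hW⟩, hW⟩
  choose s hs using hs
  have hsu : ∀ Z (W : 𝓕), Related ι J (P Z) W.1 → s Z = W := fun Z W h =>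
    Subtype.ext (related_unique hJ A (hs Z) h)
  have hres := isRestriction_related hJ A
  have hsadd : ∀ Z Z', s (Z + Z') = s Z + s Z' := fun Z Z' => hsu _ _ (by
    rw [hPadd]; exact hres.add (hs Z) (hs Z'))
  have hssmul : ∀ (f : Smooth E X) Z, s (f • Z) = restrict ι f • s Z := fun f Z => hsu _ _ (by
    rw [hPsmul]; exact hres.smul f (hs Z))
  refine ⟨s, hs, hsadd, hssmul, fun Z W h => hsu _ _ ?_⟩
  obtain ⟨hZ1, hZ2⟩ := (h𝓕 _ _ h).mp W.2
  obtain ⟨V₁, hV₁⟩ := exists_related hJ A Y₁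
  obtain ⟨V₂, hV₂⟩ := exists_related hJ A Y₂
  have h1 := hres.sub (hres.sub h (hres.smul (wA ![R, Z]) hV₁)) (hres.smul (wA ![T, Z]) hV₂)
  rwa [hZ1, hZ2, zero_smul, zero_smul, sub_zero, sub_zero] at h1

omit h𝓕 in
include hw in
/-- Functionals on the foliation are induced by sections of the elliptic tangent bundle. -/
theorem exists_leafwise_dual (ξ : 𝓕 →ₗ[Smooth F D] Smooth F D) {s : ASec J → 𝓕}
    (hsadd : ∀ Z Z', s (Z + Z') = s Z + s Z')
    (hssmul : ∀ (f : Smooth E X) Z, s (f • Z) = restrict ι f • s Z)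
    (hs0 : s 0 = 0) (hsR : s R = 0) (hsT : s T = 0) :
    ∃ V : ASec J, ∀ Z, restrict ι (wA ![V, Z]) = ξ (s Z) := by
  obtain ⟨V, hV⟩ := exists_glue_along hJ
    (fun q V => ∀ Z, wA ![V, Z] (ι q) = ξ (s Z) q) fun p => by
      choose e he using exists_extension hJ A
      -- A linear form extending ξ ∘ s off `D`: as s kills R and T, only the dx_k components of Z
      -- matter along `D`.
      let Ξ : ASec J →ₗ[Smooth E X] Smooth E X :=
        { toFun := fun Z => ∑ k, Z.1 ((A p).x k) * e (ξ (s ((A p).E₀ hJ k)))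
          map_add' := by
            intro Z Z'
            rw [← Finset.sum_add_distrib]
            exact Finset.sum_congr rfl fun k _ => add_mul _ _ _
          map_smul' := by
            intro f Z
            rw [RingHom.id_apply, smul_eq_mul, Finset.mul_sum]
            exact Finset.sum_congr rfl fun k _ => mul_assoc _ _ _ }
      obtain ⟨V, hV, -⟩ := hw Ξ
      refine ⟨V, (A p).dom, (A p).isOpen_dom.mem_nhds (A p).mem_dom, fun q hq Z => ?_⟩
      let l : ASec J →+ ℝ :=
        { toFun := fun Z => ξ (s Z) q
          map_zero' := by
            rw [hs0, map_zero]
            rfl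
          map_add' := fun Z Z' => by
            rw [hsadd, map_add]
            rfl }
      have hl : ∀ (f : Smooth E X) Z, l (f • Z) = f (ι q) * l Z := fun f Z => by
        change ξ (s (f • Z)) q = f (ι q) * ξ (s Z) q
        rw [hssmul, map_smul]
        rfl
      have h1 := frame_expand hJ hR hT (A p) hq l hl Z
      have hlR : l R = 0 := by
        change ξ (s R) q = 0
        rw [hsR, map_zero]
        rfl
      have hlT : l T = 0 := by
        change ξ (s T) q = 0
        rw [hsT, map_zero]
        rfl
      rw [hlR, hlT, mul_zero, mul_zero, add_zero, zero_add] at h1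
      change _ = l Z
      rw [h1, hV]
      change (∑ k, Z.1 ((A p).x k) * e (ξ (s ((A p).E₀ hJ k)))) (ι q) = _
      rw [smooth_sum_apply]
      refine Finset.sum_congr rfl fun k _ => ?_
      rw [smooth_mul_apply]
      exact congrArg _ (DFunLike.congr_fun (he (ξ (s ((A p).E₀ hJ k)))) q)
  refine ⟨V, fun Z => ContMDiffMap.ext fun q => ?_⟩
  have hsl : ∀ U, slotFun (ι q) wA ![0, Z] 0 U = wA ![U, Z] (ι q) := fun U =>
    congrArg (fun V => wA V (ι q)) (funext fun i => by fin_cases i <;> rfl)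
  have := hV q (slotFun (ι q) wA ![0, Z] 0) (ξ (s Z) q) (slotFun_smul _ _ _ _)
    fun V hV => by rw [hsl]; exact hV Z
  rwa [hsl] at this

variable {σ : Form (Smooth F D) 𝓕 2} (hσ : ∀ (V : Fin 2 → ASec J) (W : Fin 2 → 𝓕),
    (∀ i, Related ι J (V i) (W i).1) → σ W = restrict ι (wA V))

include hσ

omit hR hT h𝓕 in
theorem isClosedForm_leafwise (hcl : IsClosedForm wA) : IsClosedForm σ := by
  intro W
  choose s hs using fun W : 𝓕 => exists_lift hJ A W.1
  rw [extD_compat (f := restrict ι) (Rel := fun (V : ASec J) (W : 𝓕) => Related ι J V W.1)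
    (fun _ _ h => related_apply h) (fun _ _ _ _ h h' => related_lie h h') hσ fun i => hs (W i), hcl,
    map_zero]

include hw h0

/-- A functional on 𝓕 is pulled back by the projection s and represented by ω upstairs. The
representing section is orthogonal to R and T, since s kills them, so it restricts to a field in 𝓕.
-/
theorem isNondegenerate_leafwise : IsNondegenerate σ := by
  intro ξ
  obtain ⟨Y₁, h11, h12⟩ := exists_dual_radial hJ A hR hT hw
  obtain ⟨Y₂, h21, h22⟩ := exists_dual_angular hJ A hR hT hw
  have h0' : restrict ι (wA ![T, R]) = 0 := by rw [apply_swap, map_neg, h0, neg_zero]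
  obtain ⟨s, hs, hsadd, hssmul, hsfix⟩ := exists_projection hJ A h𝓕 h11 h12 h21 h22
  have hsR : s R = 0 := hsfix R 0 (related_zero_of_radial hR)
  have hsT : s T = 0 := hsfix T 0 (related_zero_of_angular hT)
  obtain ⟨V, hV⟩ := exists_leafwise_dual hJ A hR hT hw ξ hsadd hssmul
    (hsfix 0 0 fun f => rfl) hsR hsT
  obtain ⟨W₀, hW₀⟩ := exists_related hJ A V
  have hmem : W₀ ∈ 𝓕 := (h𝓕 _ _ hW₀).mpr ⟨by
    rw [apply_swap, map_neg, hV, hsR, map_zero, neg_zero], by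
    rw [apply_swap, map_neg, hV, hsT, map_zero, neg_zero]⟩
  have hσ2 : ∀ {V V' : ASec J} {W W' : 𝓕}, Related ι J V W.1 → Related ι J V' W'.1 →
      σ ![W, W'] = restrict ι (wA ![V, V']) := fun h h' =>
    hσ _ _ (fun i => by fin_cases i; exacts [h, h'])
  refine ⟨⟨W₀, hmem⟩, fun W => ?_, fun W' hW' => ?_⟩
  · obtain ⟨Z, hZ⟩ := exists_lift hJ A W.1
    rw [hσ2 (W := ⟨W₀, hmem⟩) hW₀ hZ, hV, hsfix Z W hZ]
  · -- uniqueness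
    obtain ⟨V', hV'⟩ := exists_lift hJ A W'.1
    have hzero : ∀ Z, restrict ι
        (wA ![V' - V, Z - wA ![R, Z] • Y₁ - wA ![T, Z] • Y₂]) = 0 := fun Z => by
      rw [apply_sub_left, map_sub, ← hσ2 hV' (hs Z), hW', hV, hsfix _ (s Z) (hs Z), sub_self]
    -- By adjointness of the projections, V' − V corrected by R and T is ω-orthogonal along `D` to
    -- every section.
    let u : ASec J := V' - V - wA ![V' - V, Y₁] • R - wA ![V' - V, Y₂] • T
    have hu : ∀ Z, restrict ι (wA ![u, Z]) = 0 := fun Z =>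
      (congrArg (restrict ι) (apply_projection wA R T Y₁ Y₂ (V' - V) Z)).trans (hzero Z)
    refine Subtype.ext (Derivation.ext fun f => ?_)
    obtain ⟨g, rfl⟩ := exists_extension hJ A f
    -- Pairing u with the Hamiltonian section of g shows that u g = 0 along `D`; R and T vanish
    -- there, so V' and V restrict to the same field.
    obtain ⟨G, hG, -⟩ := hw
      { toFun := fun V => V.1 g
        map_add' := fun _ _ => rfl
        map_smul' := fun _ _ => rfl }
    have h1 := hu G
    rw [apply_swap, hG, map_neg, neg_eq_zero] at h1
    ext q
    have h2 : u.1 g (ι q) = 0 := DFunLike.congr_fun h1 q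
    have hRq : R.1 g (ι q) = 0 := DFunLike.congr_fun (hR.vanishes g) q
    have hTq : T.1 g (ι q) = 0 := DFunLike.congr_fun (hT.vanishes g) q
    rw [asec_sub_apply, asec_sub_apply, asec_sub_apply, asec_smul_apply, asec_smul_apply, hRq, hTq,
      mul_zero, mul_zero, sub_zero, sub_zero] at h2
    rw [← hV' g, ← hW₀ g]
    exact sub_eq_zero.mp h2

end Leafwise

/-! ### Assembling the cosymplectic spinor -/

section Cosymplectic

variable {F : Type*} [NormedAddCommGroup F] [NormedSpace ℝ F]
  {D : Type*} [TopologicalSpace D] [ChartedSpace F D]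

/-- The sign in −α₁∧α₂ is absorbed by listing the one-forms in the opposite order. -/
theorem formExp_wedge_formProd {A N : Type*} [CommRing A] [AddCommGroup N] [Module A N]
    [Algebra ℝ A] (a b : Form A N 1) (β : Form A N 2) :
    formExp β ⋏ formProd ![b, a] = -(homog a ⋏ homog b ⋏ formExp β) := by
  rw [formProd_two, wedge_comm_of_even (parity_formExp β), homog_one_wedge_comm, neg_wedge,
    wedge_assoc]

theorem clifford_zero (ρ : DForms F D) (k : ℕ) (W : Fin k → VField F D) :
    clifford 0 0 ρ k W = 0 := by
  rw [clifford, homog_zero, zero_wedge, map_zero, Pi.zero_apply, add_zero, AlternatingMap.zero_apply]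

theorem isCosymplecticOn_of_agreeAt {α₁ α₂ : DForm F D 1} {β : DForm F D 2} {U : Set D} {l : ℕ}
    {ρ : DForms F D} (h₁ : IsClosedForm α₁) (h₂ : IsClosedForm α₂) (hβ : IsClosedOn β U)
    (hrank : ∀ q ∈ U, ¬ NonzeroAt (formPow (homog β) (l + 1) (2 * (l + 1))) q)
    (hρ : ∀ q ∈ U, AgreeAt ρ (-(homog α₁ ⋏ homog α₂ ⋏ formExp β)) q)
    (htop : ∀ q, NonzeroAt (ρ (2 + 2 * l)) q) : IsCosymplecticOn l ![α₁, α₂] β U where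
  closed_one i := by
    fin_cases i
    · exact fun V p _ => DFunLike.congr_fun (h₁ V) p
    · exact fun V p _ => DFunLike.congr_fun (h₂ V) p
  closed_two := hβ
  rank_ge q hq := (nonzeroAt_formPow (nonzeroAt_neg.mp ((nonzeroAt_congr (hρ q hq)).mp (htop q)))).2
  rank_le := hrank
  volume q hq := (nonzeroAt_formPow (nonzeroAt_neg.mp ((nonzeroAt_congr (hρ q hq)).mp (htop q)))).1

theorem isCosymplecticOn_swap {α₁ α₂ : DForm F D 1} {β : DForm F D 2} {U : Set D} {l : ℕ}
    (h : IsCosymplecticOn l ![α₁, α₂] β U) : IsCosymplecticOn l ![α₂, α₁] β U where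
  closed_one i := by
    fin_cases i
    · exact h.closed_one 1
    · exact h.closed_one 0
  closed_two := h.closed_two
  rank_ge := h.rank_ge
  rank_le := h.rank_le
  volume q hq := by
    have := h.volume q hq
    rw [formProd_two, homog_one_wedge_comm, neg_wedge, nonzeroAt_neg] at this
    rwa [formProd_two]

/-- Since ρ is closed, the integrability condition dρ = v · ρ holds globally with v = 0. -/
theorem isCosymplecticSpinor_of_local {α₁ α₂ : DForm F D 1} {l : ℕ} {ρ : DForms F D}
    (h₁ : IsClosedForm α₁) (h₂ : IsClosedForm α₂) (hρ : ∀ j, IsClosedForm (ρ j))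
    (htop : ∀ q, NonzeroAt (ρ (2 + 2 * l)) q)
    (hloc : ∀ p : D, ∃ U : Set D, IsOpen U ∧ p ∈ U ∧ ∃ β : DForm F D 2,
      IsCosymplecticOn l ![α₁, α₂] β U ∧
      ∀ q ∈ U, AgreeAt ρ (-(homog α₁ ⋏ homog α₂ ⋏ formExp β)) q) :
    IsCosymplecticSpinor 2 l ρ where
  pure p := by
    obtain ⟨U, hU, hp, β, -, hβ⟩ := hloc p
    refine ⟨⟨_, htop p⟩, ⟨β, 2, ![α₂, α₁], ?_⟩, Set.univ, isOpen_univ, trivial, 0, 0,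
      fun q _ => ⟨fun W => ?_, fun k W => ?_⟩⟩
    · rw [formExp_wedge_formProd]
      exact hβ p hp
    · rw [clifford_zero, smooth_zero_apply]
    · rw [clifford_zero, hρ]
  closed := hρ
  top := htop
  tuple := by
    refine ⟨![α₂, α₁], fun i => by fin_cases i; exacts [h₂, h₁], fun p => ?_⟩
    obtain ⟨U, hU, hp, β, hc, hβ⟩ := hloc p
    exact ⟨U, hU, hp, β, isCosymplecticOn_swap hc, fun q hq => by
      rw [formExp_wedge_formProd]
      exact hβ q hq⟩

theorem nonzeroAt_of_volume {α₁ α₂ : DForm F D 1} {b : DForms F D} {k : ℕ} {q : D}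
    (h : NonzeroAt ((formProd ![α₁, α₂] ⋏ b) k) q) : NonzeroAt (formProd ![α₁, α₂] 2) q := by
  rw [nonzeroAt_iff] at h ⊢
  intro h0
  have h1 : dformAt q (formProd ![α₁, α₂]) = 0 := by
    have hd : IsHomogeneous 2 (formProd ![α₁, α₂]) := by
      rw [formProd_two]
      exact (isHomogeneous_homog α₁).wedge (isHomogeneous_homog α₂)
    funext j
    by_cases hj : j = 2
    · rw [hj, h0]; rfl
    · ext W
      rw [evForms_apply, hd j hj]
      rfl
  rw [dformAt] at h1
  rw [dformAt, evForms_wedge, h1, zero_wedge] at h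
  exact h rfl

end Cosymplectic

end EllipticPoisson

end

theorem mainTheorem8
    {E : Type*} [NormedAddCommGroup E] [NormedSpace ℝ E] [FiniteDimensional ℝ E]
    {F : Type*} [NormedAddCommGroup F] [NormedSpace ℝ F] [FiniteDimensional ℝ F]
    {X : Type*} [TopologicalSpace X] [T2Space X] [SecondCountableTopology X]
    [ChartedSpace E X] [IsManifold 𝓘(ℝ, E) ∞ X]
    {D : Type*} [TopologicalSpace D] [ChartedSpace F D] [IsManifold 𝓘(ℝ, F) ∞ D]
    (n : ℕ) (hE : Module.finrank ℝ E = 2 * n) (hF : Module.finrank ℝ F + 2 = 2 * n)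
    (ι : C^∞⟮𝓘(ℝ, F), D; 𝓘(ℝ, E), X⟯)
    (hι : Manifold.IsSmoothEmbedding 𝓘(ℝ, F) 𝓘(ℝ, E) ∞ ι)
    (π : Bivector E X) (hπ : IsPoisson π) (hell : IsEllipticIdeal ι (divisorIdeal π n))
    (ν : Coorientation ι)
    (ωA : AForm (divisorIdeal π n) 2) (hclosed : IsClosedForm ωA) (hnondeg : IsNondegenerate ωA)
    (hdual : IsDual π ωA)
    (hzero : resQ ν (k := 0) ωA = 0)
    (ρ : DForms F D) (hρ : ρ = resQForms ν (formExp ωA))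
    (α₁ : DForm F D 1) (hα₁ : α₁ = resR ι ωA)
    (α₂ : DForm F D 1) (hα₂ : α₂ = resTheta ν ωA) :
    -- the residues are well defined
    ((∀ k, ∃! ξ : DForm F D k, IsResQ ν (formExp ωA (k + 2)) ξ) ∧
      (∃! ξ : DForm F D 1, IsResR ι ωA ξ) ∧ (∃! ξ : DForm F D 1, IsResTheta ν ωA ξ)) ∧
    -- the expansion of `ρ`
    ρ = -(homog α₁ ⋏ homog α₂) +
      resQForms ν (∑ k ∈ Finset.Icc 3 n, ((k ! : ℝ)⁻¹) • formPow (homog ωA) k) ∧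
    -- `ρ` is a closed 2-cosymplectic global pure spinor
    IsCosymplecticSpinor 2 (n - 2) ρ ∧
    IsClosedForm α₁ ∧ IsClosedForm α₂ ∧
    -- the symplectic foliation and the local form of `ρ`
    ∃ (𝓕 : LieRinehartSubalgebra (Smooth F D) (VField F D)) (σ : Form (Smooth F D) 𝓕 2),
      IsUnimodularSymplecticFoliation 2 𝓕 σ ∧
      (∀ V, V ∈ 𝓕 ↔ α₁ ![V] = 0 ∧ α₂ ![V] = 0) ∧
      ∀ p : D, ∃ U : Set D, IsOpen U ∧ p ∈ U ∧ ∃ β : DForm F D 2,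
        IsCosymplecticOn (n - 2) ![α₁, α₂] β U ∧
        (∀ q ∈ U, AgreeAt ρ (-(homog α₁ ⋏ homog α₂ ⋏ formExp β)) q) ∧
        ∀ (V W : 𝓕), ∀ q ∈ U, σ ![V, W] q = β ![V.1, W.1] q := by
  have : T2Space D := hι.isEmbedding.t2Space
  have : LocallyCompactSpace X := ChartedSpace.locallyCompactSpace E X
  have hex : ∀ p, Nonempty (AdaptedFrame ι (divisorIdeal π n) ν p) := fun p => by
    obtain ⟨S⟩ := exists_sliceCoords (by omega) ι hι p
    exact exists_adaptedFrame S hell ν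
  let A := fun p => (hex p).some
  obtain ⟨R, hR⟩ := exists_radial hell A
  obtain ⟨T, hT⟩ := exists_angular hell A
  have h0 := restrict_eq_zero_of_resQ hell A hR hT hzero
  have h₁ : IsClosedForm α₁ := hα₁ ▸ isClosedForm_resR hell A hR hT hclosed h0
  have h₂ : IsClosedForm α₂ := hα₂ ▸ isClosedForm_resTheta hell A hR hT hclosed h0
  -- Upstairs, lying in the common kernel of the residues means ω-orthogonality to R and T along
  -- `D`.
  have hmem : ∀ V W, Related ι (divisorIdeal π n) V W → (W ∈ commonKernel α₁ α₂ h₁ h₂ ↔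
      restrict ι (ωA ![R, V]) = 0 ∧ restrict ι (ωA ![T, V]) = 0) := fun V W hVW => by
    have hr := (isResR_iff hell A hR ωA _).mp (theForm_eq (existsUnique_resR hell A hR hT h0))
      ![V] ![W] (fun i => by fin_cases i; exact hVW)
    have ht := (isResTheta_iff hell A hT ωA _).mp
      (theForm_eq (existsUnique_resTheta hell A hR hT h0)) ![V] ![W]
      (fun i => by fin_cases i; exact hVW)
    rw [mem_commonKernel, hα₁, hα₂]
    exact and_congr (iff_of_eq (congrArg (· = 0) hr)) (iff_of_eq (congrArg (· = 0) ht))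
  -- A point of `D` forces n ≥ 2, so the truncated difference n − 2 is genuine and the degree is 2n
  -- − 2.
  have htop : ∀ q, NonzeroAt (ρ (2 + 2 * (n - 2))) q := fun q => by
    have := two_le_of_restrict hell A hR hT hF hnondeg h0 q
    rw [hρ]
    exact nonzeroAt_resQForms hell A hR hT hF hnondeg (by omega) q
  have hloc : ∀ p : D, ∃ U : Set D, IsOpen U ∧ p ∈ U ∧ ∃ β : DForm F D 2,
      IsCosymplecticOn (n - 2) ![α₁, α₂] β U ∧
      (∀ q ∈ U, AgreeAt ρ (-(homog α₁ ⋏ homog α₂ ⋏ formExp β)) q) ∧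
      ∀ q ∈ U, IsLocalForm ι ωA R T β q := fun p => by
    obtain ⟨U, hU, hp, β, hβ, hβq⟩ := exists_localForm hell A hR hT hclosed hnondeg h0 p
    have hagree : ∀ q ∈ U, AgreeAt ρ (-(homog α₁ ⋏ homog α₂ ⋏ formExp β)) q := fun q hq => by
      rw [hρ, hα₁, hα₂]
      exact (hβq q hq).agreeAt hell A hR hT h0
    refine ⟨U, hU, hp, β, isCosymplecticOn_of_agreeAt h₁ h₂ hβ (fun q hq => ?_) hagree htop,
      hagree, hβq⟩
    have := two_le_of_restrict hell A hR hT hF hnondeg h0 q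
    exact (hβq q hq).not_nonzeroAt hell A hR hT (by omega) _
  obtain ⟨σ, hσ, -⟩ := existsUnique_leafwise hell A hR hT hmem
  refine ⟨⟨fun k => existsUnique_resQ hell A hR hT _, existsUnique_resR hell A hR hT h0,
    existsUnique_resTheta hell A hR hT h0⟩, ?_, ?_, h₁, h₂, commonKernel α₁ α₂ h₁ h₂, σ,
    ⟨⟨![α₁, α₂], fun i => by fin_cases i; exacts [h₁, h₂], fun q => ?_, fun V => ?_⟩,
      isClosedForm_leafwise hell A hσ hclosed,
      isNondegenerate_leafwise hell A hR hT hnondeg h0 hmem hσ⟩, fun V => Iff.rfl, fun p => ?_⟩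
  · rw [hρ, hα₁, hα₂]
    exact resQForms_formExp_eq hell A hR hT h0 hF hnondeg
  · refine isCosymplecticSpinor_of_local h₁ h₂
      (fun j => hρ ▸ isClosedForm_resQForms hell A hR hT hclosed j) htop fun p => ?_
    obtain ⟨U, hU, hp, β, hc, hagree, -⟩ := hloc p
    exact ⟨U, hU, hp, β, hc, hagree⟩
  · obtain ⟨U, -, hq, β, hc, -⟩ := hloc q
    exact nonzeroAt_of_volume (hc.volume q hq)
  · rw [mem_commonKernel, Fin.forall_fin_two]
    rfl
  · obtain ⟨U, hU, hp, β, hc, hagree, hβ⟩ := hloc p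
    refine ⟨U, hU, hp, β, hc, hagree, fun V W q hq => ?_⟩
    obtain ⟨V', hV'⟩ := exists_lift hell A V.1
    obtain ⟨W', hW'⟩ := exists_lift hell A W.1
    have hr : ∀ Z : VField F D, α₁ ![Z] = 0 → resR ι ωA ![Z] = 0 := fun Z h => by rwa [← hα₁]
    have ht : ∀ Z : VField F D, α₂ ![Z] = 0 → resTheta ν ωA ![Z] = 0 := fun Z h => by rwa [← hα₂]
    rw [(hβ q hq).apply_eq hell A hR hT h0 hV' hW' (hr _ V.2.1) (ht _ V.2.2) (hr _ W.2.1)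
      (ht _ W.2.2),
      hσ ![V', W'] ![V, W] (fun i => by fin_cases i; exacts [hV', hW'])]
    rfl
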